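/- **Setting.** Let $\mathbb C^\times=\mathbb C\setminus\{0\}$. For $n\ge1$ put $D_n=\{(z_1,\dots,z_n)\in(\mathbb C^\times)^n: z_{k+1}/z_k\notin(0,\infty)\text{ for }1\le k<n\}$. Consider families of functions $F_n:(\mathbb C^\times)^n\to\mathbb C$, $n\ge1$. **The differential equation.** Call $(F_n)$ a *PDE family* if every $F_n$ is holomorphic on $D_n$, $F_1\equiv(2\pi i)^{-1}$, $F_n=0$ at the points of $D_n$ with $z_1+\dots+z_n=0$ for $n\ge2$, and on $D_n$ $$dF_n(z_1,\dots,z_n)=\sum_{k=1}^{n-1}F_k(z_1,\dots,z_k)\,F_{n-k}(z_{k+1},\dots,z_n)\Bigl[\frac{dz_{k+1}+\dots+dz_n}{z_{k+1}+\dots+z_n}-\frac{dz_1+\dots+dz_k}{z_1+\dots+z_k}\Bigr],$$ the equation being imposed where no denominator vanishes (at the remaining points it is understood by continuation). **The continuity and holomorphicity condition.** For real $\theta_1,\dots,\theta_n$ put $$v_n(\theta_1,\dots,\theta_n)=\sum_{\psi,\xi}\frac{(-1)^{l-1}}{l}\prod_{c=1}^m\frac1{|\psi^{-1}(c)|!},$$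 the sum being over $1\le l\le m\le n$ and order-preserving surjections $\psi:\{1,\dots,n\}\to\{1,\dots,m\}$, $\xi:\{1,\dots,m\}\to\{1,\dots,l\}$ such that $\psi(a)=\psi(b)$ implies $\theta_a=\theta_b$, and $\psi(a)<\psi(b)$ together with $\xi\psi(a)=\xi\psi(b)$ implies $\theta_a>\theta_b$. The family $(F_n)$ satisfies the condition if for all $n\ge1$ and $\tilde z\in(\mathbb C^\times)^n$ there are an open neighbourhood $N_{\tilde z}$ of $\tilde z$ in $(\mathbb C^\times)^n$, on which $\mathrm{Re}(z_k\tilde z_k^{-1})>0$ for all $k$, and functions $z\mapsto G_n(z;\tilde z)$, each continuous and holomorphic on an open domain containing all points at which it is evaluated below, such that for all $z\in N_{\tilde z}$ $$F_n(z)=\sum G_m\bigl(z_{a_0+1}+\dots+z_{a_1},\dots,z_{a_{m-1}+1}+\dots+z_{a_m};\ \tilde z_{a_0+1}+\dots+\tilde z_{a_1},\dots,\tilde z_{a_{m-1}+1}+\dots+\tilde z_{a_m}\bigr)\prod_{k=1}^m v_{a_k-a_{k-1}}\bigl(\arg z_{a_{k-1}+1},\dots,\arg z_{a_k}\bigr).$$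 Here the sum is over $1\le m\le n$ and $0=a_0<a_1<\dots<a_m=n$ for which there are $c_1,\dots,c_m\in[0,2\pi)$ with $\tilde z_a\in e^{ic_k}(0,\infty)$ whenever $a_{k-1}<a\le a_k$, and in the $k$-th factor $\arg$ takes values in $(c_k-\pi/2,c_k+\pi/2)$. **Side conditions.** 1. $F_n(\lambda z_1,\dots,\lambda z_n)=F_n(z_1,\dots,z_n)$ for all $\lambda,z_1,\dots,z_n\in\mathbb C^\times$. 2. $F_1\equiv(2\pi i)^{-1}$. 3. $\sum_{\sigma\in S_n}F_n(z_{\sigma(1)},\dots,z_{\sigma(n)})=0$ for $n>1$. 4. $|F_n(z_1,\dots,z_n)|=o(|z_k|^{-1})$ as $z_k\to0$ with the other $z_l$ fixed, for each $k$. **Generating functions.** For $z,w$ in $\mathfrak H^n$, $\mathfrak H$ the open upper half plane, with $\arg\in(0,\pi)$, let $s_n(z;w)=(-1)^r$ if for every $1\le i<n$ either (a) $\arg z_i\le\arg z_{i+1}$ and $\arg(w_1+\dots+w_i)>\arg(w_{i+1}+\dots+w_n)$, or (b) $\arg z_i>\arg z_{i+1}$ and $\arg(w_1+\dots+w_i)\le\arg(w_{i+1}+\dots+w_n)$,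 where $r$ is the number of $i$ satisfying (a); otherwise $s_n(z;w)=0$. Let $$u_n(z;w)=\sum_{\psi,\xi}\ \prod_{a=1}^{l}s\bigl((z'_b)_{\xi(b)=a};(w'_b)_{\xi(b)=a}\bigr)\cdot\frac{(-1)^{l-1}}{l}\prod_{b=1}^m\frac1{|\psi^{-1}(b)|!},$$ with $\psi,\xi$ order-preserving surjections as above, $z'_b=\sum_{\psi(i)=b}z_i$, $w'_b=\sum_{\psi(i)=b}w_i$, subject to $\arg z_i=\arg z'_{\psi(i)}$ for all $i$ and $\arg\bigl(\sum_{\xi(b)=a}w'_b\bigr)=\arg(w_1+\dots+w_n)$ for all $a$. Let $K$ be an abelian group of finite rank and $C\subset K$ a subset closed under addition such that each $\alpha\in C$ is $\beta+\gamma$ for only finitely many pairs $\beta,\gamma\in C$. Let $\mathrm{Stab}$ be a nonempty open subset of the complex vector space $\mathrm{Hom}(K,\mathbb C)$ with $Z(C)\subset\mathfrak H$ for all $Z\in\mathrm{Stab}$. Let $\mathcal H$ be an associative unital $\mathbb C$-algebra with subspaces $\mathcal H^\alpha$ satisfying $\mathcal H^\alpha*\mathcal H^\beta\subseteq\mathcal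 H^{\alpha+\beta}$ for $\alpha,\beta\in C$, and let $\epsilon^\alpha(Z)\in\mathcal H^\alpha$, for $\alpha\in C$ and $Z\in\mathrm{Stab}$, satisfy the wall-crossing formula $$\epsilon^\alpha(\tilde Z)=\sum_{n\ge1,\ \alpha_1+\dots+\alpha_n=\alpha}u_n\bigl(Z(\alpha_1),\dots,Z(\alpha_n);\tilde Z(\alpha_1),\dots,\tilde Z(\alpha_n)\bigr)\,\epsilon^{\alpha_1}(Z)*\dots*\epsilon^{\alpha_n}(Z)$$ for all $Z,\tilde Z\in\mathrm{Stab}$ and $\alpha\in C$, the sum being over $\alpha_i\in C$. (This holds for the positive cone $C(\mathcal A)$ and the invariants $\epsilon^\alpha(\mu)$ of the slope stability conditions $\mu$ given by $Z\in\mathrm{Stab}(\mathcal A)$.) Put $$f^\alpha(Z)=\sum_{n\ge1,\ \alpha_1+\dots+\alpha_n=\alpha}F_n\bigl(Z(\alpha_1),\dots,Z(\alpha_n)\bigr)\,\epsilon^{\alpha_1}(Z)*\dots*\epsilon^{\alpha_n}(Z).$$ **Corollary.** There is exactly one PDE family $(F_n)$ on $(\mathbb C^\times)^n$, $n\ge1$,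 that satisfies the continuity and holomorphicity condition. It also satisfies the side conditions 1–4, and it is the only family $F_n:(\mathbb C^\times)^n\to\mathbb C$ satisfying the continuity and holomorphicity condition and 1–4. For this family, and all data as above, every $f^\alpha$, $\alpha\in C$, is a continuous and holomorphic function $\mathrm{Stab}\to\mathcal H^\alpha$, in the sense that locally on $\mathrm{Stab}$ it is a finite sum of fixed vectors of $\mathcal H^\alpha$ with continuous and holomorphic scalar coefficients. -/

import Mathlib

open Topology

noncomputable section

namespace StabGen

/-! ## Ordered partitions of `{1, …, n}` into consecutive blocks

A choice `0 = a₀ < a₁ < ⋯ < a_m = n` is a `Composition n`: the number of blocks is `m = c.length`,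
the `k`-th block `{a_{k-1}+1, …, a_k}` has `c.blocksFun k` elements and is enumerated increasingly
by `c.embedding k`.  Equivalently, `c.index : Fin n → Fin c.length` is a surjective order-preserving
map, and every such map onto some `{1, …, m}` arises from exactly one composition. -/

/-- The block sums `(z_{a₀+1} + ⋯ + z_{a₁}, …, z_{a_{m-1}+1} + ⋯ + z_{a_m})`. -/
def blockSum {n : ℕ} (c : Composition n) (z : Fin n → ℂ) : Fin c.length → ℂ :=
  fun k => ∑ j, z (c.embedding k j)

/-! ## Transformation coefficients for slope stability -/

/-- The alternative (a) at position `i` in the definition of `S`: with `τ = arg ∘ z` and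
`τ' = arg ∘ w`, `τ(i) ≤ τ(i+1)` and `τ'({1, …, i}) > τ'({i+1, …, n})`. -/
def condA {n : ℕ} (z w : Fin n → ℂ) (i j : Fin n) : Prop :=
  (z i).arg ≤ (z j).arg ∧
    (∑ k ∈ Finset.univ.filter (fun k => j ≤ k), w k).arg <
      (∑ k ∈ Finset.univ.filter (fun k => k ≤ i), w k).arg

/-- The alternative (b): `τ(i) > τ(i+1)` and `τ'({1, …, i}) ≤ τ'({i+1, …, n})`. -/
def condB {n : ℕ} (z w : Fin n → ℂ) (i j : Fin n) : Prop :=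
  (z j).arg < (z i).arg ∧
    (∑ k ∈ Finset.univ.filter (fun k => k ≤ i), w k).arg ≤
      (∑ k ∈ Finset.univ.filter (fun k => j ≤ k), w k).arg

open Classical in
/-- `s_n(z₁, …, z_n; w₁, …, w_n)`, for `z_k, w_k` in the upper half plane, where `arg` takes values
in `(0, π)`.  The pairs `(i, j)` with `j = i + 1` run over the positions `1, …, n - 1`. -/
def transS {n : ℕ} (z w : Fin n → ℂ) : ℚ :=
  if ∀ i j : Fin n, (j : ℕ) = i + 1 → condA z w i j ∨ condB z w i j then
    (-1) ^ (Finset.univ.filter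
      (fun p : Fin n × Fin n => (p.2 : ℕ) = p.1 + 1 ∧ condA z w p.1 p.2)).card
  else 0

open Classical in
/-- `u_n(z₁, …, z_n; w₁, …, w_n)`, for `z_k, w_k` in the upper half plane.  The sum runs over
order-preserving surjections `ψ = p.index : {1, …, n} → {1, …, m}` and
`ξ = q.index : {1, …, m} → {1, …, l}` such that, with `λ(b) = κ(ψ⁻¹(b))`, `μ(a) = λ(ξ⁻¹(a))`,
`τ ∘ κ = τ ∘ λ ∘ ψ` and `τ' ∘ μ` is constantly `τ'({1, …, n})`. -/
def transU {n : ℕ} (z w : Fin n → ℂ) : ℚ :=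
  ∑ p : Composition n, ∑ q : Composition p.length,
    if (∀ i : Fin n, (z i).arg = (blockSum p z (p.index i)).arg) ∧
        (∀ a : Fin q.length, (blockSum q (blockSum p w) a).arg = (∑ i, w i).arg) then
      (∏ a : Fin q.length,
          transS (fun j => blockSum p z (q.embedding a j))
            (fun j => blockSum p w (q.embedding a j))) *
        ((-1) ^ (q.length - 1) / (q.length : ℚ)) *
        ∏ b : Fin p.length, (1 / ((p.blocksFun b).factorial : ℚ))
    else 0

/-! ## The continuity and holomorphicity condition -/

/-- The subset `(0, ∞)` of `ℂ`. -/
def posReals : Set ℂ := (fun x : ℝ => (x : ℂ)) '' Set.Ioi 0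

/-- Every block of `c` has all its `w_a` on one ray `e^{i c_k} (0, ∞)`. -/
def BlocksOnRays {n : ℕ} (c : Composition n) (w : Fin n → ℂ) : Prop :=
  ∀ k : Fin c.length, ∃ θ ∈ Set.Ico (0 : ℝ) (2 * Real.pi),
    ∀ j, ∃ ρ : ℝ, 0 < ρ ∧ w (c.embedding k j) = ρ * Complex.exp (θ * Complex.I)

open Classical in
/-- The local form of `u_n`, as a function of real arguments `θ₁, …, θ_n`: the sum of
`(-1)^{l-1}/l · ∏_b 1/|ψ⁻¹(b)|!` over order-preserving surjections
`ψ = p.index : {1, …, n} → {1, …, m}` and `ξ = q.index : {1, …, m} → {1, …, l}` such that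
`ψ(a) = ψ(b)` implies `θ_a = θ_b`, and `ψ(a) < ψ(b)`, `ξ(ψ(a)) = ξ(ψ(b))` imply `θ_a > θ_b`. -/
def localU {n : ℕ} (θ : Fin n → ℝ) : ℚ :=
  ∑ p : Composition n, ∑ q : Composition p.length,
    if (∀ i j : Fin n, p.index i = p.index j → θ i = θ j) ∧
        (∀ i j : Fin n, p.index i < p.index j →
          q.index (p.index i) = q.index (p.index j) → θ j < θ i) then
      ((-1) ^ (q.length - 1) / (q.length : ℚ)) *
        ∏ b : Fin p.length, (1 / ((p.blocksFun b).factorial : ℚ))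
    else 0

open Classical in
/-- The right hand side of the identity expressing `F_n(z)` through functions `G_m`, near a base
point `w`.  Here `G m w z` stands for `G_m(z; w)`.  If `w_a ∈ e^{i c_k}(0, ∞)` and
`Re (z_a / w_a) > 0`, the argument of `z_a` chosen in `(c_k - π/2, c_k + π/2)` is
`c_k + Complex.arg (z_a / w_a)`, and the common shift `c_k` does not affect comparisons. -/
def localExpansion (G : (m : ℕ) → (Fin m → ℂ) → (Fin m → ℂ) → ℂ) {n : ℕ} (w z : Fin n → ℂ) : ℂ :=
  ∑ c : Composition n,
    if BlocksOnRays c w then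
      G c.length (blockSum c w) (blockSum c z) *
        ∏ k : Fin c.length,
          (localU (fun j => (z (c.embedding k j) / w (c.embedding k j)).arg) : ℂ)
    else 0

/-- The continuity and holomorphicity condition on a family `F_n : (ℂ^×)^n → ℂ`, `n ≥ 1`.
`N n w` is the neighbourhood of `w` in `(ℂ^×)^n`, and `D m w` is an open set on which
`z ↦ G_m(z; w)` is defined, containing all the points at which the identity evaluates it. -/
def ContHolCondition (F : (n : ℕ) → (Fin n → ℂ) → ℂ) : Prop :=
  ∃ (N D : (n : ℕ) → (Fin n → ℂ) → Set (Fin n → ℂ))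
    (G : (m : ℕ) → (Fin m → ℂ) → (Fin m → ℂ) → ℂ),
    ∀ n : ℕ, 1 ≤ n → ∀ w : Fin n → ℂ, (∀ k, w k ≠ 0) →
      (IsOpen (N n w) ∧ w ∈ N n w ∧ ∀ z ∈ N n w, ∀ k, 0 < (z k * (w k)⁻¹).re) ∧
      (IsOpen (D n w) ∧ ContinuousOn (G n w) (D n w) ∧ DifferentiableOn ℂ (G n w) (D n w)) ∧
      (∀ z ∈ N n w, ∀ c : Composition n, BlocksOnRays c w →
        blockSum c z ∈ D c.length (blockSum c w)) ∧
      ∀ z ∈ N n w, F n z = localExpansion G w z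

/-! ## The side conditions -/

/-- `F_n(λ z₁, …, λ z_n) = F_n(z₁, …, z_n)`. -/
def ScaleInvariant (F : (n : ℕ) → (Fin n → ℂ) → ℂ) : Prop :=
  ∀ n : ℕ, 1 ≤ n → ∀ l : ℂ, l ≠ 0 → ∀ z : Fin n → ℂ, (∀ k, z k ≠ 0) →
    F n (fun k => l * z k) = F n z

/-- `F₁ ≡ (2πi)⁻¹`. -/
def Normalised (F : (n : ℕ) → (Fin n → ℂ) → ℂ) : Prop :=
  ∀ z : Fin 1 → ℂ, (∀ k, z k ≠ 0) → F 1 z = (2 * (Real.pi : ℂ) * Complex.I)⁻¹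

/-- `∑_{σ ∈ S_n} F_n(z_{σ(1)}, …, z_{σ(n)}) = 0` for `n > 1`. -/
def SymmetrisationVanishes (F : (n : ℕ) → (Fin n → ℂ) → ℂ) : Prop :=
  ∀ n : ℕ, 1 < n → ∀ z : Fin n → ℂ, (∀ k, z k ≠ 0) →
    ∑ σ : Equiv.Perm (Fin n), F n (fun k => z (σ k)) = 0

/-- `|F_n(z₁, …, z_n)| = o(|z_k|⁻¹)` as `z_k → 0` with the other `z_l` fixed, for all `k`. -/
def GrowthBound (F : (n : ℕ) → (Fin n → ℂ) → ℂ) : Prop :=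
  ∀ n : ℕ, 1 ≤ n → ∀ k : Fin n, ∀ z : Fin n → ℂ, (∀ l, z l ≠ 0) →
    (fun t : ℂ => ‖F n (Function.update z k t)‖) =o[𝓝[≠] (0 : ℂ)] (fun t : ℂ => ‖t‖⁻¹)

/-- The continuity and holomorphicity condition together with the side conditions. -/
def SatisfiesConditions (F : (n : ℕ) → (Fin n → ℂ) → ℂ) : Prop :=
  ContHolCondition F ∧ ScaleInvariant F ∧ Normalised F ∧ SymmetrisationVanishes F ∧ GrowthBound F

/-! ## The family constructed from the partial differential equation -/

/-- `{z ∈ (ℂ^×)^n : z_{k+1} / z_k ∉ (0, ∞) for 1 ≤ k < n}`. -/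
def cutDomain (n : ℕ) : Set (Fin n → ℂ) :=
  {z | (∀ i, z i ≠ 0) ∧ ∀ i j : Fin n, (j : ℕ) = i + 1 → z j / z i ∉ posReals}

/-- `(z₁, …, z_k)`. -/
def initPart {n : ℕ} (z : Fin n → ℂ) (k : Fin n) : Fin (k : ℕ) → ℂ :=
  fun i => z ⟨i, i.isLt.trans k.isLt⟩

/-- `(z_{k+1}, …, z_n)`. -/
def tailPart {n : ℕ} (z : Fin n → ℂ) (k : Fin n) : Fin (n - (k : ℕ)) → ℂ :=
  fun i => z ⟨k + i, Nat.add_lt_of_lt_sub' i.isLt⟩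

/-- The equation
`dF_n = ∑_{k=1}^{n-1} F_k(z₁, …, z_k) F_{n-k}(z_{k+1}, …, z_n)
  [(dz_{k+1} + ⋯ + dz_n)/(z_{k+1} + ⋯ + z_n) - (dz₁ + ⋯ + dz_k)/(z₁ + ⋯ + z_k)]`
at the point `z`, evaluated on tangent vectors `v`.  The index `k : Fin n` is positive. -/
def PDEAt (F : (n : ℕ) → (Fin n → ℂ) → ℂ) {n : ℕ} (z : Fin n → ℂ) : Prop :=
  ∀ v : Fin n → ℂ, fderiv ℂ (F n) z v =
    ∑ k ∈ Finset.univ.filter (fun k : Fin n => 0 < (k : ℕ)),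
      F k (initPart z k) * F (n - k) (tailPart z k) *
        ((∑ i, tailPart v k i) / (∑ i, tailPart z k i) -
          (∑ i, initPart v k i) / (∑ i, initPart z k i))

/-- The family is holomorphic on the cut domains, has `F₁ ≡ (2πi)⁻¹`, satisfies the differential
equation, and vanishes at the points of the cut domain with `z₁ + ⋯ + z_n = 0`.  The differential
equation is imposed at the points where no denominator vanishes; these are dense in the cut domain,
and at the remaining points the right hand side means its holomorphic continuation. -/
def IsPDESeries (F : (n : ℕ) → (Fin n → ℂ) → ℂ) : Prop :=
  (∀ n : ℕ, 1 ≤ n → DifferentiableOn ℂ (F n) (cutDomain n)) ∧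
  (∀ z ∈ cutDomain 1, F 1 z = (2 * (Real.pi : ℂ) * Complex.I)⁻¹) ∧
  (∀ n : ℕ, 1 ≤ n → ∀ z ∈ cutDomain n,
    (∀ k : Fin n, 0 < (k : ℕ) → (∑ i, initPart z k i) ≠ 0 ∧ (∑ i, tailPart z k i) ≠ 0) →
    PDEAt F z) ∧
  (∀ n : ℕ, 2 ≤ n → ∀ z ∈ cutDomain n, ∑ i, z i = 0 → F n z = 0)

/-- The family constructed from the differential equation, extended to all of `(ℂ^×)^n` so that the
continuity and holomorphicity condition holds. -/
def IsExtendedPDESeries (F : (n : ℕ) → (Fin n → ℂ) → ℂ) : Prop :=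
  IsPDESeries F ∧ ContHolCondition F

/-- Equality of two families of functions on `(ℂ^×)^n`, `n ≥ 1`. -/
def SameFamily (F F' : (n : ℕ) → (Fin n → ℂ) → ℂ) : Prop :=
  ∀ n : ℕ, 1 ≤ n → ∀ z : Fin n → ℂ, (∀ k, z k ≠ 0) → F n z = F' n z

/-! ## Generating functions -/

/-- The tuples `(α₁, …, α_n)`, `n ≥ 1`, of elements of `C` with sum `α`. -/
def decomps {K : Type*} [AddCommGroup K] (C : Set K) (α : K) : Set (Σ n : ℕ, Fin n → K) :=
  {x | 1 ≤ x.1 ∧ (∀ i, x.2 i ∈ C) ∧ ∑ i, x.2 i = α}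

/-- The data entering the generating functions: the class group `K` of finite rank with its positive
cone `C`, the open set `Stab` of central charges, the algebra `H` with its graded pieces, and the
invariants `ε^α(Z)` with their wall-crossing formula.

`coord` is a choice of linear coordinates `Z ↦ (Z(coord 1), …, Z(coord r))` identifying the complex
vector space `Hom(K, ℂ)` with `ℂ^r`; it exists precisely when `K` has rank `r`. -/
structure CountingData (K : Type*) [AddCommGroup K] (r : ℕ) (H : Type*) [Ring H] [Algebra ℂ H] where
  C : Set K
  add_mem : ∀ α ∈ C, ∀ β ∈ C, α + β ∈ C
  finite_pairs : ∀ α ∈ C, {p : K × K | p.1 ∈ C ∧ p.2 ∈ C ∧ α = p.1 + p.2}.Finite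
  coord : Fin r → K
  coord_bijective : Function.Bijective (fun (Z : K →+ ℂ) (i : Fin r) => Z (coord i))
  Stab : Set (K →+ ℂ)
  stab_upper : ∀ Z ∈ Stab, ∀ α ∈ C, 0 < (Z α).im
  stab_nonempty : Stab.Nonempty
  stab_open : IsOpen ((fun (Z : K →+ ℂ) (i : Fin r) => Z (coord i)) '' Stab)
  piece : K → Submodule ℂ H
  mul_mem : ∀ α ∈ C, ∀ β ∈ C, ∀ x ∈ piece α, ∀ y ∈ piece β, x * y ∈ piece (α + β)
  eps : (K →+ ℂ) → K → H
  eps_mem : ∀ Z ∈ Stab, ∀ α ∈ C, eps Z α ∈ piece α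
  wall_crossing : ∀ Z ∈ Stab, ∀ Z' ∈ Stab, ∀ α ∈ C,
    eps Z' α = ∑ᶠ x ∈ decomps C α,
      (transU (fun i => Z (x.2 i)) (fun i => Z' (x.2 i)) : ℂ) •
        (List.ofFn (fun i => eps Z (x.2 i))).prod

namespace CountingData

variable {K : Type*} [AddCommGroup K] {r : ℕ} {H : Type*} [Ring H] [Algebra ℂ H]

/-- The coordinates `Hom(K, ℂ) → ℂ^r`. -/
def toCoord (A : CountingData K r H) (Z : K →+ ℂ) : Fin r → ℂ := fun i => Z (A.coord i)

/-- The generating function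
`f^α(Z) = ∑ F_n(Z(α₁), …, Z(α_n)) ε^{α₁}(Z) * ⋯ * ε^{α_n}(Z)`, over all `n ≥ 1` and
`α₁, …, α_n ∈ C` with `α₁ + ⋯ + α_n = α`; there are finitely many terms. -/
def genFun (A : CountingData K r H) (F : (n : ℕ) → (Fin n → ℂ) → ℂ) (α : K) (Z : K →+ ℂ) : H :=
  ∑ᶠ x ∈ decomps A.C α,
    F x.1 (fun i => Z (x.2 i)) • (List.ofFn (fun i => A.eps Z (x.2 i))).prod

/-- `f : Stab → piece α` is continuous and holomorphic: near every point of `Stab` it is a finite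
sum `∑ φ_i v_i` of fixed vectors `v_i` of `piece α` (which may have infinite dimension) with
continuous and holomorphic scalar coefficients `φ_i`. -/
def ContHolOnStab (A : CountingData K r H) (α : K) (f : (K →+ ℂ) → H) : Prop :=
  ∀ Z₀ ∈ A.Stab, ∃ U : Set (Fin r → ℂ), IsOpen U ∧ A.toCoord Z₀ ∈ U ∧
    ∃ (d : ℕ) (v : Fin d → H) (φ : Fin d → (Fin r → ℂ) → ℂ),
      (∀ i, v i ∈ A.piece α) ∧
      (∀ i, ContinuousOn (φ i) U ∧ DifferentiableOn ℂ (φ i) U) ∧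
      ∀ Z ∈ A.Stab, A.toCoord Z ∈ U → f Z = ∑ i, φ i (A.toCoord Z) • v i

end CountingData

end StabGen

end

/-!
# A family of functions on `(ℂ^×)^n` and holomorphic generating functions

**The functions.** On the cut domain the solution of the differential equation is an explicit
integral.  For directions `d_i` with `Re (z_i d_i) > 0` let `J_n(z; d)` be the integral of
`∏ e^{-z_i x_i} ∏ 1 / (x_i - x_{i+1})` over the product of the rays `x_i ∈ d_i (0, ∞)`
(`chainIntegral`), and put `F_n(z) = (2πi)^{-n} (z_1 + ⋯ + z_n) J_n(z; d)` with `d_i = 1 / z_i`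
(`chainFun`).  The integral does not change when the rays move without meeting their neighbours,
since it is holomorphic in `d` and invariant under positive scaling of each `d_i`
(`fderiv_chainIntegral_directions`).  It is homogeneous of degree `-1` in `z`, and multiplying the
integrand by `x_k - x_{k+1}` removes one factor of the kernel, so that the integral splits into a
product; together these facts are the differential equation (`fderiv_chainFun`).  The factor
`z_1 + ⋯ + z_n` gives the zeros.

**Crossing the cuts.** In logarithmic coordinates `F_n` continues across the locus where `z_{k+1}`
and `z_k` lie on one ray (`liftFun`), and by the residue formula the continuations from the two sides
differ by `F_{n-1}` with `z_k` and `z_{k+1}` replaced by their sum (`liftFun_jump`).  Iterating this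
near a point `w` expresses the principal values on all sides of the cuts as sums, over the ways of
merging consecutive variables in clockwise order, of functions holomorphic near `w`
(`letterFun_unwindTail`).

**Composition of block sums.** Sums over ordered partitions into blocks form an associative
composition of functions of lists, `blockComp`.  On the cuts, `extFun` is the composition of the
principal values with the weights `1 / |block|!`.  The coefficients `localU` are the composition of
`(-1)^{l-1} / l`, of the clockwise condition, and of the weights `1 / |block|!`; inverting the first
of these three (`leftInv`) produces the functions `G_n`, called `germFamily`, of the continuity and
holomorphicity condition (`contHolCondition_extFun`).

**Side conditions.** Scale invariance is a change of variables.  The growth condition follows from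
a bound of the integrand by weighted geometric means (`norm_chainKernel_le`).  The symmetrisation
vanishes at generic points because that of `∏ 1 / (x_i - x_{i+1})` does, and at special points by
averaging over the generic perturbations (`symmetrisationVanishes_extFun`).

**Uniqueness.** By induction on `n`, the difference of two families with the continuity and
holomorphicity condition is holomorphic on all of `(ℂ^×)^n`, because the terms with fewer variables
cancel (`ContHolCondition.differentiableAt_sub`).  Under the differential equation its derivative
vanishes on a dense set on which it can be followed along segments, and it has a zero
(`sameFamily_of_isExtendedPDESeries`).  Under the side conditions, removable singularities, the
maximum principle and Liouville's theorem show that it is constant, and the symmetrisation makes the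
constant zero (`sameFamily_of_satisfiesConditions`).

**Generating functions.** For `Z` near `Z₀` the wall-crossing coefficient `u_n(Z; Z₀)` is the local
coefficient `localU` if the values of `Z₀` lie on one ray, and zero otherwise (`transU_eq`).  Inserting
the local expansion of `F_n`, the generating function becomes a finite sum of
`G_n(Z(α_i); Z₀(α_i)) ε^{α_1}(Z₀) * ⋯ * ε^{α_n}(Z₀)`, with fixed vectors and holomorphic coefficients
(`CountingData.contHolOnStab_genFun`).
-/

open Topology

noncomputable section

namespace StabGen

open MeasureTheory Filter

/-! ### Holomorphic dependence of integrals on parameters -/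

/-- Cauchy's estimate for the Fréchet derivative of a holomorphic function on a ball. -/
theorem norm_fderiv_le_of_forall_mem_ball {E : Type*} [NormedAddCommGroup E] [NormedSpace ℂ E]
    {f : E → ℂ} {p : E} {R C : ℝ} (hR : 0 < R)
    (hf : DifferentiableOn ℂ f (Metric.ball p R)) (hC : ∀ x ∈ Metric.ball p R, ‖f x‖ ≤ C) :
    ‖fderiv ℂ f p‖ ≤ C / (R / 2) := by
  have hp : p ∈ Metric.ball p R := Metric.mem_ball_self hR
  have hC0 : 0 ≤ C := (norm_nonneg _).trans (hC p hp)
  have hdf : DifferentiableAt ℂ f p := hf.differentiableAt (Metric.isOpen_ball.mem_nhds hp)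
  refine ContinuousLinearMap.opNorm_le_bound _ (by positivity) fun v => ?_
  rcases eq_or_ne v 0 with rfl | hv
  · simp
  have hv' : 0 < ‖v‖ := norm_pos_iff.2 hv
  set r : ℝ := R / 2 / ‖v‖ with hr
  have hr0 : 0 < r := by positivity
  have hmem : ∀ t : ℂ, ‖t‖ ≤ r → p + t • v ∈ Metric.ball p R := by
    intro t ht
    rw [Metric.mem_ball, dist_eq_norm, add_sub_cancel_left, norm_smul]
    calc ‖t‖ * ‖v‖ ≤ r * ‖v‖ := by gcongr
      _ = R / 2 := by rw [hr]; field_simp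
      _ < R := by linarith
  have hline : ∀ t : ℂ, HasDerivAt (fun t : ℂ => p + t • v) v t := by
    intro t
    simpa using ((hasDerivAt_id t).smul_const v).const_add p
  have hder : deriv (fun t : ℂ => f (p + t • v)) 0 = fderiv ℂ f p v := by
    have h0 : HasFDerivAt f (fderiv ℂ f p) (p + (0 : ℂ) • v) := by
      simpa using hdf.hasFDerivAt
    exact (h0.comp_hasDerivAt (0 : ℂ) (hline 0)).deriv
  have hdc : DiffContOnCl ℂ (fun t : ℂ => f (p + t • v)) (Metric.ball 0 r) := by
    apply DifferentiableOn.diffContOnCl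
    intro t ht
    have ht' : ‖t‖ ≤ r := by
      have := Metric.closure_ball_subset_closedBall ht
      simpa using this
    have := hf.differentiableAt (Metric.isOpen_ball.mem_nhds (hmem t ht'))
    exact (this.comp t (hline t).differentiableAt).differentiableWithinAt
  have := Complex.norm_deriv_le_of_forall_mem_sphere_norm_le (f := fun t : ℂ => f (p + t • v))
    hr0 hdc (C := C) (fun t ht => hC _ (hmem t (by
      have := mem_sphere_zero_iff_norm.1 ht
      exact this.le)))
  rw [hder] at this
  calc _ ≤ C / r := this
    _ = C / (R / 2) * ‖v‖ := by rw [hr]; field_simp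

/-- An integral depends holomorphically on its parameters if the integrand does and is dominated
by an integrable function; its derivative is the integral of the derivative. -/
theorem hasFDerivAt_integral_of_dominated_of_differentiableOn {E : Type*} [NormedAddCommGroup E]
    [NormedSpace ℂ E] [FiniteDimensional ℂ E] {α : Type*} [MeasurableSpace α] {μ : Measure α}
    {f : E → α → ℂ} {U : Set E} {p : E} {g : α → ℝ} (hU : U ∈ 𝓝 p)
    (hm : ∀ q ∈ U, AEStronglyMeasurable (f q) μ)
    (hd : ∀ a, DifferentiableOn ℂ (fun q => f q a) U)
    (hb : ∀ q ∈ U, ∀ a, ‖f q a‖ ≤ g a) (hg : Integrable g μ) :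
    Integrable (fun a => fderiv ℂ (fun q => f q a) p) μ ∧
      HasFDerivAt (fun q => ∫ a, f q a ∂μ) (∫ a, fderiv ℂ (fun q => f q a) p ∂μ) p := by
  obtain ⟨R, hR, hRU⟩ := Metric.mem_nhds_iff.1 hU
  have hpU : p ∈ U := mem_of_mem_nhds hU
  have hdiff : ∀ a, ∀ q ∈ Metric.ball p R, DifferentiableAt ℂ (fun q => f q a) q := fun a q hq =>
    (hd a).differentiableAt (mem_of_superset (Metric.isOpen_ball.mem_nhds hq) hRU)
  -- the directional derivatives are measurable as limits of difference quotients
  have hdir : ∀ v : E, AEStronglyMeasurable (fun a => fderiv ℂ (fun q => f q a) p v) μ := by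
    intro v
    obtain ⟨N, hN⟩ : ∃ N : ℕ, ∀ n : ℕ, N ≤ n → p + ((n : ℂ) + 1)⁻¹ • v ∈ U := by
      have ht : Tendsto (fun n : ℕ => p + ((n : ℂ) + 1)⁻¹ • v) atTop (𝓝 p) := by
        have h1 : Tendsto (fun n : ℕ => ((n : ℂ) + 1)⁻¹) atTop (𝓝 0) := by
          simpa using tendsto_one_div_add_atTop_nhds_zero_nat (𝕜 := ℂ)
        simpa using (h1.smul_const v).const_add p
      exact eventually_atTop.1 (ht.eventually hU)
    refine aestronglyMeasurable_of_tendsto_ae (μ := μ) atTop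
      (f := fun (n : ℕ) a => (((n + N : ℕ) : ℂ) + 1) *
        (f (p + (((n + N : ℕ) : ℂ) + 1)⁻¹ • v) a - f p a)) ?_ ?_
    · intro n
      exact ((hm _ (hN _ (by omega))).sub (hm _ hpU)).const_mul _
    · refine Eventually.of_forall fun a => ?_
      have h := (hdiff a p (Metric.mem_ball_self hR)).hasFDerivAt
      have h2 : HasDerivAt (fun t : ℂ => f (p + t • v) a) (fderiv ℂ (fun q => f q a) p v) 0 := by
        have hl : HasDerivAt (fun t : ℂ => p + t • v) v 0 := by
          simpa using ((hasDerivAt_id (0 : ℂ)).smul_const v).const_add p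
        have h0 : HasFDerivAt (fun q => f q a) (fderiv ℂ (fun q => f q a) p) (p + (0 : ℂ) • v) := by
          simpa using h
        exact h0.comp_hasDerivAt (0 : ℂ) hl
      have h3 := h2.tendsto_slope_zero
      have h4 : Tendsto (fun n : ℕ => (((n + N : ℕ) : ℂ) + 1)⁻¹) atTop (𝓝[≠] 0) := by
        refine tendsto_nhdsWithin_iff.2 ⟨?_, Eventually.of_forall fun n => ?_⟩
        · have h1 : Tendsto (fun n : ℕ => ((n : ℂ) + 1)⁻¹) atTop (𝓝 0) := by
            simpa using tendsto_one_div_add_atTop_nhds_zero_nat (𝕜 := ℂ)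
          exact h1.comp (tendsto_add_atTop_nat N)
        · exact inv_ne_zero (Nat.cast_add_one_ne_zero _)
      refine (h3.comp h4).congr fun n => ?_
      simp
  have hmeas : AEStronglyMeasurable (fun a => fderiv ℂ (fun q => f q a) p) μ := by
    let b := Module.finBasis ℂ E
    let c : Fin (Module.finrank ℂ E) → (E →L[ℂ] ℂ) := fun i =>
      LinearMap.toContinuousLinearMap (b.coord i)
    have : (fun a => fderiv ℂ (fun q => f q a) p)
        = fun a => ∑ i, (fderiv ℂ (fun q => f q a) p (b i)) • c i := by
      funext a
      ext v
      have hv : fderiv ℂ (fun q => f q a) p v =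
          fderiv ℂ (fun q => f q a) p (∑ i, b.repr v i • b i) := by rw [b.sum_repr v]
      rw [hv, map_sum]
      simp [c, mul_comm]
    rw [this]
    exact Finset.aestronglyMeasurable_fun_sum _ fun i _ => (hdir (b i)).smul_const (c i)
  have hint : Integrable (fun a => fderiv ℂ (fun q => f q a) p) μ :=
    (hg.div_const (R / 2)).mono' hmeas (Eventually.of_forall fun a =>
      norm_fderiv_le_of_forall_mem_ball hR
        (fun x hx => (hdiff a x hx).differentiableWithinAt) (fun x hx => hb x (hRU hx) a))
  refine ⟨hint, ?_⟩
  refine hasFDerivAt_integral_of_dominated_of_fderiv_le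
    (F' := fun q a => fderiv ℂ (fun q => f q a) q) (bound := fun a => g a / (R / 2 / 2))
    (Metric.ball_mem_nhds p (half_pos hR)) (mem_of_superset hU hm)
    (Integrable.mono' hg (hm p hpU) (Eventually.of_forall (hb p hpU))) hmeas ?_
    (hg.div_const _) ?_
  · refine Eventually.of_forall fun a q hq => ?_
    have hsub : Metric.ball q (R / 2) ⊆ Metric.ball p R := by
      intro x hx
      have h1 := Metric.mem_ball.1 hx
      have h2 := Metric.mem_ball.1 hq
      exact Metric.mem_ball.2 ((dist_triangle x q p).trans_lt (by linarith))
    exact norm_fderiv_le_of_forall_mem_ball (half_pos hR)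
      (fun x hx => (hdiff a x (hsub hx)).differentiableWithinAt)
      (fun x hx => hb x (hRU (hsub hx)) a)
  · refine Eventually.of_forall fun a q hq => (hdiff a q ?_).hasFDerivAt
    exact Metric.ball_subset_ball (by linarith) hq

/-! ### The weights `e^{bs} e^{-a e^s}` -/

/-- The function `s ↦ e^{bs} e^{-e^s}`, the integrand of `Γ(b)` in the variable `log x`. -/
def gammaWeight (b s : ℝ) : ℝ := Real.exp (b * s) * Real.exp (-Real.exp s)

theorem integrable_gammaWeight {b : ℝ} (hb : 0 < b) : Integrable (gammaWeight b) := by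
  have h := Real.GammaIntegral_convergent hb
  have himg : Real.exp '' Set.univ = Set.Ioi 0 := by simp [Real.range_exp]
  rw [← himg, integrableOn_image_iff_integrableOn_abs_deriv_smul MeasurableSet.univ
    (fun x _ => (Real.hasDerivAt_exp x).hasDerivWithinAt) Real.exp_injective.injOn,
    integrableOn_univ] at h
  refine h.congr (Eventually.of_forall fun s => ?_)
  simp only [gammaWeight, smul_eq_mul, abs_of_pos (Real.exp_pos s)]
  rw [← Real.exp_mul, ← mul_assoc, mul_comm (Real.exp s), mul_assoc, ← Real.exp_add,
    mul_comm]
  ring_nf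

theorem exp_mul_exp_neg_mul {a b s : ℝ} (ha : 0 < a) :
    Real.exp (b * s) * Real.exp (-(a * Real.exp s)) =
      a ^ (-b) * gammaWeight b (s + Real.log a) := by
  rw [gammaWeight, Real.exp_add, Real.exp_log ha, Real.rpow_def_of_pos ha, mul_comm a,
    ← mul_assoc, ← Real.exp_add, ← Real.exp_add, ← Real.exp_add]
  ring_nf

theorem integrable_exp_mul_exp_neg_mul {a b : ℝ} (ha : 0 < a) (hb : 0 < b) :
    Integrable (fun s : ℝ => Real.exp (b * s) * Real.exp (-(a * Real.exp s))) := by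
  simp_rw [exp_mul_exp_neg_mul ha]
  exact ((integrable_gammaWeight hb).comp_add_right _).const_mul _

theorem integral_exp_mul_exp_neg_mul {a b : ℝ} (ha : 0 < a) :
    ∫ s : ℝ, Real.exp (b * s) * Real.exp (-(a * Real.exp s)) =
      a ^ (-b) * ∫ s, gammaWeight b s := by
  simp_rw [exp_mul_exp_neg_mul ha]
  rw [integral_const_mul, integral_add_right_eq_self (gammaWeight b)]

/-! ### The chain integrals -/

/-- The extension by zero of a finite sequence to `ℕ`. -/
def seqExt {R : Type*} [Zero R] {n : ℕ} (x : Fin n → R) (i : ℕ) : R :=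
  if h : i < n then x ⟨i, h⟩ else 0

theorem seqExt_of_lt {R : Type*} [Zero R] {n : ℕ} (x : Fin n → R) {i : ℕ} (h : i < n) :
    seqExt x i = x ⟨i, h⟩ := dif_pos h

theorem sum_range_seqExt {R : Type*} [AddCommMonoid R] {n : ℕ} (x : Fin n → R) :
    ∑ i ∈ Finset.range n, seqExt x i = ∑ i, x i := by
  rw [Finset.sum_range]
  exact Finset.sum_congr rfl fun i _ => seqExt_of_lt x i.isLt

/-- The kernel `∏_{i < n - 1} 1 / (x_i - x_{i+1})`. -/
def chainKernel {n : ℕ} (x : Fin n → ℂ) : ℂ :=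
  ∏ i ∈ Finset.range (n - 1), (seqExt x i - seqExt x (i + 1))⁻¹

/-- The point `x_i = d_i e^{s_i}` on the rays spanned by the directions `d_i`. -/
def rayPoint {n : ℕ} (d : Fin n → ℂ) (s : Fin n → ℝ) : Fin n → ℂ :=
  fun i => d i * Complex.exp (s i)

/-- The integrand `∏ x_i e^{-z_i x_i} · ∏ 1 / (x_i - x_{i+1})` at `x_i = d_i e^{s_i}`. -/
def chainTerm {n : ℕ} (z d : Fin n → ℂ) (s : Fin n → ℝ) : ℂ :=
  (∏ i, rayPoint d s i * Complex.exp (-(z i * rayPoint d s i))) * chainKernel (rayPoint d s)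

/-- The chain integral
`∫ e^{-∑ z_i x_i} ∏ 1 / (x_i - x_{i+1}) dx₁ ⋯ dx_n`, each `x_i` running along the ray spanned by
`d_i`.  It is written in the logarithmic coordinates `s_i` on the rays. -/
def chainIntegral {n : ℕ} (z d : Fin n → ℂ) : ℂ := ∫ s : Fin n → ℝ, chainTerm z d s

/-- The pairs `(z, d)` for which the chain integral converges absolutely: `e^{-z_i x}` decays along
the ray of `d_i`, and consecutive rays are different. -/
def chainDomain (n : ℕ) : Set ((Fin n → ℂ) × (Fin n → ℂ)) :=
  {p | (∀ i, 0 < (p.1 i * p.2 i).re) ∧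
    ∀ i j : Fin n, (j : ℕ) = i + 1 → -(p.2 i * star (p.2 j)) ∈ Complex.slitPlane}

theorem isOpen_chainDomain (n : ℕ) : IsOpen (chainDomain n) := by
  have h : chainDomain n = (⋂ i, {p | 0 < (p.1 i * p.2 i).re}) ∩
      ⋂ (i : Fin n) (j : Fin n) (_ : (j : ℕ) = i + 1),
        {p | -(p.2 i * star (p.2 j)) ∈ Complex.slitPlane} := by
    ext p
    simp [chainDomain]
  rw [h]
  refine (isOpen_iInter_of_finite fun i => ?_).inter (isOpen_iInter_of_finite fun i =>
    isOpen_iInter_of_finite fun j => isOpen_iInter_of_finite fun _ => ?_)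
  · exact isOpen_lt continuous_const (by fun_prop)
  · exact Complex.isOpen_slitPlane.preimage (by fun_prop)

/-- The rays of `a` and `b` are different, with a quantitative lower bound. -/
def RaysApart (c : ℝ) (a b : ℂ) : Prop :=
  ∀ s t : ℝ, c * (Real.exp s + Real.exp t) ≤ ‖a * Complex.exp s - b * Complex.exp t‖

theorem ne_of_neg_mul_star_mem_slitPlane {a b : ℂ} (h : -(a * star b) ∈ Complex.slitPlane)
    {s t : ℝ} (hs : 0 ≤ s) (ht : 0 ≤ t) (hst : 0 < s + t) : a * s - b * t ≠ 0 := by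
  have hab : a * star b ≠ 0 := by
    intro h0
    rw [h0, neg_zero] at h
    exact Complex.zero_notMem_slitPlane h
  have ha : a ≠ 0 := left_ne_zero_of_mul hab
  have hb : b ≠ 0 := by
    have := right_ne_zero_of_mul hab
    simpa using this
  intro h0
  have heq : a * s = b * t := sub_eq_zero.1 h0
  rcases hs.eq_or_lt with rfl | hs'
  · have ht' : (t : ℂ) = 0 := by
      rcases mul_eq_zero.1 (heq.symm.trans (by simp)) with h1 | h1
      · exact absurd h1 hb
      · exact h1
    have : t = 0 := by exact_mod_cast ht'
    simp [this] at hst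
  · have hsC : (s : ℂ) ≠ 0 := by exact_mod_cast hs'.ne'
    have ha' : a = ((t / s : ℝ) : ℂ) * b := by
      push_cast
      field_simp
      linear_combination heq
    rw [ha', mul_assoc] at h
    have h2 : b * star b = ((Complex.normSq b : ℝ) : ℂ) := Complex.mul_conj b
    rw [h2, ← Complex.ofReal_mul, ← Complex.ofReal_neg, Complex.ofReal_mem_slitPlane] at h
    have : 0 ≤ t / s * Complex.normSq b := mul_nonneg (div_nonneg ht hs) (Complex.normSq_nonneg b)
    linarith

theorem RaysApart.of_unit {c : ℝ} {a b : ℂ}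
    (h : ∀ x ∈ Set.Icc (0 : ℝ) 1, c ≤ ‖a * x - b * (1 - x : ℝ)‖) : RaysApart c a b := by
  intro s t
  have hpos : 0 < Real.exp s + Real.exp t := by positivity
  have hx := h (Real.exp s / (Real.exp s + Real.exp t))
    ⟨by positivity, (div_le_one hpos).2 (by linarith [Real.exp_pos t])⟩
  have h1 : (1 - Real.exp s / (Real.exp s + Real.exp t)) =
      Real.exp t / (Real.exp s + Real.exp t) := by field_simp; ring
  rw [h1] at hx
  have h2 : a * ((Real.exp s / (Real.exp s + Real.exp t) : ℝ) : ℂ) -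
      b * ((Real.exp t / (Real.exp s + Real.exp t) : ℝ) : ℂ) =
      (a * Complex.exp s - b * Complex.exp t) / ((Real.exp s + Real.exp t : ℝ) : ℂ) := by
    push_cast
    ring
  rw [h2, norm_div, Complex.norm_real, Real.norm_of_nonneg hpos.le, le_div_iff₀ hpos] at hx
  exact hx

theorem exists_unit_bound {a b : ℂ} (h : -(a * star b) ∈ Complex.slitPlane) :
    ∃ c > 0, ∀ x ∈ Set.Icc (0 : ℝ) 1, c ≤ ‖a * x - b * (1 - x : ℝ)‖ := by
  obtain ⟨x₀, hx₀, hmin⟩ := (isCompact_Icc (a := (0 : ℝ)) (b := 1)).exists_isMinOn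
    ⟨0, by simp⟩ (f := fun x : ℝ => ‖a * x - b * (1 - x : ℝ)‖) (by fun_prop)
  refine ⟨_, norm_pos_iff.2 (ne_of_neg_mul_star_mem_slitPlane h hx₀.1 (sub_nonneg.2 hx₀.2)
    (by simp)), fun x hx => hmin hx⟩

theorem eventually_raysApart {a b : ℂ} (h : -(a * star b) ∈ Complex.slitPlane) :
    ∃ c > 0, ∀ᶠ p : ℂ × ℂ in 𝓝 (a, b), RaysApart c p.1 p.2 := by
  obtain ⟨c, hc, hb⟩ := exists_unit_bound h
  refine ⟨c / 2, by positivity, ?_⟩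
  filter_upwards [Metric.ball_mem_nhds (a, b) (by positivity : 0 < c / 4)] with p hp
  refine RaysApart.of_unit fun x hx => ?_
  have h0 := hb x hx
  rw [Metric.mem_ball, Prod.dist_eq, max_lt_iff] at hp
  have h1 : ‖a - p.1‖ ≤ c / 4 := by rw [← dist_eq_norm, dist_comm]; exact hp.1.le
  have h2 : ‖b - p.2‖ ≤ c / 4 := by rw [← dist_eq_norm, dist_comm]; exact hp.2.le
  have h3 : a * x - b * (1 - x : ℝ) = (p.1 * x - p.2 * (1 - x : ℝ)) +
      ((a - p.1) * x - (b - p.2) * (1 - x : ℝ)) := by ring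
  have h4 : ‖(a - p.1) * x - (b - p.2) * (1 - x : ℝ)‖ ≤ c / 4 + c / 4 := by
    refine (norm_sub_le _ _).trans (add_le_add ?_ ?_)
    · rw [norm_mul, Complex.norm_real, Real.norm_of_nonneg hx.1]
      nlinarith [hx.1, hx.2, norm_nonneg (a - p.1)]
    · rw [norm_mul, Complex.norm_real, Real.norm_of_nonneg (sub_nonneg.2 hx.2)]
      nlinarith [hx.1, hx.2, norm_nonneg (b - p.2)]
  rw [h3] at h0
  linarith [norm_add_le (p.1 * x - p.2 * (1 - x : ℝ)) ((a - p.1) * x - (b - p.2) * (1 - x : ℝ))]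

theorem sum_range_weights (S : ℕ → ℝ) (a : ℝ) (m : ℕ) :
    ∑ i ∈ Finset.range m, ((1 - (i + 1) * a) * S i + (i + 1) * a * S (i + 1)) =
      (1 - a) * ∑ i ∈ Finset.range m, S i + m * a * S m := by
  induction m with
  | zero => simp
  | succ m ih => rw [Finset.sum_range_succ, ih, Finset.sum_range_succ]; push_cast; ring

theorem exp_convex_comb_le {α s t : ℝ} (h0 : 0 ≤ α) (h1 : α ≤ 1) :
    Real.exp ((1 - α) * s + α * t) ≤ Real.exp s + Real.exp t := by
  rcases le_total s t with h | h
  · have : (1 - α) * s + α * t ≤ t := by nlinarith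
    linarith [Real.exp_le_exp.2 this, Real.exp_pos s]
  · have : (1 - α) * s + α * t ≤ s := by nlinarith
    linarith [Real.exp_le_exp.2 this, Real.exp_pos t]

/-- The product of the differences `x_i - x_{i+1}` is bounded below by the weighted geometric means
of `|x_i|` and `|x_{i+1}|` with weights `1 - (i+1)/n` and `(i+1)/n`.  With this choice of weights
each `|x_i|` gets the same total exponent `1 - 1/n`, so that the kernel is integrable. -/
theorem norm_chainKernel_le {n : ℕ} (hn : 1 ≤ n) {d : Fin n → ℂ} {c : ℝ} (hc : 0 < c)
    (hd : ∀ i j : Fin n, (j : ℕ) = i + 1 → RaysApart c (d i) (d j)) (s : Fin n → ℝ) :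
    ‖chainKernel (rayPoint d s)‖ ≤
      c⁻¹ ^ (n - 1) * ∏ i, Real.exp (((n : ℝ)⁻¹ - 1) * s i) := by
  have hn0 : (0 : ℝ) < n := by exact_mod_cast hn
  have hcast : ((n - 1 : ℕ) : ℝ) = n - 1 := by rw [Nat.cast_sub hn]; simp
  have hexp : ∏ i, Real.exp (((n : ℝ)⁻¹ - 1) * s i) =
      ∏ i ∈ Finset.range (n - 1),
        Real.exp (-((1 - (i + 1) * (n : ℝ)⁻¹) * seqExt s i +
          (i + 1) * (n : ℝ)⁻¹ * seqExt s (i + 1))) := by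
    rw [← Real.exp_sum, ← Real.exp_sum, Finset.sum_neg_distrib, sum_range_weights,
      ← Finset.mul_sum, ← sum_range_seqExt s, hcast]
    congr 1
    obtain ⟨m, rfl⟩ : ∃ m, n = m + 1 := ⟨n - 1, by omega⟩
    rw [Finset.sum_range_succ, Nat.add_sub_cancel]
    push_cast
    field_simp
    ring
  rw [hexp, ← Finset.card_range (n - 1), ← Finset.prod_const, Finset.card_range,
    ← Finset.prod_mul_distrib, chainKernel, norm_prod]
  refine Finset.prod_le_prod (fun _ _ => norm_nonneg _) fun i hi => ?_
  have hi' : i + 1 < n := by have := Finset.mem_range.1 hi; omega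
  rw [seqExt_of_lt _ (by omega : i < n), seqExt_of_lt _ hi', seqExt_of_lt _ (by omega : i < n),
    seqExt_of_lt _ hi', norm_inv, Real.exp_neg, ← mul_inv]
  refine inv_anti₀ (by positivity) ?_
  refine le_trans ?_ (hd ⟨i, by omega⟩ ⟨i + 1, hi'⟩ rfl _ _)
  refine mul_le_mul_of_nonneg_left (exp_convex_comb_le (by positivity) ?_) hc.le
  rw [← div_eq_mul_inv, div_le_one hn0]
  exact_mod_cast hi'.le

/-- The dominating function for the integrand of the chain integral. -/
def chainBound {n : ℕ} (c D : ℝ) (a : Fin n → ℝ) (s : Fin n → ℝ) : ℝ :=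
  c⁻¹ ^ (n - 1) * D ^ n *
    ∏ i, (Real.exp ((n : ℝ)⁻¹ * s i) * Real.exp (-(a i * Real.exp (s i))))

theorem norm_chainTerm_le {n : ℕ} (hn : 1 ≤ n) {z d : Fin n → ℂ} {c D : ℝ} {a : Fin n → ℝ}
    (hc : 0 < c) (hD : ∀ i, ‖d i‖ ≤ D) (ha : ∀ i, a i ≤ (z i * d i).re)
    (hd : ∀ i j : Fin n, (j : ℕ) = i + 1 → RaysApart c (d i) (d j)) (s : Fin n → ℝ) :
    ‖chainTerm z d s‖ ≤ chainBound c D a s := by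
  have h1 : ∀ i, ‖rayPoint d s i * Complex.exp (-(z i * rayPoint d s i))‖ ≤
      D * Real.exp (s i) * Real.exp (-(a i * Real.exp (s i))) := by
    intro i
    rw [norm_mul, rayPoint, norm_mul, ← Complex.ofReal_exp, Complex.norm_real,
      Real.norm_of_nonneg (Real.exp_pos _).le, Complex.norm_exp]
    have : (-(z i * (d i * (Real.exp (s i) : ℂ)))).re = -((z i * d i).re * Real.exp (s i)) := by
      rw [← mul_assoc, Complex.neg_re, Complex.re_mul_ofReal]
    rw [this]
    have hD0 : 0 ≤ D := (norm_nonneg _).trans (hD i)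
    gcongr
    · exact hD i
    · exact ha i
  rw [chainTerm, norm_mul, norm_prod]
  refine (mul_le_mul (Finset.prod_le_prod (fun _ _ => norm_nonneg _) fun i _ => h1 i)
    (norm_chainKernel_le hn hc hd s) (norm_nonneg _)
    (Finset.prod_nonneg fun i _ => (norm_nonneg _).trans (h1 i))).trans (le_of_eq ?_)
  have h2 : ∏ i, (Real.exp ((n : ℝ)⁻¹ * s i) * Real.exp (-(a i * Real.exp (s i)))) =
      (∏ i, Real.exp (s i) * Real.exp (-(a i * Real.exp (s i)))) *
        ∏ i, Real.exp (((n : ℝ)⁻¹ - 1) * s i) := by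
    rw [← Finset.prod_mul_distrib]
    refine Finset.prod_congr rfl fun i _ => ?_
    rw [mul_right_comm, ← Real.exp_add, ← Real.exp_add, ← Real.exp_add]
    ring_nf
  rw [chainBound, h2]
  simp_rw [mul_assoc D]
  rw [Finset.prod_mul_distrib, Finset.prod_const, Finset.card_univ, Fintype.card_fin]
  ring

theorem integrable_chainBound {n : ℕ} (hn : 1 ≤ n) {c D : ℝ} {a : Fin n → ℝ} (ha : ∀ i, 0 < a i) :
    Integrable (chainBound c D a) := by
  refine Integrable.const_mul ?_ _
  exact Integrable.fintype_prod (f := fun i (s : ℝ) =>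
    Real.exp ((n : ℝ)⁻¹ * s) * Real.exp (-(a i * Real.exp s)))
    fun i => integrable_exp_mul_exp_neg_mul (ha i) (by positivity)

theorem integral_chainBound {n : ℕ} {c D : ℝ} {a : Fin n → ℝ} (ha : ∀ i, 0 < a i) :
    ∫ s, chainBound c D a s = c⁻¹ ^ (n - 1) * D ^ n * (∫ s, gammaWeight (n : ℝ)⁻¹ s) ^ n *
      ∏ i, a i ^ (-(n : ℝ)⁻¹) := by
  unfold chainBound
  rw [integral_const_mul, integral_fintype_prod_volume_eq_prod (f := fun i (s : ℝ) =>
    Real.exp ((n : ℝ)⁻¹ * s) * Real.exp (-(a i * Real.exp s)))]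
  simp_rw [fun i => integral_exp_mul_exp_neg_mul (b := (n : ℝ)⁻¹) (ha i)]
  rw [Finset.prod_mul_distrib, Finset.prod_const, Finset.card_univ, Fintype.card_fin]
  ring

/-- Uniform estimate for chain integrals. -/
theorem norm_chainIntegral_le {n : ℕ} (hn : 1 ≤ n) {z d : Fin n → ℂ} {c D : ℝ} {a : Fin n → ℝ}
    (hc : 0 < c) (hD : ∀ i, ‖d i‖ ≤ D) (ha0 : ∀ i, 0 < a i) (ha : ∀ i, a i ≤ (z i * d i).re)
    (hd : ∀ i j : Fin n, (j : ℕ) = i + 1 → RaysApart c (d i) (d j)) :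
    ‖chainIntegral z d‖ ≤ c⁻¹ ^ (n - 1) * D ^ n * (∫ s, gammaWeight (n : ℝ)⁻¹ s) ^ n *
      ∏ i, a i ^ (-(n : ℝ)⁻¹) := by
  rw [← integral_chainBound ha0]
  exact norm_integral_le_of_norm_le (integrable_chainBound hn ha0)
    (Eventually.of_forall (norm_chainTerm_le hn hc hD ha hd))

/-- The convergence conditions hold locally uniformly, which is what the domination of the integrand
needs. -/
theorem exists_local_bounds {n : ℕ} {p : (Fin n → ℂ) × (Fin n → ℂ)} (hp : p ∈ chainDomain n) :
    ∃ c > 0, ∃ D a : ℝ, 0 < a ∧ ∀ᶠ q in 𝓝 p, q ∈ chainDomain n ∧ (∀ i, ‖q.2 i‖ ≤ D) ∧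
      (∀ i, a ≤ (q.1 i * q.2 i).re) ∧
      ∀ i j : Fin n, (j : ℕ) = i + 1 → RaysApart c (q.2 i) (q.2 j) := by
  have h1 : ∀ i j : Fin n, ∀ᶠ c in 𝓝[>] (0 : ℝ), (j : ℕ) = i + 1 →
      ∀ᶠ q in 𝓝 p, RaysApart c (q.2 i) (q.2 j) := by
    intro i j
    by_cases hij : (j : ℕ) = i + 1
    · obtain ⟨c, hc, h⟩ := eventually_raysApart (hp.2 i j hij)
      filter_upwards [Ioc_mem_nhdsGT hc] with c' hc' _
      have hcont : Tendsto (fun q : (Fin n → ℂ) × (Fin n → ℂ) => (q.2 i, q.2 j)) (𝓝 p)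
          (𝓝 (p.2 i, p.2 j)) := by
        exact Continuous.tendsto (by fun_prop) p
      filter_upwards [hcont.eventually h] with q hq s t
      exact (mul_le_mul_of_nonneg_right hc'.2 (by positivity)).trans (hq s t)
    · exact Eventually.of_forall fun _ h => absurd h hij
  have h2 : ∀ i : Fin n, ∀ᶠ a in 𝓝[>] (0 : ℝ), ∀ᶠ q in 𝓝 p, a ≤ (q.1 i * q.2 i).re := by
    intro i
    have h3 := hp.1 i
    filter_upwards [Ioo_mem_nhdsGT h3] with a ha
    have hcont : Tendsto (fun q : (Fin n → ℂ) × (Fin n → ℂ) => (q.1 i * q.2 i).re) (𝓝 p)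
        (𝓝 (p.1 i * p.2 i).re) := Continuous.tendsto (by fun_prop) p
    filter_upwards [hcont.eventually (lt_mem_nhds ha.2)] with q hq using hq.le
  obtain ⟨c, hc, hc0⟩ := ((eventually_all.2 fun i => eventually_all.2 (h1 i)).and
    self_mem_nhdsWithin).exists
  obtain ⟨a, ha, ha0⟩ := ((eventually_all.2 h2).and self_mem_nhdsWithin).exists
  refine ⟨c, hc0, ‖p.2‖ + 1, a, ha0, ?_⟩
  have h4 : ∀ᶠ q in 𝓝 p, ∀ i, ‖q.2 i‖ ≤ ‖p.2‖ + 1 := by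
    have hcont : Tendsto (fun q : (Fin n → ℂ) × (Fin n → ℂ) => ‖q.2‖) (𝓝 p) (𝓝 ‖p.2‖) :=
      Continuous.tendsto (by fun_prop) p
    filter_upwards [hcont.eventually (gt_mem_nhds (lt_add_one _))] with q hq i
    exact (norm_le_pi_norm q.2 i).trans hq.le
  have h5 : ∀ᶠ q in 𝓝 p, ∀ i j : Fin n, (j : ℕ) = i + 1 → RaysApart c (q.2 i) (q.2 j) :=
    eventually_all.2 fun i => eventually_all.2 fun j => by
      by_cases hij : (j : ℕ) = i + 1
      · filter_upwards [hc i j hij] with q hq _ using hq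
      · exact Eventually.of_forall fun _ h => absurd h hij
  filter_upwards [(isOpen_chainDomain n).mem_nhds hp, h4, eventually_all.2 ha, h5] with q a b c d
    using ⟨a, b, c, d⟩

theorem seqExt_sub_ne_zero {n : ℕ} {p : (Fin n → ℂ) × (Fin n → ℂ)} (hp : p ∈ chainDomain n)
    (s : Fin n → ℝ) {i : ℕ} (hi : i ∈ Finset.range (n - 1)) :
    seqExt (rayPoint p.2 s) i - seqExt (rayPoint p.2 s) (i + 1) ≠ 0 := by
  have hi' : i + 1 < n := by have := Finset.mem_range.1 hi; omega
  rw [seqExt_of_lt _ (by omega : i < n), seqExt_of_lt _ hi']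
  have := ne_of_neg_mul_star_mem_slitPlane (hp.2 ⟨i, by omega⟩ ⟨i + 1, hi'⟩ rfl)
    (Real.exp_pos (s ⟨i, by omega⟩)).le (Real.exp_pos (s ⟨i + 1, hi'⟩)).le
    (by positivity)
  simpa [rayPoint] using this

theorem continuous_seqExt_rayPoint {n : ℕ} (d : Fin n → ℂ) (i : ℕ) :
    Continuous fun s => seqExt (rayPoint d s) i := by
  unfold seqExt
  split_ifs
  · unfold rayPoint; fun_prop
  · exact continuous_const

theorem continuous_chainTerm {n : ℕ} {p : (Fin n → ℂ) × (Fin n → ℂ)} (hp : p ∈ chainDomain n) :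
    Continuous (chainTerm p.1 p.2) := by
  unfold chainTerm chainKernel
  refine Continuous.mul (by unfold rayPoint; fun_prop) (continuous_finsetProd _ fun i hi => ?_)
  exact ((continuous_seqExt_rayPoint _ _).sub (continuous_seqExt_rayPoint _ _)).inv₀
    fun s => seqExt_sub_ne_zero hp s hi

theorem integrable_chainTerm {n : ℕ} (hn : 1 ≤ n) {p : (Fin n → ℂ) × (Fin n → ℂ)}
    (hp : p ∈ chainDomain n) : Integrable (chainTerm p.1 p.2) := by
  obtain ⟨c, hc, D, a, ha, h⟩ := exists_local_bounds hp
  obtain ⟨-, h1, h2, h3⟩ := h.self_of_nhds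
  exact (integrable_chainBound hn fun _ => ha).mono'
    (continuous_chainTerm hp).aestronglyMeasurable
    (Eventually.of_forall (norm_chainTerm_le hn hc h1 h2 h3))

theorem differentiableOn_finsetProd {E ι : Type*} [NormedAddCommGroup E] [NormedSpace ℂ E]
    {u : Finset ι} {g : ι → E → ℂ} {U : Set E} (h : ∀ i ∈ u, DifferentiableOn ℂ (g i) U) :
    DifferentiableOn ℂ (fun x => ∏ i ∈ u, g i x) U := by
  classical
  induction u using Finset.induction_on with
  | empty => simp
  | insert a u ha ih =>
    simp_rw [Finset.prod_insert ha]
    exact (h a (Finset.mem_insert_self a u)).mul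
      (ih fun i hi => h i (Finset.mem_insert_of_mem hi))

theorem differentiableOn_chainTerm {n : ℕ} (s : Fin n → ℝ) :
    DifferentiableOn ℂ (fun q : (Fin n → ℂ) × (Fin n → ℂ) => chainTerm q.1 q.2 s)
      (chainDomain n) := by
  have hpt : ∀ i, Differentiable ℂ fun q : (Fin n → ℂ) × (Fin n → ℂ) => rayPoint q.2 s i := by
    intro i
    unfold rayPoint
    fun_prop
  have hext : ∀ i, Differentiable ℂ fun q : (Fin n → ℂ) × (Fin n → ℂ) =>
      seqExt (rayPoint q.2 s) i := by
    intro i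
    unfold seqExt
    split_ifs
    · exact hpt _
    · exact differentiable_const _
  unfold chainTerm chainKernel
  refine DifferentiableOn.mul (differentiableOn_finsetProd fun i _ => ?_)
    (differentiableOn_finsetProd fun i hi => ?_)
  · have := hpt i
    refine Differentiable.differentiableOn ?_
    fun_prop
  · exact ((hext i).sub (hext (i + 1))).differentiableOn.inv fun q hq =>
      seqExt_sub_ne_zero hq s hi

/-- Chain integrals are holomorphic in `z` and the directions. -/
theorem hasFDerivAt_chainIntegral {n : ℕ} (hn : 1 ≤ n) {p : (Fin n → ℂ) × (Fin n → ℂ)}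
    (hp : p ∈ chainDomain n) :
    Integrable (fun s => fderiv ℂ (fun q : (Fin n → ℂ) × (Fin n → ℂ) => chainTerm q.1 q.2 s) p) ∧
    HasFDerivAt (fun q : (Fin n → ℂ) × (Fin n → ℂ) => chainIntegral q.1 q.2)
      (∫ s, fderiv ℂ (fun q : (Fin n → ℂ) × (Fin n → ℂ) => chainTerm q.1 q.2 s) p) p := by
  obtain ⟨c, hc, D, a, ha, h⟩ := exists_local_bounds hp
  refine hasFDerivAt_integral_of_dominated_of_differentiableOn h
    (fun q hq => (continuous_chainTerm hq.1).aestronglyMeasurable)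
    (fun s => (differentiableOn_chainTerm s).mono fun q hq => hq.1)
    (fun q hq => norm_chainTerm_le hn hc hq.2.1 hq.2.2.1 hq.2.2.2)
    (integrable_chainBound hn fun _ => ha)

/-! ### Invariance properties of chain integrals -/

theorem chainKernel_smul {n : ℕ} (a : ℂ) (x : Fin n → ℂ) :
    chainKernel (fun i => a * x i) = a⁻¹ ^ (n - 1) * chainKernel x := by
  unfold chainKernel
  rw [← Finset.card_range (n - 1), ← Finset.prod_const, Finset.card_range,
    ← Finset.prod_mul_distrib]
  refine Finset.prod_congr rfl fun i hi => ?_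
  have hi' : i + 1 < n := by have := Finset.mem_range.1 hi; omega
  rw [seqExt_of_lt _ (by omega : i < n), seqExt_of_lt _ hi', seqExt_of_lt _ (by omega : i < n),
    seqExt_of_lt _ hi', ← mul_sub, mul_inv]

theorem chainIntegral_smul {n : ℕ} (hn : 1 ≤ n) {a : ℂ} (ha : a ≠ 0) (z d : Fin n → ℂ) :
    a * chainIntegral (fun i => a * z i) d = chainIntegral z fun i => a * d i := by
  unfold chainIntegral
  rw [← integral_const_mul]
  congr 1
  funext s
  have h1 : rayPoint (fun i => a * d i) s = fun i => a * rayPoint d s i := by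
    funext i
    simp [rayPoint, mul_assoc]
  obtain ⟨m, rfl⟩ : ∃ m, n = m + 1 := ⟨n - 1, by omega⟩
  rw [chainTerm, chainTerm, h1, chainKernel_smul]
  simp only [mul_assoc a, Finset.prod_mul_distrib, Finset.prod_const, Finset.card_univ,
    Fintype.card_fin, Nat.add_sub_cancel, inv_pow, mul_left_comm _ a]
  field_simp
  ring

theorem chainIntegral_mul_exp {n : ℕ} (z d : Fin n → ℂ) (t : Fin n → ℝ) :
    chainIntegral z (fun i => d i * Complex.exp (t i)) = chainIntegral z d := by
  unfold chainIntegral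
  rw [← integral_add_right_eq_self (chainTerm z d) t]
  congr 1
  funext s
  have h1 : rayPoint (fun i => d i * Complex.exp (t i)) s = rayPoint d (s + t) := by
    funext i
    simp only [rayPoint, Pi.add_apply, Complex.ofReal_add, Complex.exp_add]
    ring
  rw [chainTerm, chainTerm, h1]

theorem ne_zero_of_mem_chainDomain {n : ℕ} {p : (Fin n → ℂ) × (Fin n → ℂ)}
    (hp : p ∈ chainDomain n) (i : Fin n) : p.2 i ≠ 0 := by
  intro h
  have := hp.1 i
  simp [h] at this

/-- Chain integrals do not change under rotation of the rays: they are holomorphic in the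
directions and invariant under positive real scalings, so the derivative vanishes. -/
theorem fderiv_chainIntegral_directions {n : ℕ} (hn : 1 ≤ n) {p : (Fin n → ℂ) × (Fin n → ℂ)}
    (hp : p ∈ chainDomain n) (v : Fin n → ℂ) :
    fderiv ℂ (fun q : (Fin n → ℂ) × (Fin n → ℂ) => chainIntegral q.1 q.2) p (0, v) = 0 := by
  obtain ⟨-, h⟩ := hasFDerivAt_chainIntegral hn hp
  rw [h.fderiv]
  set L := ∫ s, fderiv ℂ (fun q : (Fin n → ℂ) × (Fin n → ℂ) => chainTerm q.1 q.2 s) p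
  have hbasis : ∀ i : Fin n, L (0, Pi.single i 1) = 0 := by
    intro i
    have hγ : HasDerivAt (fun t : ℝ => (p.1, fun j => p.2 j * Complex.exp
        ((Pi.single i t : Fin n → ℝ) j))) (0, Pi.single i (p.2 i)) 0 := by
      refine (hasDerivAt_const _ _).prodMk (hasDerivAt_pi.2 fun j => ?_)
      rcases eq_or_ne j i with rfl | hj
      · simp only [Pi.single_eq_same]
        have := ((Complex.ofRealCLM.hasDerivAt (x := 0)).cexp).const_mul (p.2 j)
        simpa using this
      · simp only [Pi.single_eq_of_ne hj]
        exact hasDerivAt_const _ _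
    have h0 : (p.1, fun j => p.2 j * Complex.exp ((Pi.single i (0 : ℝ) : Fin n → ℝ) j)) = p := by
      simp
    have hc := (h0.symm ▸ h : HasFDerivAt _ L _).restrictScalars ℝ |>.comp_hasDerivAt (0 : ℝ) hγ
    have hconst : (fun q : (Fin n → ℂ) × (Fin n → ℂ) => chainIntegral q.1 q.2) ∘
        (fun t : ℝ => (p.1, fun j => p.2 j * Complex.exp ((Pi.single i t : Fin n → ℝ) j))) =
        fun _ => chainIntegral p.1 p.2 := by
      funext t
      exact chainIntegral_mul_exp p.1 p.2 _
    rw [hconst] at hc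
    have h1 := hc.unique (hasDerivAt_const _ _)
    have h2 : ((0 : Fin n → ℂ), (Pi.single i (p.2 i) : Fin n → ℂ)) =
        p.2 i • ((0 : Fin n → ℂ), (Pi.single i 1 : Fin n → ℂ)) := by
      rw [Prod.smul_mk, smul_zero, ← Pi.single_smul, smul_eq_mul, mul_one]
    rw [h2] at h1
    have h3 : p.2 i * L (0, Pi.single i 1) = 0 := by
      rw [← smul_eq_mul, ← map_smul]
      exact h1
    exact (mul_eq_zero.1 h3).resolve_left (ne_zero_of_mem_chainDomain hp i)
  have hv : ((0 : Fin n → ℂ), v) = ∑ i, v i • ((0 : Fin n → ℂ), (Pi.single i 1 : Fin n → ℂ)) := by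
    refine Prod.ext ?_ ?_
    · simp [Prod.fst_sum]
    · rw [Prod.snd_sum]
      simp only [Prod.smul_mk]
      conv_lhs => rw [← Finset.univ_sum_single v]
      refine Finset.sum_congr rfl fun i _ => ?_
      rw [← Pi.single_smul, smul_eq_mul, mul_one]
  rw [hv, map_sum]
  exact Finset.sum_eq_zero fun i _ => by rw [map_smul, hbasis, smul_zero]

/-- The chain integral is unchanged when the directions move along a path. -/
theorem chainIntegral_eq_of_path {n : ℕ} (hn : 1 ≤ n) {z : Fin n → ℂ} {γ : ℝ → Fin n → ℂ}
    (hγ : Differentiable ℝ γ) (h : ∀ t ∈ Set.Icc (0 : ℝ) 1, (z, γ t) ∈ chainDomain n) :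
    chainIntegral z (γ 1) = chainIntegral z (γ 0) := by
  have hder : ∀ t ∈ Set.Icc (0 : ℝ) 1, HasDerivAt (fun t => chainIntegral z (γ t)) 0 t := by
    intro t ht
    have h1 := (hasFDerivAt_chainIntegral hn (h t ht)).2
    have h2 : HasDerivAt (fun t => (z, γ t)) (0, deriv γ t) t :=
      (hasDerivAt_const _ _).prodMk (hγ t).hasDerivAt
    have h3 := (h1.restrictScalars ℝ).comp_hasDerivAt t h2
    have h4 := fderiv_chainIntegral_directions hn (h t ht) (deriv γ t)
    rw [h1.fderiv] at h4
    rw [← h4]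
    exact h3
  exact constant_of_has_deriv_right_zero (f := fun t => chainIntegral z (γ t))
    (fun t ht => (hder t ht).continuousAt.continuousWithinAt)
    (fun t ht => (hder t (Set.Ico_subset_Icc_self ht)).hasDerivWithinAt) 1 (by simp)

/-! ### The differential equation -/

theorem hasFDerivAt_chainIntegral_left {n : ℕ} (hn : 1 ≤ n) {z d : Fin n → ℂ}
    (hp : (z, d) ∈ chainDomain n) :
    HasFDerivAt (fun z => chainIntegral z d)
      ((fderiv ℂ (fun q : (Fin n → ℂ) × (Fin n → ℂ) => chainIntegral q.1 q.2) (z, d)).comp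
        (ContinuousLinearMap.inl ℂ _ _)) z := by
  obtain ⟨-, h⟩ := hasFDerivAt_chainIntegral hn hp
  have h1 : HasFDerivAt (fun z : Fin n → ℂ => (z, d)) (ContinuousLinearMap.inl ℂ _ _) z :=
    hasFDerivAt_prodMk_left z d
  exact h.differentiableAt.hasFDerivAt.comp z h1

theorem fderiv_chainTerm {n : ℕ} {z d : Fin n → ℂ} (hp : (z, d) ∈ chainDomain n) (s : Fin n → ℝ)
    (v : Fin n → ℂ) :
    fderiv ℂ (fun q : (Fin n → ℂ) × (Fin n → ℂ) => chainTerm q.1 q.2 s) (z, d) (v, 0) =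
      -(∑ i, v i * rayPoint d s i) * chainTerm z d s := by
  have h := ((differentiableOn_chainTerm s).differentiableAt
    ((isOpen_chainDomain n).mem_nhds hp)).hasFDerivAt
  have h1 : HasDerivAt (fun t : ℂ => (z + t • v, d)) (v, 0) 0 := by
    refine HasDerivAt.prodMk ?_ (hasDerivAt_const _ _)
    simpa using ((hasDerivAt_id (0 : ℂ)).smul_const v).const_add z
  have h0 : (z + (0 : ℂ) • v, d) = (z, d) := by simp
  have h2 := (h0.symm ▸ h : HasFDerivAt _ _ _).comp_hasDerivAt (0 : ℂ) h1
  have h3 : (fun q : (Fin n → ℂ) × (Fin n → ℂ) => chainTerm q.1 q.2 s) ∘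
      (fun t : ℂ => (z + t • v, d)) = fun t : ℂ =>
        Complex.exp (-(t * ∑ i, v i * rayPoint d s i)) * chainTerm z d s := by
    funext t
    simp only [Function.comp_apply, chainTerm, Pi.add_apply, Pi.smul_apply, smul_eq_mul,
      Finset.prod_mul_distrib, ← Complex.exp_sum, Finset.mul_sum, ← Finset.sum_neg_distrib]
    have : ∑ i, -((z i + t * v i) * rayPoint d s i) =
        ∑ i, -(t * (v i * rayPoint d s i)) + ∑ i, -(z i * rayPoint d s i) := by
      rw [← Finset.sum_add_distrib]
      exact Finset.sum_congr rfl fun i _ => by ring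
    rw [this, Complex.exp_add]
    ring
  rw [h3] at h2
  have h4 : HasDerivAt (fun t : ℂ =>
      Complex.exp (-(t * ∑ i, v i * rayPoint d s i)) * chainTerm z d s)
      (-(∑ i, v i * rayPoint d s i) * chainTerm z d s) 0 := by
    have := ((((hasDerivAt_id (0 : ℂ)).mul_const (∑ i, v i * rayPoint d s i)).neg).cexp).mul_const
      (chainTerm z d s)
    simpa using this
  rw [h0] at h2
  exact h2.unique h4

/-- Differentiation under the integral sign. -/
theorem fderiv_chainIntegral_left {n : ℕ} (hn : 1 ≤ n) {z d : Fin n → ℂ}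
    (hp : (z, d) ∈ chainDomain n) (v : Fin n → ℂ) :
    Integrable (fun s => (∑ i, v i * rayPoint d s i) * chainTerm z d s) ∧
    fderiv ℂ (fun z => chainIntegral z d) z v =
      -∫ s, (∑ i, v i * rayPoint d s i) * chainTerm z d s := by
  obtain ⟨hi, h⟩ := hasFDerivAt_chainIntegral hn hp
  have h0 := hi.apply_continuousLinearMap (v, (0 : Fin n → ℂ))
  simp_rw [fderiv_chainTerm hp] at h0
  constructor
  · simpa [neg_mul] using h0.neg
  · rw [(hasFDerivAt_chainIntegral_left hn hp).fderiv, ContinuousLinearMap.comp_apply, h.fderiv,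
      ContinuousLinearMap.inl_apply, ContinuousLinearMap.integral_apply hi]
    simp_rw [fderiv_chainTerm hp, neg_mul]
    rw [integral_neg]

/-- Euler's identity: the chain integral is homogeneous of degree `-1` in `z`. -/
theorem fderiv_chainIntegral_self {n : ℕ} (hn : 1 ≤ n) {z d : Fin n → ℂ}
    (hp : (z, d) ∈ chainDomain n) :
    fderiv ℂ (fun z => chainIntegral z d) z z = -chainIntegral z d := by
  have h := hasFDerivAt_chainIntegral_left hn hp
  have hg : HasDerivAt (fun t : ℝ => fun i => Complex.exp t * z i) z 0 := by
    refine hasDerivAt_pi.2 fun i => ?_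
    simpa using ((Complex.ofRealCLM.hasDerivAt (x := 0)).cexp).mul_const (z i)
  have h0 : (fun i => Complex.exp (0 : ℝ) * z i) = z := by simp
  have h6 : HasFDerivAt (fun z => chainIntegral z d) (fderiv ℂ (fun z => chainIntegral z d) z)
      (fun i => Complex.exp (0 : ℝ) * z i) := by
    rw [h0]
    exact h.differentiableAt.hasFDerivAt
  have h1 := (h6.restrictScalars ℝ).comp_hasDerivAt (0 : ℝ) hg
  have h2 : (fun z => chainIntegral z d) ∘ (fun t : ℝ => fun i => Complex.exp t * z i) =
      fun t : ℝ => Complex.exp (-t) * chainIntegral z d := by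
    funext t
    have h3 := chainIntegral_smul hn (Complex.exp_ne_zero t) z d
    have h4 := chainIntegral_mul_exp z d fun _ => t
    simp_rw [mul_comm (d _)] at h4
    rw [h4] at h3
    rw [Function.comp_apply, ← h3, ← mul_assoc, ← Complex.exp_add, neg_add_cancel,
      Complex.exp_zero, one_mul]
  rw [h2] at h1
  have h5 : HasDerivAt (fun t : ℝ => Complex.exp (-t) * chainIntegral z d)
      (-chainIntegral z d) 0 := by
    simpa using ((Complex.ofRealCLM.hasDerivAt (x := 0)).neg.cexp).mul_const (chainIntegral z d)
  exact h1.unique h5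

theorem integral_comp_sum_equiv {ι ι' κ : Type*} [Fintype ι] [Fintype ι'] [Fintype κ]
    (e : ι ⊕ ι' ≃ κ) (f : (ι → ℝ) → ℂ) (g : (ι' → ℝ) → ℂ) :
    ∫ s : κ → ℝ, f (fun i => s (e (Sum.inl i))) * g (fun i => s (e (Sum.inr i))) =
      (∫ s, f s) * ∫ s, g s := by
  rw [← integral_prod_mul]
  have h := (volume_measurePreserving_sumPiEquivProdPi_symm
    (fun _ : ι ⊕ ι' => ℝ)).trans (volume_measurePreserving_piCongrLeft (fun _ : κ => ℝ) e)
  rw [← h.integral_comp']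
  refine integral_congr_ae (Eventually.of_forall fun p => ?_)
  have h1 : ∀ x, ((MeasurableEquiv.sumPiEquivProdPi fun _ : ι ⊕ ι' => ℝ).symm.trans
      (MeasurableEquiv.piCongrLeft (fun _ : κ => ℝ) e)) p (e x) =
      (MeasurableEquiv.sumPiEquivProdPi fun _ : ι ⊕ ι' => ℝ).symm p x := fun x =>
    Equiv.piCongrLeft_apply_apply (fun _ : κ => ℝ) e _ x
  simp only [h1]
  rfl

/-- Equivalence of `{1, …, k} ⊔ {1, …, n - k}` with `{1, …, n}`. -/
def splitEquiv {n : ℕ} (k : Fin n) : Fin (k : ℕ) ⊕ Fin (n - (k : ℕ)) ≃ Fin n :=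
  finSumFinEquiv.trans (finCongr (by have := k.isLt; omega))

theorem splitEquiv_inl {n : ℕ} (k : Fin n) (i : Fin (k : ℕ)) :
    splitEquiv k (Sum.inl i) = ⟨i, i.isLt.trans k.isLt⟩ := by
  ext; simp [splitEquiv]

theorem splitEquiv_inr {n : ℕ} (k : Fin n) (i : Fin (n - (k : ℕ))) :
    splitEquiv k (Sum.inr i) = ⟨k + i, Nat.add_lt_of_lt_sub' i.isLt⟩ := by
  ext; simp [splitEquiv]

/-- Multiplication by `x_k - x_{k+1}` splits the chain into two. -/
theorem sub_mul_chainTerm {n : ℕ} {z d : Fin n → ℂ} (hp : (z, d) ∈ chainDomain n) (k : Fin n)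
    (hk : 0 < (k : ℕ)) (s : Fin n → ℝ) :
    (seqExt (rayPoint d s) (k - 1) - seqExt (rayPoint d s) k) * chainTerm z d s =
      chainTerm (initPart z k) (initPart d k) (fun i => s (splitEquiv k (Sum.inl i))) *
        chainTerm (tailPart z k) (tailPart d k) (fun i => s (splitEquiv k (Sum.inr i))) := by
  have hkn := k.isLt
  have hr1 : rayPoint (initPart d k) (fun i => s (splitEquiv k (Sum.inl i))) =
      fun i => rayPoint d s (splitEquiv k (Sum.inl i)) := by
    funext i; simp [rayPoint, initPart, splitEquiv_inl]
  have hr2 : rayPoint (tailPart d k) (fun i => s (splitEquiv k (Sum.inr i))) =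
      fun i => rayPoint d s (splitEquiv k (Sum.inr i)) := by
    funext i; simp [rayPoint, tailPart, splitEquiv_inr]
  have hK : (seqExt (rayPoint d s) (k - 1) - seqExt (rayPoint d s) k) *
      chainKernel (rayPoint d s) =
      chainKernel (fun i => rayPoint d s (splitEquiv k (Sum.inl i))) *
        chainKernel (fun i => rayPoint d s (splitEquiv k (Sum.inr i))) := by
    unfold chainKernel
    have hn : n - 1 = (k - 1) + (1 + (n - k - 1)) := by omega
    have hne := seqExt_sub_ne_zero hp s (i := k - 1) (Finset.mem_range.2 (by omega))
    rw [hn, Finset.prod_range_add, Finset.prod_range_add, Finset.prod_range_one]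
    have hk1 : (k : ℕ) - 1 + 0 + 1 = k := by omega
    rw [hk1]
    have e1 : ∏ i ∈ Finset.range (k - 1),
        (seqExt (rayPoint d s) i - seqExt (rayPoint d s) (i + 1))⁻¹ =
        ∏ i ∈ Finset.range (k - 1),
          (seqExt (fun i => rayPoint d s (splitEquiv k (Sum.inl i))) i -
            seqExt (fun i => rayPoint d s (splitEquiv k (Sum.inl i))) (i + 1))⁻¹ := by
      refine Finset.prod_congr rfl fun i hi => ?_
      have := Finset.mem_range.1 hi
      rw [seqExt_of_lt _ (by omega : i < n), seqExt_of_lt _ (by omega : i + 1 < n),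
        seqExt_of_lt _ (by omega : i < k), seqExt_of_lt _ (by omega : i + 1 < k)]
      simp only [splitEquiv_inl]
    have e2 : ∏ i ∈ Finset.range (n - k - 1),
        (seqExt (rayPoint d s) (k - 1 + (1 + i)) - seqExt (rayPoint d s) (k - 1 + (1 + i) + 1))⁻¹ =
        ∏ i ∈ Finset.range (n - k - 1),
          (seqExt (fun i => rayPoint d s (splitEquiv k (Sum.inr i))) i -
            seqExt (fun i => rayPoint d s (splitEquiv k (Sum.inr i))) (i + 1))⁻¹ := by
      refine Finset.prod_congr rfl fun i hi => ?_
      have := Finset.mem_range.1 hi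
      have a1 : (k : ℕ) - 1 + (1 + i) = k + i := by omega
      rw [a1, seqExt_of_lt _ (by omega : (k : ℕ) + i < n),
        seqExt_of_lt _ (by omega : (k : ℕ) + i + 1 < n),
        seqExt_of_lt _ (by omega : i < n - k), seqExt_of_lt _ (by omega : i + 1 < n - k)]
      simp only [splitEquiv_inr]
      rfl
    rw [e1, e2]
    rw [show (k : ℕ) - 1 + 1 = k by omega] at hne
    simp only [add_zero]
    rw [mul_left_comm (∏ i ∈ Finset.range (k - 1), _), ← mul_assoc, mul_inv_cancel₀ hne, one_mul]
  rw [chainTerm, chainTerm, chainTerm, hr1, hr2, mul_left_comm, hK,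
    ← (splitEquiv k).prod_comp, Fintype.prod_sum_type]
  simp only [initPart, tailPart, splitEquiv_inl, splitEquiv_inr]
  ring

theorem integral_sub_mul_chainTerm {n : ℕ} {z d : Fin n → ℂ} (hp : (z, d) ∈ chainDomain n)
    (k : Fin n) (hk : 0 < (k : ℕ)) :
    ∫ s, (seqExt (rayPoint d s) (k - 1) - seqExt (rayPoint d s) k) * chainTerm z d s =
      chainIntegral (initPart z k) (initPart d k) *
        chainIntegral (tailPart z k) (tailPart d k) := by
  simp_rw [sub_mul_chainTerm hp k hk]
  exact integral_comp_sum_equiv (splitEquiv k) _ _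

theorem sum_range_mul_eq (v x : ℕ → ℂ) (m : ℕ) :
    ∑ i ∈ Finset.range (m + 1), v i * x i =
      ∑ k ∈ Finset.range m, (∑ i ∈ Finset.range (k + 1), v i) * (x k - x (k + 1)) +
        (∑ i ∈ Finset.range (m + 1), v i) * x m := by
  induction m with
  | zero => simp
  | succ m ih =>
    rw [Finset.sum_range_succ, ih, Finset.sum_range_succ (fun k => _ * (x k - x (k + 1))) m,
      Finset.sum_range_succ v (m + 1)]
    ring

theorem sum_filter_pos_eq {n : ℕ} {M : Type*} [AddCommMonoid M] (f : Fin (n + 1) → M) :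
    ∑ k ∈ Finset.univ.filter (fun k : Fin (n + 1) => 0 < (k : ℕ)), f k = ∑ k : Fin n, f k.succ := by
  rw [Finset.sum_filter, Fin.sum_univ_succ]
  simp

theorem sum_initPart {n : ℕ} (z : Fin n → ℂ) (k : Fin n) :
    ∑ i, initPart z k i = ∑ i ∈ Finset.range (k : ℕ), seqExt z i := by
  rw [Finset.sum_range]
  exact Finset.sum_congr rfl fun i _ => (seqExt_of_lt z (i.isLt.trans k.isLt)).symm

theorem sum_initPart_add_sum_tailPart {n : ℕ} (z : Fin n → ℂ) (k : Fin n) :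
    ∑ i, initPart z k i + ∑ i, tailPart z k i = ∑ i, z i := by
  rw [← (splitEquiv k).sum_comp, Fintype.sum_sum_type]
  simp only [splitEquiv_inl, splitEquiv_inr]
  rfl

theorem sum_mul_eq_of_sum_eq_zero {n : ℕ} {v : Fin n → ℂ} (hv : ∑ i, v i = 0) (x : Fin n → ℂ) :
    ∑ i, v i * x i = ∑ k ∈ Finset.univ.filter (fun k : Fin n => 0 < (k : ℕ)),
      (∑ i, initPart v k i) * (seqExt x (k - 1) - seqExt x k) := by
  cases n with
  | zero => simp
  | succ m =>
    have h := sum_range_mul_eq (seqExt v) (seqExt x) m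
    rw [sum_range_seqExt, hv, zero_mul, add_zero] at h
    have h1 : ∑ i, v i * x i = ∑ i ∈ Finset.range (m + 1), seqExt v i * seqExt x i := by
      rw [Finset.sum_range]
      exact Finset.sum_congr rfl fun i _ => by
        rw [seqExt_of_lt v i.isLt, seqExt_of_lt x i.isLt]
    rw [h1, h, Finset.sum_range, sum_filter_pos_eq]
    refine Finset.sum_congr rfl fun k _ => ?_
    rw [sum_initPart]
    simp

/-- In a direction `v` with `∑ v_i = 0` the derivative of a chain integral is a sum of products of
two shorter chain integrals. -/
theorem fderiv_chainIntegral_of_sum_eq_zero {n : ℕ} (hn : 1 ≤ n) {z d : Fin n → ℂ}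
    (hp : (z, d) ∈ chainDomain n) {v : Fin n → ℂ} (hv : ∑ i, v i = 0) :
    fderiv ℂ (fun z => chainIntegral z d) z v =
      -∑ k ∈ Finset.univ.filter (fun k : Fin n => 0 < (k : ℕ)), (∑ i, initPart v k i) *
        (chainIntegral (initPart z k) (initPart d k) *
          chainIntegral (tailPart z k) (tailPart d k)) := by
  rw [(fderiv_chainIntegral_left hn hp v).2]
  have hint : ∀ k : Fin n, 0 < (k : ℕ) → Integrable (fun s =>
      (seqExt (rayPoint d s) (k - 1) - seqExt (rayPoint d s) k) * chainTerm z d s) := by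
    intro k hk
    have h1 : ∀ i : Fin n, Integrable (fun s => rayPoint d s i * chainTerm z d s) := fun i => by
      have := (fderiv_chainIntegral_left hn hp (Pi.single i 1)).1
      simpa [Pi.single_apply] using this
    have hk' := k.isLt
    simp_rw [sub_mul]
    have h2 := (h1 ⟨k - 1, by omega⟩).sub (h1 k)
    refine h2.congr (Eventually.of_forall fun s => ?_)
    simp only [Pi.sub_apply]
    rw [seqExt_of_lt _ (by omega : (k : ℕ) - 1 < n), seqExt_of_lt _ hk']
  congr 1
  have hsum : ∀ s, (∑ i, v i * rayPoint d s i) * chainTerm z d s =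
      ∑ k ∈ Finset.univ.filter (fun k : Fin n => 0 < (k : ℕ)), (∑ i, initPart v k i) *
        ((seqExt (rayPoint d s) (k - 1) - seqExt (rayPoint d s) k) * chainTerm z d s) := by
    intro s
    rw [sum_mul_eq_of_sum_eq_zero hv, Finset.sum_mul]
    exact Finset.sum_congr rfl fun k _ => mul_assoc _ _ _
  simp_rw [hsum]
  rw [integral_finsetSum _ fun k hk => (hint k (Finset.mem_filter.1 hk).2).const_mul _]
  refine Finset.sum_congr rfl fun k hk => ?_
  rw [integral_const_mul, integral_sub_mul_chainTerm hp k (Finset.mem_filter.1 hk).2]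

/-- The normalised chain integral `(2πi)^{-n} (z₁ + ⋯ + z_n) ∫ ⋯`.  The function `F_n` is obtained
on the cut domain by integrating along the rays spanned by the `1 / z_k`. -/
def chainFun {n : ℕ} (z d : Fin n → ℂ) : ℂ :=
  (2 * (Real.pi : ℂ) * Complex.I)⁻¹ ^ n * ((∑ i, z i) * chainIntegral z d)

theorem sum_initPart_sub {n : ℕ} (a b : ℂ) (v z : Fin n → ℂ) (k : Fin n) :
    ∑ i, initPart (a • v - b • z) k i = a * ∑ i, initPart v k i - b * ∑ i, initPart z k i := by
  rw [Finset.mul_sum, Finset.mul_sum, ← Finset.sum_sub_distrib]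
  rfl

/-- The normalised chain integrals satisfy the differential equation.  By Euler's identity the
derivative in the direction `v` is that of the chain integral in the direction `S v - V z` of
coordinate sum zero, where `S` and `V` are the coordinate sums of `z` and `v`. -/
theorem fderiv_chainFun {n : ℕ} (hn : 1 ≤ n) {z d : Fin n → ℂ} (hp : (z, d) ∈ chainDomain n)
    (hz : ∀ k : Fin n, 0 < (k : ℕ) → (∑ i, initPart z k i) ≠ 0 ∧ (∑ i, tailPart z k i) ≠ 0)
    (v : Fin n → ℂ) :
    fderiv ℂ (fun z => chainFun z d) z v =
      ∑ k ∈ Finset.univ.filter (fun k : Fin n => 0 < (k : ℕ)),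
        chainFun (initPart z k) (initPart d k) * chainFun (tailPart z k) (tailPart d k) *
        ((∑ i, tailPart v k i) / (∑ i, tailPart z k i) -
          (∑ i, initPart v k i) / (∑ i, initPart z k i)) := by
  have hd := (hasFDerivAt_chainIntegral_left hn hp).differentiableAt.hasFDerivAt
  set L := fderiv ℂ (fun z => chainIntegral z d) z with hL
  have hsum : HasFDerivAt (fun z : Fin n → ℂ => ∑ i, z i)
      (∑ i, ContinuousLinearMap.proj (R := ℂ) (φ := fun _ : Fin n => ℂ) i) z :=
    HasFDerivAt.fun_sum fun i _ => (ContinuousLinearMap.proj (R := ℂ) (φ := fun _ => ℂ) i).hasFDerivAt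
  have h := ((hsum.mul hd).const_mul ((2 * (Real.pi : ℂ) * Complex.I)⁻¹ ^ n)).fderiv
  have heq : fderiv ℂ (fun z => chainFun z d) z v = (2 * (Real.pi : ℂ) * Complex.I)⁻¹ ^ n *
      ((∑ i, z i) * L v + chainIntegral z d * ∑ i, v i) := by
    unfold chainFun
    refine (congrArg (fun M => M v) h).trans ?_
    simp [mul_add]
  have hE := fderiv_chainIntegral_self hn hp
  rw [← hL] at hE
  have h1 : (∑ i, z i) * L v + chainIntegral z d * ∑ i, v i =
      L ((∑ i, z i) • v - (∑ i, v i) • z) := by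
    rw [map_sub, map_smul, map_smul, hE, smul_eq_mul, smul_eq_mul]
    ring
  have h2 : ∑ i, ((∑ i, z i) • v - (∑ i, v i) • z) i = 0 := by
    simp only [Pi.sub_apply, Pi.smul_apply, smul_eq_mul, Finset.sum_sub_distrib, ← Finset.mul_sum]
    ring
  rw [heq, h1, hL, fderiv_chainIntegral_of_sum_eq_zero hn hp h2, ← Finset.sum_neg_distrib,
    Finset.mul_sum]
  refine Finset.sum_congr rfl fun k hk => ?_
  obtain ⟨hS, hT⟩ := hz k (Finset.mem_filter.1 hk).2
  rw [sum_initPart_sub, ← sum_initPart_add_sum_tailPart z k, ← sum_initPart_add_sum_tailPart v k]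
  have hpow : (2 * (Real.pi : ℂ) * Complex.I)⁻¹ ^ n =
      (2 * (Real.pi : ℂ) * Complex.I)⁻¹ ^ (k : ℕ) *
        (2 * (Real.pi : ℂ) * Complex.I)⁻¹ ^ (n - (k : ℕ)) := by
    rw [← pow_add]
    congr 1
    have := k.isLt
    omega
  rw [chainFun, chainFun, hpow]
  field_simp
  ring

/-- The exponential integral `∫ e^{-zx} dx` along the ray of `d`, equal to `1 / z`. -/
theorem integral_ray_exp {z d : ℂ} (h : 0 < (z * d).re) :
    ∫ s : ℝ, d * Complex.exp s * Complex.exp (-(z * (d * Complex.exp s))) = z⁻¹ := by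
  have hz : z ≠ 0 := by rintro rfl; simp at h
  have hre : ∀ s : ℝ, (-(z * (d * Complex.exp s))).re = -((z * d).re * Real.exp s) := by
    intro s
    rw [← mul_assoc, ← Complex.ofReal_exp, Complex.neg_re, Complex.re_mul_ofReal]
  have hder : ∀ s : ℝ, HasDerivAt
      (fun s : ℝ => -(z⁻¹ * Complex.exp (-(z * (d * Complex.exp s)))))
      (d * Complex.exp s * Complex.exp (-(z * (d * Complex.exp s)))) s := by
    intro s
    have h1 := (((((Complex.ofRealCLM.hasDerivAt (x := s)).cexp.const_mul d).const_mul
      z).neg.cexp).const_mul z⁻¹).neg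
    convert! h1 using 1
    simp
    field_simp
  have hint : Integrable (fun s : ℝ =>
      d * Complex.exp s * Complex.exp (-(z * (d * Complex.exp s)))) := by
    refine ((integrable_exp_mul_exp_neg_mul h one_pos).const_mul ‖d‖).mono'
      (Continuous.aestronglyMeasurable (by fun_prop)) (Eventually.of_forall fun s => ?_)
    rw [norm_mul, norm_mul, ← Complex.ofReal_exp, Complex.norm_real,
      Real.norm_of_nonneg (Real.exp_pos _).le, Complex.norm_exp, Complex.ofReal_exp, hre, one_mul,
      mul_assoc]
  have hbot : Tendsto (fun s : ℝ => -(z⁻¹ * Complex.exp (-(z * (d * Complex.exp s))))) atBot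
      (𝓝 (-z⁻¹)) := by
    have h1 : Tendsto (fun s : ℝ => Complex.exp s) atBot (𝓝 0) := by
      have := (Complex.continuous_ofReal.tendsto 0).comp Real.tendsto_exp_atBot
      simpa [Function.comp_def] using this
    have h2 := ((Complex.continuous_exp.tendsto _).comp
      (((h1.const_mul d).const_mul z).neg)).const_mul z⁻¹ |>.neg
    simpa [Function.comp_def] using h2
  have htop : Tendsto (fun s : ℝ => -(z⁻¹ * Complex.exp (-(z * (d * Complex.exp s))))) atTop
      (𝓝 0) := by
    rw [tendsto_zero_iff_norm_tendsto_zero]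
    simp_rw [norm_neg, norm_mul, Complex.norm_exp, hre]
    have h1 : Tendsto (fun s : ℝ => Real.exp (-((z * d).re * Real.exp s))) atTop (𝓝 0) :=
      Real.tendsto_exp_neg_atTop_nhds_zero.comp (Real.tendsto_exp_atTop.const_mul_atTop h)
    simpa using h1.const_mul ‖z⁻¹‖
  rw [integral_of_hasDerivAt_of_tendsto hder hint hbot htop]
  simp

theorem chainIntegral_one {z d : Fin 1 → ℂ} (h : 0 < (z 0 * d 0).re) :
    chainIntegral z d = (z 0)⁻¹ := by
  rw [← integral_ray_exp h, chainIntegral,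
    ← (volume_preserving_funUnique (Fin 1) ℝ).integral_comp']
  refine integral_congr_ae (Eventually.of_forall fun s => ?_)
  simp [chainTerm, chainKernel, rayPoint, MeasurableEquiv.funUnique]

theorem chainFun_one {z d : Fin 1 → ℂ} (h : 0 < (z 0 * d 0).re) :
    chainFun z d = (2 * (Real.pi : ℂ) * Complex.I)⁻¹ := by
  have hz : z 0 ≠ 0 := by intro h0; simp [h0] at h
  rw [chainFun, chainIntegral_one h]
  simp [hz]

/-- Simultaneous rescaling of `z` and rotation of the rays. -/
theorem chainFun_smul {n : ℕ} (hn : 1 ≤ n) {a : ℂ} (ha : a ≠ 0) (z d : Fin n → ℂ) :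
    chainFun (fun i => a * z i) d = chainFun z fun i => a * d i := by
  rw [chainFun, chainFun, ← chainIntegral_smul hn ha, ← Finset.mul_sum]
  ring

/-! ### Moving a ray across another ray -/

/-- The integrand `x e^{-ζx} / (x - 1)`, where `x = d e^s` runs along the ray of `d`. -/
def cauchyTerm (ζ d : ℂ) (s : ℝ) : ℂ :=
  d * Complex.exp s * Complex.exp (-(ζ * (d * Complex.exp s))) / (d * Complex.exp s - 1)

/-- The integral of `e^{-ζx} dx / (x - 1)` along the ray of `d`. -/
def rayCauchy (ζ d : ℂ) : ℂ := ∫ s : ℝ, cauchyTerm ζ d s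

/-- The pairs `(ζ, d)` for which `rayCauchy` converges absolutely. -/
def cauchyDomain : Set (ℂ × ℂ) := {p | 0 < (p.1 * p.2).re ∧ -p.2 ∈ Complex.slitPlane}

theorem isOpen_cauchyDomain : IsOpen cauchyDomain :=
  IsOpen.inter (s := {p : ℂ × ℂ | 0 < (p.1 * p.2).re})
    (t := {p : ℂ × ℂ | -p.2 ∈ Complex.slitPlane}) (isOpen_lt continuous_const (by fun_prop))
    (Complex.isOpen_slitPlane.preimage (by fun_prop))

theorem mul_exp_sub_one_ne_zero {d : ℂ} (h : -d ∈ Complex.slitPlane) (s : ℝ) :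
    d * Complex.exp s - 1 ≠ 0 := by
  have h' : -(d * star 1) ∈ Complex.slitPlane := by simpa using h
  have := ne_of_neg_mul_star_mem_slitPlane h' (Real.exp_pos s).le zero_le_one (by positivity)
  simpa using this

theorem continuous_cauchyTerm {p : ℂ × ℂ} (hp : p ∈ cauchyDomain) :
    Continuous (cauchyTerm p.1 p.2) := by
  unfold cauchyTerm
  exact Continuous.div (by fun_prop) (by fun_prop) fun s => mul_exp_sub_one_ne_zero hp.2 s

theorem exists_cauchyTerm_bound {p : ℂ × ℂ} (hp : p ∈ cauchyDomain) :
    ∃ C a : ℝ, 0 < a ∧ ∀ᶠ q in 𝓝 p, q ∈ cauchyDomain ∧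
      ∀ s, ‖cauchyTerm q.1 q.2 s‖ ≤ C * (Real.exp (1 * s) * Real.exp (-(a * Real.exp s))) := by
  obtain ⟨c, hc, h⟩ := eventually_raysApart (a := p.2) (b := 1) (by simpa using hp.2)
  have h1 : ∀ᶠ q : ℂ × ℂ in 𝓝 p, RaysApart c q.2 1 := by
    have ht : Tendsto (fun q : ℂ × ℂ => (q.2, (1 : ℂ))) (𝓝 p) (𝓝 (p.2, 1)) :=
      Continuous.tendsto (by fun_prop) p
    exact ht.eventually h
  have h2 : ∀ᶠ q : ℂ × ℂ in 𝓝 p, (p.1 * p.2).re / 2 ≤ (q.1 * q.2).re := by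
    have ht : Tendsto (fun q : ℂ × ℂ => (q.1 * q.2).re) (𝓝 p) (𝓝 (p.1 * p.2).re) :=
      Continuous.tendsto (by fun_prop) p
    filter_upwards [ht.eventually (lt_mem_nhds (half_lt_self hp.1))] with q hq using hq.le
  have h3 : ∀ᶠ q : ℂ × ℂ in 𝓝 p, ‖q.2‖ ≤ ‖p.2‖ + 1 := by
    have ht : Tendsto (fun q : ℂ × ℂ => ‖q.2‖) (𝓝 p) (𝓝 ‖p.2‖) :=
      Continuous.tendsto (by fun_prop) p
    filter_upwards [ht.eventually (gt_mem_nhds (lt_add_one _))] with q hq using hq.le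
  refine ⟨(‖p.2‖ + 1) * c⁻¹, (p.1 * p.2).re / 2, half_pos hp.1, ?_⟩
  filter_upwards [isOpen_cauchyDomain.mem_nhds hp, h1, h2, h3] with q k0 k1 k2 k3
  refine ⟨k0, fun s => ?_⟩
  have hden : c ≤ ‖q.2 * Complex.exp s - 1‖ := by
    have h4 := k1 s 0
    simp only [Real.exp_zero, Complex.ofReal_zero, Complex.exp_zero, mul_one] at h4
    exact le_trans (by nlinarith [Real.exp_pos s]) h4
  have hre : (-(q.1 * (q.2 * Complex.exp s))).re = -((q.1 * q.2).re * Real.exp s) := by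
    rw [← mul_assoc, ← Complex.ofReal_exp, Complex.neg_re, Complex.re_mul_ofReal]
  rw [cauchyTerm, norm_div, norm_mul, norm_mul, Complex.norm_exp, Complex.norm_exp, hre,
    div_eq_mul_inv]
  calc _ ≤ (‖p.2‖ + 1) * Real.exp s * Real.exp (-((p.1 * p.2).re / 2 * Real.exp s)) * c⁻¹ := by
        rw [Complex.ofReal_re]
        gcongr
    _ = _ := by rw [one_mul]; ring

theorem integrable_cauchyTerm {p : ℂ × ℂ} (hp : p ∈ cauchyDomain) :
    Integrable (cauchyTerm p.1 p.2) := by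
  obtain ⟨C, a, ha, h⟩ := exists_cauchyTerm_bound hp
  exact ((integrable_exp_mul_exp_neg_mul ha one_pos).const_mul C).mono'
    (continuous_cauchyTerm hp).aestronglyMeasurable (Eventually.of_forall h.self_of_nhds.2)

theorem differentiableOn_cauchyTerm (s : ℝ) :
    DifferentiableOn ℂ (fun q : ℂ × ℂ => cauchyTerm q.1 q.2 s) cauchyDomain := by
  unfold cauchyTerm
  have h1 : Differentiable ℂ fun q : ℂ × ℂ =>
    q.2 * Complex.exp s * Complex.exp (-(q.1 * (q.2 * Complex.exp s))) := by fun_prop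
  have h2 : Differentiable ℂ fun q : ℂ × ℂ => q.2 * Complex.exp s - 1 := by fun_prop
  simp_rw [div_eq_mul_inv]
  exact h1.differentiableOn.mul (h2.differentiableOn.inv fun q hq =>
    mul_exp_sub_one_ne_zero hq.2 s)

theorem hasFDerivAt_rayCauchy {p : ℂ × ℂ} (hp : p ∈ cauchyDomain) :
    Integrable (fun s => fderiv ℂ (fun q : ℂ × ℂ => cauchyTerm q.1 q.2 s) p) ∧
      HasFDerivAt (fun q : ℂ × ℂ => rayCauchy q.1 q.2)
        (∫ s, fderiv ℂ (fun q : ℂ × ℂ => cauchyTerm q.1 q.2 s) p) p := by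
  obtain ⟨C, a, ha, h⟩ := exists_cauchyTerm_bound hp
  exact hasFDerivAt_integral_of_dominated_of_differentiableOn h
    (fun q hq => (continuous_cauchyTerm hq.1).aestronglyMeasurable)
    (fun s => (differentiableOn_cauchyTerm s).mono fun q hq => hq.1)
    (fun q hq => hq.2) ((integrable_exp_mul_exp_neg_mul ha one_pos).const_mul C)

theorem rayCauchy_mul_exp (ζ d : ℂ) (t : ℝ) : rayCauchy ζ (d * Complex.exp t) = rayCauchy ζ d := by
  unfold rayCauchy
  rw [← integral_add_right_eq_self (cauchyTerm ζ d) t]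
  congr 1
  funext s
  have : d * Complex.exp t * Complex.exp s = d * Complex.exp ((s + t : ℝ) : ℂ) := by
    rw [Complex.ofReal_add, Complex.exp_add]; ring
  rw [cauchyTerm, cauchyTerm, this]

theorem fderiv_rayCauchy_snd {p : ℂ × ℂ} (hp : p ∈ cauchyDomain) :
    fderiv ℂ (fun q : ℂ × ℂ => rayCauchy q.1 q.2) p (0, 1) = 0 := by
  obtain ⟨-, h⟩ := hasFDerivAt_rayCauchy hp
  rw [h.fderiv]
  set L := ∫ s, fderiv ℂ (fun q : ℂ × ℂ => cauchyTerm q.1 q.2 s) p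
  have hγ : HasDerivAt (fun t : ℝ => (p.1, p.2 * Complex.exp t)) (0, p.2) 0 := by
    refine (hasDerivAt_const _ _).prodMk ?_
    simpa using ((Complex.ofRealCLM.hasDerivAt (x := 0)).cexp).const_mul p.2
  have h0 : (p.1, p.2 * Complex.exp (0 : ℝ)) = p := by simp
  have h6 : HasFDerivAt (fun q : ℂ × ℂ => rayCauchy q.1 q.2) L
      (p.1, p.2 * Complex.exp (0 : ℝ)) := by rw [h0]; exact h
  have hc := (h6.restrictScalars ℝ).comp_hasDerivAt (0 : ℝ) hγ
  have hconst : (fun q : ℂ × ℂ => rayCauchy q.1 q.2) ∘ (fun t : ℝ => (p.1, p.2 * Complex.exp t)) =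
      fun _ => rayCauchy p.1 p.2 := by
    funext t
    exact rayCauchy_mul_exp p.1 p.2 t
  rw [hconst] at hc
  have h1 := hc.unique (hasDerivAt_const _ _)
  have hd : p.2 ≠ 0 := by
    intro h
    have := hp.1
    simp [h] at this
  have h2 : ((0 : ℂ), p.2) = p.2 • ((0 : ℂ), (1 : ℂ)) := by simp
  have h3 : p.2 * L (0, 1) = 0 := by
    rw [← smul_eq_mul, ← map_smul, ← h2]
    exact h1
  exact (mul_eq_zero.1 h3).resolve_left hd

theorem fderiv_rayCauchy_fst {p : ℂ × ℂ} (hp : p ∈ cauchyDomain) :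
    fderiv ℂ (fun q : ℂ × ℂ => rayCauchy q.1 q.2) p (1, 0) = -p.1⁻¹ - rayCauchy p.1 p.2 := by
  obtain ⟨hi, h⟩ := hasFDerivAt_rayCauchy hp
  have hterm : ∀ s : ℝ, fderiv ℂ (fun q : ℂ × ℂ => cauchyTerm q.1 q.2 s) p (1, 0) =
      -(p.2 * Complex.exp s * Complex.exp (-(p.1 * (p.2 * Complex.exp s)))) -
        cauchyTerm p.1 p.2 s := by
    intro s
    have hne := mul_exp_sub_one_ne_zero hp.2 s
    have h1 : HasDerivAt (fun t : ℂ => (t, p.2)) (1, 0) p.1 :=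
      (hasDerivAt_id _).prodMk (hasDerivAt_const _ _)
    have h2 := ((differentiableOn_cauchyTerm s).differentiableAt
      (isOpen_cauchyDomain.mem_nhds hp)).hasFDerivAt
    have h3 := HasFDerivAt.comp_hasDerivAt (f := fun t : ℂ => (t, p.2)) p.1 h2 h1
    have h4 : HasDerivAt (fun t : ℂ => cauchyTerm t p.2 s)
        (p.2 * Complex.exp s * (Complex.exp (-(p.1 * (p.2 * Complex.exp s))) *
          (-(p.2 * Complex.exp s))) / (p.2 * Complex.exp s - 1)) p.1 := by
      have := ((((hasDerivAt_id p.1).mul_const (p.2 * Complex.exp s)).neg.cexp).const_mul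
        (p.2 * Complex.exp s)).div_const (p.2 * Complex.exp s - 1)
      simpa [cauchyTerm] using this
    rw [h3.unique h4, cauchyTerm]
    field_simp
    ring
  have hI : Integrable (fun s : ℝ =>
      p.2 * Complex.exp s * Complex.exp (-(p.1 * (p.2 * Complex.exp s)))) := by
    have := ((hi.apply_continuousLinearMap (1, 0)).add (integrable_cauchyTerm hp)).neg
    refine this.congr (Eventually.of_forall fun s => ?_)
    simp [hterm]
  rw [h.fderiv, ContinuousLinearMap.integral_apply hi]
  simp_rw [hterm]
  rw [integral_sub hI.fun_neg (integrable_cauchyTerm hp), integral_neg, integral_ray_exp hp.1]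
  rfl

/-- Along any path, `e^ζ` times the Cauchy integral has derivative `- e^ζ ζ' / ζ`, whatever the
motion of the ray. -/
theorem hasDerivAt_exp_mul_rayCauchy {γ δ : ℝ → ℂ} {γ' δ' : ℂ} {t : ℝ} (hγ : HasDerivAt γ γ' t)
    (hδ : HasDerivAt δ δ' t) (h : (γ t, δ t) ∈ cauchyDomain) :
    HasDerivAt (fun t => Complex.exp (γ t) * rayCauchy (γ t) (δ t))
      (-(Complex.exp (γ t) * (γ' / γ t))) t := by
  have h1 := (hasFDerivAt_rayCauchy h).2.differentiableAt.hasFDerivAt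
  have h2 := (h1.restrictScalars ℝ).comp_hasDerivAt t (hγ.prodMk hδ)
  have h3 : fderiv ℂ (fun q : ℂ × ℂ => rayCauchy q.1 q.2) (γ t, δ t) (γ', δ') =
      γ' * (-(γ t)⁻¹ - rayCauchy (γ t) (δ t)) := by
    have : (γ', δ') = γ' • ((1 : ℂ), (0 : ℂ)) + δ' • ((0 : ℂ), (1 : ℂ)) := by simp
    rw [this, map_add, map_smul, map_smul, fderiv_rayCauchy_snd h, fderiv_rayCauchy_fst h,
      smul_zero, add_zero, smul_eq_mul]
  have h4 := hγ.cexp.mul h2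
  convert! h4 using 1
  rw [ContinuousLinearMap.coe_restrictScalars', h3]
  simp only [Function.comp_apply]
  ring

theorem re_exp_mul_pos {r s θ : ℝ} (hr : 0 < r) (hs : 0 < s) (hθ : |θ| < Real.pi / 2) :
    0 < ((r * s : ℝ) * Complex.exp (θ * Complex.I)).re := by
  rw [Complex.re_ofReal_mul, Complex.exp_ofReal_mul_I_re]
  have := abs_lt.1 hθ
  exact mul_pos (mul_pos hr hs) (Real.cos_pos_of_mem_Ioo ⟨by linarith, this.2⟩)

theorem neg_exp_mem_slitPlane {θ : ℝ} (h0 : 0 < θ) (h1 : θ < 2 * Real.pi) :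
    -Complex.exp (-(θ * Complex.I)) ∈ Complex.slitPlane := by
  have h2 : -Complex.exp (-(θ * Complex.I)) = Complex.exp (((Real.pi - θ : ℝ) : ℂ) * Complex.I) := by
    rw [Complex.ofReal_sub, sub_mul, sub_eq_add_neg, Complex.exp_add, Complex.exp_pi_mul_I]
    ring
  rw [h2, Complex.mem_slitPlane_iff_arg]
  refine ⟨?_, Complex.exp_ne_zero _⟩
  rw [Complex.arg_exp_mul_I, (toIocMod_eq_self Real.two_pi_pos).2 ⟨by linarith, by linarith⟩]
  intro h
  linarith

/-- The mean value property of the exponential function on circles around the origin. -/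
theorem integral_exp_circle (ζ : ℂ) :
    ∫ t in (0 : ℝ)..(2 * Real.pi), Complex.exp (ζ * Complex.exp (t * Complex.I)) =
      2 * Real.pi := by
  have h := Complex.circleIntegral_sub_inv_smul_of_differentiable_on_off_countable
    (f := fun w => Complex.exp (ζ * w)) (c := 0) (w := 0) (R := 1) Set.countable_empty
    (by simp) (by fun_prop) (fun w _ => by fun_prop)
  simp only [circleIntegral, deriv_circleMap, circleMap, sub_zero, Complex.ofReal_one, one_mul,
    zero_add, smul_eq_mul, mul_zero, Complex.exp_zero, mul_one] at h
  have h1 : ∀ t : ℝ, Complex.exp (t * Complex.I) * Complex.I *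
      ((Complex.exp (t * Complex.I))⁻¹ * Complex.exp (ζ * Complex.exp (t * Complex.I))) =
      Complex.I * Complex.exp (ζ * Complex.exp (t * Complex.I)) := by
    intro t
    have := Complex.exp_ne_zero (t * Complex.I)
    field_simp
  simp_rw [h1] at h
  rw [intervalIntegral.integral_const_mul] at h
  have h2 : Complex.I * (∫ t in (0 : ℝ)..(2 * Real.pi),
      Complex.exp (ζ * Complex.exp (t * Complex.I))) = Complex.I * (2 * Real.pi) := by
    rw [h]; ring
  exact mul_left_cancel₀ Complex.I_ne_zero h2

/-- The residue formula: the Cauchy integrals along two rays on both sides of the point `1` differ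
by `2πi e^{-ζ}`.  The ray is turned the long way round the origin, following the argument of `ζ`. -/
theorem rayCauchy_jump {r β τ : ℝ} (hr : 0 < r) (hτ : 0 < τ) (h : |β| + τ < Real.pi / 2) :
    rayCauchy (r * Complex.exp (β * Complex.I)) (Complex.exp (-(τ * Complex.I))) -
      rayCauchy (r * Complex.exp (β * Complex.I)) (Complex.exp (τ * Complex.I)) =
      2 * Real.pi * Complex.I * Complex.exp (-(r * Complex.exp (β * Complex.I))) := by
  set ζ : ℂ := r * Complex.exp (β * Complex.I) with hζ
  have hπ := Real.pi_pos
  have hζ0 : ζ ≠ 0 := mul_ne_zero (by exact_mod_cast hr.ne') (Complex.exp_ne_zero _)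
  let γ : ℝ → ℂ := fun t => ζ * Complex.exp (t * Complex.I)
  let φ : ℝ → ℝ := fun t => τ + t * (1 - τ / Real.pi)
  let δ : ℝ → ℂ := fun t => Complex.exp (-((φ t : ℝ) * Complex.I))
  have hφ : ∀ t ∈ Set.Icc (0 : ℝ) (2 * Real.pi), τ ≤ φ t ∧ φ t ≤ 2 * Real.pi - τ ∧
      |t - φ t| ≤ τ := by
    intro t ht
    have h1 : φ t = τ + t - τ * (t / Real.pi) := by simp only [φ]; ring
    have h2 : 0 ≤ t / Real.pi := div_nonneg ht.1 hπ.le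
    have h3 : t / Real.pi ≤ 2 := (div_le_iff₀ hπ).2 ht.2
    have h4 : t = t / Real.pi * Real.pi := by field_simp
    have h5 := neg_abs_le β
    have h6 := le_abs_self β
    have hτπ : τ ≤ Real.pi := by linarith [abs_nonneg β]
    refine ⟨?_, ?_, abs_le.2 ⟨?_, ?_⟩⟩
    · rw [h1]; nlinarith
    · rw [h1]; nlinarith
    · rw [h1]; nlinarith
    · rw [h1]; nlinarith
  have hdom : ∀ t ∈ Set.Icc (0 : ℝ) (2 * Real.pi), (γ t, δ t) ∈ cauchyDomain := by
    intro t ht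
    obtain ⟨h1, h2, h3⟩ := hφ t ht
    refine ⟨?_, neg_exp_mem_slitPlane (by linarith) (by linarith)⟩
    have h4 : γ t * δ t = ((r * 1 : ℝ) : ℂ) * Complex.exp (((β + (t - φ t) : ℝ) : ℂ) * Complex.I) := by
      simp only [γ, δ, hζ]
      rw [mul_assoc, mul_assoc, ← Complex.exp_add, ← Complex.exp_add]
      push_cast
      ring_nf
    show 0 < (γ t * δ t).re
    rw [h4]
    refine re_exp_mul_pos hr one_pos ((abs_add_le _ _).trans_lt ?_)
    linarith
  have hγ : ∀ t, HasDerivAt γ (γ t * Complex.I) t := by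
    intro t
    have := (((Complex.ofRealCLM.hasDerivAt (x := t)).mul_const Complex.I).cexp).const_mul ζ
    convert! this using 1
    simp only [γ]
    simp
    ring
  have hδ : ∀ t, DifferentiableAt ℝ δ t := by
    intro t
    simp only [δ, φ]
    fun_prop
  have hder : ∀ t ∈ Set.uIcc (0 : ℝ) (2 * Real.pi),
      HasDerivAt (fun t => Complex.exp (γ t) * rayCauchy (γ t) (δ t))
        (-(Complex.I * Complex.exp (ζ * Complex.exp (t * Complex.I)))) t := by
    intro t ht
    rw [Set.uIcc_of_le (by positivity)] at ht
    have h1 := hasDerivAt_exp_mul_rayCauchy (hγ t) (hδ t).hasDerivAt (hdom t ht)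
    convert h1 using 1
    have : γ t ≠ 0 := mul_ne_zero hζ0 (Complex.exp_ne_zero _)
    field_simp
    simp only [γ]
    ring_nf
  have hint := intervalIntegral.integral_eq_sub_of_hasDerivAt hder
    (Continuous.intervalIntegrable (by fun_prop) _ _)
  rw [intervalIntegral.integral_neg, intervalIntegral.integral_const_mul, integral_exp_circle]
    at hint
  have hγ1 : γ (2 * Real.pi) = ζ := by
    simp only [γ]
    push_cast
    rw [Complex.exp_two_pi_mul_I, mul_one]
  have hγ0 : γ 0 = ζ := by simp [γ]
  have hδ1 : δ (2 * Real.pi) = Complex.exp (τ * Complex.I) := by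
    simp only [δ, φ]
    have : -(((τ + 2 * Real.pi * (1 - τ / Real.pi) : ℝ) : ℂ) * Complex.I) =
        τ * Complex.I - 2 * Real.pi * Complex.I := by
      have : (Real.pi : ℂ) ≠ 0 := by exact_mod_cast hπ.ne'
      push_cast
      field_simp
      ring
    rw [this, Complex.exp_sub, Complex.exp_two_pi_mul_I, div_one]
  have hδ0 : δ 0 = Complex.exp (-(τ * Complex.I)) := by simp [δ, φ]
  rw [hγ1, hγ0, hδ1, hδ0] at hint
  have h5 : Complex.exp ζ * Complex.exp (-ζ) = 1 := by rw [← Complex.exp_add]; simp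
  linear_combination (Complex.exp (-ζ)) * hint -
    (rayCauchy ζ (Complex.exp (-(τ * Complex.I))) - rayCauchy ζ (Complex.exp (τ * Complex.I))) * h5

/-- The Cauchy integral does not change while the ray does not cross the point `1`. -/
theorem rayCauchy_eq_of_path {ζ : ℂ} {γ : ℝ → ℂ} (hγ : Differentiable ℝ γ) {a b : ℝ} (hab : a ≤ b)
    (h : ∀ t ∈ Set.Icc a b, (ζ, γ t) ∈ cauchyDomain) :
    rayCauchy ζ (γ b) = rayCauchy ζ (γ a) := by
  have hder : ∀ t ∈ Set.Icc a b, HasDerivAt (fun t => Complex.exp ζ * rayCauchy ζ (γ t)) 0 t := by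
    intro t ht
    have := hasDerivAt_exp_mul_rayCauchy (hasDerivAt_const t ζ) (hγ t).hasDerivAt (h t ht)
    simpa using this
  have := constant_of_has_deriv_right_zero (f := fun t => Complex.exp ζ * rayCauchy ζ (γ t))
    (fun t ht => (hder t ht).continuousAt.continuousWithinAt)
    (fun t ht => (hder t (Set.Ico_subset_Icc_self ht)).hasDerivWithinAt) b ⟨hab, le_rfl⟩
  exact mul_left_cancel₀ (Complex.exp_ne_zero ζ) this

/-! ### The jump of a chain integral -/

theorem neg_div_mem_slitPlane {a b : ℂ} (h : -(b * star a) ∈ Complex.slitPlane) :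
    -(a / b) ∈ Complex.slitPlane := by
  have hb : b ≠ 0 := by
    rintro rfl
    simp at h
  have hN : 0 < (Complex.normSq b)⁻¹ := inv_pos.2 (Complex.normSq_pos.2 hb)
  have h1 : -(a / b) = ((Complex.normSq b)⁻¹ : ℝ) * star (-(b * star a)) := by
    rw [div_eq_mul_inv, Complex.inv_def, star_neg, star_mul, star_star, ← starRingEnd_apply]
    ring
  rw [Complex.mem_slitPlane_iff] at h ⊢
  rw [h1, Complex.re_ofReal_mul, Complex.im_ofReal_mul]
  rcases h with h | h
  · exact Or.inl (mul_pos hN h)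
  · refine Or.inr (mul_ne_zero hN.ne' ?_)
    rw [← starRingEnd_apply, Complex.conj_im]
    exact neg_ne_zero.2 h

/-- The integrand `x e^{-zx} / (x - y)` along the ray of `a`. -/
def rayTerm (z a y : ℂ) (s : ℝ) : ℂ :=
  a * Complex.exp s * Complex.exp (-(z * (a * Complex.exp s))) * (a * Complex.exp s - y)⁻¹

theorem rayTerm_eq_cauchyTerm {z a y : ℂ} (hy : y ≠ 0) :
    rayTerm z a y = cauchyTerm (z * y) (a / y) := by
  funext s
  rw [rayTerm, cauchyTerm]
  have h1 : z * y * (a / y * Complex.exp s) = z * (a * Complex.exp s) := by field_simp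
  have h2 : a / y * Complex.exp s - 1 = (a * Complex.exp s - y) / y := by field_simp
  rw [h1, h2]
  rcases eq_or_ne (a * Complex.exp s - y) 0 with h0 | h0
  · simp [h0]
  · field_simp

theorem mem_cauchyDomain_div {z a y : ℂ} (h : 0 < (z * a).re)
    (h' : -(y * star a) ∈ Complex.slitPlane) : (z * y, a / y) ∈ cauchyDomain := by
  have hy : y ≠ 0 := by rintro rfl; simp at h'
  refine ⟨?_, neg_div_mem_slitPlane h'⟩
  have : z * y * (a / y) = z * a := by field_simp
  simpa [this] using h

theorem integrable_rayTerm {z a y : ℂ} (h : 0 < (z * a).re)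
    (h' : -(y * star a) ∈ Complex.slitPlane) : Integrable (rayTerm z a y) := by
  have hy : y ≠ 0 := by rintro rfl; simp at h'
  rw [rayTerm_eq_cauchyTerm hy]
  exact integrable_cauchyTerm (p := (z * y, a / y)) (mem_cauchyDomain_div h h')

theorem neg_mul_exp_mem_slitPlane {a b : ℂ} (h : -(b * star a) ∈ Complex.slitPlane) (t : ℝ) :
    -(b * Complex.exp t * star a) ∈ Complex.slitPlane := by
  have h1 : -(b * Complex.exp t * star a) = (Real.exp t : ℝ) * (-(b * star a)) := by
    push_cast; ring
  rw [Complex.mem_slitPlane_iff] at h ⊢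
  rw [h1, Complex.re_ofReal_mul, Complex.im_ofReal_mul]
  exact h.imp (fun h => mul_pos (Real.exp_pos t) h) fun h => mul_ne_zero (Real.exp_pos t).ne' h

/-- The residue formula for a pole at an arbitrary point `y` of the ray of `a`. -/
theorem integral_rayTerm_jump {z a : ℂ} {r β τ t : ℝ} (hr : 0 < r) (hτ : 0 < τ)
    (h : |β| + τ < Real.pi / 2) (hza : z * a = r * Complex.exp (β * Complex.I)) :
    (∫ s, rayTerm z (a * Complex.exp (-(τ * Complex.I))) (a * Complex.exp t) s) -
      ∫ s, rayTerm z (a * Complex.exp (τ * Complex.I)) (a * Complex.exp t) s =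
      2 * Real.pi * Complex.I * Complex.exp (-(z * (a * Complex.exp t))) := by
  have ha : a ≠ 0 := by
    rintro rfl
    rw [mul_zero] at hza
    exact mul_ne_zero (by exact_mod_cast hr.ne') (Complex.exp_ne_zero _) hza.symm
  have hy : a * Complex.exp t ≠ 0 := mul_ne_zero ha (Complex.exp_ne_zero _)
  have h1 : z * (a * Complex.exp t) = ((r * Real.exp t : ℝ) : ℂ) * Complex.exp (β * Complex.I) := by
    rw [← mul_assoc, hza]
    push_cast
    ring
  have h2 : ∀ w : ℂ, a * w / (a * Complex.exp t) = w * Complex.exp ((-t : ℝ) : ℂ) := by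
    intro w
    rw [Complex.ofReal_neg, Complex.exp_neg]
    have := Complex.exp_ne_zero t
    field_simp
  simp_rw [rayTerm_eq_cauchyTerm hy, h2, h1]
  have := rayCauchy_jump (mul_pos hr (Real.exp_pos t)) hτ h
  rw [← rayCauchy_mul_exp _ (Complex.exp (-(τ * Complex.I))) (-t),
    ← rayCauchy_mul_exp _ (Complex.exp (τ * Complex.I)) (-t)] at this
  exact this

theorem integral_rayTerm_eq {z a y : ℂ} {τ : ℝ} (hτ : 0 < τ)
    (hza : ∀ θ ∈ Set.Icc (-τ) τ, 0 < (z * (a * Complex.exp (-(θ * Complex.I)))).re)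
    (h : ∀ θ : ℝ, θ ∈ Set.Icc (-τ) τ →
      -(y * star (a * Complex.exp (-(θ * Complex.I)))) ∈ Complex.slitPlane) :
    ∫ s, rayTerm z (a * Complex.exp (-(τ * Complex.I))) y s =
      ∫ s, rayTerm z (a * Complex.exp (τ * Complex.I)) y s := by
  have hy : y ≠ 0 := by
    rintro rfl
    have := h 0 ⟨by linarith, hτ.le⟩
    simp at this
  simp_rw [rayTerm_eq_cauchyTerm hy]
  have := rayCauchy_eq_of_path (ζ := z * y)
    (γ := fun θ : ℝ => a * Complex.exp (-(θ * Complex.I)) / y) (a := -τ) (b := τ)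
    (by fun_prop) (by linarith) fun θ hθ => mem_cauchyDomain_div (hza θ hθ) (h θ hθ)
  simpa [rayCauchy] using this

/-- The kernel of the chain obtained by inserting a point `x` before the `k`-th one, without the
factor at the new junction. -/
def insertKernel {n : ℕ} (k : Fin (n + 1)) (x : ℂ) (X : Fin (n + 1) → ℂ) : ℂ :=
  ∏ i : Fin n, (X i.castSucc - if i.succ = k then x else X i.succ)⁻¹

theorem chainKernel_succ {n : ℕ} (x : Fin (n + 1) → ℂ) :
    chainKernel x = ∏ i : Fin n, (x i.castSucc - x i.succ)⁻¹ := by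
  rw [chainKernel, Nat.add_sub_cancel, Finset.prod_range]
  refine Finset.prod_congr rfl fun i _ => ?_
  rw [seqExt_of_lt x (by omega : (i : ℕ) < n + 1), seqExt_of_lt x (by omega : (i : ℕ) + 1 < n + 1)]
  rfl

theorem insertKernel_self {n : ℕ} (k : Fin (n + 1)) (X : Fin (n + 1) → ℂ) :
    insertKernel k (X k) X = chainKernel X := by
  rw [insertKernel, chainKernel_succ]
  refine Finset.prod_congr rfl fun i _ => ?_
  split_ifs with h
  · rw [h]
  · rfl

theorem insertNth_castSucc_castSucc {R : Type*} {n : ℕ} (k : Fin (n + 1)) (x : R)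
    (X : Fin (n + 1) → R) (i : Fin n) :
    (k.castSucc.insertNth x X : Fin (n + 2) → R) (k.succAbove i).castSucc = X i.castSucc := by
  have h1 : (k.succAbove i).castSucc = k.castSucc.succAbove i.castSucc := by
    ext
    simp only [Fin.succAbove, Fin.lt_def, Fin.val_castSucc]
    split_ifs <;> simp
  rw [h1, Fin.insertNth_apply_succAbove]

theorem insertNth_castSucc_succ {R : Type*} {n : ℕ} (k : Fin (n + 1)) (x : R)
    (X : Fin (n + 1) → R) (i : Fin n) :
    (k.castSucc.insertNth x X : Fin (n + 2) → R) (k.succAbove i).succ =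
      if i.succ = k then x else X i.succ := by
  split_ifs with h
  · have h1 : (k.succAbove i).succ = k.castSucc := by
      ext
      have : (i : ℕ) + 1 = k := by rw [← h]; simp
      simp only [Fin.succAbove, Fin.lt_def, Fin.val_castSucc, Fin.val_succ]
      rw [if_pos (by omega)]
      simpa using this
    rw [h1, Fin.insertNth_apply_same]
  · have h1 : (k.succAbove i).succ = k.castSucc.succAbove i.succ := by
      ext
      have : (i : ℕ) + 1 ≠ k := fun h' => h (Fin.ext (by simpa using h'))
      simp only [Fin.succAbove, Fin.lt_def, Fin.val_castSucc, Fin.val_succ]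
      split_ifs <;> simp <;> omega
    rw [h1, Fin.insertNth_apply_succAbove]

theorem chainKernel_insertNth {n : ℕ} (k : Fin (n + 1)) (x : ℂ) (X : Fin (n + 1) → ℂ) :
    chainKernel (k.castSucc.insertNth x X : Fin (n + 2) → ℂ) =
      (x - X k)⁻¹ * insertKernel k x X := by
  rw [chainKernel_succ, Fin.prod_univ_succAbove _ k, insertKernel]
  congr 1
  · have : k.succ = k.castSucc.succAbove k := by simp
    rw [Fin.insertNth_apply_same, this, Fin.insertNth_apply_succAbove]
  · refine Finset.prod_congr rfl fun i _ => ?_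
    rw [insertNth_castSucc_castSucc, insertNth_castSucc_succ]

/-- As a function of the inserted point, the kernel is constant or a multiple of `1 / (b - x)`. -/
theorem insertKernel_eq {n : ℕ} (k : Fin (n + 1)) (X : Fin (n + 1) → ℂ) :
    (∃ R, ∀ x, insertKernel k x X = R) ∨
      ∃ (i : Fin n) (R : ℂ), i.succ = k ∧ ∀ x, insertKernel k x X = (X i.castSucc - x)⁻¹ * R := by
  rcases Fin.eq_zero_or_eq_succ k with rfl | ⟨i, rfl⟩
  · refine Or.inl ⟨insertKernel 0 0 X, fun x => ?_⟩
    exact Finset.prod_congr rfl fun i _ => by simp [Fin.succ_ne_zero]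
  · refine Or.inr ⟨i, ∏ j ∈ Finset.univ.erase i, (X j.castSucc - X j.succ)⁻¹, rfl, fun x => ?_⟩
    rw [insertKernel, ← Finset.mul_prod_erase _ _ (Finset.mem_univ i), if_pos rfl]
    congr 1
    refine Finset.prod_congr rfl fun j hj => ?_
    rw [if_neg fun h => (Finset.mem_erase.1 hj).1 (Fin.succ_injective _ h)]

/-- The jump of a chain integral when the ray of the variable `p = k.castSucc` is moved across the
ray of the next variable: the two variables are identified. -/
theorem chainIntegral_jump {n : ℕ} (k : Fin (n + 1)) (z : Fin (n + 2) → ℂ) (d : Fin (n + 1) → ℂ)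
    {r β τ : ℝ} (hr : 0 < r) (hτ : 0 < τ) (h : |β| + τ < Real.pi / 2)
    (hza : z k.castSucc * d k = r * Complex.exp (β * Complex.I))
    (hdom : ∀ θ : ℝ, θ ∈ Set.Icc (-τ) τ → θ ≠ 0 →
      (z, (k.castSucc.insertNth (d k * Complex.exp (-(θ * Complex.I))) d : Fin (n + 2) → ℂ)) ∈
        chainDomain (n + 2))
    (hd : ∀ i : Fin n, -(d i.castSucc * star (d i.succ)) ∈ Complex.slitPlane) :
    chainIntegral z
        (k.castSucc.insertNth (d k * Complex.exp (-(τ * Complex.I))) d : Fin (n + 2) → ℂ) -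
      chainIntegral z
        (k.castSucc.insertNth (d k * Complex.exp (τ * Complex.I)) d : Fin (n + 2) → ℂ) =
      2 * Real.pi * Complex.I * chainIntegral
        (fun j => z (k.castSucc.succAbove j) + if j = k then z k.castSucc else 0) d := by
  have hterm : ∀ (a : ℂ) (s : ℝ) (y : Fin (n + 1) → ℝ),
      chainTerm z (k.castSucc.insertNth a d : Fin (n + 2) → ℂ) (k.castSucc.insertNth s y) =
        rayTerm (z k.castSucc) a (rayPoint d y k) s *
          insertKernel k (a * Complex.exp s) (rayPoint d y) *
          ∏ j, (rayPoint d y j *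
            Complex.exp (-(z (k.castSucc.succAbove j) * rayPoint d y j))) := by
    intro a s y
    have h1 : rayPoint (k.castSucc.insertNth a d : Fin (n + 2) → ℂ) (k.castSucc.insertNth s y) =
        k.castSucc.insertNth (a * Complex.exp s) (rayPoint d y) := by
      funext i
      refine Fin.succAboveCases k.castSucc ?_ (fun j => ?_) i
      · simp [rayPoint]
      · simp [rayPoint]
    rw [chainTerm, h1, chainKernel_insertNth, Fin.prod_univ_succAbove _ k.castSucc]
    simp only [Fin.insertNth_apply_same, Fin.insertNth_apply_succAbove, rayTerm]
    ring
  have hsplit : ∀ a : ℂ,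
      (z, (k.castSucc.insertNth a d : Fin (n + 2) → ℂ)) ∈ chainDomain (n + 2) →
      Integrable (fun y : Fin (n + 1) → ℝ => ∫ s : ℝ,
        chainTerm z (k.castSucc.insertNth a d : Fin (n + 2) → ℂ) (k.castSucc.insertNth s y)) ∧
      chainIntegral z (k.castSucc.insertNth a d : Fin (n + 2) → ℂ) =
        ∫ y : Fin (n + 1) → ℝ, ∫ s : ℝ,
          chainTerm z (k.castSucc.insertNth a d : Fin (n + 2) → ℂ)
            (k.castSucc.insertNth s y) := by
    intro a ha
    have hi := integrable_chainTerm (by omega) ha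
    have hmp := (volume_preserving_piFinSuccAbove (fun _ : Fin (n + 2) => ℝ) k.castSucc).symm
    have hi' := (hmp.integrable_comp_emb (MeasurableEquiv.measurableEmbedding _)).2 hi
    refine ⟨hi'.integral_prod_right, ?_⟩
    rw [chainIntegral, ← hmp.integral_comp']
    exact integral_prod_symm _ hi'
  have hτ' : τ ∈ Set.Icc (-τ) τ := ⟨by linarith, le_rfl⟩
  have hτ'' : -τ ∈ Set.Icc (-τ) τ := ⟨le_rfl, by linarith⟩
  have hdτ := hdom τ hτ' hτ.ne'
  have hdτ' := hdom (-τ) hτ'' (by linarith)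
  have hneg : -(((-τ : ℝ) : ℂ) * Complex.I) = τ * Complex.I := by push_cast; ring
  rw [hneg] at hdτ'
  have hre : ∀ θ ∈ Set.Icc (-τ) τ,
      0 < (z k.castSucc * (d k * Complex.exp (-(θ * Complex.I)))).re := by
    intro θ hθ
    have h1 : z k.castSucc * (d k * Complex.exp (-(θ * Complex.I))) =
        ((r * 1 : ℝ) : ℂ) * Complex.exp (((β + -θ : ℝ) : ℂ) * Complex.I) := by
      rw [← mul_assoc, hza, mul_assoc, ← Complex.exp_add]
      push_cast
      ring_nf
    rw [h1]
    refine re_exp_mul_pos hr one_pos ((abs_add_le _ _).trans_lt ?_)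
    rw [abs_neg]
    linarith [abs_le.2 hθ]
  -- the direction before the moving ray stays apart from it
  have hprev : ∀ i : Fin n, i.succ = k → ∀ θ : ℝ, θ ∈ Set.Icc (-τ) τ →
      -(d i.castSucc * star (d k * Complex.exp (-(θ * Complex.I)))) ∈ Complex.slitPlane := by
    intro i hi θ hθ
    rcases eq_or_ne θ 0 with rfl | h0
    · have := hd i
      rw [hi] at this
      simpa using this
    · have h1 := (hdom θ hθ h0).2 (k.succAbove i).castSucc (k.succAbove i).succ (by simp)
      simp only at h1
      rwa [insertNth_castSucc_castSucc, insertNth_castSucc_succ, if_pos hi] at h1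
  have hnext : ∀ θ : ℝ, θ ∈ Set.Icc (-τ) τ → θ ≠ 0 →
      -(d k * star (d k * Complex.exp (-(θ * Complex.I)))) ∈ Complex.slitPlane := by
    intro θ hθ h0
    have h1 := (hdom (-θ) ⟨by linarith [hθ.2], by linarith [hθ.1]⟩ (neg_ne_zero.2 h0)).2
      k.castSucc k.succ (by simp)
    have h2 : k.succ = k.castSucc.succAbove k := by simp
    simp only [Fin.insertNth_apply_same] at h1
    rw [h2, Fin.insertNth_apply_succAbove] at h1
    have h3 : d k * star (d k * Complex.exp (-(θ * Complex.I))) =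
        d k * Complex.exp (-(((-θ : ℝ) : ℂ) * Complex.I)) * star (d k) := by
      rw [star_mul]
      have : star (Complex.exp (-(θ * Complex.I))) = Complex.exp (-(((-θ : ℝ) : ℂ) * Complex.I)) := by
        rw [← starRingEnd_apply, ← Complex.exp_conj]
        simp
      rw [this]
      ring
    rw [h3]
    exact h1
  have hinner : ∀ y : Fin (n + 1) → ℝ,
      (∫ s : ℝ, rayTerm (z k.castSucc) (d k * Complex.exp (-(τ * Complex.I))) (rayPoint d y k) s *
          insertKernel k (d k * Complex.exp (-(τ * Complex.I)) * Complex.exp s) (rayPoint d y)) -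
        ∫ s : ℝ, rayTerm (z k.castSucc) (d k * Complex.exp (τ * Complex.I)) (rayPoint d y k) s *
          insertKernel k (d k * Complex.exp (τ * Complex.I) * Complex.exp s) (rayPoint d y) =
      2 * Real.pi * Complex.I * (Complex.exp (-(z k.castSucc * rayPoint d y k)) *
        chainKernel (rayPoint d y)) := by
    intro y
    have hjump := integral_rayTerm_jump (t := y k) hr hτ h hza
    rcases insertKernel_eq k (rayPoint d y) with ⟨R, hR⟩ | ⟨i, R, hi, hR⟩
    · simp_rw [← insertKernel_self k, hR, integral_mul_const]
      rw [← sub_mul, rayPoint, hjump]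
      ring
    · have hb : ∀ θ : ℝ, θ ∈ Set.Icc (-τ) τ → -(rayPoint d y i.castSucc *
          star (d k * Complex.exp (-(θ * Complex.I)))) ∈ Complex.slitPlane := fun θ hθ =>
        neg_mul_exp_mem_slitPlane (hprev i hi θ hθ) _
      have hbk : rayPoint d y i.castSucc - rayPoint d y k ≠ 0 := by
        have h1 := hd i
        rw [hi] at h1
        have := ne_of_neg_mul_star_mem_slitPlane h1 (Real.exp_pos (y i.castSucc)).le
          (Real.exp_pos (y k)).le (by positivity)
        simpa [rayPoint] using this
      -- partial fractions
      have hpf : ∀ θ : ℝ, θ ∈ Set.Icc (-τ) τ → θ ≠ 0 →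
          ∫ s : ℝ, rayTerm (z k.castSucc) (d k * Complex.exp (-(θ * Complex.I)))
            (rayPoint d y k) s *
            insertKernel k (d k * Complex.exp (-(θ * Complex.I)) * Complex.exp s) (rayPoint d y) =
          (rayPoint d y i.castSucc - rayPoint d y k)⁻¹ * R *
            ((∫ s, rayTerm (z k.castSucc) (d k * Complex.exp (-(θ * Complex.I)))
                (rayPoint d y k) s) -
              ∫ s, rayTerm (z k.castSucc) (d k * Complex.exp (-(θ * Complex.I)))
                (rayPoint d y i.castSucc) s) := by
        intro θ hθ h0
        have hsl : -(rayPoint d y k * star (d k * Complex.exp (-(θ * Complex.I)))) ∈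
            Complex.slitPlane := neg_mul_exp_mem_slitPlane (hnext θ hθ h0) (y k)
        rw [← integral_sub (integrable_rayTerm (hre θ hθ) hsl)
          (integrable_rayTerm (hre θ hθ) (hb θ hθ)), ← integral_const_mul]
        refine integral_congr_ae (Eventually.of_forall fun s => ?_)
        simp only [hR]
        have n1 : d k * Complex.exp (-(θ * Complex.I)) * Complex.exp s - rayPoint d y k ≠ 0 := by
          have := ne_of_neg_mul_star_mem_slitPlane hsl zero_le_one
            (Real.exp_pos s).le (by positivity)
          rw [← neg_ne_zero, neg_sub]
          simpa [rayPoint] using this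
        have n2 : rayPoint d y i.castSucc -
            d k * Complex.exp (-(θ * Complex.I)) * Complex.exp s ≠ 0 := by
          have := ne_of_neg_mul_star_mem_slitPlane (hb θ hθ) zero_le_one
            (Real.exp_pos s).le (by positivity)
          simpa using this
        have n3 : d k * Complex.exp (-(θ * Complex.I)) * Complex.exp s -
            rayPoint d y i.castSucc ≠ 0 := by
          rw [← neg_ne_zero, neg_sub]
          exact n2
        simp only [rayTerm]
        generalize d k * Complex.exp (-(θ * Complex.I)) * Complex.exp s = x at *
        have n4 : (rayPoint d y i.castSucc - x)⁻¹ = -(x - rayPoint d y i.castSucc)⁻¹ := by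
          rw [← inv_neg, neg_sub]
        rw [n4]
        field_simp
        ring
      have e1 := hpf τ hτ' hτ.ne'
      have e2 := hpf (-τ) hτ'' (by linarith)
      rw [hneg] at e2
      rw [e1, e2, integral_rayTerm_eq hτ hre hb, ← mul_sub, sub_sub_sub_cancel_right,
        ← insertKernel_self k, hR]
      simp only [rayPoint] at hjump ⊢
      rw [hjump]
      ring
  obtain ⟨i1, e1⟩ := hsplit _ hdτ
  obtain ⟨i2, e2⟩ := hsplit _ hdτ'
  rw [e1, e2, ← integral_sub i1 i2, chainIntegral, ← integral_const_mul]
  refine integral_congr_ae (Eventually.of_forall fun y => ?_)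
  simp only [hterm, integral_mul_const]
  rw [← sub_mul, hinner, chainTerm]
  have hprod : ∏ i, rayPoint d y i * Complex.exp (-((z (k.castSucc.succAbove i) +
      if i = k then z k.castSucc else 0) * rayPoint d y i)) =
      (∏ j, (rayPoint d y j * Complex.exp (-(z (k.castSucc.succAbove j) * rayPoint d y j)))) *
        Complex.exp (-(z k.castSucc * rayPoint d y k)) := by
    have h1 : ∀ i, rayPoint d y i * Complex.exp (-((z (k.castSucc.succAbove i) +
        if i = k then z k.castSucc else 0) * rayPoint d y i)) =
        (rayPoint d y i * Complex.exp (-(z (k.castSucc.succAbove i) * rayPoint d y i))) *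
          if i = k then Complex.exp (-(z k.castSucc * rayPoint d y k)) else 1 := by
      intro i
      split_ifs with hik
      · subst hik
        rw [mul_assoc, ← Complex.exp_add]
        ring_nf
      · simp
    simp_rw [h1]
    rw [Finset.prod_mul_distrib, Finset.prod_ite_eq' Finset.univ k]
    simp
  rw [hprod]
  ring

/-! ### The lifted function -/

/-- The tuples `φ` of arguments of rays for which the chain integral with `arg z_i = θ_i` converges,
in the component of the set of all such tuples given by `0 < φ_{i+1} - φ_i < 2π`. -/
def contourSet {n : ℕ} (θ : Fin n → ℝ) : Set (Fin n → ℝ) :=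
  {φ | (∀ i, |φ i - θ i| < Real.pi / 2) ∧
    ∀ i j : Fin n, (j : ℕ) = i + 1 → 0 < φ j - φ i ∧ φ j - φ i < 2 * Real.pi}

/-- The directions `e^{-iφ}` of the rays of integration. -/
def dirs {n : ℕ} (φ : Fin n → ℝ) : Fin n → ℂ := fun i => Complex.exp (-(φ i * Complex.I))

open Classical in
/-- The function `F_n` in logarithmic coordinates `u_k = log z_k`, continued holomorphically from
the set where `0 < Im (u_{k+1} - u_k) < 2π` to a neighbourhood of its closure. -/
def liftFun {n : ℕ} (u : Fin n → ℂ) : ℂ :=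
  if h : ∃ φ, φ ∈ contourSet (fun i => (u i).im) then
    chainFun (fun i => Complex.exp (u i)) (dirs h.choose)
  else 0

theorem exp_mul_exp_neg_mul_I (u : ℂ) (φ : ℝ) :
    Complex.exp u * Complex.exp (-(φ * Complex.I)) =
      (Real.exp u.re : ℝ) * Complex.exp (((u.im - φ : ℝ) : ℂ) * Complex.I) := by
  rw [Complex.ofReal_exp, ← Complex.exp_add, ← Complex.exp_add]
  congr 1
  conv_lhs => rw [← Complex.re_add_im u]
  push_cast
  ring

theorem mem_chainDomain_of_mem_contourSet {n : ℕ} {u : Fin n → ℂ} {φ : Fin n → ℝ}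
    (h : φ ∈ contourSet fun i => (u i).im) :
    ((fun i => Complex.exp (u i)), dirs φ) ∈ chainDomain n := by
  refine ⟨fun i => ?_, fun i j hij => ?_⟩
  · have h1 := exp_mul_exp_neg_mul_I (u i) (φ i)
    have h2 := re_exp_mul_pos (Real.exp_pos (u i).re) one_pos
      (θ := (u i).im - φ i) (by rw [abs_sub_comm]; exact h.1 i)
    rw [mul_one, ← h1] at h2
    exact h2
  · obtain ⟨h1, h2⟩ := h.2 i j hij
    have h3 := neg_exp_mem_slitPlane (θ := 2 * Real.pi - (φ j - φ i)) (by linarith) (by linarith)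
    have h4 : dirs φ i * star (dirs φ j) =
        Complex.exp (-(((2 * Real.pi - (φ j - φ i) : ℝ) : ℂ) * Complex.I)) := by
      have h5 : -(((2 * Real.pi - (φ j - φ i) : ℝ) : ℂ) * Complex.I) =
          (φ j - φ i) * Complex.I - 2 * Real.pi * Complex.I := by
        push_cast
        ring
      rw [h5, Complex.exp_sub, Complex.exp_two_pi_mul_I, div_one, dirs, dirs,
        ← starRingEnd_apply, ← Complex.exp_conj, ← Complex.exp_add]
      congr 1
      simp
      ring
    rw [h4]
    exact h3

theorem convex_contourSet {n : ℕ} (θ : Fin n → ℝ) : Convex ℝ (contourSet θ) := by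
  intro φ hφ ψ hψ a b ha hb hab
  have hcomb : ∀ x y c : ℝ, x < c → y < c → a * x + b * y < c := by
    intro x y c hx hy
    rcases ha.eq_or_lt with rfl | ha'
    · have : b = 1 := by linarith
      subst this; linarith
    · have hb' : b = 1 - a := by linarith
      subst hb'
      nlinarith
  refine ⟨fun i => abs_lt.2 ⟨?_, ?_⟩, fun i j hij => ⟨?_, ?_⟩⟩
  · have h1 := hcomb _ _ _ (neg_lt.2 (abs_lt.1 (hφ.1 i)).1) (neg_lt.2 (abs_lt.1 (hψ.1 i)).1)
    have hb' : b = 1 - a := by linarith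
    subst hb'
    simp only [Pi.add_apply, Pi.smul_apply, smul_eq_mul]
    linarith
  · have h1 := hcomb _ _ _ (abs_lt.1 (hφ.1 i)).2 (abs_lt.1 (hψ.1 i)).2
    have hb' : b = 1 - a := by linarith
    subst hb'
    simp only [Pi.add_apply, Pi.smul_apply, smul_eq_mul]
    linarith
  · have h1 := hcomb _ _ _ (neg_lt_zero.2 (hφ.2 i j hij).1) (neg_lt_zero.2 (hψ.2 i j hij).1)
    simp only [Pi.add_apply, Pi.smul_apply, smul_eq_mul]
    linarith
  · have h1 := hcomb _ _ _ (hφ.2 i j hij).2 (hψ.2 i j hij).2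
    simp only [Pi.add_apply, Pi.smul_apply, smul_eq_mul]
    linarith

theorem liftFun_eq {n : ℕ} (hn : 1 ≤ n) {u : Fin n → ℂ} {φ : Fin n → ℝ}
    (h : φ ∈ contourSet fun i => (u i).im) :
    liftFun u = chainFun (fun i => Complex.exp (u i)) (dirs φ) := by
  have hex : ∃ φ, φ ∈ contourSet (fun i => (u i).im) := ⟨φ, h⟩
  rw [liftFun, dif_pos hex, chainFun, chainFun]
  congr 2
  set ψ := hex.choose with hψ
  have hψm : ψ ∈ contourSet (fun i => (u i).im) := hex.choose_spec
  have := chainIntegral_eq_of_path hn (z := fun i => Complex.exp (u i))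
    (γ := fun t : ℝ => dirs (fun i => (1 - t) * φ i + t * ψ i))
    (by unfold dirs; fun_prop)
    (fun t ht => mem_chainDomain_of_mem_contourSet
      (convex_contourSet _ h hψm (sub_nonneg.2 ht.2) ht.1 (by ring)))
  simpa using this

theorem eventually_mem_contourSet {n : ℕ} {u : Fin n → ℂ} {φ : Fin n → ℝ}
    (h : φ ∈ contourSet fun i => (u i).im) :
    ∀ᶠ v : Fin n → ℂ in 𝓝 u, φ ∈ contourSet fun i => (v i).im := by
  have h1 : ∀ i, ∀ᶠ v : Fin n → ℂ in 𝓝 u, |φ i - (v i).im| < Real.pi / 2 := by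
    intro i
    have : Continuous fun v : Fin n → ℂ => |φ i - (v i).im| :=
      (continuous_const.sub (Complex.continuous_im.comp (continuous_apply i))).abs
    exact (this.tendsto u).eventually (gt_mem_nhds (h.1 i))
  filter_upwards [eventually_all.2 h1] with v hv using ⟨hv, h.2⟩

/-- The set on which the lifted function is defined. -/
def liftDomain (n : ℕ) : Set (Fin n → ℂ) := {u | (contourSet fun i => (u i).im).Nonempty}

theorem eventually_liftFun_eq {n : ℕ} (hn : 1 ≤ n) {u : Fin n → ℂ} {φ : Fin n → ℝ}
    (h : φ ∈ contourSet fun i => (u i).im) :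
    ∀ᶠ v in 𝓝 u, liftFun v = chainFun (fun i => Complex.exp (v i)) (dirs φ) := by
  filter_upwards [eventually_mem_contourSet h] with v hv using liftFun_eq hn hv

theorem differentiableAt_chainFun {n : ℕ} (hn : 1 ≤ n) {z d : Fin n → ℂ}
    (hp : (z, d) ∈ chainDomain n) : DifferentiableAt ℂ (fun z => chainFun z d) z := by
  unfold chainFun
  have h1 := (hasFDerivAt_chainIntegral_left hn hp).differentiableAt
  have h2 : DifferentiableAt ℂ (fun z : Fin n → ℂ => ∑ i, z i) z := by fun_prop
  exact (h2.mul h1).const_mul _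

theorem differentiableAt_liftFun {n : ℕ} (hn : 1 ≤ n) {u : Fin n → ℂ} (hu : u ∈ liftDomain n) :
    DifferentiableAt ℂ (liftFun : (Fin n → ℂ) → ℂ) u := by
  obtain ⟨φ, hφ⟩ := hu
  have h1 := differentiableAt_chainFun hn (mem_chainDomain_of_mem_contourSet hφ)
  have h2 : DifferentiableAt ℂ (fun v : Fin n → ℂ => fun i => Complex.exp (v i)) u := by fun_prop
  have h3 : DifferentiableAt ℂ (fun v => chainFun (fun i => Complex.exp (v i)) (dirs φ)) u :=
    DifferentiableAt.comp (g := fun z => chainFun z (dirs φ))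
      (f := fun (v : Fin n → ℂ) i => Complex.exp (v i)) u h1 h2
  exact h3.congr_of_eventuallyEq (eventually_liftFun_eq hn hφ)

/-- The lifted function is invariant under simultaneous translation: it is built from a scale
invariant function, and contours can be rotated along with the variables. -/
theorem liftFun_add_const {n : ℕ} (hn : 1 ≤ n) (u : Fin n → ℂ) (a : ℂ) :
    liftFun (fun i => u i + a) = liftFun u := by
  have key : ∀ (u : Fin n → ℂ) (a : ℂ) (φ : Fin n → ℝ), φ ∈ contourSet (fun i => (u i).im) →
      (fun i => φ i + a.im) ∈ contourSet fun i => (u i + a).im := by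
    intro u a φ hφ
    refine ⟨fun i => ?_, fun i j hij => ?_⟩
    · have := hφ.1 i
      simpa using this
    · have := hφ.2 i j hij
      simpa using this
  by_cases h : ∃ φ, φ ∈ contourSet fun i => (u i).im
  · obtain ⟨φ, hφ⟩ := h
    rw [liftFun_eq hn hφ, liftFun_eq hn (key u a φ hφ)]
    have h1 : (fun i => Complex.exp (u i + a)) = fun i => Complex.exp a * Complex.exp (u i) := by
      funext i
      rw [Complex.exp_add, mul_comm]
    rw [h1, chainFun_smul hn (Complex.exp_ne_zero a), chainFun, chainFun]
    congr 2
    rw [← chainIntegral_mul_exp _ (dirs φ) fun _ => a.re]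
    congr 1
    funext i
    rw [dirs, dirs, ← Complex.exp_add, ← Complex.exp_add]
    congr 1
    push_cast
    linear_combination -Complex.re_add_im a
  · have h' : ¬∃ φ, φ ∈ contourSet fun i => (u i + a).im := by
      rintro ⟨φ, hφ⟩
      have := key _ (-a) _ hφ
      simp only [add_neg_cancel_right] at this
      exact h ⟨_, this⟩
    rw [liftFun, liftFun, dif_neg h, dif_neg h']

theorem liftFun_one (u : Fin 1 → ℂ) : liftFun u = (2 * (Real.pi : ℂ) * Complex.I)⁻¹ := by
  have h : (fun i => (u i).im) ∈ contourSet fun i => (u i).im := by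
    refine ⟨fun i => by simp [Real.pi_pos], fun i j hij => ?_⟩
    have := j.isLt
    omega
  rw [liftFun_eq le_rfl h]
  exact chainFun_one ((mem_chainDomain_of_mem_contourSet h).1 0)

theorem forall_adjacent {n : ℕ} {P : Fin (n + 1) → Fin (n + 1) → Prop} :
    (∀ i j : Fin (n + 1), (j : ℕ) = i + 1 → P i j) ↔ ∀ c : Fin n, P c.castSucc c.succ := by
  refine ⟨fun h c => h _ _ (by simp), fun h i j hij => ?_⟩
  have hi : (i : ℕ) < n := by have := j.isLt; omega
  have := h ⟨i, hi⟩
  convert! this using 1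
  exact Fin.ext (by simpa using hij)

/-- The wall-crossing formula of the lifted function: a turn by `2π` of the variables after the
`k`-th one adds the function with the `k`-th variable and the next one merged, if these two are
close to a common ray. -/
theorem liftFun_jump {n : ℕ} (k : Fin (n + 1)) (u : Fin (n + 2) → ℂ) (u' : Fin (n + 1) → ℂ)
    (φ : Fin (n + 1) → ℝ)
    (hφ : ∀ i j : Fin (n + 1), (j : ℕ) = i + 1 → 0 < φ j - φ i ∧ φ j - φ i < 2 * Real.pi)
    (hu : ∀ j, |φ j - (u (k.castSucc.succAbove j)).im| < Real.pi / 2)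
    (huk : |φ k - (u k.castSucc).im| < Real.pi / 2)
    (hu' : ∀ j, |φ j - (u' j).im| < Real.pi / 2)
    (hexp : ∀ j, Complex.exp (u' j) = Complex.exp (u (k.castSucc.succAbove j)) +
      if j = k then Complex.exp (u k.castSucc) else 0) :
    liftFun (fun i => if k.castSucc < i then u i + 2 * Real.pi * Complex.I else u i) =
      liftFun u + liftFun u' := by
  have hπ := Real.pi_pos
  have hφ' := forall_adjacent.1 hφ
  -- the angle by which the ray is moved
  obtain ⟨τ, ⟨hτ1, hτ2⟩, hτ⟩ : ∃ τ : ℝ, (|φ k - (u k.castSucc).im| + τ < Real.pi / 2 ∧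
      ∀ i : Fin n, i.succ = k → τ < φ k - φ i.castSucc ∧ φ k - φ i.castSucc + τ < 2 * Real.pi) ∧
      0 < τ := by
    have e1 : ∀ᶠ τ in 𝓝[>] (0 : ℝ), |φ k - (u k.castSucc).im| + τ < Real.pi / 2 := by
      filter_upwards [Ioo_mem_nhdsGT (sub_pos.2 huk)] with τ h
      linarith [h.2]
    have e2 : ∀ i : Fin n, ∀ᶠ τ in 𝓝[>] (0 : ℝ), i.succ = k →
        τ < φ k - φ i.castSucc ∧ φ k - φ i.castSucc + τ < 2 * Real.pi := by
      intro i
      by_cases hi : i.succ = k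
      · have h := hφ' i
        rw [hi] at h
        filter_upwards [Ioo_mem_nhdsGT h.1, Ioo_mem_nhdsGT (sub_pos.2 h.2)] with τ h1 h2 _
        exact ⟨h1.2, by linarith [h2.2]⟩
      · exact Eventually.of_forall fun τ h => absurd h hi
    exact ((e1.and (eventually_all.2 e2)).and self_mem_nhdsWithin).exists
  have hτπ : τ < Real.pi := by linarith [abs_nonneg (φ k - (u k.castSucc).im)]
  set p := k.castSucc with hp
  let ψ : ℝ → Fin (n + 2) → ℝ := fun θ => p.insertNth (φ k + θ) φ
  let w : Fin (n + 2) → ℂ := fun i => if p < i then u i + 2 * Real.pi * Complex.I else u i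
  let χ : ℝ → Fin (n + 2) → ℝ := fun θ i => if p < i then ψ θ i + 2 * Real.pi else ψ θ i
  have hw : (fun i => Complex.exp (w i)) = fun i => Complex.exp (u i) := by
    funext i
    simp only [w]
    split_ifs
    · rw [Complex.exp_add, Complex.exp_two_pi_mul_I, mul_one]
    · rfl
  have hχ : ∀ θ, dirs (χ θ) = dirs (ψ θ) := by
    intro θ
    funext i
    simp only [dirs, χ]
    split_ifs
    · push_cast
      rw [add_mul, neg_add, Complex.exp_add, Complex.exp_neg (2 * _ * _),
        Complex.exp_two_pi_mul_I, inv_one, mul_one]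
    · rfl
  have hψd : ∀ θ, dirs (ψ θ) =
      (p.insertNth (dirs φ k * Complex.exp (-(θ * Complex.I))) (dirs φ) : Fin (n + 2) → ℂ) := by
    intro θ
    funext i
    refine Fin.succAboveCases p ?_ (fun j => ?_) i
    · simp only [dirs, ψ, Fin.insertNth_apply_same]
      rw [← Complex.exp_add]
      congr 1
      push_cast
      ring
    · simp only [dirs, ψ, Fin.insertNth_apply_succAbove]
  have hnear : ∀ θ, |θ| ≤ τ → ∀ i, |ψ θ i - (u i).im| < Real.pi / 2 := by
    intro θ hθ i
    refine Fin.succAboveCases p ?_ (fun j => ?_) i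
    · simp only [ψ, Fin.insertNth_apply_same]
      rw [show φ k + θ - (u p).im = (φ k - (u p).im) + θ by ring]
      exact (abs_add_le _ _).trans_lt (by linarith)
    · simp only [ψ, Fin.insertNth_apply_succAbove]
      exact hu j
  have hadj : ∀ θ, |θ| ≤ τ → ∀ i : Fin n,
      0 < ψ θ (k.succAbove i).succ - ψ θ (k.succAbove i).castSucc ∧
        ψ θ (k.succAbove i).succ - ψ θ (k.succAbove i).castSucc < 2 * Real.pi := by
    intro θ hθ i
    simp only [ψ]
    rw [hp, insertNth_castSucc_castSucc, insertNth_castSucc_succ]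
    have hθ' := abs_le.1 hθ
    split_ifs with hi
    · obtain ⟨h1, h2⟩ := hτ2 i hi
      constructor <;> linarith
    · exact hφ' i
  have hks : k.succ = p.succAbove k := by simp [hp]
  have hψk : ∀ θ, ψ θ k.succ - ψ θ k.castSucc = -θ := by
    intro θ
    simp only [ψ]
    rw [hks, Fin.insertNth_apply_succAbove, ← hp, Fin.insertNth_apply_same]
    ring
  have hneg : ∀ θ, θ < 0 → -τ ≤ θ → ψ θ ∈ contourSet fun i => (u i).im := by
    intro θ h0 h1
    have hθ : |θ| ≤ τ := abs_le.2 ⟨h1, by linarith⟩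
    refine ⟨hnear θ hθ, forall_adjacent.2 fun c => ?_⟩
    rcases Fin.eq_self_or_eq_succAbove k c with rfl | ⟨i, rfl⟩
    · rw [hψk]
      constructor <;> linarith
    · exact hadj θ hθ i
  have hpos : ∀ θ, 0 < θ → θ ≤ τ → χ θ ∈ contourSet fun i => (w i).im := by
    intro θ h0 h1
    have hθ : |θ| ≤ τ := abs_le.2 ⟨by linarith, h1⟩
    refine ⟨fun i => ?_, forall_adjacent.2 fun c => ?_⟩
    · have := hnear θ hθ i
      simp only [χ, w]
      split_ifs
      · simpa using this
      · exact this
    · simp only [χ]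
      rcases Fin.eq_self_or_eq_succAbove k c with rfl | ⟨i, rfl⟩
      · rw [if_pos (by simp [hp, Fin.lt_def]), if_neg (by simp [hp])]
        have := hψk θ
        constructor <;> linarith
      · have h2 : p < (k.succAbove i).succ ↔ p < (k.succAbove i).castSucc := by
          have : (k.succAbove i : ℕ) ≠ k := fun h => Fin.succAbove_ne k i (Fin.ext h)
          simp only [hp, Fin.lt_def, Fin.val_castSucc, Fin.val_succ]
          omega
        have := hadj θ hθ i
        simp only [h2]
        split_ifs
        · constructor <;> linarith
        · exact this
  have hdom : ∀ θ : ℝ, θ ∈ Set.Icc (-τ) τ → θ ≠ 0 → ((fun i => Complex.exp (u i)),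
      (p.insertNth (dirs φ k * Complex.exp (-(θ * Complex.I))) (dirs φ) : Fin (n + 2) → ℂ)) ∈
        chainDomain (n + 2) := by
    intro θ hθ h0
    rw [← hψd]
    rcases lt_or_gt_of_ne h0 with h | h
    · exact mem_chainDomain_of_mem_contourSet (hneg θ h hθ.1)
    · rw [← hw, ← hχ]
      exact mem_chainDomain_of_mem_contourSet (hpos θ h hθ.2)
  have hm : φ ∈ contourSet fun i => (u' i).im := ⟨hu', hφ⟩
  have hd := forall_adjacent.1 (mem_chainDomain_of_mem_contourSet hm).2
  have hJ := chainIntegral_jump k (fun i => Complex.exp (u i)) (dirs φ)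
    (Real.exp_pos (u p).re) hτ (β := (u p).im - φ k) (by rw [abs_sub_comm]; exact hτ1)
    (exp_mul_exp_neg_mul_I (u p) (φ k)) hdom hd
  have e1 := liftFun_eq (by omega) (hneg (-τ) (by linarith) le_rfl)
  have e2 := liftFun_eq (by omega) (hpos τ hτ le_rfl)
  have e3 := liftFun_eq (by omega) hm
  rw [hw, hχ, hψd] at e2
  rw [hψd] at e1
  have hneg' : -(((-τ : ℝ) : ℂ) * Complex.I) = τ * Complex.I := by push_cast; ring
  rw [hneg'] at e1
  have hz : (fun i => Complex.exp (u' i)) = fun j => Complex.exp (u (p.succAbove j)) +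
      if j = k then Complex.exp (u p) else 0 := funext hexp
  have hsum : ∑ j, Complex.exp (u' j) = ∑ i, Complex.exp (u i) := by
    simp_rw [hexp]
    rw [Finset.sum_add_distrib, Finset.sum_ite_eq' Finset.univ k, Fin.sum_univ_succAbove _ p]
    simp [add_comm]
  change liftFun w = _
  rw [e1, e2, e3, chainFun, chainFun, chainFun, hsum, hz]
  have h2π : 2 * (Real.pi : ℂ) * Complex.I ≠ 0 := Complex.two_pi_I_ne_zero
  rw [← sub_eq_iff_eq_add', ← mul_sub, ← mul_sub, hJ, pow_succ]
  field_simp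
  rfl

/-! ### Existence of contours and the growth of the lifted function -/

/-- Angles with consecutive differences in `[0, 2π]` can be moved by at most `π / 8` such that the
differences stay away from `0` and `2π` by an amount depending on the number of angles only. -/
theorem exists_near_angles {n : ℕ} (hn : 1 ≤ n) {α : Fin n → ℝ}
    (hα : ∀ i j : Fin n, (j : ℕ) = i + 1 → 0 ≤ α j - α i ∧ α j - α i ≤ 2 * Real.pi) :
    ∃ φ : Fin n → ℝ, (∀ i, |φ i - α i| ≤ Real.pi / 8) ∧
      ∀ i j : Fin n, (j : ℕ) = i + 1 →
        Real.pi / (8 * n) ≤ φ j - φ i ∧ φ j - φ i ≤ 2 * Real.pi - Real.pi / (8 * n) := by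
  have hπ := Real.pi_pos
  have hn' : (1 : ℝ) ≤ n := by exact_mod_cast hn
  have hb : ∀ (k : ℕ) (hk : k < n), 0 ≤ α ⟨k, hk⟩ - α ⟨0, hn⟩ ∧
      α ⟨k, hk⟩ - α ⟨0, hn⟩ ≤ 2 * Real.pi * k := by
    intro k
    induction k with
    | zero => intro hk; simp
    | succ k ih =>
      intro hk
      have h1 := ih (by omega)
      have h2 := hα ⟨k, by omega⟩ ⟨k + 1, hk⟩ rfl
      push_cast
      constructor <;> linarith
  set lam : ℝ := 1 / (8 * n) with hlam
  have hl0 : 0 < lam := by positivity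
  have hln : lam * n = 1 / 8 := by rw [hlam]; field_simp
  have hl1 : lam ≤ 1 := by nlinarith
  have hlπ : Real.pi / (8 * n) = lam * Real.pi := by rw [hlam]; ring
  refine ⟨fun i => α i + lam * (Real.pi * i - (α i - α ⟨0, hn⟩)), fun i => ?_,
    fun i j hij => ?_⟩
  · obtain ⟨h1, h2⟩ := hb i i.isLt
    have hi : ((i : ℕ) : ℝ) ≤ n := by exact_mod_cast i.isLt.le
    rw [add_sub_cancel_left, abs_mul, abs_of_pos hl0]
    have h3 : |Real.pi * i - (α i - α ⟨0, hn⟩)| ≤ Real.pi * n := by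
      have h4 : Real.pi * i ≤ Real.pi * n := by gcongr
      refine (abs_le.2 ⟨?_, ?_⟩).trans h4 <;> linarith
    calc lam * |Real.pi * i - (α i - α ⟨0, hn⟩)| ≤ lam * (Real.pi * n) := by gcongr
      _ = Real.pi / 8 := by linear_combination Real.pi * hln
  · obtain ⟨h1, h2⟩ := hα i j hij
    have h3 : ((j : ℕ) : ℝ) = i + 1 := by exact_mod_cast hij
    rw [hlπ]
    simp only [h3]
    constructor <;> nlinarith

theorem mem_contourSet_of_abs_sub_le {n : ℕ} (hn : 1 ≤ n) {α φ θ : Fin n → ℝ}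
    (h : ∀ i, |φ i - α i| ≤ Real.pi / 8)
    (hφ : ∀ i j : Fin n, (j : ℕ) = i + 1 →
        Real.pi / (8 * n) ≤ φ j - φ i ∧ φ j - φ i ≤ 2 * Real.pi - Real.pi / (8 * n))
    (hθ : ∀ i, |θ i - α i| < Real.pi / 4) : φ ∈ contourSet θ := by
  have hπ := Real.pi_pos
  have hn' : (1 : ℝ) ≤ n := by exact_mod_cast hn
  have h0 : 0 < Real.pi / (8 * n) := by positivity
  refine ⟨fun i => ?_, fun i j hij => ?_⟩
  · have h1 := abs_le.1 (h i)
    have h2 := abs_lt.1 (hθ i)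
    rw [abs_lt]
    constructor <;> linarith [h1.1, h1.2, h2.1, h2.2]
  · have := hφ i j hij
    constructor <;> linarith [this.1, this.2]

theorem mem_liftDomain {n : ℕ} (hn : 1 ≤ n) {α : Fin n → ℝ} {u : Fin n → ℂ}
    (hα : ∀ i j : Fin n, (j : ℕ) = i + 1 → 0 ≤ α j - α i ∧ α j - α i ≤ 2 * Real.pi)
    (hu : ∀ i, |(u i).im - α i| < Real.pi / 4) : u ∈ liftDomain n := by
  obtain ⟨φ, h1, h2⟩ := exists_near_angles hn hα
  exact ⟨φ, mem_contourSet_of_abs_sub_le hn h1 h2 hu⟩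

/-- By compactness, rays at an angle of at least `δ` are uniformly apart. -/
theorem exists_raysApart_const {δ : ℝ} (hδ : 0 < δ) :
    ∃ c > 0, ∀ φ ψ : ℝ, δ ≤ ψ - φ → ψ - φ ≤ 2 * Real.pi - δ →
      RaysApart c (Complex.exp (-(φ * Complex.I))) (Complex.exp (-(ψ * Complex.I))) := by
  by_cases hne : δ ≤ 2 * Real.pi - δ
  · have hcomp : IsCompact (Set.Icc δ (2 * Real.pi - δ) ×ˢ Set.Icc (0 : ℝ) 1) :=
      isCompact_Icc.prod isCompact_Icc
    obtain ⟨⟨τ, x⟩, ⟨hτ, hx⟩, hmin⟩ := hcomp.exists_isMinOn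
      ⟨(δ, 0), ⟨⟨le_rfl, hne⟩, by simp⟩⟩
      (f := fun p : ℝ × ℝ => ‖(p.2 : ℂ) - Complex.exp (-(p.1 * Complex.I)) * (1 - p.2 : ℝ)‖)
      (by fun_prop)
    refine ⟨_, norm_pos_iff.2 (?_ : (x : ℂ) - Complex.exp (-(τ * Complex.I)) * (1 - x : ℝ) ≠ 0),
      fun φ ψ h1 h2 => RaysApart.of_unit fun y hy => ?_⟩
    · have h3 := neg_exp_mem_slitPlane (θ := 2 * Real.pi - τ) (by linarith [hτ.2])
        (by linarith [hτ.1])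
      have h4 : -(1 * star (Complex.exp (-(τ * Complex.I)))) =
          -Complex.exp (-(((2 * Real.pi - τ : ℝ) : ℂ) * Complex.I)) := by
        have h5 : -(((2 * Real.pi - τ : ℝ) : ℂ) * Complex.I) =
            τ * Complex.I - 2 * Real.pi * Complex.I := by
          push_cast
          ring
        rw [h5, Complex.exp_sub, Complex.exp_two_pi_mul_I, div_one, one_mul,
          ← starRingEnd_apply, ← Complex.exp_conj]
        simp
      rw [← h4] at h3
      have := ne_of_neg_mul_star_mem_slitPlane h3 hx.1 (sub_nonneg.2 hx.2) (by simp)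
      simpa using this
    · have h5 := hmin (a := (ψ - φ, y)) ⟨⟨h1, h2⟩, hy⟩
      refine (show _ ≤ _ from h5).trans_eq ?_
      have h6 : Complex.exp (-(φ * Complex.I)) * y - Complex.exp (-(ψ * Complex.I)) * (1 - y : ℝ) =
          Complex.exp (((-φ : ℝ) : ℂ) * Complex.I) *
            (y - Complex.exp (-(((ψ - φ : ℝ) : ℂ) * Complex.I)) * (1 - y : ℝ)) := by
        rw [mul_sub, ← mul_assoc _ (Complex.exp _), ← Complex.exp_add]
        congr 3 <;> push_cast <;> ring
      rw [h6, norm_mul, Complex.norm_exp_ofReal_mul_I, one_mul]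
  · exact ⟨1, one_pos, fun φ ψ h1 h2 => absurd (h1.trans h2) hne⟩

/-- The growth of the lifted function, uniformly in the variables: the angles between consecutive
rays of the contour can be bounded below in terms of `n` only. -/
theorem exists_norm_liftFun_le {n : ℕ} (hn : 1 ≤ n) :
    ∃ C : ℝ, ∀ u : Fin n → ℂ,
      (∀ i j : Fin n, (j : ℕ) = i + 1 → 0 ≤ (u j).im - (u i).im ∧
        (u j).im - (u i).im ≤ 2 * Real.pi) →
      ‖liftFun u‖ ≤ C * ‖∑ i, Complex.exp (u i)‖ *
        ∏ i, ‖Complex.exp (u i)‖ ^ (-(n : ℝ)⁻¹) := by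
  have hπ := Real.pi_pos
  have hn' : (1 : ℝ) ≤ n := by exact_mod_cast hn
  obtain ⟨c, hc, hrays⟩ := exists_raysApart_const (δ := Real.pi / (8 * n)) (by positivity)
  refine ⟨‖(2 * (Real.pi : ℂ) * Complex.I)⁻¹ ^ n‖ * (c⁻¹ ^ (n - 1) * 1 ^ n *
    (∫ s, gammaWeight (n : ℝ)⁻¹ s) ^ n) * ∏ i : Fin n, (2⁻¹ : ℝ) ^ (-(n : ℝ)⁻¹),
    fun u hu => ?_⟩
  obtain ⟨φ, h1, h2⟩ := exists_near_angles hn hu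
  have h3 := mem_contourSet_of_abs_sub_le hn h1 h2 (θ := fun i => (u i).im)
    (fun i => by rw [sub_self, abs_zero]; linarith)
  rw [liftFun_eq hn h3, chainFun]
  have h4 := norm_chainIntegral_le hn (z := fun i => Complex.exp (u i)) (d := dirs φ) (c := c)
    (D := 1) (a := fun i => 2⁻¹ * ‖Complex.exp (u i)‖) hc
    (fun i => by
      rw [dirs, show -((φ i : ℂ) * Complex.I) = ((-φ i : ℝ) : ℂ) * Complex.I by push_cast; ring,
        Complex.norm_exp_ofReal_mul_I])
    (fun i => mul_pos (by norm_num) (norm_pos_iff.2 (Complex.exp_ne_zero _)))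
    (fun i => by
      rw [dirs, exp_mul_exp_neg_mul_I, Complex.re_ofReal_mul, Complex.exp_ofReal_mul_I_re,
        Complex.norm_exp, mul_comm]
      gcongr
      have h5 : |(u i).im - φ i| ≤ Real.pi / 3 := by
        rw [abs_sub_comm]
        exact (h1 i).trans (by linarith)
      rw [← Real.cos_abs, inv_eq_one_div, ← Real.cos_pi_div_three]
      exact Real.cos_le_cos_of_nonneg_of_le_pi (abs_nonneg _) (by linarith) h5)
    (fun i j hij => hrays _ _ (h2 i j hij).1 (h2 i j hij).2)
  rw [norm_mul, norm_mul]
  have h6 : ∏ i, (2⁻¹ * ‖Complex.exp (u i)‖) ^ (-(n : ℝ)⁻¹) =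
      (∏ i : Fin n, (2⁻¹ : ℝ) ^ (-(n : ℝ)⁻¹)) * ∏ i, ‖Complex.exp (u i)‖ ^ (-(n : ℝ)⁻¹) := by
    rw [← Finset.prod_mul_distrib]
    exact Finset.prod_congr rfl fun i _ => Real.mul_rpow (by norm_num) (norm_nonneg _)
  rw [h6] at h4
  calc _ ≤ ‖(2 * (Real.pi : ℂ) * Complex.I)⁻¹ ^ n‖ * (‖∑ i, Complex.exp (u i)‖ *
        (c⁻¹ ^ (n - 1) * 1 ^ n * (∫ s, gammaWeight (n : ℝ)⁻¹ s) ^ n *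
          ((∏ i : Fin n, (2⁻¹ : ℝ) ^ (-(n : ℝ)⁻¹)) *
            ∏ i, ‖Complex.exp (u i)‖ ^ (-(n : ℝ)⁻¹)))) := by gcongr
    _ = _ := by ring

/-! ### Ordered partitions of lists -/

open Classical in
/-- The ways of cutting the list `l` into nonempty consecutive blocks. -/
def parts {A : Type*} (l : List A) : Finset (List (List A)) :=
  Finset.univ.image fun c : Composition l.length => l.splitWrtComposition c

theorem mem_parts {A : Type*} {l : List A} {ls : List (List A)} :
    ls ∈ parts l ↔ ls.flatten = l ∧ [] ∉ ls := by
  classical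
  simp only [parts, Finset.mem_image, Finset.mem_univ, true_and]
  constructor
  · rintro ⟨c, rfl⟩
    refine ⟨List.flatten_splitWrtComposition l c, fun h => ?_⟩
    exact (List.length_pos_of_mem_splitWrtComposition h).ne' rfl
  · rintro ⟨rfl, h⟩
    refine ⟨⟨ls.map List.length, fun {i} hi => ?_, by rw [List.length_flatten]⟩,
      List.splitWrtComposition_flatten ls _ rfl⟩
    obtain ⟨b, hb, rfl⟩ := List.mem_map.1 hi
    exact List.length_pos_iff.2 fun h0 => h (h0 ▸ hb)

theorem splitWrtComposition_ofFn {A : Type*} {n : ℕ} (x : Fin n → A) (c : Composition n) :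
    (List.ofFn x).splitWrtComposition c =
      List.ofFn fun k => List.ofFn fun j => x (c.embedding k j) := by
  refine List.ext_getElem (by simp [List.length_splitWrtComposition]) fun i h1 h2 => ?_
  rw [List.getElem_splitWrtComposition, List.getElem_ofFn]
  simp only [List.length_ofFn] at h2
  have hle : c.sizeUpTo (i + 1) ≤ n := c.sizeUpTo_le _
  have hs := c.sizeUpTo_succ' ⟨i, h2⟩
  refine List.ext_getElem (by simp at hs ⊢; omega) fun j h3 h4 => ?_
  simp [Composition.embedding]

theorem sum_parts_ofFn {A M : Type*} [AddCommMonoid M] {n : ℕ} (x : Fin n → A)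
    (f : List (List A) → M) :
    ∑ ls ∈ parts (List.ofFn x), f ls =
      ∑ c : Composition n, f (List.ofFn fun k => List.ofFn fun j => x (c.embedding k j)) := by
  classical
  have key : ∀ (l : List A) (hl : l.length = n), ∑ ls ∈ parts l, f ls =
      ∑ c : Composition n, f (l.splitWrtComposition c) := by
    rintro l rfl
    rw [parts, Finset.sum_image]
    intro c _ c' _ h
    have h1 := congrArg (List.map List.length) h
    simp only [List.map_length_splitWrtComposition] at h1
    exact Composition.ext h1
  rw [key _ (List.length_ofFn)]
  simp_rw [splitWrtComposition_ofFn]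

theorem sum_parts_map {A B M : Type*} [AddCommMonoid M] (g : A → B) (l : List A)
    (f : List (List B) → M) :
    ∑ ls ∈ parts (l.map g), f ls = ∑ ls ∈ parts l, f (ls.map (List.map g)) := by
  obtain ⟨n, x, rfl⟩ : ∃ n, ∃ x : Fin n → A, l = List.ofFn x := ⟨_, _, (List.ofFn_get l).symm⟩
  rw [List.map_ofFn, sum_parts_ofFn, sum_parts_ofFn]
  simp only [List.map_ofFn, Function.comp_def]

open Classical in
/-- The families of ordered partitions of the members of a list of lists. -/
def partsFamilies {A : Type*} : List (List A) → Finset (List (List (List A)))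
  | [] => {[]}
  | b :: ls => (parts b ×ˢ partsFamilies ls).image fun p => p.1 :: p.2

theorem mem_partsFamilies {A : Type*} {ls : List (List A)} {M : List (List (List A))} :
    M ∈ partsFamilies ls ↔ M.map List.flatten = ls ∧ ∀ m ∈ M, [] ∉ m := by
  classical
  induction ls generalizing M with
  | nil =>
    simp only [partsFamilies, Finset.mem_singleton, List.map_eq_nil_iff]
    constructor
    · rintro rfl
      simp
    · exact fun h => h.1
  | cons b ls ih =>
    simp only [partsFamilies, Finset.mem_image, Finset.mem_product, Prod.exists, mem_parts, ih]
    constructor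
    · rintro ⟨m, M, ⟨⟨rfl, h1⟩, rfl, h2⟩, rfl⟩
      exact ⟨rfl, by simpa using ⟨h1, h2⟩⟩
    · rintro ⟨h1, h2⟩
      obtain ⟨m, M, rfl, h3, h4⟩ := List.map_eq_cons_iff.1 h1
      exact ⟨m, M, ⟨⟨h3, h2 m (by simp)⟩, h4, fun m' hm' => h2 m' (by simp [hm'])⟩, rfl⟩

theorem prod_map_sum_parts {A R : Type*} [Semiring R] (g : List (List A) → R)
    (ls : List (List A)) :
    (ls.map fun b => ∑ m ∈ parts b, g m).prod = ∑ M ∈ partsFamilies ls, (M.map g).prod := by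
  classical
  induction ls with
  | nil => simp [partsFamilies]
  | cons b ls ih =>
    rw [partsFamilies, Finset.sum_image (by rintro ⟨a, b⟩ _ ⟨c, d⟩ _ h; simpa using h),
      List.map_cons, List.prod_cons, ih, Finset.sum_mul_sum, Finset.sum_product]
    simp

/-- Grouping the blocks of a partition, and cutting each block of a coarser partition, are the same.
-/
theorem sum_parts_parts {A M : Type*} [AddCommMonoid M] (l : List A)
    (f : List (List (List A)) → M) :
    ∑ ls ∈ parts l, ∑ P ∈ parts ls, f P = ∑ ls ∈ parts l, ∑ P ∈ partsFamilies ls, f P := by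
  rw [Finset.sum_sigma', Finset.sum_sigma']
  refine Finset.sum_bij' (fun x _ => ⟨x.2.map List.flatten, x.2⟩)
    (fun x _ => ⟨x.2.flatten, x.2⟩) ?_ ?_ ?_ ?_ (fun _ _ => rfl)
  · rintro ⟨ls, P⟩ h
    simp only [Finset.mem_sigma, mem_parts, mem_partsFamilies] at h ⊢
    obtain ⟨⟨rfl, h1⟩, rfl, h2⟩ := h
    refine ⟨⟨by rw [List.flatten_flatten], fun h => ?_⟩, trivial, fun m hm h => ?_⟩
    · obtain ⟨m, hm, h3⟩ := List.mem_map.1 h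
      rcases m with _ | ⟨b, m⟩
      · exact h2 hm
      · have : b = [] := List.flatten_eq_nil_iff.1 h3 b (by simp)
        exact h1 (List.mem_flatten.2 ⟨_, hm, by simp [this]⟩)
    · exact h1 (List.mem_flatten.2 ⟨m, hm, h⟩)
  · rintro ⟨ls, P⟩ h
    simp only [Finset.mem_sigma, mem_parts, mem_partsFamilies] at h ⊢
    obtain ⟨⟨rfl, h1⟩, rfl, h2⟩ := h
    refine ⟨⟨by rw [List.flatten_flatten], fun h => ?_⟩, trivial, fun h => ?_⟩
    · obtain ⟨m, hm, h3⟩ := List.mem_flatten.1 h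
      exact h2 m hm h3
    · exact h1 (List.mem_map.2 ⟨[], h, rfl⟩)
  · rintro ⟨ls, P⟩ h
    simp only [Finset.mem_sigma, mem_parts] at h
    simp [h.2.1]
  · rintro ⟨ls, P⟩ h
    simp only [Finset.mem_sigma, mem_partsFamilies] at h
    simp [h.2.1]

/-- Composition of functions of lists, where the letters of a block are merged by `μ`: the sum over
all ways of cutting the list into blocks of `φ`, evaluated at the merged blocks, times the product
of the values of `a` at the blocks. -/
def blockComp {A : Type*} (μ : List A → A) (φ a : List A → ℂ) (l : List A) : ℂ :=
  ∑ ls ∈ parts l, φ (ls.map μ) * (ls.map a).prod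

theorem blockComp_assoc {A : Type*} {μ : List A → A}
    (hμ : ∀ ls : List (List A), [] ∉ ls → μ (ls.map μ) = μ ls.flatten) (φ a b : List A → ℂ)
    (l : List A) : blockComp μ (blockComp μ φ a) b l = blockComp μ φ (blockComp μ a b) l := by
  have h1 : ∀ ls : List (List A), blockComp μ φ a (ls.map μ) * (ls.map b).prod = ∑ P ∈ parts ls,
      φ (P.map fun m => μ (m.map μ)) * (P.map fun m => a (m.map μ) * (m.map b).prod).prod := by
    intro ls
    rw [blockComp, sum_parts_map, Finset.sum_mul]
    refine Finset.sum_congr rfl fun P hP => ?_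
    rw [List.prod_map_mul, ← mul_assoc]
    congr 1
    · simp only [List.map_map]
      rfl
    · rw [← (mem_parts.1 hP).1, List.map_flatten, List.prod_flatten, List.map_map]
      rfl
  have h2 : ∀ ls : List (List A), φ (ls.map μ) * (ls.map (blockComp μ a b)).prod =
      ∑ P ∈ partsFamilies ls,
        φ (P.map fun m => μ (m.map μ)) * (P.map fun m => a (m.map μ) * (m.map b).prod).prod := by
    intro ls
    have : blockComp μ a b = fun l => ∑ ls ∈ parts l, a (ls.map μ) * (ls.map b).prod := rfl
    rw [this, prod_map_sum_parts, Finset.mul_sum]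
    refine Finset.sum_congr rfl fun P hP => ?_
    obtain ⟨h3, h4⟩ := mem_partsFamilies.1 hP
    rw [← h3, List.map_map]
    congr 2
    exact List.map_congr_left fun m hm => (hμ m (h4 m hm)).symm
  rw [blockComp, Finset.sum_congr rfl fun ls _ => h1 ls, sum_parts_parts]
  exact (Finset.sum_congr rfl fun ls _ => h2 ls).symm

theorem parts_nil {A : Type*} : parts ([] : List A) = {[]} := by
  ext ls
  rw [mem_parts, Finset.mem_singleton, List.flatten_eq_nil_iff]
  constructor
  · rintro ⟨h1, h2⟩
    exact List.eq_nil_iff_forall_not_mem.2 fun b hb => h2 (h1 b hb ▸ hb)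
  · rintro rfl
    simp

theorem ne_nil_of_mem_parts_cons {A : Type*} {x : A} {l : List A} {ls : List (List A)}
    (h : ls ∈ parts (x :: l)) : ∃ b bs, ls = (x :: b) :: bs := by
  obtain ⟨h1, h2⟩ := mem_parts.1 h
  rcases ls with _ | ⟨_ | ⟨y, b⟩, bs⟩
  · simp at h1
  · simp at h2
  · simp only [List.flatten_cons, List.cons_append, List.cons.injEq] at h1
    exact ⟨b, bs, by rw [h1.1]⟩

/-- Prefix the first block of a list of blocks by `b`. -/
def prefixHead {A : Type*} (b : List A) : List (List A) → List (List A)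
  | [] => []
  | c :: ls => (b ++ c) :: ls

theorem prefixHead_nil {A : Type*} (ls : List (List A)) : prefixHead [] ls = ls := by
  cases ls <;> rfl

theorem prefixHead_prefixHead {A : Type*} (b c : List A) (ls : List (List A)) :
    prefixHead b (prefixHead c ls) = prefixHead (b ++ c) ls := by
  cases ls
  · rfl
  · simp [prefixHead]

theorem sum_parts_singleton {A M : Type*} [AddCommMonoid M] (x : A) (f : List (List A) → M) :
    ∑ ls ∈ parts [x], f ls = f [[x]] := by
  have : parts [x] = {[[x]]} := by
    ext ls
    rw [Finset.mem_singleton]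
    constructor
    · intro h
      obtain ⟨b, bs, rfl⟩ := ne_nil_of_mem_parts_cons h
      obtain ⟨h1, h2⟩ := mem_parts.1 h
      simp only [List.flatten_cons, List.cons_append, List.cons.injEq, List.append_eq_nil_iff,
        true_and] at h1
      obtain ⟨rfl, h3⟩ := h1
      rcases bs with _ | ⟨c, bs⟩
      · rfl
      · have : c = [] := List.flatten_eq_nil_iff.1 h3 c (by simp)
        simp [this] at h2
    · rintro rfl
      simp [mem_parts]
  rw [this, Finset.sum_singleton]

theorem sum_parts_cons_cons {A M : Type*} [AddCommMonoid M] (x y : A) (l : List A)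
    (f : List (List A) → M) :
    ∑ ls ∈ parts (x :: y :: l), f ls =
      ∑ ls ∈ parts (y :: l), f ([x] :: ls) + ∑ ls ∈ parts (y :: l), f (prefixHead [x] ls) := by
  classical
  have h : parts (x :: y :: l) =
      (parts (y :: l)).image (fun ls => [x] :: ls) ∪ (parts (y :: l)).image (prefixHead [x]) := by
    ext ls
    simp only [Finset.mem_union, Finset.mem_image]
    constructor
    · intro h
      obtain ⟨b, bs, rfl⟩ := ne_nil_of_mem_parts_cons h
      obtain ⟨h1, h2⟩ := mem_parts.1 h
      simp only [List.flatten_cons, List.cons_append, List.cons.injEq, true_and] at h1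
      rcases b with _ | ⟨z, b⟩
      · exact Or.inl ⟨bs, mem_parts.2 ⟨by simpa using h1, fun h => h2 (by simp [h])⟩, rfl⟩
      · exact Or.inr ⟨(z :: b) :: bs, mem_parts.2 ⟨by simpa using h1, fun h => h2 (by simpa using h)⟩,
          rfl⟩
    · rintro (⟨ls, h, rfl⟩ | ⟨ls, h, rfl⟩)
      · obtain ⟨h1, h2⟩ := mem_parts.1 h
        exact mem_parts.2 ⟨by simp [h1], by simpa using h2⟩
      · obtain ⟨b, bs, rfl⟩ := ne_nil_of_mem_parts_cons h
        obtain ⟨h1, h2⟩ := mem_parts.1 h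
        exact mem_parts.2 ⟨by simpa [prefixHead] using h1, by simpa [prefixHead] using h2⟩
  rw [h, Finset.sum_union, Finset.sum_image, Finset.sum_image]
  · intro ls h ls' h' heq
    obtain ⟨b, bs, rfl⟩ := ne_nil_of_mem_parts_cons (Finset.mem_coe.1 h)
    obtain ⟨b', bs', rfl⟩ := ne_nil_of_mem_parts_cons (Finset.mem_coe.1 h')
    simpa [prefixHead] using heq
  · intro ls h ls' h' heq
    simpa using heq
  · rw [Finset.disjoint_left]
    intro P h1 h2
    obtain ⟨ls, _, rfl⟩ := Finset.mem_image.1 h1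
    obtain ⟨ls', h3, h4⟩ := Finset.mem_image.1 h2
    obtain ⟨b, bs, rfl⟩ := ne_nil_of_mem_parts_cons h3
    simp [prefixHead] at h4

theorem length_le_of_mem_parts {A : Type*} {l : List A} {ls : List (List A)} (h : ls ∈ parts l) :
    ls.length ≤ l.length := by
  obtain ⟨rfl, h2⟩ := mem_parts.1 h
  rw [List.length_flatten, ← List.length_map (f := List.length) (as := ls)]
  refine (List.length_le_sum_of_one_le _ fun k hk => ?_)
  obtain ⟨b, hb, rfl⟩ := List.mem_map.1 hk
  exact List.length_pos_iff.2 fun h0 => h2 (h0 ▸ hb)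

theorem eq_map_singleton_of_mem_parts {A : Type*} {l : List A} {ls : List (List A)}
    (h : ls ∈ parts l) (hl : l.length ≤ ls.length) : ls = l.map fun x => [x] := by
  induction l generalizing ls with
  | nil => simpa [parts_nil] using h
  | cons x l ih =>
    obtain ⟨b, bs, rfl⟩ := ne_nil_of_mem_parts_cons h
    obtain ⟨h1, h2⟩ := mem_parts.1 h
    simp only [List.flatten_cons, List.cons_append, List.cons.injEq, true_and] at h1
    have h3 : bs ∈ parts bs.flatten := mem_parts.2 ⟨rfl, fun h => h2 (by simp [h])⟩
    have h4 := length_le_of_mem_parts h3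
    have h5 := congrArg List.length h1
    simp only [List.length_append, List.length_cons] at h5 hl
    have h6 : b = [] := List.length_eq_zero_iff.1 (by omega)
    subst h6
    simp only [List.nil_append] at h1
    rw [h1] at h3
    rw [ih h3 (by omega)]
    rfl

theorem map_singleton_mem_parts {A : Type*} (l : List A) : (l.map fun x => [x]) ∈ parts l := by
  rw [mem_parts]
  constructor
  · induction l with
    | nil => rfl
    | cons x l ih => simpa using ih
  · simp

theorem singleton_mem_parts {A : Type*} {l : List A} (hl : l ≠ []) : [l] ∈ parts l := by
  rw [mem_parts]
  simpa using hl.symm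

theorem blockComp_map {A B : Type*} {μ : List A → A} {ν : List B → B} (g : A → B)
    (φ a : List B → ℂ) (l : List A) (hg : ∀ b ≠ [], g (μ b) = ν (b.map g)) :
    blockComp ν φ a (l.map g) =
      blockComp μ (fun l => φ (l.map g)) (fun l => a (l.map g)) l := by
  rw [blockComp, sum_parts_map, blockComp]
  refine Finset.sum_congr rfl fun ls hls => ?_
  have h : ∀ b ∈ ls, b ≠ [] := fun b hb h0 => (mem_parts.1 hls).2 (h0 ▸ hb)
  simp only [List.map_map]
  congr 2
  exact List.map_congr_left fun b hb => (hg b (h b hb)).symm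

/-- The neutral element for the composition of functions of lists. -/
def unitFun {A : Type*} (l : List A) : ℂ := if l.length = 1 then 1 else 0

theorem unitFun_blockComp {A : Type*} (μ : List A → A) (a : List A → ℂ) {l : List A}
    (hl : l ≠ []) : blockComp μ unitFun a l = a l := by
  rw [blockComp, Finset.sum_eq_single_of_mem _ (singleton_mem_parts hl)]
  · simp [unitFun]
  · intro ls hls h
    have : ls.length ≠ 1 := by
      intro h1
      obtain ⟨b, rfl⟩ := List.length_eq_one_iff.1 h1
      obtain ⟨h2, _⟩ := mem_parts.1 hls
      exact h (by simpa using h2)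
    simp [unitFun, this]

theorem blockComp_congr {A : Type*} {μ : List A → A} {φ φ' a a' : List A → ℂ} {l : List A}
    (h : ∀ ls ∈ parts l, φ (ls.map μ) * (ls.map a).prod = φ' (ls.map μ) * (ls.map a').prod) :
    blockComp μ φ a l = blockComp μ φ' a' l :=
  Finset.sum_congr rfl h

open Classical in
/-- The left inverse for composition of a function of lists which takes the value `1` at the lists
of length `1`, given by the evident recursion. -/
def leftInv {A : Type*} (μ : List A → A) (a : List A → ℂ) (l : List A) : ℂ :=
  unitFun l - ∑ ls ∈ (parts l).attach,
    if _h : ls.1.length < l.length then leftInv μ a (ls.1.map μ) * (ls.1.map a).prod else 0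
termination_by l.length
decreasing_by simpa using _h

/-- The inverse is defined by recursion on the length: all blocks are singletons in the only term of
the composition in which the inverse is evaluated at a list of the full length. -/
theorem leftInv_blockComp {A : Type*} {μ : List A → A} {a : List A → ℂ}
    (ha : ∀ x, a [x] = 1) (hμ : ∀ x, μ [x] = x) (l : List A) :
    blockComp μ (leftInv μ a) a l = unitFun l := by
  classical
  have h := leftInv.eq_1 μ a l
  have h1 := Finset.sum_attach (parts l)
    (fun ls => if ls.length < l.length then leftInv μ a (ls.map μ) * (ls.map a).prod else 0)
  simp only [dite_eq_ite] at h
  rw [h1] at h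
  rw [blockComp, ← Finset.sum_filter_add_sum_filter_not _ (fun ls => ls.length < l.length),
    Finset.sum_filter, eq_sub_iff_add_eq.1 h |>.symm, add_comm]
  congr 1
  rw [Finset.sum_eq_single_of_mem (l.map fun x => [x])]
  · have e1 : ((l.map fun x => [x]).map μ) = l := by
      rw [List.map_map]
      exact (List.map_congr_left fun x _ => hμ x).trans (List.map_id l)
    have e2 : ((l.map fun x => [x]).map a).prod = 1 := by
      rw [List.map_map]
      exact List.prod_eq_one fun y hy => by
        obtain ⟨x, _, rfl⟩ := List.mem_map.1 hy
        exact ha x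
    rw [e1, e2, mul_one]
  · rw [Finset.mem_filter]
    exact ⟨map_singleton_mem_parts l, by simp⟩
  · intro ls hls hne
    rw [Finset.mem_filter, not_lt] at hls
    exact absurd (eq_map_singleton_of_mem_parts hls.1 hls.2) hne

/-! ### Wall-crossing of the lifted function -/

/-- A complex number `z = a.2` together with a real number `α = a.1` approximating its argument. -/
abbrev Letter := ℝ × ℂ

/-- The deviation of the argument of `z` from `α`, for a letter `(α, z)`. -/
def Letter.dev (a : Letter) : ℝ := (a.2 * Complex.exp (-(a.1 * Complex.I))).arg

/-- The logarithm of `z` with imaginary part near `α`, for a letter `(α, z)`. -/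
def Letter.lift (a : Letter) : ℂ :=
  Complex.log (a.2 * Complex.exp (-(a.1 * Complex.I))) + a.1 * Complex.I

/-- The letter `(α + 2π, z)`. -/
def Letter.turn (a : Letter) : Letter := (a.1 + 2 * Real.pi, a.2)

/-- The letter `(α, z)` has `|arg z - α| < π / 4`, expressed by a condition that is stable under
addition of the `z`. -/
def Letter.IsNear (a : Letter) : Prop :=
  |(a.2 * Complex.exp (-(a.1 * Complex.I))).im| < (a.2 * Complex.exp (-(a.1 * Complex.I))).re

namespace Letter

theorem IsNear.ne_zero {a : Letter} (h : a.IsNear) : a.2 ≠ 0 := by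
  rintro h0
  simp [IsNear, h0] at h

theorem exp_lift {a : Letter} (h : a.2 ≠ 0) : Complex.exp a.lift = a.2 := by
  rw [lift, Complex.exp_add, Complex.exp_log (mul_ne_zero h (Complex.exp_ne_zero _)), mul_assoc,
    ← Complex.exp_add]
  simp

theorem im_lift (a : Letter) : a.lift.im = a.dev + a.1 := by
  simp [lift, dev, Complex.log_im]

theorem exp_neg_turn (a : Letter) :
    Complex.exp (-(a.turn.1 * Complex.I)) = Complex.exp (-(a.1 * Complex.I)) := by
  have : -(a.turn.1 * Complex.I) = -(a.1 * Complex.I) - 2 * Real.pi * Complex.I := by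
    simp only [turn]
    push_cast
    ring
  rw [this, Complex.exp_sub, Complex.exp_two_pi_mul_I, div_one]

theorem isNear_turn {a : Letter} : a.turn.IsNear ↔ a.IsNear := by
  rw [IsNear, IsNear, exp_neg_turn]
  rfl

theorem lift_turn (a : Letter) : a.turn.lift = a.lift + 2 * Real.pi * Complex.I := by
  rw [lift, exp_neg_turn, lift]
  simp only [turn]
  push_cast
  ring

theorem abs_arg_lt_of_abs_im_lt_re {v : ℂ} (h : |v.im| < v.re) : |v.arg| < Real.pi / 4 := by
  have hπ := Real.pi_pos
  have hre : 0 < v.re := (abs_nonneg _).trans_lt h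
  have h1 : |v.arg| < Real.pi / 2 := Complex.abs_arg_lt_pi_div_two_iff.2 (Or.inl hre)
  have hv : v ≠ 0 := fun h0 => by simp [h0] at hre
  have hn : 0 < ‖v‖ := norm_pos_iff.2 hv
  by_contra hcon
  rw [not_lt] at hcon
  have h2 : Real.cos |v.arg| ≤ Real.cos (Real.pi / 4) :=
    Real.cos_le_cos_of_nonneg_of_le_pi (by positivity) (by linarith) hcon
  have h3 : Real.sin (Real.pi / 4) ≤ Real.sin |v.arg| :=
    Real.sin_le_sin_of_le_of_le_pi_div_two (by linarith) h1.le hcon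
  rw [Real.cos_pi_div_four] at h2
  rw [Real.sin_pi_div_four] at h3
  have h4 : Real.sin |v.arg| = |Real.sin v.arg| := by
    rcases abs_cases v.arg with ⟨h, h'⟩ | ⟨h, h'⟩
    · rw [h, abs_of_nonneg (Real.sin_nonneg_of_nonneg_of_le_pi h' (by rw [h] at h1; linarith))]
    · rw [h, Real.sin_neg, abs_of_nonpos]
      exact Real.sin_nonpos_of_nonpos_of_neg_pi_le h'.le (by rw [h] at h1; linarith)
  rw [Real.cos_abs, Complex.cos_arg hv] at h2
  rw [h4, Complex.sin_arg, abs_div, abs_of_pos hn] at h3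
  have h5 : |v.im| / ‖v‖ < v.re / ‖v‖ := by gcongr
  linarith

theorem IsNear.abs_dev_lt {a : Letter} (h : a.IsNear) : |a.dev| < Real.pi / 4 :=
  abs_arg_lt_of_abs_im_lt_re h

theorem IsNear.add {α : ℝ} {x y : ℂ} (hx : IsNear (α, x)) (hy : IsNear (α, y)) :
    IsNear (α, x + y) := by
  unfold IsNear at *
  simp only [add_mul, Complex.add_im, Complex.add_re] at *
  exact (abs_add_le _ _).trans_lt (add_lt_add hx hy)

theorem IsNear.abs_im_lift_sub_lt {a : Letter} (h : a.IsNear) :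
    |a.lift.im - a.1| < Real.pi / 4 := by
  rw [im_lift, add_sub_cancel_right]
  exact h.abs_dev_lt

/-- The condition on consecutive letters under which the lifted function is defined. -/
def Adj (a b : Letter) : Prop := 0 ≤ b.1 - a.1 ∧ b.1 - a.1 ≤ 2 * Real.pi

end Letter

/-- The value of the lifted function at the logarithms of a list of letters. -/
def letterFun (l : List Letter) : ℂ := liftFun fun i => (l.get i).lift

theorem letterFun_eq {n : ℕ} {l : List Letter} (h : l.length = n) {u : Fin n → ℂ}
    (hu : ∀ i : Fin n, (l[(i : ℕ)]'(by rw [h]; exact i.isLt)).lift = u i) :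
    letterFun l = liftFun u := by
  subst h
  rw [letterFun]
  congr 1
  funext i
  exact hu i

/-- The jump formula `liftFun_jump` for lists of letters: advancing `y` and all later letters by a full
turn adds the value at the list in which `x` and `y` are merged. -/
theorem letterFun_jump (p r : List Letter) (α : ℝ) (x y : ℂ)
    (hp : ∀ a ∈ p, a.IsNear) (hr : ∀ a ∈ r, a.IsNear) (hx : Letter.IsNear (α, x))
    (hy : Letter.IsNear (α, y)) (hc : (p ++ (α, y) :: r).IsChain Letter.Adj) :
    letterFun (p ++ (α, x) :: ((α, y) :: r).map Letter.turn) =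
      letterFun (p ++ (α, x) :: (α, y) :: r) + letterFun (p ++ (α, x + y) :: r) := by
  have hπ := Real.pi_pos
  set n := p.length + r.length with hn
  set l := p ++ (α, x) :: (α, y) :: r with hl
  set l' := p ++ (α, x + y) :: r with hl'
  set ly := p ++ (α, y) :: r with hly
  have hll : l.length = n + 2 := by simp [hl, hn]; omega
  have hll' : l'.length = n + 1 := by simp [hl', hn]; omega
  have hlly : ly.length = n + 1 := by simp [hly, hn]; omega
  have hnl : ∀ a ∈ l, a.IsNear := by
    simp only [hl, List.mem_append, List.mem_cons]
    rintro a (h | rfl | rfl | h)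
    · exact hp a h
    · exact hx
    · exact hy
    · exact hr a h
  have hnl' : ∀ a ∈ l', a.IsNear := by
    simp only [hl', List.mem_append, List.mem_cons]
    rintro a (h | rfl | h)
    · exact hp a h
    · exact hx.add hy
    · exact hr a h
  let k : Fin (n + 1) := ⟨p.length, by omega⟩
  let ang : Fin (n + 1) → ℝ := fun i => (ly[(i : ℕ)]'(by rw [hlly]; exact i.isLt)).1
  obtain ⟨φ, h1, h2⟩ := exists_near_angles (by omega) (α := ang) (by
    intro i j hij
    have h3 := List.isChain_iff_getElem.1 hc i (by rw [hlly]; have := j.isLt; omega)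
    simp only [ang, hij]
    exact h3)
  have hang' : ∀ j : Fin (n + 1), (l'[(j : ℕ)]'(by rw [hll']; exact j.isLt)).1 = ang j := by
    intro j
    simp only [ang, hl', hly, List.getElem_append, List.getElem_cons]
    split_ifs <;> rfl
  have hsucc : ∀ j : Fin (n + 1), l[(k.castSucc.succAbove j : ℕ)]'(by
      rw [hll]; exact (k.castSucc.succAbove j).isLt) = ly[(j : ℕ)]'(by rw [hlly]; exact j.isLt) := by
    intro j
    rcases lt_or_ge (j : ℕ) p.length with h | h
    · have : (k.castSucc.succAbove j : ℕ) = j := by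
        rw [Fin.succAbove_of_castSucc_lt _ _ (by simpa [Fin.lt_def, k] using h)]
        rfl
      simp only [this, hl, hly, List.getElem_append_left h]
    · have : (k.castSucc.succAbove j : ℕ) = j + 1 := by
        rw [Fin.succAbove_of_le_castSucc _ _ (by simpa [Fin.le_def, k] using h)]
        rfl
      simp only [this, hl, hly]
      rw [List.getElem_append_right (by omega), List.getElem_append_right h]
      have h3 : (j : ℕ) + 1 - p.length = ((j : ℕ) - p.length) + 1 := by omega
      simp only [h3, List.getElem_cons_succ]
  have hnear : ∀ (a : Letter) (j : Fin (n + 1)), a.IsNear → a.1 = ang j →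
      |φ j - a.lift.im| < Real.pi / 2 := by
    intro a j ha haj
    have h3 := abs_lt.1 ha.abs_im_lift_sub_lt
    have h4 := abs_le.1 (h1 j)
    rw [haj] at h3
    rw [abs_lt]
    constructor <;> linarith [h3.1, h3.2, h4.1, h4.2]
  have hkl : l[p.length]'(by omega) = (α, x) := by simp [hl]
  have hangk : ang k = α := by simp [ang, k, hly]
  have hdiff : ∀ i j : Fin (n + 1), (j : ℕ) = i + 1 → 0 < φ j - φ i ∧ φ j - φ i < 2 * Real.pi := by
    intro i j hij
    have h3 := h2 i j hij
    have h4 : 0 < Real.pi / (8 * ((n + 1 : ℕ) : ℝ)) := by positivity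
    constructor <;> linarith [h3.1, h3.2]
  have hJ := liftFun_jump k
    (fun i : Fin (n + 2) => (l[(i : ℕ)]'(by rw [hll]; exact i.isLt)).lift)
    (fun i : Fin (n + 1) => (l'[(i : ℕ)]'(by rw [hll']; exact i.isLt)).lift) φ hdiff
    (fun j => hnear _ j (hnl _ (List.getElem_mem _)) (by rw [hsucc]))
    (hnear _ k (hnl _ (List.getElem_mem _)) (by
      rw [hangk]
      simp only [k, Fin.castSucc_mk, hkl]))
    (fun j => hnear _ j (hnl' _ (List.getElem_mem _)) (hang' j))
    (fun j => by
      rw [Letter.exp_lift (hnl' _ (List.getElem_mem _)).ne_zero,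
        Letter.exp_lift (hnl _ (List.getElem_mem _)).ne_zero, hsucc]
      split_ifs with hj
      · subst hj
        rw [Letter.exp_lift (hnl _ (List.getElem_mem _)).ne_zero]
        simp only [k, Fin.castSucc_mk, hkl]
        simp [hl', hly, add_comm]
      · rw [add_zero]
        have hj' : (j : ℕ) ≠ p.length := fun h => hj (Fin.ext h)
        simp only [hl', hly, List.getElem_append, List.getElem_cons]
        split_ifs with h3 h4
        · rfl
        · omega
        · rfl)
  rw [letterFun_eq hll (fun i => rfl), letterFun_eq hll' (fun i => rfl), ← hJ]
  refine letterFun_eq (by simp [hn]; omega) fun i => ?_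
  simp only [List.map_cons]
  have hi := i.isLt
  have hik : k.castSucc < i ↔ p.length < (i : ℕ) := by simp [Fin.lt_def, k]
  simp only [hik]
  split_ifs with h3
  · rw [← Letter.lift_turn]
    congr 1
    rw [List.getElem_append_right (by omega)]
    simp only [hl]
    rw [List.getElem_append_right (by omega)]
    obtain ⟨m, hm⟩ : ∃ m, (i : ℕ) - p.length = m + 1 := ⟨_, (Nat.sub_add_cancel (by omega)).symm⟩
    simp only [hm, List.getElem_cons_succ, ← List.map_cons, List.getElem_map]
  · congr 1
    simp only [hl]
    rcases lt_or_eq_of_le (not_lt.1 h3) with h4 | h4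
    · rw [List.getElem_append_left h4, List.getElem_append_left h4]
    · simp [h4]

/-- Two letters near the same ray, in clockwise order. -/
def Letter.Desc (a b : Letter) : Prop := a.1 = b.1 ∧ b.dev < a.dev

instance : IsTrans Letter Letter.Desc :=
  ⟨fun _ _ _ h1 h2 => ⟨h1.1.trans h2.1, h2.2.trans h1.2⟩⟩

/-- The letter `(α, z₁ + ⋯ + z_k)`, for a list of letters `(α, z_i)`. -/
def merge (l : List Letter) : Letter := ((l.map Prod.fst).headD 0, (l.map Prod.snd).sum)

theorem merge_singleton (x : Letter) : merge [x] = x := by simp [merge]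

theorem merge_map_merge (ls : List (List Letter)) (h : [] ∉ ls) :
    merge (ls.map merge) = merge ls.flatten := by
  unfold merge
  ext
  · rcases ls with _ | ⟨_ | ⟨x, b⟩, ls⟩
    · rfl
    · simp at h
    · simp
  · simp only [List.map_map, List.map_flatten, List.sum_flatten]
    rfl

theorem merge_fst {l : List Letter} {α : ℝ} (hl : l ≠ []) (h : ∀ a ∈ l, a.1 = α) :
    (merge l).1 = α := by
  rcases l with _ | ⟨x, l⟩
  · exact absurd rfl hl
  · simpa [merge] using h x (by simp)

theorem merge_snd (l : List Letter) : (merge l).2 = (l.map Prod.snd).sum := rfl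

theorem isNear_merge {l : List Letter} {α : ℝ} (hl : l ≠ []) (h : ∀ a ∈ l, a.1 = α)
    (hn : ∀ a ∈ l, a.IsNear) : (merge l).IsNear := by
  have : merge l = (α, (l.map Prod.snd).sum) := Prod.ext (merge_fst hl h) rfl
  rw [this]
  clear this
  induction l with
  | nil => exact absurd rfl hl
  | cons x l ih =>
    have hx : Letter.IsNear (α, x.2) := by
      rw [← h x (by simp)]
      exact hn x (by simp)
    rcases l with _ | ⟨y, l⟩
    · simpa using hx
    · rw [List.map_cons, List.sum_cons]
      exact hx.add (ih (by simp) (fun a ha => h a (List.mem_cons_of_mem _ ha))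
        fun a ha => hn a (List.mem_cons_of_mem _ ha))

theorem isChain_adj_congr {l l' : List Letter} (h : l.map Prod.fst = l'.map Prod.fst) :
    l.IsChain Letter.Adj ↔ l'.IsChain Letter.Adj := by
  have key : ∀ l : List Letter, l.IsChain Letter.Adj ↔
      (l.map Prod.fst).IsChain fun a b : ℝ => 0 ≤ b - a ∧ b - a ≤ 2 * Real.pi := fun l => by
    rw [List.isChain_map]
    rfl
  rw [key, key, h]

theorem isChain_adj_map_turn {l : List Letter} :
    (l.map Letter.turn).IsChain Letter.Adj ↔ l.IsChain Letter.Adj := by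
  rw [List.isChain_map]
  unfold Letter.Adj Letter.turn
  simp

open Classical in
/-- For letters `x, l` in the closure of a generic position: add `2π` to the angles of all letters
after each pair of consecutive letters near the same ray which are in clockwise order.  The list
begins after `x`. -/
def unwindTail : Letter → List Letter → List Letter
  | _, [] => []
  | x, y :: l => if x.Desc y then (y :: unwindTail y l).map Letter.turn else y :: unwindTail y l

theorem isNear_unwindTail {x : Letter} {l : List Letter} (h : ∀ a ∈ l, a.IsNear) :
    ∀ a ∈ unwindTail x l, a.IsNear := by
  induction l generalizing x with
  | nil => simp [unwindTail]
  | cons y l ih =>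
    have h1 : ∀ a ∈ y :: unwindTail y l, a.IsNear := by
      intro a ha
      rcases List.mem_cons.1 ha with rfl | ha
      · exact h _ (by simp)
      · exact ih (fun a ha => h a (by simp [ha])) a ha
    rw [unwindTail]
    split_ifs
    · intro a ha
      obtain ⟨b, hb, rfl⟩ := List.mem_map.1 ha
      exact Letter.isNear_turn.2 (h1 b hb)
    · exact h1

theorem isChain_adj_unwindTail {x : Letter} {l : List Letter} (h : (x :: l).IsChain Letter.Adj) :
    (x :: unwindTail x l).IsChain Letter.Adj := by
  induction l generalizing x with
  | nil => exact h
  | cons y l ih =>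
    rw [List.isChain_cons_cons] at h
    rw [unwindTail]
    split_ifs with hd
    · rw [List.map_cons, List.isChain_cons_cons, ← List.map_cons, isChain_adj_map_turn]
      refine ⟨?_, ih h.2⟩
      have := Real.pi_pos
      simp only [Letter.Adj, Letter.turn, hd.1]
      constructor <;> linarith
    · exact List.isChain_cons_cons.2 ⟨h.1, ih h.2⟩

open Classical in
/-- The indicator function of lists of letters near the same ray, in clockwise order. -/
def descFun (b : List Letter) : ℂ := if b.IsChain Letter.Desc then 1 else 0

/-- The form of `letterFun_unwindTail` that is proved by induction: letters `p` stand in front, and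
the letters `b`, which are in clockwise order, have already been merged with `x`. -/
theorem letterFun_prefix_unwindTail (l p b : List Letter) (x : Letter)
    (hb : (b ++ [x]).IsChain Letter.Desc) (hpn : ∀ a ∈ p, a.IsNear) (hbn : ∀ a ∈ b ++ [x], a.IsNear)
    (hln : ∀ a ∈ l, a.IsNear) (hp : (p ++ [x]).IsChain Letter.Adj)
    (hl : (x :: l).IsChain Letter.Adj) :
    letterFun (p ++ merge (b ++ [x]) :: unwindTail x l) =
      ∑ ls ∈ parts (x :: l), letterFun (p ++ (prefixHead b ls).map merge) *
        ((prefixHead b ls).map descFun).prod := by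
  have hfst : ∀ a ∈ b ++ [x], a.1 = x.1 := by
    have := List.pairwise_append.1 hb.pairwise
    intro a ha
    rcases List.mem_append.1 ha with ha | ha
    · exact (this.2.2 a ha x (by simp)).1
    · rw [List.mem_singleton.1 ha]
  have hmfst : (merge (b ++ [x])).1 = x.1 := merge_fst (by simp) hfst
  have hmn : (merge (b ++ [x])).IsNear := isNear_merge (by simp) hfst hbn
  induction l generalizing p b x with
  | nil =>
    rw [sum_parts_singleton]
    simp [unwindTail, prefixHead, descFun, hb]
  | cons y l ih =>
    set m := merge (b ++ [x]) with hm
    have hyn : y.IsNear := hln y (by simp)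
    have hln' : ∀ a ∈ l, a.IsNear := fun a ha => hln a (by simp [ha])
    have hxy := (List.isChain_cons_cons.1 hl).1
    have hyl := (List.isChain_cons_cons.1 hl).2
    rw [sum_parts_cons_cons]
    -- the partitions whose first block ends with `x`
    have h1 : ∑ ls ∈ parts (y :: l), letterFun (p ++ (prefixHead b ([x] :: ls)).map merge) *
        ((prefixHead b ([x] :: ls)).map descFun).prod =
        letterFun (p ++ m :: y :: unwindTail y l) := by
      have h2 := ih (p ++ [m]) [] y (by simp)
        (by
          intro a ha
          rcases List.mem_append.1 ha with ha | ha
          · exact hpn a ha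
          · rw [List.mem_singleton.1 ha]; exact hmn)
        (by simpa using hyn) hln'
        (by
          rw [isChain_adj_congr (l' := p ++ x :: [y]) (by simp [hmfst]), List.isChain_split]
          exact ⟨hp, by simpa using hxy⟩)
        hyl (by simp) (by simp [merge]) (by simpa [merge_singleton] using hyn)
      rw [List.nil_append, merge_singleton] at h2
      simp only [prefixHead_nil, List.append_assoc, List.singleton_append] at h2
      rw [h2]
      refine Finset.sum_congr rfl fun ls _ => ?_
      simp [prefixHead, descFun, hb, hm]
    rw [h1, unwindTail]
    split_ifs with hd
    · have hadj : (p ++ [y]).IsChain Letter.Adj := by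
        rw [isChain_adj_congr (l' := p ++ [x]) (by simp [hd.1])]
        exact hp
      have hbxy : (b ++ [x] ++ [y]).IsChain Letter.Desc := by
        rw [List.append_assoc, List.singleton_append, List.isChain_split]
        exact ⟨hb, by simpa using hd⟩
      have hfst' : ∀ a ∈ b ++ [x] ++ [y], a.1 = y.1 := by
        intro a ha
        rcases List.mem_append.1 ha with ha | ha
        · rw [hfst a ha, hd.1]
        · rw [List.mem_singleton.1 ha]
      have hn' : ∀ a ∈ b ++ [x] ++ [y], a.IsNear := by
        intro a ha
        rcases List.mem_append.1 ha with ha | ha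
        · exact hbn a ha
        · rw [List.mem_singleton.1 ha]; exact hyn
      have h2 := ih p (b ++ [x]) y hbxy hpn hn' hln' hadj hyl hfst'
        (merge_fst (by simp) hfst') (isNear_merge (by simp) hfst' hn')
      have hmy : merge (b ++ [x] ++ [y]) = (x.1, m.2 + y.2) := by
        refine Prod.ext ((merge_fst (by simp) hfst').trans hd.1.symm) ?_
        simp [merge, hm, add_assoc]
      have hm' : m = (x.1, m.2) := Prod.ext hmfst rfl
      have hy' : y = (x.1, y.2) := Prod.ext hd.1.symm rfl
      have hJ := letterFun_jump p (unwindTail y l) x.1 m.2 y.2 hpn (isNear_unwindTail hln')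
        (hm' ▸ hmn) (hy' ▸ hyn)
        (by
          rw [← hy', List.isChain_split]
          exact ⟨hadj, isChain_adj_unwindTail hyl⟩)
      rw [← hm', ← hy', ← hmy, h2] at hJ
      rw [hJ]
      simp only [prefixHead_prefixHead]
    · rw [left_eq_add]
      refine Finset.sum_eq_zero fun ls hls => ?_
      obtain ⟨c, cs, rfl⟩ := ne_nil_of_mem_parts_cons hls
      have : ¬ (b ++ x :: y :: c).IsChain Letter.Desc := by
        intro h
        rw [List.isChain_split, List.isChain_cons_cons] at h
        exact hd h.2.1
      simp [prefixHead, descFun, this]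

/-- The wall-crossing formula of the lifted function: the unwound logarithms of letters are
replaced by logarithms near given angles, at the cost of merging letters in clockwise order. -/
theorem letterFun_unwindTail (x : Letter) (l : List Letter) (hn : ∀ a ∈ x :: l, a.IsNear)
    (hl : (x :: l).IsChain Letter.Adj) :
    letterFun (x :: unwindTail x l) = blockComp merge letterFun descFun (x :: l) := by
  have := letterFun_prefix_unwindTail l [] [] x (by simp) (by simp) (by simpa using hn x (by simp))
    (fun a ha => hn a (by simp [ha])) (by simp) hl
  rw [blockComp]
  simpa only [List.nil_append, merge_singleton, prefixHead_nil] using this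

/-! ### The extended family -/

/-- `u` is a tuple of logarithms of `z` with consecutive differences of arguments in `[0, 2π)`. -/
def IsLift {n : ℕ} (u z : Fin n → ℂ) : Prop :=
  (∀ i, Complex.exp (u i) = z i) ∧ ∀ i j : Fin n, (j : ℕ) = i + 1 →
    0 ≤ (u j).im - (u i).im ∧ (u j).im - (u i).im < 2 * Real.pi

theorem exists_isLift {n : ℕ} {z : Fin n → ℂ} (hz : ∀ i, z i ≠ 0) :
    ∃ u, IsLift u z ∧ ∀ i : Fin n, (i : ℕ) = 0 → (u i).im = (z i).arg := by
  have hπ := Real.two_pi_pos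
  let a : ℕ → ℝ := fun k => Nat.rec (seqExt z 0).arg
    (fun i x => x + toIcoMod hπ 0 ((seqExt z (i + 1)).arg - x)) k
  have ha : ∀ k, ∃ m : ℤ, a k = (seqExt z k).arg + m * (2 * Real.pi) := by
    intro k
    rcases k with _ | k
    · exact ⟨0, by simp [a]⟩
    · refine ⟨-toIcoDiv hπ 0 ((seqExt z (k + 1)).arg - a k), ?_⟩
      have h1 : a (k + 1) = a k + toIcoMod hπ 0 ((seqExt z (k + 1)).arg - a k) := rfl
      rw [h1, toIcoMod, zsmul_eq_mul]
      push_cast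
      ring
  have hstep : ∀ k, 0 ≤ a (k + 1) - a k ∧ a (k + 1) - a k < 2 * Real.pi := by
    intro k
    have h1 : a (k + 1) - a k = toIcoMod hπ 0 ((seqExt z (k + 1)).arg - a k) :=
      add_sub_cancel_left _ _
    rw [h1]
    have := toIcoMod_mem_Ico hπ 0 ((seqExt z (k + 1)).arg - a k)
    simpa using this
  let u : Fin n → ℂ := fun i => Complex.ofReal (Real.log ‖z i‖) + Complex.ofReal (a i) * Complex.I
  refine ⟨u, ⟨fun i => ?_, fun i j hij => ?_⟩, fun i hi => ?_⟩
  · obtain ⟨m, hm⟩ := ha i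
    rw [seqExt_of_lt _ i.isLt] at hm
    have h1 : Complex.ofReal (a i) * Complex.I =
        Complex.ofReal (z i).arg * Complex.I + m * (2 * Real.pi * Complex.I) := by
      rw [hm]
      push_cast
      ring
    simp only [u]
    rw [Complex.exp_add, h1, Complex.exp_add, Complex.exp_int_mul_two_pi_mul_I, mul_one,
      ← Complex.ofReal_exp, Real.exp_log (norm_pos_iff.2 (hz i)), Complex.norm_mul_exp_arg_mul_I]
  · have := hstep i
    rw [← hij] at this
    simpa [u] using this
  · have : a i = (z i).arg := by
      rw [hi, ← seqExt_of_lt z i.isLt, hi]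
      rfl
    simpa [u] using this

theorem IsLift.exists_eq_add {n : ℕ} (hn : 1 ≤ n) {u v z : Fin n → ℂ} (hu : IsLift u z)
    (hv : IsLift v z) : ∃ m : ℤ, ∀ i, u i = v i + m * (2 * Real.pi * Complex.I) := by
  have hπ := Real.pi_pos
  have h1 : ∀ i, ∃ m : ℤ, u i = v i + m * (2 * Real.pi * Complex.I) := fun i =>
    Complex.exp_eq_exp_iff_exists_int.1 ((hu.1 i).trans (hv.1 i).symm)
  choose m hm using h1
  have him : ∀ i, (u i).im = (v i).im + m i * (2 * Real.pi) := by
    intro i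
    rw [hm i]
    simp
  have h2 : ∀ (k : ℕ) (hk : k < n), m ⟨k, hk⟩ = m ⟨0, hn⟩ := by
    intro k
    induction k with
    | zero => intro _; rfl
    | succ k ih =>
      intro hk
      rw [← ih (by omega)]
      have h3 := hu.2 ⟨k, by omega⟩ ⟨k + 1, hk⟩ rfl
      have h4 := hv.2 ⟨k, by omega⟩ ⟨k + 1, hk⟩ rfl
      rw [him, him] at h3
      have h5 : ((m ⟨k + 1, hk⟩ - m ⟨k, by omega⟩ : ℤ) : ℝ) < 1 := by
        push_cast
        by_contra hcon
        nlinarith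
      have h6 : (-1 : ℝ) < ((m ⟨k + 1, hk⟩ - m ⟨k, by omega⟩ : ℤ) : ℝ) := by
        push_cast
        by_contra hcon
        nlinarith
      have h7 : m ⟨k + 1, hk⟩ - m ⟨k, by omega⟩ < 1 := by exact_mod_cast h5
      have h8 : -1 < m ⟨k + 1, hk⟩ - m ⟨k, by omega⟩ := by exact_mod_cast h6
      omega
  exact ⟨m ⟨0, hn⟩, fun i => by rw [hm i, h2 i i.isLt]⟩

theorem IsLift.liftFun_eq {n : ℕ} (hn : 1 ≤ n) {u v z : Fin n → ℂ} (hu : IsLift u z)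
    (hv : IsLift v z) : liftFun u = liftFun v := by
  obtain ⟨m, hm⟩ := hu.exists_eq_add hn hv
  rw [← liftFun_add_const hn v (m * (2 * Real.pi * Complex.I))]
  exact congrArg _ (funext hm)

open Classical in
/-- The value at `z` of the lifted function at logarithms with consecutive differences of arguments
in `[0, 2π)`. -/
def principalFun (n : ℕ) (z : Fin n → ℂ) : ℂ := if h : ∃ u, IsLift u z then liftFun h.choose else 0

theorem IsLift.principalFun_eq {n : ℕ} (hn : 1 ≤ n) {u z : Fin n → ℂ} (hu : IsLift u z) :
    principalFun n z = liftFun u := by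
  have h : ∃ u, IsLift u z := ⟨u, hu⟩
  rw [principalFun, dif_pos h]
  exact h.choose_spec.liftFun_eq hn hu

open Classical in
/-- The extended family: an average of the principal values over the ways of merging variables on
common rays, with the weights `∏ 1 / |block|!`. -/
def extFun (n : ℕ) (z : Fin n → ℂ) : ℂ :=
  ∑ c : Composition n, if BlocksOnRays c z then
    principalFun c.length (blockSum c z) * ∏ k, ((c.blocksFun k).factorial : ℂ)⁻¹ else 0

/-- A family of functions of tuples as a function of lists. -/
def onList {A B : Type*} (Φ : (n : ℕ) → (Fin n → A) → B) (l : List A) : B := Φ l.length l.get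

theorem onList_ofFn {A B : Type*} (Φ : (n : ℕ) → (Fin n → A) → B) {n : ℕ} (x : Fin n → A) :
    onList Φ (List.ofFn x) = Φ n x := by
  have h : (⟨(List.ofFn x).length, (List.ofFn x).get⟩ : Σ n, Fin n → A) = ⟨n, x⟩ :=
    List.equivSigmaTuple.apply_symm_apply ⟨n, x⟩
  exact congrArg (fun p : Σ n, Fin n → A => Φ p.1 p.2) h

/-- All members of the list are on one ray. -/
def OnRay (b : List ℂ) : Prop :=
  ∃ θ ∈ Set.Ico (0 : ℝ) (2 * Real.pi), ∀ z ∈ b, ∃ ρ : ℝ, 0 < ρ ∧ z = ρ * Complex.exp (θ * Complex.I)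

open Classical in
/-- The weight `1 / |b|!` of a block on a ray. -/
def rayFun (b : List ℂ) : ℂ := if OnRay b then (b.length.factorial : ℂ)⁻¹ else 0

theorem blocksOnRays_iff {n : ℕ} (c : Composition n) (z : Fin n → ℂ) :
    BlocksOnRays c z ↔ ∀ k, OnRay (List.ofFn fun j => z (c.embedding k j)) := by
  unfold BlocksOnRays OnRay
  simp only [List.forall_mem_ofFn_iff]

/-- A sum over compositions whose blocks satisfy a condition, as a composition of functions of
lists. -/
theorem sum_composition_eq_blockComp {A : Type*} {μ : List A → A} {n : ℕ} (x : Fin n → A)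
    (Φ : List A → ℂ) (P : List A → Prop) (a : List A → ℂ) [DecidablePred P]
    (S : Composition n → Prop) [DecidablePred S]
    (hS : ∀ c, S c ↔ ∀ k, P (List.ofFn fun j => x (c.embedding k j))) :
    (∑ c : Composition n, if S c then Φ (List.ofFn fun k => μ (List.ofFn fun j => x (c.embedding k j)))
      * ∏ k, a (List.ofFn fun j => x (c.embedding k j)) else 0) =
    blockComp μ Φ (fun b => if P b then a b else 0) (List.ofFn x) := by
  rw [blockComp, sum_parts_ofFn]
  refine Finset.sum_congr rfl fun c _ => ?_
  rw [List.map_ofFn, List.map_ofFn, List.prod_ofFn]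
  simp only [Function.comp_def]
  split_ifs with h
  · congr 1
    exact Finset.prod_congr rfl fun k _ => (if_pos ((hS c).1 h k)).symm
  · obtain ⟨k, hk⟩ := not_forall.1 fun h' => h ((hS c).2 h')
    rw [Finset.prod_eq_zero (Finset.mem_univ k) (if_neg hk), mul_zero]

theorem extFun_eq_blockComp {n : ℕ} (z : Fin n → ℂ) :
    extFun n z = blockComp List.sum (onList principalFun) rayFun (List.ofFn z) := by
  classical
  have h := sum_composition_eq_blockComp (μ := List.sum) z (onList principalFun) OnRay
    (fun b => (b.length.factorial : ℂ)⁻¹) (fun c => BlocksOnRays c z)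
    (fun c => blocksOnRays_iff c z)
  rw [show rayFun = fun b => if OnRay b then (b.length.factorial : ℂ)⁻¹ else 0 from rfl]
  refine Eq.trans ?_ h
  rw [extFun]
  refine Finset.sum_congr rfl fun c _ => ?_
  simp only [onList_ofFn, List.sum_ofFn, List.length_ofFn]
  rfl

/-! ### The extended family near a point -/

/-- The letter `(α, z)` has `|arg z - α| < δ`. -/
def Letter.IsClose (δ : ℝ) (a : Letter) : Prop := a.IsNear ∧ |a.dev| < δ

/-- The condition on consecutive letters, `δ`-close to their rays, under which the comparison of the
arguments in a chain of two letters is decided by the rays unless these agree. -/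
def Letter.Apart (δ : ℝ) (a b : Letter) : Prop :=
  b.1 = a.1 ∨ (2 * δ ≤ b.1 - a.1 ∧ b.1 - a.1 ≤ 2 * Real.pi - 2 * δ)

/-- Two letters of the same angle and argument. -/
def Letter.SameDir (a b : Letter) : Prop := a.1 = b.1 ∧ a.dev = b.dev

instance : IsTrans Letter Letter.SameDir :=
  ⟨fun _ _ _ h1 h2 => ⟨h1.1.trans h2.1, h1.2.trans h2.2⟩⟩

theorem Letter.Apart.adj {δ : ℝ} (hδ : 0 < δ) {a b : Letter} (h : Letter.Apart δ a b) :
    Letter.Adj a b := by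
  have := Real.pi_pos
  rcases h with h | h
  · rw [Letter.Adj, h, sub_self]
    constructor <;> linarith
  · exact ⟨by linarith [h.1], by linarith [h.2]⟩

open Classical in
/-- The weight `1 / |b|!` of a block of letters of the same angle and argument. -/
def sameDirFun (b : List Letter) : ℂ :=
  if b.Pairwise Letter.SameDir then (b.length.factorial : ℂ)⁻¹ else 0

theorem Letter.eq_norm_mul_exp (a : Letter) :
    a.2 = ‖a.2‖ * Complex.exp (((a.dev + a.1 : ℝ) : ℂ) * Complex.I) := by
  have h1 := Complex.norm_mul_exp_arg_mul_I (a.2 * Complex.exp (-(a.1 * Complex.I)))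
  have h2 : ‖Complex.exp (-(a.1 * Complex.I))‖ = 1 := by
    rw [show -((a.1 : ℂ) * Complex.I) = ((-a.1 : ℝ) : ℂ) * Complex.I by push_cast; ring,
      Complex.norm_exp_ofReal_mul_I]
  rw [norm_mul, h2, mul_one] at h1
  have h3 : (((a.dev + a.1 : ℝ) : ℂ) * Complex.I) = a.dev * Complex.I + a.1 * Complex.I := by
    push_cast
    ring
  rw [h3, Complex.exp_add, ← mul_assoc]
  change _ = _ * Complex.exp ((a.2 * Complex.exp (-(a.1 * Complex.I))).arg * Complex.I) * _
  rw [h1, mul_assoc, ← Complex.exp_add]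
  simp

/-- The argument, up to multiples of `2π`, of a letter on the ray of argument `θ`. -/
theorem Letter.exists_dev_add_eq {a : Letter} {θ ρ : ℝ} (hρ : 0 < ρ)
    (h : a.2 = ρ * Complex.exp (θ * Complex.I)) :
    ∃ m : ℤ, a.dev + a.1 = θ + m * (2 * Real.pi) := by
  have h1 := a.eq_norm_mul_exp
  have h2 : ‖a.2‖ = ρ := by
    rw [h, norm_mul, Complex.norm_exp_ofReal_mul_I, mul_one, Complex.norm_real,
      Real.norm_of_nonneg hρ.le]
  rw [h2, h] at h1
  have h3 := mul_left_cancel₀ (by exact_mod_cast hρ.ne') h1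
  obtain ⟨m, hm⟩ := Complex.exp_eq_exp_iff_exists_int.1 h3.symm
  refine ⟨m, ?_⟩
  have := congrArg Complex.im hm
  simpa using this

theorem Letter.IsClose.sameDir {δ : ℝ} (hδ' : δ ≤ Real.pi) {a b : Letter}
    (ha : a.IsClose δ) (hb : b.IsClose δ) (hab : Letter.Apart δ a b) {θ ρ ρ' : ℝ} (hρ : 0 < ρ)
    (hρ' : 0 < ρ') (h : a.2 = ρ * Complex.exp (θ * Complex.I))
    (h' : b.2 = ρ' * Complex.exp (θ * Complex.I)) : a.SameDir b := by
  have hπ := Real.pi_pos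
  obtain ⟨m, hm⟩ := Letter.exists_dev_add_eq hρ h
  obtain ⟨m', hm'⟩ := Letter.exists_dev_add_eq hρ' h'
  have h1 := abs_lt.1 ha.2
  have h2 := abs_lt.1 hb.2
  rcases hab with heq | hab
  · have h3 : ((m' - m : ℤ) : ℝ) < 1 := by
      push_cast
      by_contra hcon
      nlinarith
    have h4 : (-1 : ℝ) < ((m' - m : ℤ) : ℝ) := by
      push_cast
      by_contra hcon
      nlinarith
    have h5 : m' - m < 1 := by exact_mod_cast h3
    have h6 : -1 < m' - m := by exact_mod_cast h4
    have h7 : m' = m := by omega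
    subst h7
    exact ⟨heq.symm, by linarith⟩
  · have h3 : ((m' - m : ℤ) : ℝ) < 1 := by
      push_cast
      by_contra hcon
      nlinarith
    have h4 : (0 : ℝ) < ((m' - m : ℤ) : ℝ) := by
      push_cast
      by_contra hcon
      nlinarith
    have h5 : m' - m < 1 := by exact_mod_cast h3
    have h6 : 0 < m' - m := by exact_mod_cast h4
    omega

/-- Near a base point, consecutive letters lie on one ray exactly if they have the same angle and
the same deviation from it; letters with different angles are too far apart. -/
theorem onRay_map_snd_iff {δ : ℝ} (hδ' : δ ≤ Real.pi) {b : List Letter}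
    (hb : ∀ a ∈ b, a.IsClose δ) (hc : b.IsChain (Letter.Apart δ)) :
    OnRay (b.map Prod.snd) ↔ b.Pairwise Letter.SameDir := by
  have hπ := Real.pi_pos
  constructor
  · rintro ⟨θ, _, hθ⟩
    refine List.IsChain.pairwise ?_
    rw [List.isChain_iff_getElem] at hc ⊢
    intro i hi
    obtain ⟨ρ, hρ, h1⟩ := hθ (b[i]).2 (List.mem_map.2 ⟨_, List.getElem_mem _, rfl⟩)
    obtain ⟨ρ', hρ', h2⟩ := hθ (b[i + 1]).2 (List.mem_map.2 ⟨_, List.getElem_mem _, rfl⟩)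
    exact (hb _ (List.getElem_mem _)).sameDir hδ' (hb _ (List.getElem_mem _)) (hc i hi) hρ hρ' h1 h2
  · intro h
    rcases b with _ | ⟨x, b⟩
    · exact ⟨0, by simp [hπ], by simp⟩
    · refine ⟨toIcoMod Real.two_pi_pos 0 (x.dev + x.1), ?_, ?_⟩
      · simpa using toIcoMod_mem_Ico Real.two_pi_pos 0 (x.dev + x.1)
      · intro z hz
        obtain ⟨a, ha, rfl⟩ := List.mem_map.1 hz
        refine ⟨‖a.2‖, norm_pos_iff.2 (hb a ha).1.ne_zero, ?_⟩
        have h1 : Letter.dev a + a.1 = x.dev + x.1 := by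
          rcases List.mem_cons.1 ha with rfl | ha
          · rfl
          · have := List.rel_of_pairwise_cons h ha
            rw [this.1, this.2]
        have h2 : ((toIcoMod Real.two_pi_pos 0 (x.dev + x.1) : ℝ) : ℂ) * Complex.I =
            ((x.dev + x.1 : ℝ) : ℂ) * Complex.I -
              (toIcoDiv Real.two_pi_pos 0 (x.dev + x.1) : ℤ) * (2 * Real.pi * Complex.I) := by
          rw [toIcoMod, zsmul_eq_mul]
          push_cast
          ring
        rw [h2, Complex.exp_sub, Complex.exp_int_mul_two_pi_mul_I, div_one, ← h1]
        exact Letter.eq_norm_mul_exp a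

theorem isChain_map_merge {R : ℝ → ℝ → Prop} {ls : List (List Letter)} (h0 : [] ∉ ls)
    (hls : ∀ b ∈ ls, ∀ a ∈ b, a.1 = (merge b).1)
    (h : ls.flatten.IsChain fun a b => R a.1 b.1) :
    (ls.map merge).IsChain fun a b => R a.1 b.1 := by
  rw [List.isChain_map]
  obtain ⟨_, h2⟩ := (List.isChain_flatten h0).1 h
  rw [List.isChain_iff_getElem] at h2 ⊢
  intro i hi
  have h3 := h2 i hi
  have hne : ∀ j (hj : j < ls.length), ls[j] ≠ [] := fun j hj h => h0 (h ▸ List.getElem_mem hj)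
  have h4 := h3 (ls[i].getLast (hne _ _)) (by rw [List.getLast?_eq_some_getLast (hne _ _)]; rfl)
    (ls[i + 1].head (hne _ _)) (by rw [List.head?_eq_some_head (hne _ _)]; rfl)
  rwa [hls _ (List.getElem_mem _) _ (List.getLast_mem _),
    hls _ (List.getElem_mem _) _ (List.head_mem _)] at h4

theorem fst_eq_merge_fst {b : List Letter} (h : b.Pairwise fun a a' => a.1 = a'.1) :
    ∀ a ∈ b, a.1 = (merge b).1 := by
  rcases b with _ | ⟨x, b⟩
  · simp
  · intro a ha
    rw [merge_fst (α := x.1) (by simp) (fun c hc => ?_)]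
    · rcases List.mem_cons.1 ha with rfl | ha
      · rfl
      · exact (List.rel_of_pairwise_cons h ha).symm
    · rcases List.mem_cons.1 hc with rfl | hc
      · rfl
      · exact (List.rel_of_pairwise_cons h hc).symm

theorem dev_merge {b : List Letter} (h0 : b ≠ []) (hn : ∀ a ∈ b, a.2 ≠ 0)
    (h : b.Pairwise Letter.SameDir) : ∀ a ∈ b, (merge b).dev = a.dev := by
  have hfst := fst_eq_merge_fst (h.imp fun h => h.1)
  obtain ⟨θ, hθ⟩ : ∃ θ, ∀ a ∈ b, a.dev = θ := by
    rcases b with _ | ⟨x, b⟩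
    · exact absurd rfl h0
    · refine ⟨x.dev, fun a ha => ?_⟩
      rcases List.mem_cons.1 ha with rfl | ha
      · rfl
      · exact (List.rel_of_pairwise_cons h ha).2.symm
  set α := (merge b).1 with hα
  intro a ha
  rw [hθ a ha]
  have h1 : ∀ c : List Letter, (∀ a ∈ c, a ∈ b) →
      ∃ ρ : ℝ, 0 ≤ ρ ∧ (c ≠ [] → 0 < ρ) ∧
        (c.map Prod.snd).sum = ρ * Complex.exp (((θ + α : ℝ) : ℂ) * Complex.I) := by
    intro c hc
    induction c with
    | nil => exact ⟨0, le_rfl, by simp, by simp⟩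
    | cons x c ih =>
      obtain ⟨ρ, h1, _, h3⟩ := ih fun a ha => hc a (by simp [ha])
      have hx := hc x (by simp)
      have hx0 : 0 < ‖x.2‖ := norm_pos_iff.2 (hn x hx)
      refine ⟨‖x.2‖ + ρ, by positivity, fun _ => by positivity, ?_⟩
      rw [List.map_cons, List.sum_cons, h3]
      conv_lhs => rw [x.eq_norm_mul_exp]
      rw [hθ x hx, hfst x hx]
      push_cast
      ring
  obtain ⟨ρ, _, h2, h3⟩ := h1 b fun a ha => ha
  have hρ := h2 h0
  have hθ' : θ ∈ Set.Ioc (-Real.pi) Real.pi := by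
    rw [← hθ a ha]
    exact Complex.arg_mem_Ioc _
  rw [Letter.dev, ← hα, merge_snd, h3, mul_assoc, ← Complex.exp_add,
    show ((θ + α : ℝ) : ℂ) * Complex.I + -(α * Complex.I) = θ * Complex.I by push_cast; ring,
    Complex.arg_real_mul _ hρ, Complex.arg_exp_mul_I]
  refine (toIocMod_eq_self Real.two_pi_pos).2 ?_
  convert! hθ' using 2
  ring

/-- The unwound logarithms are those used by the principal values of the lifted function. -/
theorem isLift_unwindTail {δ : ℝ} (hδ : 0 < δ) (hδ' : δ ≤ Real.pi / 4) {x : Letter}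
    {l : List Letter} (hl : ∀ a ∈ x :: l, a.IsClose δ) (hc : (x :: l).IsChain (Letter.Apart δ)) :
    ((x :: unwindTail x l).map Letter.lift).map Complex.exp = (x :: l).map Prod.snd ∧
      (x :: unwindTail x l).IsChain fun a b =>
        0 ≤ b.lift.im - a.lift.im ∧ b.lift.im - a.lift.im < 2 * Real.pi := by
  have hπ := Real.pi_pos
  induction l generalizing x with
  | nil => simpa [unwindTail] using Letter.exp_lift (hl x (by simp)).1.ne_zero
  | cons y l ih =>
    rw [List.isChain_cons_cons] at hc
    obtain ⟨h1, h2⟩ := ih (x := y) (fun a ha => hl a (List.mem_cons_of_mem _ ha)) hc.2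
    have hx := Letter.exp_lift (hl x (by simp)).1.ne_zero
    have hxd := abs_lt.1 (hl x (by simp)).2
    have hyd := abs_lt.1 (hl y (by simp)).2
    rw [unwindTail]
    split_ifs with hd
    · constructor
      · rw [List.map_cons, List.map_cons, hx, List.map_cons (l := y :: l), ← h1]
        simp only [List.map_map, List.map_cons, Function.comp_def, Letter.lift_turn,
          Complex.exp_add, Complex.exp_two_pi_mul_I, mul_one]
      · rw [List.map_cons, List.isChain_cons_cons, ← List.map_cons, List.isChain_map]
        refine ⟨?_, ?_⟩
        · rw [Letter.lift_turn, Complex.add_im, Letter.im_lift, Letter.im_lift, hd.1]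
          have := hd.2
          simp only [Complex.mul_im, Complex.mul_re, Complex.re_ofNat, Complex.im_ofNat,
            Complex.ofReal_re, Complex.ofReal_im, Complex.I_re, Complex.I_im]
          constructor <;> linarith
        · simpa [Letter.lift_turn] using h2
    · constructor
      · rw [List.map_cons, List.map_cons, hx, h1]
        rfl
      · rw [List.isChain_cons_cons]
        refine ⟨?_, h2⟩
        rw [Letter.im_lift, Letter.im_lift]
        rcases hc.1 with h | h
        · have h3 : x.dev ≤ y.dev := not_lt.1 fun h' => hd ⟨h.symm, h'⟩
          rw [h]
          constructor <;> linarith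
        · constructor <;> linarith [h.1, h.2]

theorem letterFun_ofFn {n : ℕ} (x : Fin n → Letter) :
    letterFun (List.ofFn x) = liftFun fun i => (x i).lift :=
  onList_ofFn (fun (n : ℕ) (x : Fin n → Letter) => liftFun fun i => (x i).lift) x

theorem principalFun_map_exp_lift {l : List Letter} (h0 : l ≠ [])
    (h : l.IsChain fun a b => 0 ≤ b.lift.im - a.lift.im ∧ b.lift.im - a.lift.im < 2 * Real.pi) :
    onList principalFun (l.map fun a => Complex.exp a.lift) = letterFun l := by
  obtain ⟨n, x, rfl⟩ : ∃ n, ∃ x : Fin n → Letter, l = List.ofFn x :=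
    ⟨_, _, (List.ofFn_get l).symm⟩
  rw [List.map_ofFn, onList_ofFn, letterFun_ofFn]
  have hn : 1 ≤ n := Nat.one_le_iff_ne_zero.2 fun hn => h0 (by subst hn; simp)
  refine IsLift.principalFun_eq hn ⟨fun i => rfl, fun i j hij => ?_⟩
  have h4 := List.isChain_iff_getElem.1 h i (by rw [← hij]; simp)
  simp only [List.getElem_ofFn] at h4
  have hj : j = ⟨(i : ℕ) + 1, by rw [← hij]; exact j.isLt⟩ := Fin.ext hij
  rw [hj]
  exact h4

/-- The principal values near a base point, as sums of the lifted function at logarithms which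
depend continuously on the variables. -/
theorem principalFun_map_snd {δ : ℝ} (hδ : 0 < δ) (hδ' : δ ≤ Real.pi / 4)
    {l : List Letter} (h0 : l ≠ []) (hl : ∀ a ∈ l, a.IsClose δ)
    (hc : l.IsChain (Letter.Apart δ)) :
    onList principalFun (l.map Prod.snd) = blockComp merge letterFun descFun l := by
  rcases l with _ | ⟨x, l⟩
  · exact absurd rfl h0
  rw [← letterFun_unwindTail x l (fun a ha => (hl a ha).1) (hc.imp fun _ _ h => h.adj hδ)]
  obtain ⟨h1, h2⟩ := isLift_unwindTail hδ hδ' hl hc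
  set L := x :: unwindTail x l with hL
  rw [← principalFun_map_exp_lift (by simp [hL]) h2, ← h1, List.map_map]
  rfl

/-- The coefficients of the expansion of the extended family into lifted functions. -/
def localCoeff (b : List Letter) : ℂ := blockComp merge descFun sameDirFun b

/-- The extended family near a point as a sum of lifted functions, for letters close to the rays
through that point. -/
theorem extFun_map_snd {δ : ℝ} (hδ : 0 < δ) (hδ' : δ ≤ Real.pi / 4)
    {l : List Letter} (h0 : l ≠ []) (hl : ∀ a ∈ l, a.IsClose δ)
    (hc : l.IsChain (Letter.Apart δ)) :
    onList extFun (l.map Prod.snd) = blockComp merge letterFun localCoeff l := by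
  have hπ := Real.pi_pos
  have e1 : onList extFun (l.map Prod.snd) =
      blockComp List.sum (onList principalFun) rayFun (l.map Prod.snd) := by
    conv_lhs => rw [← List.ofFn_get (l.map Prod.snd), onList_ofFn, extFun_eq_blockComp,
      List.ofFn_get]
  rw [e1, blockComp_map (ν := List.sum) (μ := merge) Prod.snd _ _ l (fun b _ => rfl)]
  change _ = blockComp merge letterFun (blockComp merge descFun sameDirFun) l
  rw [← blockComp_assoc merge_map_merge]
  refine blockComp_congr fun ls hls => ?_
  obtain ⟨rfl, h2⟩ := mem_parts.1 hls
  have hmem : ∀ b ∈ ls, ∀ a ∈ b, a ∈ ls.flatten := fun b hb a ha => List.mem_flatten.2 ⟨b, hb, ha⟩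
  have hchain := ((List.isChain_flatten h2).1 hc).1
  have e2 : ls.map (fun b => rayFun (b.map Prod.snd)) = ls.map sameDirFun := by
    refine List.map_congr_left fun b hb => ?_
    have := onRay_map_snd_iff (by linarith) (fun a ha => hl a (hmem b hb a ha)) (hchain b hb)
    rw [rayFun, sameDirFun, List.length_map]
    by_cases h : b.Pairwise Letter.SameDir
    · rw [if_pos h, if_pos (this.2 h)]
    · rw [if_neg h, if_neg fun h' => h (this.1 h')]
  rw [e2]
  by_cases h : ∀ b ∈ ls, b.Pairwise Letter.SameDir
  · have hne : ∀ b ∈ ls, b ≠ [] := fun b hb h => h2 (h ▸ hb)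
    have hfst : ∀ b ∈ ls, ∀ a ∈ b, a.1 = (merge b).1 := fun b hb =>
      fst_eq_merge_fst ((h b hb).imp fun h => h.1)
    rw [principalFun_map_snd hδ hδ']
    · rintro h3
      rw [List.map_eq_nil_iff] at h3
      exact h0 (by simp [h3])
    · intro a ha
      obtain ⟨b, hb, rfl⟩ := List.mem_map.1 ha
      refine ⟨isNear_merge (hne b hb) (hfst b hb) fun a ha => (hl a (hmem b hb a ha)).1, ?_⟩
      obtain ⟨x, hx⟩ := List.exists_mem_of_ne_nil b (hne b hb)
      rw [dev_merge (hne b hb) (fun a ha => (hl a (hmem b hb a ha)).1.ne_zero) (h b hb) x hx]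
      exact (hl x (hmem b hb x hx)).2
    · exact isChain_map_merge (R := fun a b => b = a ∨ (2 * δ ≤ b - a ∧ b - a ≤ 2 * Real.pi - 2 * δ))
        h2 hfst hc
  · push Not at h
    obtain ⟨b, hb, h3⟩ := h
    have : (ls.map sameDirFun).prod = 0 :=
      List.prod_eq_zero (List.mem_map.2 ⟨b, hb, if_neg h3⟩)
    rw [this, mul_zero, mul_zero]

/-! ### The continuity and holomorphicity condition -/

/-- All letters of the list have the same angle. -/
def SameAngle (l : List Letter) : Prop := ∀ a ∈ l, ∀ a' ∈ l, a.1 = a'.1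

theorem SameAngle.eq_merge {b : List Letter} (h : SameAngle b) : ∀ a ∈ b, a.1 = (merge b).1 := by
  intro a ha
  exact (merge_fst (List.ne_nil_of_mem ha) fun c hc => h c hc a ha).symm

theorem sameAngle_flatten_iff {ls : List (List Letter)} (h0 : [] ∉ ls) :
    SameAngle ls.flatten ↔ (∀ b ∈ ls, SameAngle b) ∧ SameAngle (ls.map merge) := by
  constructor
  · intro h
    have h1 : ∀ b ∈ ls, SameAngle b := fun b hb a ha a' ha' =>
      h a (List.mem_flatten.2 ⟨b, hb, ha⟩) a' (List.mem_flatten.2 ⟨b, hb, ha'⟩)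
    refine ⟨h1, fun m hm m' hm' => ?_⟩
    obtain ⟨b, hb, rfl⟩ := List.mem_map.1 hm
    obtain ⟨b', hb', rfl⟩ := List.mem_map.1 hm'
    obtain ⟨a, ha⟩ := List.exists_mem_of_ne_nil b fun h => h0 (h ▸ hb)
    obtain ⟨a', ha'⟩ := List.exists_mem_of_ne_nil b' fun h => h0 (h ▸ hb')
    rw [← (h1 b hb).eq_merge a ha, ← (h1 b' hb').eq_merge a' ha']
    exact h a (List.mem_flatten.2 ⟨b, hb, ha⟩) a' (List.mem_flatten.2 ⟨b', hb', ha'⟩)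
  · rintro ⟨h1, h2⟩ a ha a' ha'
    obtain ⟨b, hb, ha⟩ := List.mem_flatten.1 ha
    obtain ⟨b', hb', ha'⟩ := List.mem_flatten.1 ha'
    rw [(h1 b hb).eq_merge a ha, (h1 b' hb').eq_merge a' ha']
    exact h2 _ (List.mem_map_of_mem hb) _ (List.mem_map_of_mem hb')

/-- The coefficients `(-1)^(k-1) / k` of the logarithm, for lists of length `k`. -/
def logCoeff (k : ℕ) : ℂ := (-1) ^ (k - 1) / k

/-- The coefficients of the inverse under composition of the series with the coefficients
`logCoeff`. -/
def expCoeff (k : ℕ) : ℂ :=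
  leftInv (fun _ : List Unit => ()) (fun l => logCoeff l.length) (List.replicate k ())

open Classical in
/-- The coefficient `logCoeff` for lists of letters of one angle. -/
def logFun (l : List Letter) : ℂ := if SameAngle l then logCoeff l.length else 0

open Classical in
/-- The coefficient `expCoeff` for lists of letters of one angle. -/
def expFun (l : List Letter) : ℂ := if SameAngle l then expCoeff l.length else 0

theorem expFun_blockComp_logFun (l : List Letter) :
    blockComp merge expFun logFun l = unitFun l := by
  by_cases h : SameAngle l
  · have h1 := leftInv_blockComp (μ := fun _ : List Unit => ()) (a := fun l => logCoeff l.length)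
      (fun x => by simp [logCoeff]) (fun x => rfl) (l.map fun _ => ())
    rw [blockComp_map (μ := merge) (fun _ : Letter => ()) _ _ l fun _ _ => rfl] at h1
    have h2 : unitFun (l.map fun _ => ()) = unitFun l := by simp [unitFun]
    rw [← h2, ← h1]
    refine blockComp_congr fun ls hls => ?_
    obtain ⟨rfl, h0⟩ := mem_parts.1 hls
    obtain ⟨h3, h4⟩ := (sameAngle_flatten_iff h0).1 h
    congr 1
    · rw [expFun, if_pos h4, expCoeff]
      congr 1
      simp [Function.comp_def, List.map_const']
    · congr 1
      exact List.map_congr_left fun b hb => by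
        rw [logFun, if_pos (h3 b hb)]
        simp
  · have h1 : unitFun l = 0 := by
      rw [unitFun, if_neg]
      intro h1
      obtain ⟨x, rfl⟩ := List.length_eq_one_iff.1 h1
      exact h (by simp [SameAngle])
    rw [h1, blockComp]
    refine Finset.sum_eq_zero fun ls hls => ?_
    obtain ⟨rfl, h0⟩ := mem_parts.1 hls
    by_cases h2 : ∀ b ∈ ls, SameAngle b
    · rw [expFun, if_neg fun h3 => h ((sameAngle_flatten_iff h0).2 ⟨h2, h3⟩), zero_mul]
    · push Not at h2
      obtain ⟨b, hb, h3⟩ := h2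
      rw [List.prod_eq_zero (List.mem_map.2 ⟨b, hb, if_neg h3⟩), mul_zero]

/-- The coefficients in the transition from the holomorphic functions near a point to the extended
family. -/
def transitionCoeff (b : List Letter) : ℂ := blockComp merge logFun localCoeff b

/-- The holomorphic functions which describe the extended family near a point. -/
def germFun (l : List Letter) : ℂ := blockComp merge letterFun expFun l

theorem blockComp_letterFun_localCoeff (l : List Letter) :
    blockComp merge letterFun localCoeff l = blockComp merge germFun transitionCoeff l := by
  have h1 : blockComp merge germFun transitionCoeff l =
      blockComp merge letterFun (blockComp merge (blockComp merge expFun logFun) localCoeff) l := by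
    have h2 : blockComp merge (blockComp merge expFun logFun) localCoeff =
        blockComp merge expFun (blockComp merge logFun localCoeff) :=
      funext fun l => blockComp_assoc merge_map_merge _ _ _ l
    rw [h2]
    exact blockComp_assoc merge_map_merge _ _ _ l
  rw [h1]
  refine blockComp_congr fun ls hls => ?_
  obtain ⟨rfl, h0⟩ := mem_parts.1 hls
  congr 2
  refine List.map_congr_left fun b hb => ?_
  have hb0 : b ≠ [] := fun h => h0 (h ▸ hb)
  rw [show blockComp merge expFun logFun = unitFun from funext expFun_blockComp_logFun,
    unitFun_blockComp _ _ hb0]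

theorem sameAngle_of_localCoeff_ne_zero {b : List Letter} (h : localCoeff b ≠ 0) :
    SameAngle b := by
  rw [localCoeff, blockComp] at h
  obtain ⟨ls, hls, h1⟩ := Finset.exists_ne_zero_of_sum_ne_zero h
  obtain ⟨rfl, h0⟩ := mem_parts.1 hls
  refine (sameAngle_flatten_iff h0).2 ⟨fun b hb => ?_, ?_⟩
  · by_contra hcon
    refine right_ne_zero_of_mul h1 (List.prod_eq_zero (List.mem_map.2 ⟨b, hb, if_neg fun h2 => ?_⟩))
    have h3 := fst_eq_merge_fst (h2.imp fun h => h.1)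
    exact hcon fun a ha a' ha' => (h3 a ha).trans (h3 a' ha').symm
  · by_contra hcon
    refine left_ne_zero_of_mul h1 (if_neg fun h2 => ?_)
    have h3 := fst_eq_merge_fst (h2.pairwise.imp fun h => h.1)
    exact hcon fun a ha a' ha' => (h3 a ha).trans (h3 a' ha').symm

theorem sameAngle_of_transitionCoeff_ne_zero {b : List Letter} (h : transitionCoeff b ≠ 0) :
    SameAngle b := by
  rw [transitionCoeff, blockComp] at h
  obtain ⟨ls, hls, h1⟩ := Finset.exists_ne_zero_of_sum_ne_zero h
  obtain ⟨rfl, h0⟩ := mem_parts.1 hls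
  refine (sameAngle_flatten_iff h0).2 ⟨fun b hb => ?_, ?_⟩
  · refine sameAngle_of_localCoeff_ne_zero fun h2 => right_ne_zero_of_mul h1 ?_
    exact List.prod_eq_zero (List.mem_map.2 ⟨b, hb, h2⟩)
  · by_contra hcon
    exact left_ne_zero_of_mul h1 (if_neg hcon)

/-- The transition coefficients of letters with equal angles are the coefficients `localU` of their
deviations: the maps `ψ` and `ξ` are the two levels of blocks in the composition. -/
theorem transitionCoeff_ofFn {n : ℕ} {x : Fin n → Letter} (hx : ∀ i j, (x i).1 = (x j).1)
    (h0 : ∀ i, (x i).2 ≠ 0) :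
    transitionCoeff (List.ofFn x) = (localU (fun i => (x i).dev) : ℂ) := by
  have h1 : transitionCoeff (List.ofFn x) =
      blockComp merge (blockComp merge logFun descFun) sameDirFun (List.ofFn x) :=
    (blockComp_assoc merge_map_merge _ _ _ _).symm
  rw [h1, blockComp, sum_parts_ofFn, localU, Rat.cast_sum]
  refine Finset.sum_congr rfl fun p _ => ?_
  have hangle : ∀ b, SameAngle (List.ofFn fun j => x (p.embedding b j)) := by
    intro b a ha a' ha'
    obtain ⟨j, rfl⟩ := List.mem_ofFn.1 ha
    obtain ⟨j', rfl⟩ := List.mem_ofFn.1 ha'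
    exact hx _ _
  have hne : ∀ b, (List.ofFn fun j => x (p.embedding b j)) ≠ [] := by
    intro b h
    have := congrArg List.length h
    rw [List.length_ofFn] at this
    exact Nat.one_le_iff_ne_zero.1 (p.one_le_blocksFun b) this
  have hfst : ∀ (i : Fin n) (b), (merge (List.ofFn fun j => x (p.embedding b j))).1 = (x i).1 := by
    intro i b
    refine merge_fst (hne b) fun a ha => ?_
    obtain ⟨j, rfl⟩ := List.mem_ofFn.1 ha
    exact hx _ _
  rw [Rat.cast_sum, List.map_ofFn, List.map_ofFn, List.prod_ofFn, blockComp, sum_parts_ofFn,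
    Finset.sum_mul]
  refine Finset.sum_congr rfl fun q _ => ?_
  have hc1 : (∀ i j : Fin n, p.index i = p.index j → (x i).dev = (x j).dev) ↔
      ∀ b, (List.ofFn fun j => x (p.embedding b j)).Pairwise Letter.SameDir := by
    simp only [List.pairwise_ofFn]
    constructor
    · intro h b j j' _
      exact ⟨hx _ _, h _ _ (by simp)⟩
    · intro h i j hij
      have hi := p.embedding_comp_inv i
      have hj := p.embedding_comp_inv j
      obtain ⟨a, ha⟩ : ∃ a, p.embedding (p.index i) a = i := ⟨_, hi⟩
      obtain ⟨a', ha'⟩ : ∃ a, p.embedding (p.index i) a = j := by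
        rw [hij]
        exact ⟨_, hj⟩
      rcases lt_trichotomy a a' with hlt | rfl | hlt
      · have := (h _ hlt).2
        rwa [ha, ha'] at this
      · rw [← ha, ← ha']
      · have := (h _ hlt).2
        rw [ha, ha'] at this
        exact this.symm
  by_cases h2 : ∀ b, (List.ofFn fun j => x (p.embedding b j)).Pairwise Letter.SameDir
  swap
  · rw [if_neg fun h => h2 (hc1.1 h.1), Rat.cast_zero]
    obtain ⟨b, hb⟩ := not_forall.1 h2
    rw [Finset.prod_eq_zero (Finset.mem_univ b) (if_neg hb), mul_zero]
  have hdev : ∀ i, (merge (List.ofFn fun j => x (p.embedding (p.index i) j))).dev = (x i).dev := by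
    intro i
    refine dev_merge (hne _) (fun a ha => ?_) (h2 _) _
      (List.mem_ofFn.2 ⟨_, congrArg x (p.embedding_comp_inv i)⟩)
    obtain ⟨j, rfl⟩ := List.mem_ofFn.1 ha
    exact h0 _
  set y : Fin p.length → Letter := fun b => merge (List.ofFn fun j => x (p.embedding b j)) with hy
  have hyy : ∀ b b', (y b).1 = (y b').1 := fun b b' => by
    have h3 := hfst (p.embedding b ⟨0, p.one_le_blocksFun b⟩)
    exact (h3 b).trans (h3 b').symm
  have hc2 : (∀ i j : Fin n, p.index i < p.index j →
      q.index (p.index i) = q.index (p.index j) → (x j).dev < (x i).dev) ↔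
      ∀ a, (List.ofFn fun j => y (q.embedding a j)).IsChain Letter.Desc := by
    simp only [List.isChain_iff_pairwise, List.pairwise_ofFn]
    constructor
    · intro h a j j' hj
      have h3 : ∀ b, ∃ i, p.index i = b := fun b =>
        ⟨p.embedding b ⟨0, p.one_le_blocksFun b⟩, p.index_embedding _ _⟩
      obtain ⟨i, hi⟩ := h3 (q.embedding a j)
      obtain ⟨i', hi'⟩ := h3 (q.embedding a j')
      refine ⟨hyy _ _, ?_⟩
      have h4 := h i i' (by rw [hi, hi']; exact (q.embedding a).strictMono hj)
        (by rw [hi, hi', q.index_embedding, q.index_embedding])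
      rw [← hdev, ← hdev, hi, hi'] at h4
      exact h4
    · intro h i i' hlt hq
      rw [← hdev, ← hdev]
      obtain ⟨a, ha⟩ : ∃ a, q.embedding (q.index (p.index i)) a = p.index i :=
        ⟨_, q.embedding_comp_inv _⟩
      obtain ⟨a', ha'⟩ : ∃ a, q.embedding (q.index (p.index i)) a = p.index i' := by
        rw [hq]
        exact ⟨_, q.embedding_comp_inv _⟩
      have h3 : a < a' := by
        rw [← (q.embedding (q.index (p.index i))).lt_iff_lt, ha, ha']
        exact hlt
      have := (h _ h3).2
      rw [ha, ha'] at this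
      exact this
  rw [List.map_ofFn, List.map_ofFn, List.prod_ofFn]
  simp only [Function.comp_def]
  by_cases h3 : ∀ a, (List.ofFn fun j => y (q.embedding a j)).IsChain Letter.Desc
  swap
  · rw [if_neg fun h => h3 (hc2.1 h.2), Rat.cast_zero]
    obtain ⟨a, ha⟩ := not_forall.1 h3
    rw [Finset.prod_eq_zero (f := fun a => descFun (List.ofFn fun j => y (q.embedding a j)))
      (Finset.mem_univ a) (if_neg ha), mul_zero, zero_mul]
  rw [if_pos ⟨hc1.2 h2, hc2.2 h3⟩]
  have h4 : SameAngle (List.ofFn fun a => merge (List.ofFn fun j => y (q.embedding a j))) := by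
    have h5 : ∀ a, (merge (List.ofFn fun j => y (q.embedding a j))).1 =
        (y (q.embedding a ⟨0, q.one_le_blocksFun a⟩)).1 := by
      intro a
      refine merge_fst (fun h => ?_) fun c hc => ?_
      · have := congrArg List.length h
        rw [List.length_ofFn] at this
        exact Nat.one_le_iff_ne_zero.1 (q.one_le_blocksFun a) this
      · obtain ⟨j, rfl⟩ := List.mem_ofFn.1 hc
        exact hyy _ _
    intro c hc c' hc'
    obtain ⟨a, rfl⟩ := List.mem_ofFn.1 hc
    obtain ⟨a', rfl⟩ := List.mem_ofFn.1 hc'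
    rw [h5, h5]
    exact hyy _ _
  have h6 : ∏ a, descFun (List.ofFn fun j => y (q.embedding a j)) = 1 :=
    Finset.prod_eq_one fun a _ => if_pos (h3 a)
  have h7 : ∏ b, sameDirFun (List.ofFn fun j => x (p.embedding b j)) =
      ∏ b, ((p.blocksFun b).factorial : ℂ)⁻¹ := by
    refine Finset.prod_congr rfl fun b _ => ?_
    rw [sameDirFun, if_pos (h2 b), List.length_ofFn]
  rw [h6, h7, mul_one, logFun, if_pos h4, List.length_ofFn, logCoeff]
  push_cast
  simp only [one_div]

open Classical in
/-- Arguments `α_k` of `w_k` with `α_1 = arg w_1` and consecutive differences in `[0, 2π)`. -/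
def angles {n : ℕ} (w : Fin n → ℂ) : Fin n → ℝ :=
  if h : ∃ u, IsLift u w ∧ ∀ i : Fin n, (i : ℕ) = 0 → (u i).im = (w i).arg then
    fun i => (h.choose i).im
  else 0

theorem angles_eq {n : ℕ} (hn : 1 ≤ n) {u w : Fin n → ℂ} (hu : IsLift u w)
    (h0 : ∀ i : Fin n, (i : ℕ) = 0 → (u i).im = (w i).arg) : angles w = fun i => (u i).im := by
  have h : ∃ u, IsLift u w ∧ ∀ i : Fin n, (i : ℕ) = 0 → (u i).im = (w i).arg := ⟨u, hu, h0⟩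
  rw [angles, dif_pos h]
  obtain ⟨m, hm⟩ := h.choose_spec.1.exists_eq_add hn hu
  have h1 := congrArg Complex.im (hm ⟨0, hn⟩)
  rw [h.choose_spec.2 _ rfl, Complex.add_im, h0 _ rfl] at h1
  have h2 : (m : ℝ) = 0 := by
    have : (m : ℝ) * (2 * Real.pi) = 0 := by simpa using h1
    exact (mul_eq_zero.1 this).resolve_right Real.two_pi_pos.ne'
  have h3 : m = 0 := by exact_mod_cast h2
  funext i
  rw [hm i, h3]
  simp

theorem exists_isLift_angles {n : ℕ} (hn : 1 ≤ n) {w : Fin n → ℂ} (hw : ∀ i, w i ≠ 0) :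
    ∃ u, IsLift u w ∧ (∀ i : Fin n, (i : ℕ) = 0 → (u i).im = (w i).arg) ∧
      ∀ i, (u i).im = angles w i := by
  obtain ⟨u, hu, h0⟩ := exists_isLift hw
  exact ⟨u, hu, h0, fun i => by rw [angles_eq hn hu h0]⟩

theorem mul_exp_neg_angles {n : ℕ} (hn : 1 ≤ n) {w : Fin n → ℂ} (hw : ∀ i, w i ≠ 0) (i : Fin n) :
    w i * Complex.exp (-(angles w i * Complex.I)) = ‖w i‖ := by
  obtain ⟨u, hu, _, h⟩ := exists_isLift_angles hn hw
  rw [← h, ← hu.1 i, exp_mul_exp_neg_mul_I, Complex.norm_exp]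
  simp

theorem angles_adj {n : ℕ} (hn : 1 ≤ n) {w : Fin n → ℂ} (hw : ∀ i, w i ≠ 0) (i j : Fin n)
    (hij : (j : ℕ) = i + 1) :
    0 ≤ angles w j - angles w i ∧ angles w j - angles w i < 2 * Real.pi := by
  obtain ⟨u, hu, _, h⟩ := exists_isLift_angles hn hw
  rw [← h, ← h]
  exact hu.2 i j hij

theorem angles_zero {n : ℕ} (hn : 1 ≤ n) {w : Fin n → ℂ} (hw : ∀ i, w i ≠ 0) (i : Fin n)
    (hi : (i : ℕ) = 0) : angles w i = (w i).arg := by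
  obtain ⟨u, _, h0, h⟩ := exists_isLift_angles hn hw
  rw [← h, h0 i hi]

/-- Uniqueness of `angles`. -/
theorem angles_eq_of {n : ℕ} (hn : 1 ≤ n) {w : Fin n → ℂ} (hw : ∀ i, w i ≠ 0) {α : Fin n → ℝ}
    (h : ∀ i, w i * Complex.exp (-(α i * Complex.I)) = ‖w i‖)
    (hadj : ∀ i j : Fin n, (j : ℕ) = i + 1 → 0 ≤ α j - α i ∧ α j - α i < 2 * Real.pi)
    (h0 : ∀ i : Fin n, (i : ℕ) = 0 → α i = (w i).arg) : angles w = α := by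
  have := angles_eq hn (u := fun i => Complex.ofReal (Real.log ‖w i‖) + α i * Complex.I) (w := w)
    ⟨fun i => ?_, fun i j hij => by simpa using hadj i j hij⟩ (fun i hi => by simpa using h0 i hi)
  · rw [this]
    funext i
    simp
  · rw [Complex.exp_add, ← Complex.ofReal_exp, Real.exp_log (norm_pos_iff.2 (hw i)), ← h i, mul_assoc,
      ← Complex.exp_add]
    simp

/-- The letters given by `z` and the angles of `w`. -/
def letters {n : ℕ} (w z : Fin n → ℂ) (i : Fin n) : Letter := (angles w i, z i)

theorem dev_letters {n : ℕ} (hn : 1 ≤ n) {w : Fin n → ℂ} (hw : ∀ i, w i ≠ 0) (z : Fin n → ℂ)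
    (i : Fin n) : (letters w z i).dev = (z i / w i).arg := by
  have h := mul_exp_neg_angles hn hw i
  have hwi : 0 < ‖w i‖ := norm_pos_iff.2 (hw i)
  have h1 : z i * Complex.exp (-(angles w i * Complex.I)) = (‖w i‖ : ℝ) * (z i / w i) := by
    rw [← h]
    field_simp [hw i]
  rw [Letter.dev]
  change (z i * Complex.exp (-(angles w i * Complex.I))).arg = _
  rw [h1, Complex.arg_real_mul _ hwi]

theorem eventually_isClose {n : ℕ} (hn : 1 ≤ n) {w : Fin n → ℂ} (hw : ∀ i, w i ≠ 0) {δ : ℝ}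
    (hδ : 0 < δ) : ∀ᶠ z in 𝓝 w, ∀ i, (letters w z i).IsClose δ := by
  refine eventually_all.2 fun i => ?_
  have h := mul_exp_neg_angles hn hw i
  have hwi : 0 < ‖w i‖ := norm_pos_iff.2 (hw i)
  have hc : ContinuousAt (fun z : Fin n → ℂ => z i * Complex.exp (-(angles w i * Complex.I))) w :=
    ((continuous_apply i).mul continuous_const).continuousAt
  have h1 : ∀ᶠ v : ℂ in 𝓝 (‖w i‖ : ℂ), |v.im| < v.re ∧ |v.arg| < δ := by
    have e1 : ContinuousAt (fun v : ℂ => v.re - |v.im|) (‖w i‖ : ℂ) := by fun_prop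
    have e2 : ContinuousAt (fun v : ℂ => |v.arg|) (‖w i‖ : ℂ) :=
      (Complex.continuousAt_arg (Or.inl (by simpa using hw i))).abs
    have e3 := e1.eventually (lt_mem_nhds (a := 0) (by simpa using hw i))
    have e4 := e2.eventually (gt_mem_nhds (show |(‖w i‖ : ℂ).arg| < δ by
      rw [Complex.arg_ofReal_of_nonneg hwi.le, abs_zero]
      exact hδ))
    filter_upwards [e3, e4] with v h3 h4 using ⟨by linarith, h4⟩
  rw [← h] at h1
  exact hc.eventually h1

/-- Finitely many differences of angles in `[0, 2π)` which are nonzero have a positive distance from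
both ends of the interval. -/
theorem exists_apart {n : ℕ} {α : Fin n → ℝ}
    (hα : ∀ i j : Fin n, (j : ℕ) = i + 1 → 0 ≤ α j - α i ∧ α j - α i < 2 * Real.pi) :
    ∃ δ > 0, δ ≤ Real.pi / 4 ∧ ∀ i j : Fin n, (j : ℕ) = i + 1 →
      α j = α i ∨ (2 * δ ≤ α j - α i ∧ α j - α i ≤ 2 * Real.pi - 2 * δ) := by
  have h1 : ∀ i j : Fin n, ∀ᶠ δ in 𝓝[>] (0 : ℝ), (j : ℕ) = i + 1 →
      α j = α i ∨ (2 * δ ≤ α j - α i ∧ α j - α i ≤ 2 * Real.pi - 2 * δ) := by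
    intro i j
    by_cases hij : (j : ℕ) = i + 1
    swap
    · exact Eventually.of_forall fun _ h => absurd h hij
    rcases (hα i j hij).1.eq_or_lt with h | h
    · exact Eventually.of_forall fun _ _ => Or.inl (by linarith)
    · have h2 := (hα i j hij).2
      filter_upwards [Ioo_mem_nhdsGT (show (0 : ℝ) < (α j - α i) / 2 by linarith),
        Ioo_mem_nhdsGT (show (0 : ℝ) < (2 * Real.pi - (α j - α i)) / 2 by linarith)] with δ h3 h4 _
      exact Or.inr ⟨by linarith [h3.2], by linarith [h4.2]⟩
  have h2 : ∀ᶠ δ in 𝓝[>] (0 : ℝ), δ ≤ Real.pi / 4 := by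
    filter_upwards [Ioo_mem_nhdsGT (show (0 : ℝ) < Real.pi / 4 by positivity)] with δ h using h.2.le
  obtain ⟨δ, ⟨h3, h4⟩, h5⟩ :=
    ((h2.and (eventually_all.2 fun i => eventually_all.2 (h1 i))).and self_mem_nhdsWithin).exists
  exact ⟨δ, h5, h3, h4⟩

theorem isChain_ofFn {A : Type*} {R : A → A → Prop} {n : ℕ} {x : Fin n → A} :
    (List.ofFn x).IsChain R ↔ ∀ i j : Fin n, (j : ℕ) = i + 1 → R (x i) (x j) := by
  rw [List.isChain_iff_getElem]
  simp only [List.length_ofFn, List.getElem_ofFn]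
  constructor
  · intro h i j hij
    have h1 := h i (by rw [← hij]; exact j.isLt)
    have hj : j = ⟨(i : ℕ) + 1, by rw [← hij]; exact j.isLt⟩ := Fin.ext hij
    rw [hj]
    exact h1
  · exact fun h i hi => h _ _ rfl

theorem isChain_letters {n : ℕ} {R : ℝ → ℝ → Prop} {w : Fin n → ℂ}
    (h : ∀ i j : Fin n, (j : ℕ) = i + 1 → R (angles w i) (angles w j)) (z : Fin n → ℂ) :
    (List.ofFn (letters w z)).IsChain fun a b => R a.1 b.1 :=
  isChain_ofFn.2 h

theorem ofFn_letters_snd {n : ℕ} (w z : Fin n → ℂ) :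
    (List.ofFn (letters w z)).map Prod.snd = List.ofFn z := by
  rw [List.map_ofFn]
  rfl

/-- The extended family near a point `w`. -/
theorem eventually_extFun_eq {n : ℕ} (hn : 1 ≤ n) {w : Fin n → ℂ} (hw : ∀ i, w i ≠ 0) :
    ∀ᶠ z in 𝓝 w, extFun n z = blockComp merge letterFun localCoeff (List.ofFn (letters w z)) := by
  obtain ⟨δ, hδ, hδ', hα⟩ := exists_apart (angles_adj hn hw)
  filter_upwards [eventually_isClose hn hw hδ] with z hz
  rw [← extFun_map_snd hδ hδ' (fun h => ?_) (fun a ha => ?_)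
    (isChain_letters (R := fun a b => b = a ∨ (2 * δ ≤ b - a ∧ b - a ≤ 2 * Real.pi - 2 * δ)) hα z),
    ofFn_letters_snd, onList_ofFn]
  · have := congrArg List.length h
    rw [List.length_ofFn] at this
    exact Nat.one_le_iff_ne_zero.1 hn this
  · obtain ⟨i, rfl⟩ := List.mem_ofFn.1 ha
    exact hz i

theorem blocksOnRays_iff_angles {n : ℕ} (hn : 1 ≤ n) {w : Fin n → ℂ} (hw : ∀ i, w i ≠ 0)
    (c : Composition n) : BlocksOnRays c w ↔
      ∀ k j j', angles w (c.embedding k j) = angles w (c.embedding k j') := by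
  obtain ⟨δ, hδ, hδ', hα⟩ := exists_apart (angles_adj hn hw)
  have hclose := (eventually_isClose hn hw hδ).self_of_nhds
  have hchain := isChain_letters
    (R := fun a b => b = a ∨ (2 * δ ≤ b - a ∧ b - a ≤ 2 * Real.pi - 2 * δ)) hα w
  have hdev : ∀ i, (letters w w i).dev = 0 := fun i => by
    rw [dev_letters hn hw, div_self (hw i), Complex.arg_one]
  have hmem : (List.ofFn fun k => List.ofFn fun j => letters w w (c.embedding k j)) ∈
      parts (List.ofFn (letters w w)) := by
    have key : ∀ (l : List Letter) (hl : l.length = n), l.splitWrtComposition c ∈ parts l := by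
      rintro l rfl
      rw [mem_parts]
      refine ⟨List.flatten_splitWrtComposition _ _, fun h => ?_⟩
      exact (List.length_pos_of_mem_splitWrtComposition h).ne' rfl
    rw [← splitWrtComposition_ofFn]
    exact key _ (List.length_ofFn)
  obtain ⟨h1, h2⟩ := mem_parts.1 hmem
  rw [← h1, List.isChain_flatten h2] at hchain
  rw [blocksOnRays_iff]
  refine forall_congr' fun k => ?_
  have h3 := onRay_map_snd_iff (δ := δ) (by linarith [Real.pi_pos])
    (b := List.ofFn fun j => letters w w (c.embedding k j))
    (fun a ha => by
      obtain ⟨j, rfl⟩ := List.mem_ofFn.1 ha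
      exact hclose _)
    (hchain.1 _ (List.mem_ofFn.2 ⟨k, rfl⟩))
  rw [List.map_ofFn] at h3
  refine h3.trans ?_
  rw [List.pairwise_ofFn]
  constructor
  · intro h j j'
    rcases lt_trichotomy j j' with hj | rfl | hj
    · exact (h hj).1
    · rfl
    · exact (h hj).1.symm
  · intro h j j' _
    exact ⟨h j j', by rw [hdev, hdev]⟩

theorem sum_norm_mul_exp_neg {m : ℕ} {w : Fin m → ℂ} {α : ℝ}
    (h : ∀ i, w i * Complex.exp (-(α * Complex.I)) = ‖w i‖) :
    (∑ i, w i) * Complex.exp (-(α * Complex.I)) = ‖∑ i, w i‖ := by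
  have h1 : (∑ i, w i) * Complex.exp (-(α * Complex.I)) = ((∑ i, ‖w i‖ : ℝ) : ℂ) := by
    rw [Finset.sum_mul]
    push_cast
    exact Finset.sum_congr rfl fun i _ => h i
  have h2 : ‖Complex.exp (-(α * Complex.I))‖ = 1 := by
    rw [show -((α : ℂ) * Complex.I) = ((-α : ℝ) : ℂ) * Complex.I by push_cast; ring,
      Complex.norm_exp_ofReal_mul_I]
  have h3 := congrArg norm h1
  rw [norm_mul, h2, mul_one, Complex.norm_real, Real.norm_of_nonneg (by positivity)] at h3
  rw [h1, h3]

theorem blockSum_ne_zero {n : ℕ} (hn : 1 ≤ n) {w : Fin n → ℂ} (hw : ∀ i, w i ≠ 0)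
    {c : Composition n} (hc : BlocksOnRays c w) (k : Fin c.length) : blockSum c w k ≠ 0 := by
  rw [blocksOnRays_iff_angles hn hw] at hc
  have hk := c.one_le_blocksFun k
  intro h
  set α := angles w (c.embedding k ⟨0, hk⟩)
  have h1 : blockSum c w k * Complex.exp (-(α * Complex.I)) =
      ((∑ j, ‖w (c.embedding k j)‖ : ℝ) : ℂ) := by
    rw [blockSum, Finset.sum_mul]
    push_cast
    refine Finset.sum_congr rfl fun j _ => ?_
    rw [← mul_exp_neg_angles hn hw, hc k j ⟨0, hk⟩]
  rw [h, zero_mul] at h1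
  have h2 : (∑ j, ‖w (c.embedding k j)‖ : ℝ) = 0 := by exact_mod_cast h1.symm
  have h3 := (Finset.sum_eq_zero_iff_of_nonneg fun j _ => norm_nonneg _).1 h2 ⟨0, hk⟩
    (Finset.mem_univ _)
  exact hw _ (norm_eq_zero.1 h3)

theorem length_pos_of_one_le {n : ℕ} (hn : 1 ≤ n) (c : Composition n) : 1 ≤ c.length :=
  c.length_pos_of_pos hn

theorem angles_blockSum {n : ℕ} (hn : 1 ≤ n) {w : Fin n → ℂ} (hw : ∀ i, w i ≠ 0)
    {c : Composition n} (hc : BlocksOnRays c w) (k : Fin c.length) (j : Fin (c.blocksFun k)) :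
    angles (blockSum c w) k = angles w (c.embedding k j) := by
  have hc' := (blocksOnRays_iff_angles hn hw c).1 hc
  have h := angles_eq_of (length_pos_of_one_le hn c) (blockSum_ne_zero hn hw hc)
    (α := fun k => angles w (c.embedding k ⟨0, c.one_le_blocksFun k⟩)) (fun k => ?_)
    (fun k k' hk => ?_) (fun k hk => ?_)
  · rw [h]
    exact hc' k _ _
  · exact sum_norm_mul_exp_neg fun j => by
      rw [hc' k ⟨0, c.one_le_blocksFun k⟩ j]
      exact mul_exp_neg_angles hn hw _
  · have hb := c.one_le_blocksFun k
    rw [hc' k ⟨0, hb⟩ ⟨c.blocksFun k - 1, by omega⟩]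
    refine angles_adj hn hw _ _ ?_
    rw [Composition.coe_embedding, Composition.coe_embedding, hk, c.sizeUpTo_succ' k]
    simp
    omega
  · have hw0 : ((c.embedding k ⟨0, c.one_le_blocksFun k⟩ : Fin n) : ℕ) = 0 := by
      rw [Composition.coe_embedding, hk]
      simp
    rw [angles_zero hn hw _ hw0]
    have h1 := fun j => mul_exp_neg_angles hn hw (c.embedding k j)
    have h2 : blockSum c w k =
        ((∑ j, ‖w (c.embedding k j)‖ / ‖w (c.embedding k ⟨0, c.one_le_blocksFun k⟩)‖ : ℝ) : ℂ) *
          w (c.embedding k ⟨0, c.one_le_blocksFun k⟩) := by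
      rw [blockSum]
      push_cast
      rw [Finset.sum_mul]
      refine Finset.sum_congr rfl fun j _ => ?_
      rw [← h1 j, ← h1 ⟨0, c.one_le_blocksFun k⟩, hc' k j ⟨0, c.one_le_blocksFun k⟩]
      have := hw (c.embedding k ⟨0, c.one_le_blocksFun k⟩)
      field_simp
    rw [h2, Complex.arg_real_mul]
    refine Finset.sum_pos (fun j _ => ?_) ⟨⟨0, c.one_le_blocksFun k⟩, Finset.mem_univ _⟩
    exact div_pos (norm_pos_iff.2 (hw _)) (norm_pos_iff.2 (hw _))

theorem merge_ofFn_letters {n : ℕ} (hn : 1 ≤ n) {w : Fin n → ℂ} (hw : ∀ i, w i ≠ 0)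
    {c : Composition n} (hc : BlocksOnRays c w) (z : Fin n → ℂ) (k : Fin c.length) :
    merge (List.ofFn fun j => letters w z (c.embedding k j)) =
      letters (blockSum c w) (blockSum c z) k := by
  have hk := c.one_le_blocksFun k
  refine Prod.ext ?_ ?_
  · refine merge_fst (fun h => ?_) fun a ha => ?_
    · have := congrArg List.length h
      rw [List.length_ofFn] at this
      exact Nat.one_le_iff_ne_zero.1 hk this
    · obtain ⟨j, rfl⟩ := List.mem_ofFn.1 ha
      exact (angles_blockSum hn hw hc k j).symm
  · rw [merge_snd, List.map_ofFn, List.sum_ofFn]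
    rfl

/-- The functions `G_n(z; w)` of the continuity and holomorphicity condition for the extended
family. -/
def germFamily (n : ℕ) (w z : Fin n → ℂ) : ℂ := germFun (List.ofFn (letters w z))

theorem differentiableAt_letterFun {n : ℕ} (hn : 1 ≤ n) {α : Fin n → ℝ}
    (hα : ∀ i j : Fin n, (j : ℕ) = i + 1 → 0 ≤ α j - α i ∧ α j - α i ≤ 2 * Real.pi)
    {z : Fin n → ℂ} (hz : ∀ i, Letter.IsNear (α i, z i)) :
    DifferentiableAt ℂ (fun z : Fin n → ℂ => letterFun (List.ofFn fun i => (α i, z i))) z := by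
  simp only [letterFun_ofFn]
  have h1 := differentiableAt_liftFun hn (u := fun i => Letter.lift (α i, z i))
    (mem_liftDomain hn hα fun i => (hz i).abs_im_lift_sub_lt)
  have h2 : DifferentiableAt ℂ (fun (z : Fin n → ℂ) i => Letter.lift (α i, z i)) z := by
    refine differentiableAt_pi.2 fun i => ?_
    unfold Letter.lift
    have h3 : z i * Complex.exp (-(α i * Complex.I)) ∈ Complex.slitPlane :=
      Or.inl ((abs_nonneg _).trans_lt (hz i))
    have h4 : DifferentiableAt ℂ (fun z : Fin n → ℂ => z i * Complex.exp (-(α i * Complex.I))) z := by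
      fun_prop
    change DifferentiableAt ℂ (fun z : Fin n → ℂ =>
      Complex.log (z i * Complex.exp (-(α i * Complex.I))) + α i * Complex.I) z
    exact (h4.clog h3).add_const _
  exact DifferentiableAt.comp (g := liftFun)
    (f := fun (z : Fin n → ℂ) i => Letter.lift (α i, z i)) z h1 h2

theorem isNear_letters_blockSum {n : ℕ} (hn : 1 ≤ n) {w z : Fin n → ℂ} (hw : ∀ i, w i ≠ 0)
    (hz : ∀ i, (letters w z i).IsNear) {c : Composition n} (hc : BlocksOnRays c w)
    (k : Fin c.length) : (letters (blockSum c w) (blockSum c z) k).IsNear := by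
  rw [← merge_ofFn_letters hn hw hc]
  have hk := c.one_le_blocksFun k
  refine isNear_merge (α := angles (blockSum c w) k) (fun h => ?_) (fun a ha => ?_) fun a ha => ?_
  · have := congrArg List.length h
    rw [List.length_ofFn] at this
    exact Nat.one_le_iff_ne_zero.1 hk this
  · obtain ⟨j, rfl⟩ := List.mem_ofFn.1 ha
    exact (angles_blockSum hn hw hc k j).symm
  · obtain ⟨j, rfl⟩ := List.mem_ofFn.1 ha
    exact hz _

theorem differentiableAt_letterFun_blockSum {n : ℕ} (hn : 1 ≤ n) {w : Fin n → ℂ}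
    (hw : ∀ i, w i ≠ 0) {z : Fin n → ℂ} (hz : ∀ i, (letters w z i).IsNear) {c : Composition n}
    (hc : BlocksOnRays c w) : DifferentiableAt ℂ
      (fun z => letterFun (List.ofFn (letters (blockSum c w) (blockSum c z)))) z := by
  have h2 := differentiableAt_letterFun (length_pos_of_one_le hn c)
    (α := angles (blockSum c w)) (z := blockSum c z) (fun i j hij => by
      have := angles_adj (length_pos_of_one_le hn c) (blockSum_ne_zero hn hw hc) i j hij
      exact ⟨this.1, this.2.le⟩)
    (isNear_letters_blockSum hn hw hz hc)
  have h3 : DifferentiableAt ℂ (fun z : Fin n → ℂ => blockSum c z) z := by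
    unfold blockSum
    fun_prop
  exact DifferentiableAt.comp
    (g := fun y : Fin c.length → ℂ => letterFun (List.ofFn fun k => (angles (blockSum c w) k, y k)))
    (f := fun z : Fin n → ℂ => blockSum c z) z h2 h3

theorem differentiableAt_germFamily {n : ℕ} (hn : 1 ≤ n) {w : Fin n → ℂ} (hw : ∀ i, w i ≠ 0)
    {z : Fin n → ℂ} (hz : ∀ i, (letters w z i).IsNear) :
    DifferentiableAt ℂ (germFamily n w) z := by
  classical
  have h1 : germFamily n w = fun z => ∑ c : Composition n, if BlocksOnRays c w then
      letterFun (List.ofFn (letters (blockSum c w) (blockSum c z))) *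
        ∏ k, expCoeff (c.blocksFun k) else 0 := by
    funext z
    rw [germFamily, germFun, blockComp, sum_parts_ofFn]
    refine Finset.sum_congr rfl fun c _ => ?_
    rw [List.map_ofFn, List.map_ofFn, List.prod_ofFn]
    simp only [Function.comp_def]
    have h2 : BlocksOnRays c w ↔
        ∀ k, SameAngle (List.ofFn fun j => letters w z (c.embedding k j)) := by
      rw [blocksOnRays_iff_angles hn hw]
      refine forall_congr' fun k => ⟨fun h a ha a' ha' => ?_, fun h j j' => ?_⟩
      · obtain ⟨j, rfl⟩ := List.mem_ofFn.1 ha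
        obtain ⟨j', rfl⟩ := List.mem_ofFn.1 ha'
        exact h j j'
      · exact h _ (List.mem_ofFn.2 ⟨j, rfl⟩) _ (List.mem_ofFn.2 ⟨j', rfl⟩)
    by_cases hc : BlocksOnRays c w
    · rw [if_pos hc]
      simp only [merge_ofFn_letters hn hw hc]
      congr 1
      refine Finset.prod_congr rfl fun k _ => ?_
      rw [expFun, if_pos (h2.1 hc k), List.length_ofFn]
    · rw [if_neg hc]
      obtain ⟨k, hk⟩ := not_forall.1 fun h => hc (h2.2 h)
      rw [Finset.prod_eq_zero (Finset.mem_univ k) (if_neg hk), mul_zero]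
  rw [h1]
  refine DifferentiableAt.fun_sum fun c _ => ?_
  split_ifs with hc
  · refine DifferentiableAt.mul_const ?_ _
    exact differentiableAt_letterFun_blockSum hn hw hz hc
  · exact differentiableAt_const _

theorem isOpen_setOf_isNear {n : ℕ} (w : Fin n → ℂ) :
    IsOpen {z : Fin n → ℂ | ∀ i, (letters w z i).IsNear} := by
  simp only [Set.ofPred_forall]
  refine isOpen_iInter_of_finite fun i => ?_
  unfold Letter.IsNear letters
  exact isOpen_lt (by fun_prop) (by fun_prop)

/-- The right-hand side of the continuity and holomorphicity condition as a composition of functions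
of lists of letters. -/
theorem localExpansion_germFamily {n : ℕ} (hn : 1 ≤ n) {w z : Fin n → ℂ} (hw : ∀ i, w i ≠ 0)
    (hz : ∀ i, z i ≠ 0) : localExpansion germFamily w z =
      blockComp merge germFun transitionCoeff (List.ofFn (letters w z)) := by
  classical
  rw [localExpansion, blockComp, sum_parts_ofFn]
  refine Finset.sum_congr rfl fun c _ => ?_
  rw [List.map_ofFn, List.map_ofFn, List.prod_ofFn]
  simp only [Function.comp_def]
  by_cases hc : BlocksOnRays c w
  · rw [if_pos hc]
    have e1 : germFamily c.length (blockSum c w) (blockSum c z) =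
        germFun (List.ofFn fun k => letters (blockSum c w) (blockSum c z) k) := rfl
    simp only [merge_ofFn_letters hn hw hc]
    rw [e1]
    refine congrArg _ (Finset.prod_congr rfl fun k _ => ?_)
    rw [transitionCoeff_ofFn]
    · congr 2
      funext j
      rw [dev_letters hn hw]
    · exact fun j j' => (blocksOnRays_iff_angles hn hw c).1 hc k j j'
    · exact fun j => hz _
  · rw [if_neg hc]
    obtain ⟨k, hk⟩ := not_forall.1 fun h => hc ((blocksOnRays_iff_angles hn hw c).2 h)
    rw [Finset.prod_eq_zero (Finset.mem_univ k), mul_zero]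
    by_contra hcon
    have h1 := sameAngle_of_transitionCoeff_ne_zero hcon
    exact hk fun j j' => h1 _ (List.mem_ofFn.2 ⟨j, rfl⟩) _ (List.mem_ofFn.2 ⟨j', rfl⟩)

/-- The extended family satisfies the continuity and holomorphicity condition. -/
theorem contHolCondition_extFun : ContHolCondition extFun := by
  have key : ∀ (n : ℕ) (w : Fin n → ℂ), ∃ N : Set (Fin n → ℂ), 1 ≤ n → (∀ k, w k ≠ 0) →
      IsOpen N ∧ w ∈ N ∧ ∀ z ∈ N, (∀ k, 0 < (z k * (w k)⁻¹).re) ∧ (∀ i, (letters w z i).IsNear) ∧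
        extFun n z = blockComp merge letterFun localCoeff (List.ofFn (letters w z)) := by
    intro n w
    by_cases hn : 1 ≤ n
    swap
    · exact ⟨∅, fun h => absurd h hn⟩
    by_cases hw : ∀ k, w k ≠ 0
    swap
    · exact ⟨∅, fun _ h => absurd h hw⟩
    have h1 : ∀ᶠ z in 𝓝 w, ∀ k, 0 < (z k * (w k)⁻¹).re := by
      refine eventually_all.2 fun k => ?_
      have : ContinuousAt (fun z : Fin n → ℂ => (z k * (w k)⁻¹).re) w := by fun_prop
      exact this.eventually (lt_mem_nhds (by simp [hw k]))
    have h2 := eventually_isClose hn hw one_pos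
    have h3 := eventually_extFun_eq hn hw
    obtain ⟨N, hN, hNo, hwN⟩ := eventually_nhds_iff.1 (h1.and (h2.and h3))
    exact ⟨N, fun _ _ => ⟨hNo, hwN, fun z hz => ⟨(hN z hz).1, fun i => ((hN z hz).2.1 i).1,
      (hN z hz).2.2⟩⟩⟩
  choose N hN using key
  refine ⟨N, fun n w => {z | ∀ i, (letters w z i).IsNear}, germFamily, fun n hn w hw => ?_⟩
  obtain ⟨h1, h2, h3⟩ := hN n w hn hw
  have hd : DifferentiableOn ℂ (germFamily n w) {z | ∀ i, (letters w z i).IsNear} := fun z hz =>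
    (differentiableAt_germFamily hn hw hz).differentiableWithinAt
  refine ⟨⟨h1, h2, fun z hz => (h3 z hz).1⟩, ⟨isOpen_setOf_isNear w, hd.continuousOn, hd⟩,
    fun z hz c hc k => ?_, fun z hz => ?_⟩
  · exact isNear_letters_blockSum hn hw (h3 z hz).2.1 hc k
  · rw [(h3 z hz).2.2, blockComp_letterFun_localCoeff, localExpansion_germFamily hn hw]
    exact fun i => ((h3 z hz).2.1 i).ne_zero

/-! ### The differential equation for the extended family -/

/-- Only the partition into singletons contributes if `a` vanishes at all blocks in which the first
two letters are related by `R`. -/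
theorem blockComp_eq_of_isChain {R : Letter → Letter → Prop} {φ a : List Letter → ℂ}
    {l : List Letter} (hl : l.IsChain R) (ha : ∀ x y b, a (x :: y :: b) ≠ 0 → ¬ R x y)
    (h1 : ∀ x, a [x] = 1) :
    blockComp merge φ a l = φ l := by
  rw [blockComp, Finset.sum_eq_single_of_mem _ (map_singleton_mem_parts l)]
  · have e1 : (l.map fun x => [x]).map merge = l := by
      rw [List.map_map]
      exact (List.map_congr_left fun x _ => merge_singleton x).trans (List.map_id l)
    have e2 : ((l.map fun x => [x]).map a).prod = 1 := by
      rw [List.map_map]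
      exact List.prod_eq_one fun y hy => by
        obtain ⟨x, _, rfl⟩ := List.mem_map.1 hy
        exact h1 x
    rw [e1, e2, mul_one]
  · intro ls hls hne
    obtain ⟨h2, h0⟩ := mem_parts.1 hls
    rw [← h2, List.isChain_flatten h0] at hl
    by_contra hcon
    have h3 : ∀ b ∈ ls, a b ≠ 0 := fun b hb h =>
      right_ne_zero_of_mul hcon (List.prod_eq_zero (List.mem_map.2 ⟨b, hb, h⟩))
    have h4 : ∀ b ∈ ls, b.length = 1 := by
      intro b hb
      rcases b with _ | ⟨x, _ | ⟨y, b⟩⟩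
      · exact absurd hb h0
      · rfl
      · exact absurd (List.isChain_cons_cons.1 (hl.1 _ hb)).1 (ha x y b (h3 _ hb))
    refine hne (eq_map_singleton_of_mem_parts hls ?_)
    rw [← h2, List.length_flatten, List.map_congr_left h4]
    simp

theorem localCoeff_singleton (x : Letter) : localCoeff [x] = 1 := by
  rw [localCoeff, blockComp, sum_parts_singleton]
  simp [descFun, sameDirFun]

theorem one_le_of_mem {n : ℕ} (i : Fin n) : 1 ≤ n := Nat.one_le_of_lt i.isLt

theorem notMem_posReals_iff {v : ℂ} (hv : v ≠ 0) : v ∉ posReals ↔ -v ∈ Complex.slitPlane := by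
  rw [Complex.mem_slitPlane_iff_not_le_zero, Complex.le_def, Complex.neg_re, Complex.neg_im,
    Complex.zero_re, Complex.zero_im, neg_nonpos, neg_eq_zero, not_iff_not]
  constructor
  · rintro ⟨r, hr, rfl⟩
    have hr' : (0 : ℝ) < r := hr
    exact ⟨by simpa using hr'.le, by simp⟩
  · rintro ⟨h1, h2⟩
    have h3 : v = (v.re : ℝ) := Complex.ext rfl (by rw [h2, Complex.ofReal_im])
    refine ⟨v.re, lt_of_le_of_ne h1 fun h0 => hv ?_, h3.symm⟩
    rw [h3, ← h0, Complex.ofReal_zero]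

theorem isOpen_cutDomain (n : ℕ) : IsOpen (cutDomain n) := by
  refine isOpen_iff_mem_nhds.2 fun z hz => ?_
  have h1 : ∀ᶠ y in 𝓝 z, ∀ i, y i ≠ 0 := eventually_all.2 fun i =>
    (continuous_apply i).continuousAt.eventually_ne (hz.1 i)
  have h2 : ∀ᶠ y in 𝓝 z, ∀ i j : Fin n, (j : ℕ) = i + 1 → -(y j / y i) ∈ Complex.slitPlane := by
    refine eventually_all.2 fun i => eventually_all.2 fun j => ?_
    by_cases hij : (j : ℕ) = i + 1
    · have hc : ContinuousAt (fun y : Fin n → ℂ => -(y j / y i)) z :=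
        ((continuous_apply j).continuousAt.div (continuous_apply i).continuousAt (hz.1 i)).neg
      have h3 := (notMem_posReals_iff (div_ne_zero (hz.1 j) (hz.1 i))).1 (hz.2 i j hij)
      filter_upwards [hc.eventually (Complex.isOpen_slitPlane.mem_nhds h3)] with y hy _ using hy
    · exact Eventually.of_forall fun _ h => absurd h hij
  filter_upwards [h1, h2] with y hy1 hy2
  exact ⟨hy1, fun i j hij => (notMem_posReals_iff (div_ne_zero (hy1 j) (hy1 i))).2 (hy2 i j hij)⟩

theorem angles_ne_of_mem_cutDomain {n : ℕ} {w : Fin n → ℂ} (hw : w ∈ cutDomain n) {i j : Fin n}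
    (hij : (j : ℕ) = i + 1) : angles w i ≠ angles w j := by
  intro h
  have hn := one_le_of_mem i
  refine hw.2 i j hij ⟨‖w j‖ / ‖w i‖, div_pos (norm_pos_iff.2 (hw.1 j)) (norm_pos_iff.2 (hw.1 i)), ?_⟩
  have hi := hw.1 i
  push_cast
  rw [← mul_exp_neg_angles hn hw.1 i, ← mul_exp_neg_angles hn hw.1 j, h,
    mul_div_mul_right _ _ (Complex.exp_ne_zero _)]

theorem angles_mem_contourSet {n : ℕ} {w z : Fin n → ℂ} (hw : w ∈ cutDomain n)
    (hz : ∀ i, (letters w z i).IsNear) :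
    angles w ∈ contourSet fun i => (Letter.lift (letters w z i)).im := by
  have hπ := Real.pi_pos
  refine ⟨fun i => ?_, fun i j hij => ?_⟩
  · have := (hz i).abs_im_lift_sub_lt
    rw [abs_sub_comm] at this
    exact this.trans (by linarith)
  · have h1 := angles_adj (one_le_of_mem i) hw.1 i j hij
    exact ⟨lt_of_le_of_ne h1.1 fun h => angles_ne_of_mem_cutDomain hw hij (by linarith), h1.2⟩

theorem exp_lift_letters {n : ℕ} {w z : Fin n → ℂ} (hz : ∀ i, (letters w z i).IsNear) :
    (fun i => Complex.exp (Letter.lift (letters w z i))) = z :=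
  funext fun i => Letter.exp_lift (hz i).ne_zero

theorem eventually_extFun_eq_chainFun {n : ℕ} (hn : 1 ≤ n) {w : Fin n → ℂ} (hw : w ∈ cutDomain n) :
    ∀ᶠ z in 𝓝 w, extFun n z = chainFun z (dirs (angles w)) := by
  filter_upwards [eventually_extFun_eq hn hw.1, eventually_isClose hn hw.1 one_pos] with z h1 h2
  rw [h1, blockComp_eq_of_isChain (R := fun x y => x.1 ≠ y.1) _ (fun x y b hb h =>
      h (sameAngle_of_localCoeff_ne_zero hb x (by simp) y (by simp))) localCoeff_singleton, letterFun_ofFn,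
    liftFun_eq hn (angles_mem_contourSet hw fun i => (h2 i).1),
    exp_lift_letters fun i => (h2 i).1]
  exact isChain_ofFn.2 fun i j hij => angles_ne_of_mem_cutDomain hw hij

theorem isNear_letters_self {n : ℕ} {w : Fin n → ℂ} (hw : ∀ i, w i ≠ 0) (i : Fin n) :
    (letters w w i).IsNear :=
  ((eventually_isClose (one_le_of_mem i) hw one_pos).self_of_nhds i).1

theorem mem_chainDomain_angles {n : ℕ} {w : Fin n → ℂ} (hw : w ∈ cutDomain n) :
    (w, dirs (angles w)) ∈ chainDomain n := by
  have h1 := mem_chainDomain_of_mem_contourSet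
    (angles_mem_contourSet hw fun i => isNear_letters_self hw.1 i)
  rwa [exp_lift_letters fun i => isNear_letters_self hw.1 i] at h1

theorem dirs_angles {n : ℕ} {w : Fin n → ℂ} (hw : ∀ i, w i ≠ 0) :
    dirs (angles w) = fun i => ‖w i‖ / w i := by
  funext i
  rw [eq_div_iff (hw i), mul_comm]
  exact mul_exp_neg_angles (one_le_of_mem i) hw i

theorem extFun_eq_chainFun {n : ℕ} (hn : 1 ≤ n) {w : Fin n → ℂ} (hw : w ∈ cutDomain n) :
    extFun n w = chainFun w fun i => ‖w i‖ / w i := by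
  rw [← dirs_angles hw.1]
  exact (eventually_extFun_eq_chainFun hn hw).self_of_nhds

theorem initPart_mem_cutDomain {n : ℕ} {z : Fin n → ℂ} (hz : z ∈ cutDomain n) (k : Fin n) :
    initPart z k ∈ cutDomain k :=
  ⟨fun _ => hz.1 _, fun _ _ hij => hz.2 _ _ hij⟩

theorem tailPart_mem_cutDomain {n : ℕ} {z : Fin n → ℂ} (hz : z ∈ cutDomain n) (k : Fin n) :
    tailPart z k ∈ cutDomain (n - k) :=
  ⟨fun _ => hz.1 _, fun i j hij => hz.2 _ _ (by simp only [hij]; omega)⟩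

theorem normalised_extFun : Normalised extFun := by
  intro z hz
  have hz' : z ∈ cutDomain 1 := ⟨hz, fun i j hij => by have := j.isLt; omega⟩
  rw [extFun_eq_chainFun le_rfl hz', ← dirs_angles hz]
  exact chainFun_one ((mem_chainDomain_angles hz').1 0)

theorem isPDESeries_extFun : IsPDESeries extFun := by
  refine ⟨fun n hn w hw => ?_, fun z hz => normalised_extFun z hz.1, fun n hn z hz hne v => ?_,
    fun n hn z hz h0 => ?_⟩
  · exact ((differentiableAt_chainFun hn (mem_chainDomain_angles hw)).congr_of_eventuallyEq
      (eventually_extFun_eq_chainFun hn hw)).differentiableWithinAt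
  · rw [Filter.EventuallyEq.fderiv_eq (eventually_extFun_eq_chainFun hn hz),
      fderiv_chainFun hn (mem_chainDomain_angles hz) hne]
    refine Finset.sum_congr rfl fun k hk => ?_
    have hk' : 0 < (k : ℕ) := (Finset.mem_filter.1 hk).2
    rw [extFun_eq_chainFun hk' (initPart_mem_cutDomain hz k),
      extFun_eq_chainFun (by have := k.isLt; omega) (tailPart_mem_cutDomain hz k), dirs_angles hz.1]
    rfl
  · rw [extFun_eq_chainFun (by omega) hz, chainFun, h0, zero_mul, mul_zero]

theorem isExtendedPDESeries_extFun : IsExtendedPDESeries extFun :=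
  ⟨isPDESeries_extFun, contHolCondition_extFun⟩

/-! ### Invariance under scaling and the growth condition -/

theorem principalFun_smul {n : ℕ} (hn : 1 ≤ n) {l : ℂ} (hl : l ≠ 0) {z : Fin n → ℂ}
    (hz : ∀ i, z i ≠ 0) : principalFun n (fun i => l * z i) = principalFun n z := by
  obtain ⟨u, hu, _⟩ := exists_isLift hz
  have h : IsLift (fun i => u i + Complex.log l) fun i => l * z i := by
    refine ⟨fun i => ?_, fun i j hij => ?_⟩
    · rw [Complex.exp_add, Complex.exp_log hl, hu.1 i, mul_comm]
    · simpa using hu.2 i j hij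
  rw [h.principalFun_eq hn, hu.principalFun_eq hn, liftFun_add_const hn]

theorem BlocksOnRays.smul {n : ℕ} {c : Composition n} {z : Fin n → ℂ} (h : BlocksOnRays c z)
    {l : ℂ} (hl : l ≠ 0) : BlocksOnRays c fun i => l * z i := by
  intro k
  obtain ⟨θ, _, hθ⟩ := h k
  refine ⟨toIcoMod Real.two_pi_pos 0 (θ + l.arg), by
    simpa using toIcoMod_mem_Ico Real.two_pi_pos 0 (θ + l.arg), fun j => ?_⟩
  obtain ⟨ρ, hρ, h1⟩ := hθ j
  refine ⟨‖l‖ * ρ, mul_pos (norm_pos_iff.2 hl) hρ, ?_⟩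
  have h2 : ((toIcoMod Real.two_pi_pos 0 (θ + l.arg) : ℝ) : ℂ) * Complex.I =
      (θ * Complex.I + l.arg * Complex.I) -
        (toIcoDiv Real.two_pi_pos 0 (θ + l.arg) : ℤ) * (2 * Real.pi * Complex.I) := by
    rw [toIcoMod, zsmul_eq_mul]
    push_cast
    ring
  rw [h2, Complex.exp_sub, Complex.exp_int_mul_two_pi_mul_I, div_one, Complex.exp_add]
  change l * z (c.embedding k j) = _
  rw [h1]
  conv_lhs => rw [← Complex.norm_mul_exp_arg_mul_I l]
  push_cast
  ring

theorem scaleInvariant_extFun : ScaleInvariant extFun := by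
  intro n hn l hl z hz
  refine Finset.sum_congr rfl fun c _ => ?_
  have h : BlocksOnRays c (fun i => l * z i) ↔ BlocksOnRays c z := by
    refine ⟨fun h => ?_, fun h => h.smul hl⟩
    have := h.smul (inv_ne_zero hl)
    simpa [inv_mul_cancel_left₀ hl] using this
  by_cases hc : BlocksOnRays c z
  · rw [if_pos hc, if_pos (h.2 hc),
      ← principalFun_smul (length_pos_of_one_le hn c) hl (blockSum_ne_zero hn hz hc)]
    congr 2
    funext k
    rw [blockSum, blockSum, Finset.mul_sum]
  · rw [if_neg hc, if_neg (fun h' => hc (h.1 h'))]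

theorem principalFun_of_eq_one {m : ℕ} (hm : m = 1) {z : Fin m → ℂ} (hz : ∀ i, z i ≠ 0) :
    principalFun m z = (2 * (Real.pi : ℂ) * Complex.I)⁻¹ := by
  subst hm
  obtain ⟨u, hu, _⟩ := exists_isLift hz
  rw [hu.principalFun_eq le_rfl, liftFun_one]

theorem exists_norm_principalFun_le {m : ℕ} (hm : 1 ≤ m) :
    ∃ C : ℝ, ∀ z : Fin m → ℂ, (∀ i, z i ≠ 0) →
      ‖principalFun m z‖ ≤ C * ‖∑ i, z i‖ * ∏ i, ‖z i‖ ^ (-(m : ℝ)⁻¹) := by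
  obtain ⟨C, hC⟩ := exists_norm_liftFun_le hm
  refine ⟨C, fun z hz => ?_⟩
  obtain ⟨u, hu, _⟩ := exists_isLift hz
  have := hC u fun i j hij => ⟨(hu.2 i j hij).1, (hu.2 i j hij).2.le⟩
  simp only [hu.1] at this
  rwa [hu.principalFun_eq hm]

theorem norm_le_norm_blockSum {n : ℕ} {w : Fin n → ℂ} {c : Composition n}
    (hc : BlocksOnRays c w) (k : Fin c.length) (j : Fin (c.blocksFun k)) :
    ‖w (c.embedding k j)‖ ≤ ‖blockSum c w k‖ := by
  obtain ⟨θ, _, h⟩ := hc k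
  choose ρ hρ h1 using h
  have h2 : blockSum c w k = ((∑ j, ρ j : ℝ) : ℂ) * Complex.exp (θ * Complex.I) := by
    rw [blockSum]
    push_cast
    rw [Finset.sum_mul]
    exact Finset.sum_congr rfl fun j _ => h1 j
  rw [h2, h1 j, norm_mul, norm_mul, Complex.norm_real, Complex.norm_real,
    Complex.norm_exp_ofReal_mul_I, mul_one, mul_one, Real.norm_of_nonneg (hρ j).le,
    Real.norm_of_nonneg (Finset.sum_nonneg fun j _ => (hρ j).le)]
  exact Finset.single_le_sum (fun j _ => (hρ j).le) (Finset.mem_univ j)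

theorem sum_blockSum {n : ℕ} (c : Composition n) (z : Fin n → ℂ) :
    ∑ k, blockSum c z k = ∑ i, z i := by
  unfold blockSum
  rw [← Fintype.sum_sigma' (fun k (j : Fin (c.blocksFun k)) => z (c.embedding k j))]
  exact c.blocksFinEquiv.sum_comp z

open Asymptotics in
theorem rpow_isLittleO : (fun t : ℂ => ‖t‖ ^ (-(2 : ℝ)⁻¹)) =o[𝓝[≠] (0 : ℂ)] (fun t : ℂ => ‖t‖⁻¹) := by
  refine isLittleO_of_tendsto' ?_ ?_
  · filter_upwards [self_mem_nhdsWithin] with t ht h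
    exact absurd (norm_eq_zero.1 (inv_eq_zero.1 h)) ht
  · have h1 : Tendsto (fun t : ℂ => ‖t‖ ^ (2 : ℝ)⁻¹) (𝓝[≠] (0 : ℂ)) (𝓝 0) := by
      have h2 : ContinuousAt (fun t : ℂ => ‖t‖ ^ (2 : ℝ)⁻¹) 0 :=
        continuous_norm.continuousAt.rpow_const (Or.inr (by norm_num))
      have h3 : ‖(0 : ℂ)‖ ^ (2 : ℝ)⁻¹ = 0 := by
        rw [norm_zero]
        exact Real.zero_rpow (by norm_num)
      have h4 := h2.tendsto
      rw [h3] at h4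
      exact h4.mono_left nhdsWithin_le_nhds
    refine h1.congr' ?_
    filter_upwards [self_mem_nhdsWithin] with t ht
    have h0 : 0 < ‖t‖ := norm_pos_iff.2 ht
    rw [div_inv_eq_mul, ← Real.rpow_add_one h0.ne']
    norm_num

open Asymptotics in
/-- For more than one block the uniform bound gives `O(|z_k| ^ (-1/2))`, as each variable lies in
one block, whose sum has at least the absolute value of its first variable; a single block
contributes a bounded term. -/
theorem growthBound_extFun : GrowthBound extFun := by
  classical
  intro n hn k z hz
  rw [isLittleO_norm_left]
  unfold extFun
  refine IsLittleO.fun_sum fun c _ => ?_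
  refine IsBigO.trans_isLittleO ?_ rpow_isLittleO
  set κ : ℂ := ∏ k, ((c.blocksFun k).factorial : ℂ)⁻¹
  have hball : ∀ᶠ t : ℂ in 𝓝[≠] 0, t ≠ 0 ∧ ‖t‖ < 1 := by
    refine eventually_mem_nhdsWithin.and ?_
    have := Metric.ball_mem_nhds (0 : ℂ) one_pos
    filter_upwards [nhdsWithin_le_nhds this] with t ht
    simpa using ht
  have hne : ∀ t : ℂ, t ≠ 0 → ∀ i, Function.update z k t i ≠ 0 := by
    intro t ht i
    rcases eq_or_ne i k with rfl | hi
    · simpa using ht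
    · simpa [hi] using hz i
  have hone : ∀ t : ℂ, t ≠ 0 → ‖t‖ < 1 → 1 ≤ ‖t‖ ^ (-(2 : ℝ)⁻¹) := fun t h0 h1 =>
    Real.one_le_rpow_of_pos_of_le_one_of_nonpos (norm_pos_iff.2 h0) h1.le (by norm_num)
  rcases Nat.lt_or_ge 1 c.length with hm | hm
  swap
  · refine IsBigO.of_bound (‖(2 * (Real.pi : ℂ) * Complex.I)⁻¹‖ * ‖κ‖) ?_
    filter_upwards [hball] with t ⟨h0, h1⟩
    have h2 := hone t h0 h1
    rw [Real.norm_of_nonneg (by positivity)]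
    split_ifs with hc
    · rw [principalFun_of_eq_one (le_antisymm hm (length_pos_of_one_le hn c))
        (blockSum_ne_zero hn (hne t h0) hc), norm_mul]
      exact le_mul_of_one_le_right (by positivity) h2
    · rw [norm_zero]
      positivity
  obtain ⟨C, hC⟩ := exists_norm_principalFun_le (length_pos_of_one_le hn c)
  set m := c.length
  let first : Fin m → Fin n := fun b => c.embedding b ⟨0, c.one_le_blocksFun b⟩
  have hfirst : Function.Injective first := by
    intro b b' h
    have h1 := c.index_embedding b ⟨0, c.one_le_blocksFun b⟩
    have h2 := c.index_embedding b' ⟨0, c.one_le_blocksFun b'⟩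
    simp only [first] at h
    rw [← h1, h, h2]
  -- the only factor that is not bounded belongs to the block which begins with `z_k`
  let f : Fin m → ℝ := fun b => if first b = k then 1 else ‖z (first b)‖ ^ (-(m : ℝ)⁻¹)
  have hf : ∀ b, 0 ≤ f b := fun b => by
    simp only [f]
    split_ifs
    · exact zero_le_one
    · positivity
  have hprod : ∀ t : ℂ, t ≠ 0 → ‖t‖ < 1 →
      ∏ b, ‖Function.update z k t (first b)‖ ^ (-(m : ℝ)⁻¹) ≤
        (∏ b, f b) * ‖t‖ ^ (-(2 : ℝ)⁻¹) := by
    intro t h0 h1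
    have ht := norm_pos_iff.2 h0
    have hmr : (-(2 : ℝ)⁻¹) ≤ -(m : ℝ)⁻¹ := by
      have : (2 : ℝ) ≤ m := by exact_mod_cast hm
      exact neg_le_neg (inv_anti₀ (by norm_num) this)
    have h2 : ‖t‖ ^ (-(m : ℝ)⁻¹) ≤ ‖t‖ ^ (-(2 : ℝ)⁻¹) :=
      Real.rpow_le_rpow_of_exponent_ge ht h1.le hmr
    have h3 : ∀ b, ‖Function.update z k t (first b)‖ ^ (-(m : ℝ)⁻¹) =
        f b * if first b = k then ‖t‖ ^ (-(m : ℝ)⁻¹) else 1 := by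
      intro b
      simp only [f]
      split_ifs with h
      · rw [h]
        simp
      · simp [h]
    simp only [h3]
    rw [Finset.prod_mul_distrib]
    refine mul_le_mul_of_nonneg_left ?_ (Finset.prod_nonneg fun b _ => hf b)
    by_cases hb : ∃ b, first b = k
    · obtain ⟨b, hb⟩ := hb
      rw [Finset.prod_eq_single_of_mem b (Finset.mem_univ b), if_pos hb]
      · exact h2
      · intro b' _ hne
        exact if_neg fun h => hne (hfirst (h.trans hb.symm))
    · push Not at hb
      rw [Finset.prod_eq_one fun b _ => if_neg (hb b)]
      exact hone t h0 h1
  refine IsBigO.of_bound (|C| * (∑ i, ‖z i‖ + 1) * (∏ b, f b) * ‖κ‖) ?_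
  filter_upwards [hball] with t ⟨h0, h1⟩
  have hs : 0 ≤ ∑ i, ‖z i‖ + 1 := by positivity
  have hfp : 0 ≤ ∏ b, f b := Finset.prod_nonneg fun b _ => hf b
  rw [Real.norm_of_nonneg (by positivity)]
  split_ifs with hc
  swap
  · rw [norm_zero]
    positivity
  have h2 := hC _ (blockSum_ne_zero hn (hne t h0) hc)
  have h3 : ‖∑ b, blockSum c (Function.update z k t) b‖ ≤ ∑ i, ‖z i‖ + 1 := by
    rw [sum_blockSum]
    refine (norm_sum_le _ _).trans ?_
    have h4 : ∀ i, ‖Function.update z k t i‖ ≤ ‖z i‖ + if i = k then 1 else 0 := by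
      intro i
      rcases eq_or_ne i k with rfl | hi
      · simp only [Function.update_self, if_true]
        linarith [norm_nonneg (z i)]
      · simp [hi]
    refine (Finset.sum_le_sum fun i _ => h4 i).trans ?_
    rw [Finset.sum_add_distrib]
    simp
  have h5 : ∏ b, ‖blockSum c (Function.update z k t) b‖ ^ (-(m : ℝ)⁻¹) ≤
      (∏ b, f b) * ‖t‖ ^ (-(2 : ℝ)⁻¹) := by
    refine le_trans (Finset.prod_le_prod (fun b _ => by positivity) fun b _ => ?_) (hprod t h0 h1)
    refine Real.rpow_le_rpow_of_nonpos (norm_pos_iff.2 (hne t h0 _))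
      (norm_le_norm_blockSum hc b _) ?_
    rw [neg_nonpos]
    positivity
  rw [norm_mul]
  calc _ ≤ (C * ‖∑ b, blockSum c (Function.update z k t) b‖ *
        ∏ b, ‖blockSum c (Function.update z k t) b‖ ^ (-(m : ℝ)⁻¹)) * ‖κ‖ := by gcongr
    _ ≤ (|C| * (∑ i, ‖z i‖ + 1) * ((∏ b, f b) * ‖t‖ ^ (-(2 : ℝ)⁻¹))) * ‖κ‖ := by
        gcongr
        exact le_abs_self C
    _ = _ := by ring

/-! ### Symmetrisation -/

theorem sum_perm_chainKernel {n : ℕ} (hn : 1 < n) {x : Fin n → ℂ} (hx : Function.Injective x) :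
    ∑ σ : Equiv.Perm (Fin n), chainKernel (fun i => x (σ i)) = 0 := by
  obtain ⟨m, rfl⟩ : ∃ m, n = m + 2 := ⟨n - 2, by omega⟩
  -- the kernel, closed up to a cycle, is invariant under rotations
  let cyc : Equiv.Perm (Fin (m + 2)) → ℂ := fun σ => ∏ i, (x (σ i) - x (σ (i + 1)))⁻¹
  have h1 : ∀ σ : Equiv.Perm (Fin (m + 2)), chainKernel (fun i => x (σ i)) =
      cyc σ * x (σ (Fin.last _)) - cyc σ * x (σ 0) := by
    intro σ
    have hne : x (σ (Fin.last (m + 1))) - x (σ 0) ≠ 0 := by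
      refine sub_ne_zero.2 fun h => ?_
      have := σ.injective (hx h)
      simp [Fin.ext_iff] at this
    have h2 : cyc σ = chainKernel (fun i => x (σ i)) * (x (σ (Fin.last (m + 1))) - x (σ 0))⁻¹ := by
      simp only [cyc]
      rw [Fin.prod_univ_castSucc, Fin.last_add_one, chainKernel]
      congr 1
      rw [show m + 2 - 1 = m + 1 from rfl, Finset.prod_range]
      refine Finset.prod_congr rfl fun i _ => ?_
      rw [seqExt_of_lt _ (by omega), seqExt_of_lt _ (by omega), Fin.coeSucc_eq_succ]
      rfl
    rw [← mul_sub, h2, mul_assoc, inv_mul_cancel₀ hne, mul_one]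
  have h3 : ∑ σ : Equiv.Perm (Fin (m + 2)), cyc σ * x (σ (Fin.last _)) =
      ∑ σ : Equiv.Perm (Fin (m + 2)), cyc σ * x (σ 0) := by
    rw [← Equiv.sum_comp (Equiv.mulRight (Equiv.addRight (1 : Fin (m + 2))))]
    refine Finset.sum_congr rfl fun σ _ => ?_
    have h4 : cyc (σ * Equiv.addRight (1 : Fin (m + 2))) = cyc σ :=
      Equiv.prod_comp (Equiv.addRight (1 : Fin (m + 2))) fun i => (x (σ i) - x (σ (i + 1)))⁻¹
    simp only [Equiv.coe_mulRight, h4, Equiv.Perm.mul_apply, Equiv.coe_addRight, Fin.last_add_one]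
  rw [Finset.sum_congr rfl fun σ _ => h1 σ, Finset.sum_sub_distrib, h3, sub_self]

/-- The symmetrised integrand vanishes pointwise on generic rays. -/
theorem sum_perm_chainIntegral {n : ℕ} (hn : 1 < n) {z d : Fin n → ℂ}
    (hd : ∀ i j, i ≠ j → -(d i * Star.star (d j)) ∈ Complex.slitPlane)
    (h : ∀ σ : Equiv.Perm (Fin n), ((fun i => z (σ i)), fun i => d (σ i)) ∈ chainDomain n) :
    ∑ σ : Equiv.Perm (Fin n), chainIntegral (fun i => z (σ i)) (fun i => d (σ i)) = 0 := by
  have hmp : ∀ σ : Equiv.Perm (Fin n), MeasurePreserving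
      (MeasurableEquiv.piCongrLeft (fun _ : Fin n => ℝ) σ.symm) := fun σ =>
    volume_measurePreserving_piCongrLeft (fun _ : Fin n => ℝ) σ.symm
  have happ : ∀ (σ : Equiv.Perm (Fin n)) (s : Fin n → ℝ),
      MeasurableEquiv.piCongrLeft (fun _ : Fin n => ℝ) σ.symm s = fun i => s (σ i) := by
    intro σ s
    funext i
    have := Equiv.piCongrLeft_apply_apply (fun _ : Fin n => ℝ) σ.symm s (σ i)
    simp only [Equiv.symm_apply_apply] at this
    exact this
  have hterm : ∀ (σ : Equiv.Perm (Fin n)) (s : Fin n → ℝ),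
      chainTerm (fun i => z (σ i)) (fun i => d (σ i)) (fun i => s (σ i)) =
        (∏ i, rayPoint d s i * Complex.exp (-(z i * rayPoint d s i))) *
          chainKernel (fun i => rayPoint d s (σ i)) := by
    intro σ s
    rw [chainTerm]
    congr 1
    exact Equiv.prod_comp σ fun i => rayPoint d s i * Complex.exp (-(z i * rayPoint d s i))
  have hint : ∀ σ : Equiv.Perm (Fin n), Integrable fun s : Fin n → ℝ =>
      chainTerm (fun i => z (σ i)) (fun i => d (σ i)) (fun i => s (σ i)) := by
    intro σ
    have h1 := integrable_chainTerm hn.le (h σ)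
    have h2 := ((hmp σ).integrable_comp_emb
      (MeasurableEquiv.measurableEmbedding _)).2 h1
    refine h2.congr (Eventually.of_forall fun s => ?_)
    simp only [Function.comp_def, happ]
  have heq : ∀ σ : Equiv.Perm (Fin n), chainIntegral (fun i => z (σ i)) (fun i => d (σ i)) =
      ∫ s : Fin n → ℝ, chainTerm (fun i => z (σ i)) (fun i => d (σ i)) (fun i => s (σ i)) := by
    intro σ
    rw [chainIntegral, ← (hmp σ).integral_comp (MeasurableEquiv.measurableEmbedding _)]
    simp only [happ]
  rw [Finset.sum_congr rfl fun σ _ => heq σ, ← integral_finsetSum _ fun σ _ => hint σ]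
  refine integral_eq_zero_of_ae (Eventually.of_forall fun s => ?_)
  simp only [hterm, Pi.zero_apply]
  rw [← Finset.mul_sum, sum_perm_chainKernel hn, mul_zero]
  intro i j hij
  by_contra hne
  refine ne_of_neg_mul_star_mem_slitPlane (hd i j hne) (Real.exp_pos (s i)).le (Real.exp_pos (s j)).le
    (by positivity) ?_
  simp only [rayPoint] at hij
  simp [hij]

/-- The symmetrisation of the extended family vanishes where all variables are on different rays. -/
theorem sum_perm_extFun_of_generic {n : ℕ} (hn : 1 < n) {z : Fin n → ℂ} (hz : ∀ i, z i ≠ 0)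
    (hg : ∀ i j, i ≠ j → z j / z i ∉ posReals) :
    ∑ σ : Equiv.Perm (Fin n), extFun n (fun k => z (σ k)) = 0 := by
  have hcut : ∀ σ : Equiv.Perm (Fin n), (fun k => z (σ k)) ∈ cutDomain n := fun σ =>
    ⟨fun i => hz _, fun i j hij => hg _ _ fun h => by
      have := σ.injective h
      omega⟩
  have h1 : ∀ σ : Equiv.Perm (Fin n), extFun n (fun k => z (σ k)) =
      (2 * (Real.pi : ℂ) * Complex.I)⁻¹ ^ n * (∑ i, z i) *
        chainIntegral (fun k => z (σ k)) (fun k => (fun i => (‖z i‖ : ℂ) / z i) (σ k)) := by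
    intro σ
    rw [extFun_eq_chainFun hn.le (hcut σ), chainFun, ← Equiv.sum_comp σ z, ← mul_assoc]
  rw [Finset.sum_congr rfl fun σ _ => h1 σ, ← Finset.mul_sum,
    sum_perm_chainIntegral hn (z := z) (d := fun i => (‖z i‖ : ℂ) / z i), mul_zero]
  · intro i j hij
    have hi := hz i
    have hj := hz j
    have e1 : (‖z i‖ : ℂ) / z i * Star.star ((‖z j‖ : ℂ) / z j) =
        ((‖z i‖ / ‖z j‖ : ℝ) : ℂ) * (z j / z i) := by
      rw [← starRingEnd_apply, map_div₀, Complex.conj_ofReal]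
      have hcj : (starRingEnd ℂ) (z j) ≠ 0 := (map_ne_zero _).2 hj
      have hnj : (‖z j‖ : ℂ) ≠ 0 := by simpa using hj
      have := Complex.mul_conj' (z j)
      push_cast
      field_simp
      linear_combination -(‖z i‖ : ℂ) * this
    have hpos : 0 < ‖z i‖ / ‖z j‖ := div_pos (norm_pos_iff.2 hi) (norm_pos_iff.2 hj)
    have h1 := (notMem_posReals_iff (div_ne_zero hj hi)).1 (hg i j hij)
    rw [Complex.mem_slitPlane_iff] at h1 ⊢
    rw [e1, ← mul_neg, Complex.re_ofReal_mul, Complex.im_ofReal_mul]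
    exact h1.imp (fun h => mul_pos hpos h) (fun h => mul_ne_zero hpos.ne' h)
  · intro σ
    have := mem_chainDomain_angles (hcut σ)
    rwa [dirs_angles (hcut σ).1] at this

open Classical in
theorem sum_perm_strictAnti {m : ℕ} {A : Type*} [LinearOrder A] {f : Fin m → A}
    (hf : Function.Injective f) :
    ∑ ρ : Equiv.Perm (Fin m), (if StrictAnti (fun j => f (ρ j)) then (1 : ℂ) else 0) = 1 := by
  have hg : Function.Injective fun j => OrderDual.toDual (f j) := OrderDual.toDual.injective.comp hf
  have hiff : ∀ ρ : Equiv.Perm (Fin m), StrictAnti (fun j => f (ρ j)) ↔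
      StrictMono ((fun j => OrderDual.toDual (f j)) ∘ ρ) := fun ρ => Iff.rfl
  have h1 : StrictMono ((fun j => OrderDual.toDual (f j)) ∘
      Tuple.sort fun j => OrderDual.toDual (f j)) :=
    (Tuple.monotone_sort _).strictMono_of_injective (hg.comp (Equiv.injective _))
  rw [Finset.sum_eq_single_of_mem (Tuple.sort fun j => OrderDual.toDual (f j)) (Finset.mem_univ _),
    if_pos ((hiff _).2 h1)]
  intro ρ _ hne
  refine if_neg fun h => hne ?_
  have h2 := (StrictMono.range_inj ((hiff ρ).1 h) h1).1 (by
    rw [ρ.surjective.range_comp, Equiv.surjective _ |>.range_comp])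
  exact Equiv.ext fun j => hg (congrFun h2 j)

open Classical in
/-- The number of permutations which decrease on each block is `n! / ∏ |block|!`. -/
theorem sum_perm_strictAnti_blocks {n : ℕ} (c : Composition n) :
    (∑ τ : Equiv.Perm (Fin n), ∏ k,
      if StrictAnti (fun j => τ (c.embedding k j)) then (1 : ℂ) else 0) =
      n.factorial * ∏ k, ((c.blocksFun k).factorial : ℂ)⁻¹ := by
  let E : (∀ k, Equiv.Perm (Fin (c.blocksFun k))) → Equiv.Perm (Fin n) := fun ρ =>
    c.blocksFinEquiv.permCongr (Equiv.Perm.sigmaCongrRight ρ)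
  have hE : ∀ ρ k j, E ρ (c.embedding k j) = c.embedding k (ρ k j) := by
    intro ρ k j
    simp only [E, Equiv.permCongr_apply]
    have h1 : c.blocksFinEquiv.symm (c.embedding k j) = ⟨k, j⟩ := by
      rw [Equiv.symm_apply_eq]
      rfl
    rw [h1]
    rfl
  set N := ∑ τ : Equiv.Perm (Fin n), ∏ k,
      if StrictAnti (fun j => τ (c.embedding k j)) then (1 : ℂ) else 0 with hN
  have h1 : ∀ ρ : (∀ k, Equiv.Perm (Fin (c.blocksFun k))), ∑ τ : Equiv.Perm (Fin n), ∏ k,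
      (if StrictAnti (fun j => τ (c.embedding k (ρ k j))) then (1 : ℂ) else 0) = N := by
    intro ρ
    have h := Equiv.sum_comp (Equiv.mulRight (E ρ)) fun τ : Equiv.Perm (Fin n) => ∏ k,
      if StrictAnti (fun j => τ (c.embedding k j)) then (1 : ℂ) else 0
    simpa only [Equiv.coe_mulRight, Equiv.Perm.mul_apply, hE] using h
  have h2 : ∑ ρ : (∀ k, Equiv.Perm (Fin (c.blocksFun k))), ∑ τ : Equiv.Perm (Fin n), ∏ k,
      (if StrictAnti (fun j => τ (c.embedding k (ρ k j))) then (1 : ℂ) else 0) = n.factorial := by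
    rw [Finset.sum_comm]
    have h3 : ∀ τ : Equiv.Perm (Fin n), ∑ ρ : (∀ k, Equiv.Perm (Fin (c.blocksFun k))), ∏ k,
        (if StrictAnti (fun j => τ (c.embedding k (ρ k j))) then (1 : ℂ) else 0) = 1 := by
      intro τ
      rw [← Fintype.prod_sum fun k (ρ : Equiv.Perm (Fin (c.blocksFun k))) =>
        if StrictAnti (fun j => τ (c.embedding k (ρ j))) then (1 : ℂ) else 0]
      exact Finset.prod_eq_one fun k _ =>
        sum_perm_strictAnti (f := fun j => τ (c.embedding k j))
          (τ.injective.comp (c.embedding k).injective)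
    rw [Finset.sum_congr rfl fun τ _ => h3 τ]
    simp [Fintype.card_perm]
  rw [Finset.sum_congr rfl fun ρ _ => h1 ρ, Finset.sum_const, Finset.card_univ, Fintype.card_pi,
    nsmul_eq_mul] at h2
  simp only [Fintype.card_perm, Fintype.card_fin] at h2
  have h4 : ∀ k, ((c.blocksFun k).factorial : ℂ) ≠ 0 := fun k => by
    exact_mod_cast (Nat.factorial_pos _).ne'
  rw [← h2, Nat.cast_prod, mul_assoc, mul_comm N, ← mul_assoc, ← Finset.prod_mul_distrib,
    Finset.prod_congr rfl fun k _ => mul_inv_cancel₀ (h4 k), Finset.prod_const_one, one_mul]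

theorem localCoeff_of_dev_ne {b : List Letter} (hb : b.IsChain fun x y => x.dev ≠ y.dev) :
    localCoeff b = descFun b := by
  classical
  refine blockComp_eq_of_isChain hb (fun x y b h hne => ?_) fun x => by simp [sameDirFun]
  refine h (if_neg fun h1 => ?_)
  exact hne (List.rel_of_pairwise_cons h1 (by simp)).2

open Classical in
/-- The extended family near `w`, as a sum over ordered partitions whose blocks lie on rays for
`w`. -/
theorem blockComp_letterFun_letters {n : ℕ} (hn : 1 ≤ n) {w : Fin n → ℂ} (hw : ∀ i, w i ≠ 0)
    (z : Fin n → ℂ) : blockComp merge letterFun localCoeff (List.ofFn (letters w z)) =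
      ∑ c : Composition n, if BlocksOnRays c w then
        letterFun (List.ofFn (letters (blockSum c w) (blockSum c z))) *
          ∏ k, localCoeff (List.ofFn fun j => letters w z (c.embedding k j)) else 0 := by
  rw [blockComp, sum_parts_ofFn]
  refine Finset.sum_congr rfl fun c _ => ?_
  rw [List.map_ofFn, List.map_ofFn, List.prod_ofFn]
  simp only [Function.comp_def]
  split_ifs with hc
  · simp only [merge_ofFn_letters hn hw hc]
  · obtain ⟨k, hk⟩ := not_forall.1 fun h => hc ((blocksOnRays_iff_angles hn hw c).2 h)
    rw [Finset.prod_eq_zero (Finset.mem_univ k), mul_zero]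
    by_contra hcon
    have h1 := sameAngle_of_localCoeff_ne_zero hcon
    exact hk fun j j' => h1 _ (List.mem_ofFn.2 ⟨j, rfl⟩) _ (List.mem_ofFn.2 ⟨j', rfl⟩)

theorem letterFun_letters_self {n : ℕ} (hn : 1 ≤ n) {w : Fin n → ℂ} (hw : ∀ i, w i ≠ 0) :
    letterFun (List.ofFn (letters w w)) = principalFun n w := by
  rw [letterFun_ofFn, IsLift.principalFun_eq hn]
  refine ⟨fun i => Letter.exp_lift (hw i), fun i j hij => ?_⟩
  rw [Letter.im_lift, Letter.im_lift, dev_letters hn hw, dev_letters hn hw, div_self (hw i),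
    div_self (hw j), sub_eq_add_neg]
  have := angles_adj hn hw i j hij
  simp only [Complex.arg_one, zero_add, letters]
  constructor <;> linarith [this.1, this.2]

/-- Rotate the variable `w_i` by the angle `ε π(i)`. -/
def perturb {n : ℕ} (π : Equiv.Perm (Fin n)) (w : Fin n → ℂ) (ε : ℝ) (i : Fin n) : ℂ :=
  w i * Complex.exp (((ε * ((π i : Fin n) : ℕ) : ℝ) : ℂ) * Complex.I)

theorem tendsto_perturb {n : ℕ} (π : Equiv.Perm (Fin n)) (w : Fin n → ℂ) :
    Tendsto (perturb π w) (𝓝[>] 0) (𝓝 w) := by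
  have h1 : Continuous (perturb π w) := by
    unfold perturb
    fun_prop
  have h2 := (h1.tendsto 0).mono_left (nhdsWithin_le_nhds (s := Set.Ioi (0 : ℝ)))
  have h3 : perturb π w 0 = w := by
    funext i
    simp [perturb]
  rwa [h3] at h2

theorem perturb_ne_zero {n : ℕ} {π : Equiv.Perm (Fin n)} {w : Fin n → ℂ} {ε : ℝ}
    (hw : ∀ i, w i ≠ 0) (i : Fin n) : perturb π w ε i ≠ 0 :=
  mul_ne_zero (hw i) (Complex.exp_ne_zero _)

theorem eventually_small (n : ℕ) : ∀ᶠ ε in 𝓝[>] (0 : ℝ), 0 < ε ∧ ε * n < Real.pi := by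
  have h : (0 : ℝ) < Real.pi / (n + 1) := by positivity
  filter_upwards [Ioo_mem_nhdsGT h] with ε hε
  refine ⟨hε.1, ?_⟩
  have h1 := (lt_div_iff₀ (by positivity)).1 hε.2
  nlinarith [hε.1]

theorem eventually_perturb_generic {n : ℕ} (π : Equiv.Perm (Fin n)) {w : Fin n → ℂ}
    (hw : ∀ i, w i ≠ 0) : ∀ᶠ ε in 𝓝[>] (0 : ℝ), ∀ i j, i ≠ j →
      perturb π w ε j / perturb π w ε i ∉ posReals := by
  refine eventually_all.2 fun i => eventually_all.2 fun j => ?_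
  by_cases hij : i = j
  · exact Eventually.of_forall fun _ h => absurd hij h
  by_cases hpos : w j / w i ∈ posReals
  · obtain ⟨r, hr, hrw⟩ := hpos
    filter_upwards [eventually_small n] with ε ⟨hε, hεn⟩ _
    rintro ⟨s, hs, hsw⟩
    have hr' : (0 : ℝ) < r := hr
    have hs' : (0 : ℝ) < s := hs
    have h1 : perturb π w ε j / perturb π w ε i = (r : ℂ) *
        Complex.exp (((ε * ((π j : ℕ) - (π i : ℕ)) : ℝ) : ℂ) * Complex.I) := by
      have h2 : ((ε * ((π j : ℕ) - (π i : ℕ)) : ℝ) : ℂ) * Complex.I =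
          ((ε * (π j : ℕ) : ℝ) : ℂ) * Complex.I - ((ε * (π i : ℕ) : ℝ) : ℂ) * Complex.I := by
        push_cast
        ring
      rw [h2, Complex.exp_sub]
      simp only at hrw
      rw [hrw, perturb, perturb]
      have := hw i
      field_simp
    have h3 : (perturb π w ε j / perturb π w ε i).arg = 0 := by
      rw [← hsw]
      exact Complex.arg_ofReal_of_nonneg hs'.le
    have hlt : ∀ k : Fin n, ((k : ℕ) : ℝ) < n := fun k => by exact_mod_cast k.isLt
    have hbound : ε * ((π j : ℕ) - (π i : ℕ)) ∈ Set.Ioc (-Real.pi) Real.pi := by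
      have e1 := hlt (π j)
      have e2 := hlt (π i)
      have e3 : (0 : ℝ) ≤ ((π j : Fin n) : ℕ) := by positivity
      have e4 : (0 : ℝ) ≤ ((π i : Fin n) : ℕ) := by positivity
      constructor <;> nlinarith
    rw [h1, Complex.arg_real_mul _ hr', Complex.arg_exp_mul_I,
      (toIocMod_eq_self Real.two_pi_pos).2 (by convert! hbound using 2; ring)] at h3
    have h4 : ((π j : ℕ) : ℝ) = (π i : ℕ) := by
      have := (mul_eq_zero.1 h3).resolve_left hε.ne'
      linarith
    have h5 : (π j : ℕ) = (π i : ℕ) := by exact_mod_cast h4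
    exact hij (π.injective (Fin.ext h5.symm))
  · have hslit := (notMem_posReals_iff (div_ne_zero (hw j) (hw i))).1 hpos
    have hc : ContinuousAt (fun z : Fin n → ℂ => -(z j / z i)) w :=
      ((continuous_apply j).continuousAt.div (continuous_apply i).continuousAt (hw i)).neg
    have h1 := (tendsto_perturb π w).eventually
      (hc.eventually (Complex.isOpen_slitPlane.mem_nhds hslit))
    filter_upwards [h1] with ε h2 _
    exact (notMem_posReals_iff (div_ne_zero (perturb_ne_zero hw j) (perturb_ne_zero hw i))).2 h2

theorem dev_letters_perturb {n : ℕ} (hn : 1 ≤ n) {π σ : Equiv.Perm (Fin n)} {w : Fin n → ℂ}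
    (hw : ∀ i, w i ≠ 0) {ε : ℝ} (hε : 0 < ε) (hεn : ε * n < Real.pi) (i : Fin n) :
    (letters (fun k => w (σ k)) (fun k => perturb π w ε (σ k)) i).dev =
      ε * ((π (σ i) : Fin n) : ℕ) := by
  rw [dev_letters hn fun i => hw _, perturb, mul_div_cancel_left₀ _ (hw _), Complex.arg_exp_mul_I]
  refine (toIocMod_eq_self Real.two_pi_pos).2 ?_
  have h1 : ((π (σ i) : ℕ) : ℝ) < n := by exact_mod_cast (π (σ i)).isLt
  have h2 : (0 : ℝ) ≤ ((π (σ i) : Fin n) : ℕ) := by positivity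
  have := Real.pi_pos
  constructor <;> nlinarith

open Classical in
/-- At the perturbed points the coefficient of a block tells whether the perturbation has put its
members into clockwise order. -/
theorem localCoeff_perturb {n : ℕ} (hn : 1 ≤ n) {π σ : Equiv.Perm (Fin n)} {w : Fin n → ℂ}
    (hw : ∀ i, w i ≠ 0) {c : Composition n} (hc : BlocksOnRays c fun k => w (σ k)) {ε : ℝ}
    (hε : 0 < ε) (hεn : ε * n < Real.pi) (k : Fin c.length) :
    localCoeff (List.ofFn fun j =>
      letters (fun k => w (σ k)) (fun k => perturb π w ε (σ k)) (c.embedding k j)) =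
        if StrictAnti (fun j => (π * σ) (c.embedding k j)) then 1 else 0 := by
  have hdev := dev_letters_perturb hn (π := π) (σ := σ) hw hε hεn
  have hang := (blocksOnRays_iff_angles hn (fun i => hw _) c).1 hc
  rw [localCoeff_of_dev_ne, descFun]
  · congr 1
    rw [eq_iff_iff, List.isChain_iff_pairwise, List.pairwise_ofFn]
    constructor
    · intro h j j' hj
      have h1 := (h hj).2
      rw [hdev, hdev] at h1
      have h2 := lt_of_mul_lt_mul_left h1 hε.le
      exact_mod_cast h2
    · intro h j j' hj
      refine ⟨hang k j j', ?_⟩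
      rw [hdev, hdev]
      have h1 : (π (σ (c.embedding k j')) : ℕ) < π (σ (c.embedding k j)) := h hj
      have h2 : ((π (σ (c.embedding k j')) : ℕ) : ℝ) < (π (σ (c.embedding k j)) : ℕ) := by
        exact_mod_cast h1
      exact mul_lt_mul_of_pos_left h2 hε
  · refine isChain_ofFn.2 fun i j hij h => ?_
    rw [hdev, hdev] at h
    have h1 : ((π (σ (c.embedding k i)) : ℕ) : ℝ) = (π (σ (c.embedding k j)) : ℕ) :=
      mul_left_cancel₀ hε.ne' h
    have h2 : (π (σ (c.embedding k i)) : ℕ) = π (σ (c.embedding k j)) := by exact_mod_cast h1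
    have h3 := (c.embedding k).injective (σ.injective (π.injective (Fin.ext h2)))
    rw [h3] at hij
    omega

/-- The symmetrisation vanishes at generic points; at a special point `w` it is the limit of an
average of symmetrisations at generic points, over the orders in which the variables can be rotated
into a generic position. -/
theorem symmetrisationVanishes_extFun : SymmetrisationVanishes extFun := by
  classical
  intro n hn1 w hw
  have hn : 1 ≤ n := hn1.le
  have hwσ : ∀ σ : Equiv.Perm (Fin n), ∀ i, w (σ i) ≠ 0 := fun σ i => hw _
  -- the limit of each summand
  let T : Equiv.Perm (Fin n) → Equiv.Perm (Fin n) → ℂ := fun σ π =>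
    ∑ c : Composition n, if BlocksOnRays c (fun k => w (σ k)) then
      principalFun c.length (blockSum c fun k => w (σ k)) *
        ∏ k, (if StrictAnti (fun j => (π * σ) (c.embedding k j)) then (1 : ℂ) else 0) else 0
  have hpσ : ∀ σ π : Equiv.Perm (Fin n), Tendsto (fun ε i => perturb π w ε (σ i)) (𝓝[>] 0)
      (𝓝 fun i => w (σ i)) := fun σ π =>
    tendsto_pi_nhds.2 fun i => (tendsto_pi_nhds.1 (tendsto_perturb π w)) (σ i)
  have hlim : ∀ σ π : Equiv.Perm (Fin n), Tendsto (fun ε => extFun n fun i => perturb π w ε (σ i))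
      (𝓝[>] 0) (𝓝 (T σ π)) := by
    intro σ π
    have h1 := (hpσ σ π).eventually (eventually_extFun_eq hn (hwσ σ))
    have h2 : Tendsto (fun ε => ∑ c : Composition n, if BlocksOnRays c (fun k => w (σ k)) then
        letterFun (List.ofFn (letters (blockSum c fun k => w (σ k))
          (blockSum c fun i => perturb π w ε (σ i)))) *
          ∏ k, (if StrictAnti (fun j => (π * σ) (c.embedding k j)) then (1 : ℂ) else 0) else 0)
        (𝓝[>] 0) (𝓝 (T σ π)) := by
      refine tendsto_finsetSum _ fun c _ => ?_
      split_ifs with hc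
      · refine Tendsto.mul_const _ ?_
        rw [← letterFun_letters_self (length_pos_of_one_le hn c)
          (blockSum_ne_zero hn (hwσ σ) hc)]
        exact ((differentiableAt_letterFun_blockSum hn (hwσ σ)
          (isNear_letters_self (hwσ σ)) hc).continuousAt.tendsto).comp (hpσ σ π)
      · exact tendsto_const_nhds
    refine h2.congr' ?_
    filter_upwards [h1, eventually_small n] with ε h3 ⟨h4, h5⟩
    rw [h3, blockComp_letterFun_letters hn (hwσ σ)]
    refine Finset.sum_congr rfl fun c _ => ?_
    split_ifs with hc
    · congr 1
      exact Finset.prod_congr rfl fun k _ => (localCoeff_perturb hn hw hc h4 h5 k).symm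
    · rfl
  have hsum : ∑ π, ∑ σ, T σ π = 0 := by
    refine tendsto_nhds_unique (tendsto_finsetSum Finset.univ fun π _ =>
      tendsto_finsetSum Finset.univ fun σ _ => hlim σ π) (tendsto_const_nhds.congr' ?_)
    have h1 : ∀ᶠ ε in 𝓝[>] (0 : ℝ), ∀ π : Equiv.Perm (Fin n), ∀ i j, i ≠ j →
        perturb π w ε j / perturb π w ε i ∉ posReals :=
      eventually_all.2 fun π => eventually_perturb_generic π hw
    filter_upwards [h1] with ε h2
    exact (Finset.sum_eq_zero fun π _ =>
      sum_perm_extFun_of_generic hn1 (perturb_ne_zero hw) (h2 π)).symm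
  have hT : ∀ σ, ∑ π, T σ π = n.factorial * extFun n (fun k => w (σ k)) := by
    intro σ
    simp only [T]
    rw [Finset.sum_comm, extFun, Finset.mul_sum]
    refine Finset.sum_congr rfl fun c _ => ?_
    split_ifs with hc
    · rw [← Finset.mul_sum]
      have h1 := Equiv.sum_comp (Equiv.mulRight σ) fun τ : Equiv.Perm (Fin n) => ∏ k,
        if StrictAnti (fun j => τ (c.embedding k j)) then (1 : ℂ) else 0
      simp only [Equiv.coe_mulRight] at h1
      refine (congrArg _ (Eq.trans ?_ (sum_perm_strictAnti_blocks c))).trans (by ring)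
      convert! h1
    · simp
  rw [Finset.sum_comm, Finset.sum_congr rfl fun σ _ => hT σ, ← Finset.mul_sum] at hsum
  refine (mul_eq_zero.1 hsum).resolve_left ?_
  exact_mod_cast (Nat.factorial_pos n).ne'

/-! ### Uniqueness -/

theorem transitionCoeff_singleton (x : Letter) : transitionCoeff [x] = 1 := by
  rw [transitionCoeff, blockComp, sum_parts_singleton]
  simp [logFun, SameAngle, logCoeff, localCoeff_singleton]

theorem localU_arg_of_eq_one {m : ℕ} (hm : m = 1) {v : Fin m → ℂ} (hv : ∀ i, v i ≠ 0) :
    (localU (fun i => (v i).arg) : ℂ) = 1 := by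
  subst hm
  have h := transitionCoeff_ofFn (x := fun i : Fin 1 => ((0, v i) : Letter)) (fun _ _ => rfl) hv
  have h1 : (fun i : Fin 1 => (v i).arg) = fun i => Letter.dev (0, v i) := by
    funext i
    simp [Letter.dev]
  rw [h1, ← h]
  simp [transitionCoeff_singleton]

theorem blocksOnRays_ones {n : ℕ} (hn : 1 ≤ n) {w : Fin n → ℂ} (hw : ∀ i, w i ≠ 0) :
    BlocksOnRays (Composition.ones n) w := by
  rw [blocksOnRays_iff_angles hn hw]
  intro k j j'
  have h1 : j = j' := by
    have h2 := (Composition.ones n).blocksFun k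
    have h3 := Composition.ones_blocksFun n k
    exact Fin.ext (by have := j.isLt; have := j'.isLt; omega)
  rw [h1]

theorem ofFn_blockSum_ones {n : ℕ} (w z : Fin n → ℂ) :
    (List.ofFn fun k => (blockSum (Composition.ones n) w k, blockSum (Composition.ones n) z k)) =
      List.ofFn fun i => (w i, z i) := by
  have key : ∀ (y : Fin n → ℂ) (i : ℕ) (h : i < (Composition.ones n).length) (h' : i < n),
      blockSum (Composition.ones n) y ⟨i, h⟩ = y ⟨i, h'⟩ := by
    intro y i h h'
    have h1 := Composition.ones_blocksFun n ⟨i, h⟩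
    rw [blockSum]
    have h2 : ∀ j, (Composition.ones n).embedding ⟨i, h⟩ j = ⟨i, h'⟩ := by
      intro j
      have hj : (j : ℕ) = 0 := by have := j.isLt; omega
      refine Fin.ext ?_
      rw [Composition.coe_embedding, hj, Composition.ones_sizeUpTo]
      simp [h'.le]
    simp only [h2, Finset.sum_const, Finset.card_univ, Fintype.card_fin, h1, one_smul]
  refine List.ext_getElem (by simp [Composition.ones_length]) fun i h1 h2 => ?_
  simp only [List.length_ofFn] at h1 h2
  simp only [List.getElem_ofFn]
  rw [key w i h1 h2, key z i h1 h2]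

theorem apply_blockSum_ones {B : Type*} (Φ : (m : ℕ) → (Fin m → ℂ) → (Fin m → ℂ) → B) {n : ℕ}
    (w z : Fin n → ℂ) :
    Φ (Composition.ones n).length (blockSum (Composition.ones n) w)
      (blockSum (Composition.ones n) z) = Φ n w z := by
  have h1 := onList_ofFn (fun (m : ℕ) (x : Fin m → ℂ × ℂ) => Φ m (fun i => (x i).1) fun i => (x i).2)
    (fun k => (blockSum (Composition.ones n) w k, blockSum (Composition.ones n) z k))
  have h2 := onList_ofFn (fun (m : ℕ) (x : Fin m → ℂ × ℂ) => Φ m (fun i => (x i).1) fun i => (x i).2)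
    (fun i => (w i, z i))
  rw [ofFn_blockSum_ones] at h1
  exact h1.symm.trans h2

/-- If the local functions of two families agree for fewer variables, then the families differ by
the difference of their local functions. -/
theorem localExpansion_sub_localExpansion {n : ℕ} (hn : 1 ≤ n)
    {G G' : (m : ℕ) → (Fin m → ℂ) → (Fin m → ℂ) → ℂ} {w : Fin n → ℂ} (hw : ∀ i, w i ≠ 0)
    (h : ∀ m, 1 ≤ m → m < n → ∀ w : Fin m → ℂ, (∀ i, w i ≠ 0) → ∀ᶠ z in 𝓝 w, G m w z = G' m w z) :
    ∀ᶠ z in 𝓝 w, localExpansion G w z - localExpansion G' w z = G n w z - G' n w z := by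
  classical
  have h1 : ∀ᶠ z in 𝓝 w, ∀ c : Composition n, c ≠ Composition.ones n → BlocksOnRays c w →
      G c.length (blockSum c w) (blockSum c z) = G' c.length (blockSum c w) (blockSum c z) := by
    refine eventually_all.2 fun c => ?_
    by_cases hc : c ≠ Composition.ones n ∧ BlocksOnRays c w
    · have h2 : c.length < n := lt_of_le_of_ne c.length_le fun h2 =>
        hc.1 (Composition.eq_ones_iff_length.2 h2)
      have h3 := h _ (length_pos_of_one_le hn c) h2 _ (blockSum_ne_zero hn hw hc.2)
      have hcont : Continuous fun z : Fin n → ℂ => blockSum c z := by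
        unfold blockSum
        fun_prop
      filter_upwards [(hcont.tendsto w).eventually h3] with z hz _ _ using hz
    · exact Eventually.of_forall fun _ h2 h3 => absurd ⟨h2, h3⟩ hc
  have h0 : ∀ᶠ z in 𝓝 w, ∀ i, z i ≠ 0 := eventually_all.2 fun i =>
    (continuous_apply i).continuousAt.eventually_ne (hw i)
  filter_upwards [h1, h0] with z hz hz0
  rw [localExpansion, localExpansion, ← Finset.sum_sub_distrib,
    Finset.sum_eq_single_of_mem (Composition.ones n) (Finset.mem_univ _)]
  · rw [if_pos (blocksOnRays_ones hn hw), if_pos (blocksOnRays_ones hn hw), apply_blockSum_ones G,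
      apply_blockSum_ones G', Finset.prod_eq_one, mul_one, mul_one]
    intro k _
    exact localU_arg_of_eq_one (Composition.ones_blocksFun n k)
      (v := fun j => z ((Composition.ones n).embedding k j) / w ((Composition.ones n).embedding k j))
      fun j => div_ne_zero (hz0 _) (hw _)
  · intro c _ hc
    split_ifs with hc'
    · rw [hz c hc hc', sub_self]
    · rw [sub_zero]

/-- The difference of two solutions of the continuity and holomorphicity condition which agree for
fewer variables is holomorphic. -/
theorem ContHolCondition.differentiableAt_sub {F F' : (n : ℕ) → (Fin n → ℂ) → ℂ}
    (hF : ContHolCondition F) (hF' : ContHolCondition F') {n : ℕ} (hn : 1 ≤ n)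
    (h : ∀ m, 1 ≤ m → m < n → ∀ z : Fin m → ℂ, (∀ i, z i ≠ 0) → F m z = F' m z)
    {w : Fin n → ℂ} (hw : ∀ i, w i ≠ 0) : DifferentiableAt ℂ (fun z => F n z - F' n z) w := by
  obtain ⟨N, D, G, hG⟩ := hF
  obtain ⟨N', D', G', hG'⟩ := hF'
  have hsub : ∀ m, 1 ≤ m → ∀ w : Fin m → ℂ, (∀ i, w i ≠ 0) →
      ∀ᶠ z in 𝓝 w, F m z - F' m z = localExpansion G w z - localExpansion G' w z := by
    intro m hm w hw
    obtain ⟨⟨h1, h2, _⟩, _, _, h3⟩ := hG m hm w hw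
    obtain ⟨⟨h1', h2', _⟩, _, _, h3'⟩ := hG' m hm w hw
    filter_upwards [h1.mem_nhds h2, h1'.mem_nhds h2'] with z hz hz'
    rw [h3 z hz, h3' z hz']
  have hlocal : ∀ m, 1 ≤ m → m < n → ∀ w : Fin m → ℂ, (∀ i, w i ≠ 0) →
      ∀ᶠ z in 𝓝 w, G m w z = G' m w z := by
    intro m
    induction m using Nat.strong_induction_on with
    | _ m ih =>
      intro hm hmn w hw
      have h0 : ∀ᶠ z in 𝓝 w, ∀ i, z i ≠ 0 := eventually_all.2 fun i =>
        (continuous_apply i).continuousAt.eventually_ne (hw i)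
      filter_upwards [hsub m hm w hw, localExpansion_sub_localExpansion hm (G := G) (G' := G') hw
        fun k hk hkm => ih k hkm hk (hkm.trans hmn), h0] with z h1 h2 h3
      rw [h m hm hmn z h3, sub_self] at h1
      rw [← h1] at h2
      exact (sub_eq_zero.1 h2.symm)
  have hdiff : ∀ (G : (m : ℕ) → (Fin m → ℂ) → (Fin m → ℂ) → ℂ)
      (N D : (n : ℕ) → (Fin n → ℂ) → Set (Fin n → ℂ)), w ∈ N n w → IsOpen (D n w) →
      DifferentiableOn ℂ (G n w) (D n w) →
      (∀ z ∈ N n w, ∀ c : Composition n, BlocksOnRays c w →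
        blockSum c z ∈ D c.length (blockSum c w)) → DifferentiableAt ℂ (G n w) w := by
    intro G N D h1 h2 h3 h4
    have h5 := h4 w h1 _ (blocksOnRays_ones hn hw)
    rw [apply_blockSum_ones (fun m w z => z ∈ D m w)] at h5
    exact (h3 w h5).differentiableAt (h2.mem_nhds h5)
  obtain ⟨⟨_, h2, _⟩, ⟨h3, _, h4⟩, h5, _⟩ := hG n hn w hw
  obtain ⟨⟨_, h2', _⟩, ⟨h3', _, h4'⟩, h5', _⟩ := hG' n hn w hw
  refine ((hdiff G N D h2 h3 h4 h5).sub (hdiff G' N' D' h2' h3' h4' h5')).congr_of_eventuallyEq ?_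
  filter_upwards [hsub n hn w hw, localExpansion_sub_localExpansion hn hw hlocal] with z h6 h7
  rw [h6, h7]
  rfl

theorem exists_differentiable_of_isLittleO {g : ℂ → ℂ} (hd : ∀ t ≠ 0, DifferentiableAt ℂ g t)
    (hg : g =o[𝓝[≠] (0 : ℂ)] fun t : ℂ => t⁻¹) :
    ∃ h : ℂ → ℂ, Differentiable ℂ h ∧ ∀ t ≠ 0, h t = g t := by
  refine ⟨Function.update g 0 (limUnder (𝓝[≠] 0) g), ?_, fun t ht => Function.update_of_ne ht _ _⟩
  rw [← differentiableOn_univ]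
  refine Complex.differentiableOn_update_limUnder_of_isLittleO univ_mem
    (fun t ht => (hd t ht.2).differentiableWithinAt) ?_
  simp only [sub_zero]
  refine hg.sub ?_
  rw [Asymptotics.isLittleO_const_left]
  right
  exact tendsto_norm_inv_nhdsNE_zero_atTop

/-- A scale invariant holomorphic function on `(ℂ^×)^n` whose growth at the coordinate hyperplanes
is smaller than that of a simple pole is constant: it extends to each hyperplane, is bounded by the
maximum principle and homogeneity, and Liouville's theorem applies in each variable. -/
theorem eq_of_scaleInvariant_of_isLittleO {n : ℕ} {f : (Fin n → ℂ) → ℂ}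
    (hd : ∀ z : Fin n → ℂ, (∀ i, z i ≠ 0) → DifferentiableAt ℂ f z)
    (hs : ∀ l : ℂ, l ≠ 0 → ∀ z : Fin n → ℂ, (∀ i, z i ≠ 0) → f (fun k => l * z k) = f z)
    (hg : ∀ (k : Fin n) (z : Fin n → ℂ), (∀ i, z i ≠ 0) →
      (fun t : ℂ => f (Function.update z k t)) =o[𝓝[≠] (0 : ℂ)] fun t : ℂ => t⁻¹)
    {z w : Fin n → ℂ} (hz : ∀ i, z i ≠ 0) (hw : ∀ i, w i ≠ 0) : f z = f w := by
  classical
  have hupd : ∀ (k : Fin n) (z : Fin n → ℂ), (∀ i, z i ≠ 0) → ∀ t : ℂ, t ≠ 0 →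
      ∀ i, Function.update z k t i ≠ 0 := by
    intro k z hz t ht i
    rcases eq_or_ne i k with rfl | h
    · simpa using ht
    · simpa [h] using hz i
  have hext : ∀ (k : Fin n) (z : Fin n → ℂ), (∀ i, z i ≠ 0) →
      ∃ h : ℂ → ℂ, Differentiable ℂ h ∧ ∀ t ≠ 0, h t = f (Function.update z k t) := by
    intro k z hz
    refine exists_differentiable_of_isLittleO (fun t ht => ?_) (hg k z hz)
    exact (hd _ (hupd k z hz t ht)).comp t (hasDerivAt_update z k t).differentiableAt
  obtain ⟨M, hM⟩ : ∃ M, ∀ z : Fin n → ℂ, (∀ i, ‖z i‖ = 1) → ‖f z‖ ≤ M := by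
    have hc : IsCompact (Set.univ.pi fun _ : Fin n => Metric.sphere (0 : ℂ) 1) :=
      isCompact_univ_pi fun _ => isCompact_sphere _ _
    obtain ⟨M, hM⟩ := hc.exists_bound_of_continuousOn (f := f) fun z hz =>
      (hd z fun i h => by simpa [h] using hz i trivial).continuousAt.continuousWithinAt
    exact ⟨M, fun z hz => hM z fun i _ => by simpa using hz i⟩
  have hpoly : ∀ (S : Finset (Fin n)) (z : Fin n → ℂ), (∀ i, z i ≠ 0) → (∀ i, ‖z i‖ ≤ 1) →
      (∀ i ∉ S, ‖z i‖ = 1) → ‖f z‖ ≤ M := by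
    intro S
    induction S using Finset.induction_on with
    | empty => exact fun z _ _ h => hM z fun i => h i (Finset.notMem_empty i)
    | insert k S hk ih =>
      intro z hz h1 h2
      obtain ⟨h, hh, hhf⟩ := hext k z hz
      have h3 : ‖h (z k)‖ ≤ M := by
        refine Complex.norm_le_of_forall_mem_frontier_norm_le (U := Metric.ball 0 1)
          Metric.isBounded_ball hh.diffContOnCl (fun t ht => ?_) ?_
        · rw [frontier_ball _ one_ne_zero, mem_sphere_zero_iff_norm] at ht
          have ht0 : t ≠ 0 := by
            rintro rfl
            simp at ht
          rw [hhf t ht0]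
          refine ih _ (hupd k z hz t ht0) (fun i => ?_) fun i hi => ?_
          · rcases eq_or_ne i k with rfl | hik
            · simpa using ht.le
            · simpa [hik] using h1 i
          · rcases eq_or_ne i k with rfl | hik
            · simpa using ht
            · simpa [hik] using h2 i (by simp [hik, hi])
        · rw [closure_ball _ one_ne_zero, mem_closedBall_zero_iff]
          exact h1 k
      rwa [hhf _ (hz k), Function.update_eq_self] at h3
  have hbound : ∀ z : Fin n → ℂ, (∀ i, z i ≠ 0) → ‖f z‖ ≤ M := by
    intro z hz
    have hr : 0 < 1 + ∑ i, ‖z i‖ := by positivity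
    have hl : ((1 + ∑ i, ‖z i‖ : ℝ) : ℂ)⁻¹ ≠ 0 := inv_ne_zero (by exact_mod_cast hr.ne')
    rw [← hs _ hl z hz]
    refine hpoly Finset.univ _ (fun i => mul_ne_zero hl (hz i)) (fun i => ?_) (by simp)
    rw [norm_mul, norm_inv, Complex.norm_real, Real.norm_of_nonneg hr.le, inv_mul_le_one₀ hr]
    have := Finset.single_le_sum (f := fun i => ‖z i‖) (fun i _ => norm_nonneg _)
      (Finset.mem_univ i)
    linarith
  have hconst : ∀ (k : Fin n) (z : Fin n → ℂ), (∀ i, z i ≠ 0) → ∀ t : ℂ, t ≠ 0 →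
      f (Function.update z k t) = f z := by
    intro k z hz t ht
    obtain ⟨h, hh, hhf⟩ := hext k z hz
    have hb : Bornology.IsBounded (Set.range h) := by
      rw [isBounded_iff_forall_norm_le]
      refine ⟨max M ‖h 0‖, ?_⟩
      rintro _ ⟨t, rfl⟩
      rcases eq_or_ne t 0 with rfl | ht
      · exact le_max_right _ _
      · rw [hhf t ht]
        exact (hbound _ (hupd k z hz t ht)).trans (le_max_left _ _)
    have h1 := hh.apply_eq_apply_of_bounded hb t (z k)
    rwa [hhf t ht, hhf _ (hz k), Function.update_eq_self] at h1
  have hpiece : ∀ S : Finset (Fin n), f (S.piecewise w z) = f z := by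
    intro S
    induction S using Finset.induction_on with
    | empty => simp
    | insert k S hk ih =>
      rw [Finset.piecewise_insert, hconst k _ _ _ (hw k), ih]
      intro i
      by_cases hi : i ∈ S
      · simpa [hi] using hw i
      · simpa [hi] using hz i
  have h := hpiece Finset.univ
  rw [Finset.piecewise_univ] at h
  exact h.symm

/-- The difference of two solutions is constant by `eq_of_scaleInvariant_of_isLittleO`, and the
symmetrisation of a constant is a nonzero multiple of it. -/
theorem sameFamily_of_satisfiesConditions {F F' : (n : ℕ) → (Fin n → ℂ) → ℂ}
    (hF : SatisfiesConditions F) (hF' : SatisfiesConditions F') : SameFamily F F' := by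
  intro n
  induction n using Nat.strong_induction_on with
  | _ n ih =>
    intro hn z hz
    obtain ⟨hc, hs, h1, hsym, hg⟩ := hF
    obtain ⟨hc', hs', h1', hsym', hg'⟩ := hF'
    rcases hn.eq_or_lt with rfl | hn1
    · rw [h1 z hz, h1' z hz]
    have hconst : ∀ z w : Fin n → ℂ, (∀ i, z i ≠ 0) → (∀ i, w i ≠ 0) →
        F n z - F' n z = F n w - F' n w := by
      intro z w hz hw
      refine eq_of_scaleInvariant_of_isLittleO (f := fun z => F n z - F' n z)
        (fun z hz => hc.differentiableAt_sub hc' hn (fun m hm hmn => ih m hmn hm) hz)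
        (fun l hl z hz => ?_) (fun k z hz => ?_) hz hw
      · rw [hs n hn l hl z hz, hs' n hn l hl z hz]
      · have h2 := hg n hn k z hz
        have h3 := hg' n hn k z hz
        simp only [← norm_inv] at h2 h3
        exact h2.of_norm_norm.sub h3.of_norm_norm
    have h2 := hsym n hn1 z hz
    have h3 := hsym' n hn1 z hz
    have h4 : ∑ σ : Equiv.Perm (Fin n), (F n (fun k => z (σ k)) - F' n (fun k => z (σ k))) = 0 := by
      rw [Finset.sum_sub_distrib, h2, h3, sub_zero]
    rw [Finset.sum_congr rfl fun σ _ => hconst _ z (fun k => hz (σ k)) hz, Finset.sum_const,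
      smul_eq_zero, Finset.card_univ, Fintype.card_perm] at h4
    exact sub_eq_zero.1 (h4.resolve_left (Nat.factorial_ne_zero _))

theorem finite_setOf_im_mul_conj_eq_zero {a b c d : ℂ} (h : (a * starRingEnd ℂ c).im ≠ 0) :
    {t : ℝ | ((a + t * b) * starRingEnd ℂ (c + t * d)).im = 0}.Finite := by
  let P : Polynomial ℝ := Polynomial.C (a * starRingEnd ℂ c).im +
    Polynomial.C ((a * starRingEnd ℂ d).im + (b * starRingEnd ℂ c).im) * Polynomial.X +
    Polynomial.C (b * starRingEnd ℂ d).im * Polynomial.X ^ 2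
  have hP : ∀ t : ℝ, P.eval t = ((a + t * b) * starRingEnd ℂ (c + t * d)).im := by
    intro t
    simp [P]
    ring
  have hP0 : P ≠ 0 := by
    intro h0
    have h1 := hP 0
    rw [h0] at h1
    simp only [Polynomial.eval_zero, Complex.ofReal_zero, zero_mul, add_zero] at h1
    exact h h1.symm
  refine (Polynomial.finite_setOfPred_isRoot hP0).subset fun t ht => ?_
  rw [Set.mem_ofPred_eq, Polynomial.IsRoot.def, hP]
  exact ht

/-- The points of the cut domain at which the differential equation is imposed. -/
def regularDomain (n : ℕ) : Set (Fin n → ℂ) :=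
  {z | z ∈ cutDomain n ∧ ∀ k : Fin n, 0 < (k : ℕ) →
    (∑ i, initPart z k i) ≠ 0 ∧ (∑ i, tailPart z k i) ≠ 0}

/-- Two solutions of the differential equation which agree for fewer variables have the same
derivative. -/
theorem hasFDerivAt_sub_of_isPDESeries {F F' : (n : ℕ) → (Fin n → ℂ) → ℂ} (hF : IsPDESeries F)
    (hF' : IsPDESeries F') {n : ℕ} (hn : 1 ≤ n)
    (h : ∀ m, 1 ≤ m → m < n → ∀ z : Fin m → ℂ, (∀ i, z i ≠ 0) → F m z = F' m z)
    {z : Fin n → ℂ} (hz : z ∈ regularDomain n) :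
    HasFDerivAt (fun z => F n z - F' n z) (0 : (Fin n → ℂ) →L[ℂ] ℂ) z := by
  have hd := ((hF.1 n hn).differentiableAt ((isOpen_cutDomain n).mem_nhds hz.1)).hasFDerivAt
  have hd' := ((hF'.1 n hn).differentiableAt ((isOpen_cutDomain n).mem_nhds hz.1)).hasFDerivAt
  have h1 : fderiv ℂ (F n) z = fderiv ℂ (F' n) z := by
    ext1 v
    rw [hF.2.2.1 n hn z hz.1 hz.2 v, hF'.2.2.1 n hn z hz.1 hz.2 v]
    refine Finset.sum_congr rfl fun k hk => ?_
    have hk0 : 0 < (k : ℕ) := (Finset.mem_filter.1 hk).2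
    have hkn := k.isLt
    rw [h k hk0 hkn (initPart z k) fun i => hz.1.1 _,
      h (n - k) (by omega) (by omega) (tailPart z k) fun i => hz.1.1 _]
  have h2 := hd.sub hd'
  rwa [h1, sub_self] at h2

/-- A continuous function on `(ℂ^×)^n` with vanishing derivative on the regular domain does not
change along a segment in `(ℂ^×)^n` whose starting point is regular in the stronger sense that
adjacent coordinates are linearly independent over `ℝ`: such a segment leaves the regular domain at
finitely many points only. -/
theorem eq_of_segment {n : ℕ} {f : (Fin n → ℂ) → ℂ}
    (hc : ∀ z : Fin n → ℂ, (∀ i, z i ≠ 0) → ContinuousAt f z)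
    (hd : ∀ z ∈ regularDomain n, HasFDerivAt f (0 : (Fin n → ℂ) →L[ℂ] ℂ) z) {p w : Fin n → ℂ}
    (hp : p ∈ regularDomain n)
    (hp' : ∀ i j : Fin n, (j : ℕ) = i + 1 → (p j * starRingEnd ℂ (p i)).im ≠ 0)
    (hw : ∀ i, w i / p i ∈ Complex.slitPlane) : f w = f p := by
  have hp0 := hp.1.1
  have hseg : ∀ t ∈ Set.Icc (0 : ℝ) 1, ∀ i, p i + t * (w i - p i) ≠ 0 := by
    intro t ht i h0
    have h1 := (Complex.starConvex_one_slitPlane) (hw i) (sub_nonneg.2 ht.2) ht.1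
      (sub_add_cancel 1 t)
    have h2 : (1 - t : ℝ) • (1 : ℂ) + t • (w i / p i) = 0 := by
      have h3 : (1 - t : ℝ) • (1 : ℂ) + t • (w i / p i) = (p i + t * (w i - p i)) / p i := by
        have := hp0 i
        simp only [Complex.real_smul]
        push_cast
        field_simp
        ring
      rw [h3, h0, zero_div]
    rw [h2] at h1
    exact Complex.slitPlane_ne_zero h1 rfl
  let S : Set ℝ :=
    (⋃ i : Fin n, ⋃ j : Fin n, {t : ℝ | (j : ℕ) = i + 1 ∧
      ((p j + t * (w j - p j)) * starRingEnd ℂ (p i + t * (w i - p i))).im = 0}) ∪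
    ⋃ k : Fin n, {t : ℝ | 0 < (k : ℕ) ∧
      ((∑ i, initPart p k i) + t * ∑ i, initPart (fun i => w i - p i) k i = 0 ∨
        (∑ i, tailPart p k i) + t * ∑ i, tailPart (fun i => w i - p i) k i = 0)}
  have haff : ∀ a b : ℂ, a ≠ 0 → {t : ℝ | a + t * b = 0}.Finite := by
    intro a b ha
    have h1 : (a * starRingEnd ℂ (Complex.I * a)).im ≠ 0 := by
      have h2 := Complex.normSq_pos.2 ha
      rw [Complex.normSq_apply] at h2
      simp only [map_mul, Complex.conj_I, Complex.mul_im, Complex.mul_re, Complex.neg_re,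
        Complex.neg_im, Complex.I_re, Complex.I_im, Complex.conj_re, Complex.conj_im]
      intro h3
      linarith
    refine (finite_setOf_im_mul_conj_eq_zero (b := b) (d := 0) h1).subset fun t ht => ?_
    simp only [Set.mem_ofPred_eq] at ht ⊢
    rw [ht]
    simp
  have hS : S.Finite := by
    refine Set.Finite.union (Set.finite_iUnion fun i => Set.finite_iUnion fun j => ?_)
      (Set.finite_iUnion fun k => ?_)
    · by_cases hij : (j : ℕ) = i + 1
      · exact (finite_setOf_im_mul_conj_eq_zero (hp' i j hij)).subset fun t ht => ht.2
      · exact Set.finite_empty.subset fun t ht => hij ht.1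
    · by_cases hk : 0 < (k : ℕ)
      · exact ((haff _ _ (hp.2 k hk).1).union (haff _ _ (hp.2 k hk).2)).subset fun t ht => ht.2
      · exact Set.finite_empty.subset fun t ht => hk ht.1
  have hreg : ∀ t ∈ Set.Icc (0 : ℝ) 1, t ∉ S → (fun i => p i + t * (w i - p i)) ∈
      regularDomain n := by
    intro t ht hts
    simp only [S, Set.mem_union, Set.mem_iUnion, Set.mem_ofPred_eq, not_or, not_exists] at hts
    refine ⟨⟨hseg t ht, fun i j hij hpos => hts.1 i j ⟨hij, ?_⟩⟩, fun k hk => ?_⟩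
    · obtain ⟨r, _, hr⟩ := hpos
      rw [eq_div_iff (hseg t ht i)] at hr
      simp only at hr
      rw [← hr, mul_assoc, Complex.mul_conj, ← Complex.ofReal_mul, Complex.ofReal_im]
    · have h1 := hts.2 k
      simp only [not_and, not_or] at h1
      have h2 := h1 hk
      simp only [initPart, tailPart, Finset.sum_add_distrib, ← Finset.mul_sum] at h2 ⊢
      exact h2
  have hline : ∀ t : ℝ, HasDerivAt (fun t : ℝ => fun i => p i + t * (w i - p i))
      (fun i => w i - p i) t := by
    intro t
    rw [hasDerivAt_pi]
    intro i
    have h1 := (Complex.ofRealCLM.hasDerivAt (x := t)).mul_const (w i - p i)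
    simpa using h1.const_add (p i)
  have hint := MeasureTheory.integral_eq_of_hasDerivAt_off_countable
    (fun t : ℝ => f fun i => p i + t * (w i - p i)) (fun _ => 0) (a := 0) (b := 1) hS.countable
    (fun t ht => ?_) (fun t ht => ?_) (by simp)
  · simp only [intervalIntegral.integral_zero, Complex.ofReal_one, one_mul, Complex.ofReal_zero,
      zero_mul, add_zero, add_sub_cancel] at hint
    exact (sub_eq_zero.1 hint.symm)
  · rw [Set.uIcc_of_le zero_le_one] at ht
    exact (ContinuousAt.comp (f := fun t : ℝ => fun i => p i + t * (w i - p i))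
      (hc _ (hseg t ht)) (hline t).continuousAt).continuousWithinAt
  · rw [min_eq_left zero_le_one, max_eq_right zero_le_one] at ht
    have h1 := (hd _ (hreg t (Set.Ioo_subset_Icc_self ht.1) ht.2)).restrictScalars ℝ
    exact h1.comp_hasDerivAt t (hline t)

theorem geom_sum_range_ne_zero {ω : ℂ} {N k : ℕ} (h : IsPrimitiveRoot ω N)
    (hk : 0 < k) (hkN : k < N) : ∑ i ∈ Finset.range k, ω ^ i ≠ 0 := by
  intro h0
  have h1 := geom_sum_mul ω k
  rw [h0, zero_mul] at h1
  exact h.pow_ne_one_of_pos_of_lt hk.ne' hkN (sub_eq_zero.1 h1.symm)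

/-- The powers of a primitive `2n`-th root of unity are a base point from which almost all of
`(ℂ^×)^n` can be seen. -/
theorem exists_mem_regularDomain {n : ℕ} (hn : 2 ≤ n) :
    ∃ p ∈ regularDomain n, ∀ i j : Fin n, (j : ℕ) = i + 1 →
      (p j * starRingEnd ℂ (p i)).im ≠ 0 := by
  set ω : ℂ := Complex.exp (2 * Real.pi * Complex.I / (2 * n : ℕ)) with hω
  have hprim : IsPrimitiveRoot ω (2 * n) := Complex.isPrimitiveRoot_exp _ (by omega)
  have hnorm : ‖ω‖ = 1 := hprim.norm'_eq_one (by omega)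
  have hω0 : ω ≠ 0 := by
    rw [← norm_ne_zero_iff, hnorm]
    exact one_ne_zero
  have him : ω.im ≠ 0 := by
    intro h0
    have h1 : ω ^ 2 = 1 := by
      have h2 := Complex.mul_conj ω
      rw [Complex.conj_eq_iff_im.2 h0, Complex.normSq_eq_norm_sq, hnorm] at h2
      rw [sq, h2]
      simp
    exact hprim.pow_ne_one_of_pos_of_lt two_ne_zero (by omega) h1
  have hadj : ∀ i j : Fin n, (j : ℕ) = i + 1 →
      (ω ^ (j : ℕ) * starRingEnd ℂ (ω ^ (i : ℕ))).im ≠ 0 := by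
    intro i j hij
    rw [hij, pow_succ', mul_assoc, Complex.mul_conj, Complex.normSq_eq_norm_sq, norm_pow, hnorm]
    simpa using him
  refine ⟨fun i => ω ^ (i : ℕ), ⟨⟨fun i => pow_ne_zero _ hω0, fun i j hij hpos => ?_⟩,
    fun k hk => ⟨?_, ?_⟩⟩, hadj⟩
  · obtain ⟨r, _, hr⟩ := hpos
    simp only at hr
    rw [eq_div_iff (pow_ne_zero _ hω0)] at hr
    refine hadj i j hij ?_
    rw [← hr, mul_assoc, Complex.mul_conj, ← Complex.ofReal_mul, Complex.ofReal_im]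
  · simp only [initPart]
    rw [Fin.sum_univ_eq_sum_range fun i => ω ^ i]
    exact geom_sum_range_ne_zero hprim hk (by omega)
  · simp only [tailPart, pow_add]
    rw [← Finset.mul_sum, Fin.sum_univ_eq_sum_range fun i => ω ^ i]
    exact mul_ne_zero (pow_ne_zero _ hω0)
      (geom_sum_range_ne_zero hprim (by omega) (by omega))

theorem exists_mem_cutDomain_sum_eq_zero {n : ℕ} (hn : 2 ≤ n) :
    ∃ q ∈ cutDomain n, ∑ i, q i = 0 := by
  set ζ : ℂ := Complex.exp (2 * Real.pi * Complex.I / n) with hζ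
  have hprim : IsPrimitiveRoot ζ n := Complex.isPrimitiveRoot_exp _ (by omega)
  have hnorm : ‖ζ‖ = 1 := hprim.norm'_eq_one (by omega)
  have hζ0 : ζ ≠ 0 := Complex.exp_ne_zero _
  refine ⟨fun i => ζ ^ (i : ℕ), ⟨fun i => pow_ne_zero _ hζ0, fun i j hij hpos => ?_⟩, ?_⟩
  · obtain ⟨r, hr0, hr⟩ := hpos
    simp only at hr
    rw [hij, pow_succ, mul_div_cancel_left₀ _ (pow_ne_zero _ hζ0)] at hr
    rw [← hr, Complex.norm_real, Real.norm_of_nonneg (le_of_lt hr0)] at hnorm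
    rw [hnorm] at hr
    exact hprim.ne_one hn (by simpa using hr.symm)
  · rw [Fin.sum_univ_eq_sum_range fun i => ζ ^ i]
    exact hprim.geom_sum_eq_zero hn

theorem eventually_mul_exp_mem_slitPlane {x : ℂ} (hx : x ≠ 0) :
    ∀ᶠ ε : ℝ in 𝓝[>] 0, x * Complex.exp (ε * Complex.I) ∈ Complex.slitPlane := by
  by_cases h : x ∈ Complex.slitPlane
  · have hc : Continuous fun ε : ℝ => x * Complex.exp (ε * Complex.I) := by fun_prop
    have h1 := hc.tendsto 0
    simp only [Complex.ofReal_zero, zero_mul, Complex.exp_zero, mul_one] at h1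
    exact (h1.eventually (Complex.isOpen_slitPlane.mem_nhds h)).filter_mono nhdsWithin_le_nhds
  · filter_upwards [Ioo_mem_nhdsGT Real.pi_pos] with ε hε
    rw [Complex.mem_slitPlane_iff, not_or, not_lt, not_not] at h
    have h1 : x.re ≠ 0 := fun h1 => hx (Complex.ext h1 h.2)
    rw [Complex.mem_slitPlane_iff]
    right
    rw [Complex.mul_im, h.2, Complex.exp_ofReal_mul_I_im, zero_mul, add_zero]
    exact mul_ne_zero h1 (Real.sin_pos_of_mem_Ioo hε).ne'

/-- The difference of two solutions is continuous and locally constant on the regular domain, hence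
constant by `eq_of_segment` and a small rotation, and it vanishes where `z_1 + ⋯ + z_n = 0`. -/
theorem sameFamily_of_isExtendedPDESeries {F F' : (n : ℕ) → (Fin n → ℂ) → ℂ}
    (hF : IsExtendedPDESeries F) (hF' : IsExtendedPDESeries F') : SameFamily F F' := by
  intro n
  induction n using Nat.strong_induction_on with
  | _ n ih =>
    intro hn z hz
    rcases hn.eq_or_lt with rfl | hn2
    · have h1 : z ∈ cutDomain 1 := ⟨hz, fun i j hij => by omega⟩
      rw [hF.1.2.1 z h1, hF'.1.2.1 z h1]
    have ih' : ∀ m, 1 ≤ m → m < n → ∀ z : Fin m → ℂ, (∀ i, z i ≠ 0) → F m z = F' m z :=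
      fun m hm hmn => ih m hmn hm
    have hc : ∀ z : Fin n → ℂ, (∀ i, z i ≠ 0) → ContinuousAt (fun z => F n z - F' n z) z :=
      fun z hz => (hF.2.differentiableAt_sub hF'.2 hn ih' hz).continuousAt
    obtain ⟨p, hp, hp'⟩ := exists_mem_regularDomain hn2
    have hconst : ∀ w : Fin n → ℂ, (∀ i, w i ≠ 0) → F n w - F' n w = F n p - F' n p := by
      intro w hw
      have h1 : ∀ᶠ ε : ℝ in 𝓝[>] 0, ∀ i, w i / p i * Complex.exp (ε * Complex.I) ∈
          Complex.slitPlane := eventually_all.2 fun i =>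
        eventually_mul_exp_mem_slitPlane (div_ne_zero (hw i) (hp.1.1 i))
      have h2 : Tendsto (fun ε : ℝ => fun i => w i * Complex.exp (ε * Complex.I)) (𝓝[>] 0)
          (𝓝 w) := by
        have h3 : Continuous fun ε : ℝ => fun i => w i * Complex.exp (ε * Complex.I) := by fun_prop
        have h4 := h3.tendsto 0
        simp only [Complex.ofReal_zero, zero_mul, Complex.exp_zero, mul_one] at h4
        exact h4.mono_left nhdsWithin_le_nhds
      have h3 := (hc w hw).tendsto.comp h2
      refine tendsto_nhds_unique h3 (tendsto_const_nhds.congr' ?_)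
      filter_upwards [h1] with ε hε
      refine (eq_of_segment hc
        (fun z hz => hasFDerivAt_sub_of_isPDESeries hF.1 hF'.1 hn ih' hz) hp hp' fun i => ?_).symm
      rw [mul_div_right_comm]
      exact hε i
    obtain ⟨q, hq, hq0⟩ := exists_mem_cutDomain_sum_eq_zero hn2
    have h1 := hconst q hq.1
    rw [hF.1.2.2.2 n hn2 q hq hq0, hF'.1.2.2.2 n hn2 q hq hq0, sub_zero] at h1
    have h2 := hconst z hz
    rw [← h1] at h2
    exact sub_eq_zero.1 h2

/-! ### The wall-crossing coefficients near a given stability condition -/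

theorem arg_pos_of_im_pos {a : ℂ} (ha : 0 < a.im) : 0 < a.arg :=
  lt_of_le_of_ne (Complex.arg_nonneg_iff.2 ha.le) fun h =>
    ha.ne' (Complex.arg_eq_zero_iff.1 h.symm).2

/-- In the upper half plane, comparing arguments is deciding the sign of an imaginary part. -/
theorem arg_lt_arg_iff {a b : ℂ} (ha : 0 < a.im) (hb : 0 < b.im) :
    b.arg < a.arg ↔ 0 < (a * starRingEnd ℂ b).im := by
  have ha0 : a ≠ 0 := fun h => by simp [h] at ha
  have hb0 : b ≠ 0 := fun h => by simp [h] at hb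
  have h1 : (a * starRingEnd ℂ b).im = ‖a‖ * ‖b‖ * Real.sin (a.arg - b.arg) := by
    rw [Real.sin_sub]
    have h2 := Complex.norm_mul_cos_arg a
    have h3 := Complex.norm_mul_sin_arg a
    have h4 := Complex.norm_mul_cos_arg b
    have h5 := Complex.norm_mul_sin_arg b
    rw [Complex.mul_im, Complex.conj_re, Complex.conj_im, ← h2, ← h3, ← h4, ← h5]
    ring
  have hpos : 0 < ‖a‖ * ‖b‖ := mul_pos (norm_pos_iff.2 ha0) (norm_pos_iff.2 hb0)
  have h2 : 0 < a.arg := arg_pos_of_im_pos ha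
  have h3 : 0 < b.arg := arg_pos_of_im_pos hb
  have h4 := Complex.arg_le_pi a
  have h5 := Complex.arg_le_pi b
  rw [h1, mul_pos_iff_of_pos_left hpos]
  constructor
  · exact fun h => Real.sin_pos_of_pos_of_lt_pi (by linarith) (by linarith)
  · intro h
    by_contra hc
    exact absurd h (Real.sin_nonpos_of_nonpos_of_neg_pi_le (by linarith) (by linarith)).not_gt

theorem im_sum_pos {ι : Type*} {s : Finset ι} (hs : s.Nonempty) {w : ι → ℂ}
    (hw : ∀ i, 0 < (w i).im) : 0 < (∑ i ∈ s, w i).im := by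
  rw [Complex.im_sum]
  exact Finset.sum_pos (fun i _ => hw i) hs

theorem arg_sum_eq {ι : Type*} {s : Finset ι} (hs : s.Nonempty) {w : ι → ℂ}
    (hw : ∀ i, 0 < (w i).im) {c : ℝ} (h : ∀ i ∈ s, (w i).arg = c) :
    (∑ i ∈ s, w i).arg = c := by
  have hw0 : ∀ i, w i ≠ 0 := fun i h0 => by
    have := hw i
    simp [h0] at this
  have h1 : ∑ i ∈ s, w i = ((∑ i ∈ s, ‖w i‖ : ℝ) : ℂ) * Complex.exp (c * Complex.I) := by
    push_cast
    rw [Finset.sum_mul]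
    refine Finset.sum_congr rfl fun i hi => ?_
    rw [← h i hi, Complex.norm_mul_exp_arg_mul_I]
  obtain ⟨i, hi⟩ := hs
  have h2 : 0 < ∑ i ∈ s, ‖w i‖ :=
    Finset.sum_pos (fun i _ => norm_pos_iff.2 (hw0 i)) ⟨i, hi⟩
  rw [h1, Complex.arg_real_mul _ h2, ← h i hi, ← Complex.arg_real_mul _ (norm_pos_iff.2 (hw0 i)),
    Complex.norm_mul_exp_arg_mul_I]

theorem strictAnti_of_adj {m : ℕ} {f : Fin m → ℝ}
    (h : ∀ i j : Fin m, (j : ℕ) = i + 1 → f j < f i) {i j : Fin m} (hij : i < j) : f j < f i := by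
  obtain ⟨j, hj⟩ := j
  induction j with
  | zero => exact absurd (Fin.lt_def.1 hij) (Nat.not_lt_zero _)
  | succ j ih =>
    have h1 := h ⟨j, by omega⟩ ⟨j + 1, hj⟩ rfl
    rcases (Nat.lt_succ_iff.1 (Fin.lt_def.1 hij)).eq_or_lt with h2 | h2
    · have h3 : i = ⟨j, by omega⟩ := Fin.ext h2
      rwa [h3]
    · exact h1.trans (ih (by omega) h2)

theorem sum_filter_adj {m : ℕ} (w : Fin m → ℂ) {i j : Fin m} (hij : (j : ℕ) = i + 1) :
    (∑ k ∈ Finset.univ.filter (fun k => k ≤ i), w k) +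
      ∑ k ∈ Finset.univ.filter (fun k => j ≤ k), w k = ∑ k, w k := by
  rw [← Finset.sum_filter_add_sum_filter_not Finset.univ (fun k => k ≤ i)]
  congr 2
  ext k
  simp only [Finset.mem_filter, Finset.mem_univ, true_and, Fin.le_def]
  omega

/-- The relation between the phases of nearby stability conditions: phases which differ for the
second differ in the same way for the first. -/
def RefinesPhases {m : ℕ} (z w : Fin m → ℂ) : Prop :=
  ∀ i j, (w i).arg < (w j).arg → (z i).arg < (z j).arg

theorem RefinesPhases.comp {m k : ℕ} {z w : Fin m → ℂ} (h : RefinesPhases z w)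
    (e : Fin k → Fin m) : RefinesPhases (fun i => z (e i)) fun i => w (e i) :=
  fun i j hij => h (e i) (e j) hij

/-- If `z` refines the phases of `w` and `s_n(z; w)` is nonzero, then all members of `w` have the
same phase.  With `W = w_1 + ⋯ + w_n`, consider `h_i = Im ((w_1 + ⋯ + w_i) W̄)`, whose sign decides
between the two alternatives at `i`. A positive maximum of `h` contradicts both of them, so that only
the second alternative occurs, and the phases of `z`, hence of `w`, decrease.  Then `h_1 ≤ 0` shows
that no phase exceeds that of `W`. -/
theorem arg_eq_of_transS_ne_zero {m : ℕ} {z w : Fin m → ℂ} (hw : ∀ i, 0 < (w i).im)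
    (hzw : RefinesPhases z w) (h : transS z w ≠ 0) (i j : Fin m) : (w i).arg = (w j).arg := by
  classical
  have hm : Nonempty (Fin m) := ⟨i⟩
  have hcond : ∀ i j : Fin m, (j : ℕ) = i + 1 → condA z w i j ∨ condB z w i j := by
    by_contra hc
    exact h (if_neg hc)
  set W := ∑ k, w k with hW
  have hWpos : 0 < W.im := im_sum_pos Finset.univ_nonempty hw
  let g : Fin m → ℝ := fun k => (w k * starRingEnd ℂ W).im
  let H : Fin m → ℝ := fun i => ∑ k ∈ Finset.univ.filter (fun k => k ≤ i), g k
  have hg : ∀ k, 0 < g k ↔ W.arg < (w k).arg := fun k => (arg_lt_arg_iff (hw k) hWpos).symm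
  have hgsum : ∑ k, g k = 0 := by
    simp only [g]
    rw [← Complex.im_sum, ← Finset.sum_mul, ← hW, Complex.mul_conj, Complex.ofReal_im]
  have hsucc : ∀ i j : Fin m, (j : ℕ) = i + 1 → H j = g j + H i := by
    intro i j hij
    have h1 : Finset.univ.filter (fun k => k ≤ j) =
        insert j (Finset.univ.filter fun k : Fin m => k ≤ i) := by
      ext k
      simp only [Finset.mem_filter, Finset.mem_univ, true_and, Finset.mem_insert, Fin.le_def,
        Fin.ext_iff]
      omega
    simp only [H]
    rw [h1, Finset.sum_insert]
    simp only [Finset.mem_filter, Finset.mem_univ, true_and, Fin.le_def]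
    omega
  have hfirst : ∀ i : Fin m, (i : ℕ) = 0 → H i = g i := by
    intro i hi
    have h1 : Finset.univ.filter (fun k => k ≤ i) = {i} := by
      ext k
      simp only [Finset.mem_filter, Finset.mem_univ, true_and, Finset.mem_singleton, Fin.le_def,
        Fin.ext_iff]
      omega
    simp only [H]
    rw [h1, Finset.sum_singleton]
  have hlast : ∀ i : Fin m, (i : ℕ) + 1 = m → H i = 0 := by
    intro i hi
    have h1 : Finset.univ.filter (fun k => k ≤ i) = Finset.univ := by
      refine Finset.filter_true_of_mem fun k _ => ?_
      rw [Fin.le_def]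
      omega
    simp only [H]
    rw [h1, hgsum]
  have hH : ∀ i j : Fin m, (j : ℕ) = i + 1 →
      ((∑ k ∈ Finset.univ.filter (fun k => j ≤ k), w k).arg <
        (∑ k ∈ Finset.univ.filter (fun k => k ≤ i), w k).arg ↔ 0 < H i) := by
    intro i j hij
    rw [arg_lt_arg_iff (im_sum_pos ⟨i, by simp⟩ hw) (im_sum_pos ⟨j, by simp⟩ hw)]
    have h1 : H i = ((∑ k ∈ Finset.univ.filter (fun k => k ≤ i), w k) * starRingEnd ℂ W).im := by
      simp only [H, g]
      rw [← Complex.im_sum, ← Finset.sum_mul]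
    rw [h1, hW, ← sum_filter_adj w hij, map_add, mul_add, Complex.mul_conj, Complex.add_im,
      Complex.ofReal_im, zero_add]
  have hHnonpos : ∀ i, H i ≤ 0 := by
    by_contra hc
    push Not at hc
    obtain ⟨i₀, hi₀⟩ := hc
    obtain ⟨i₁, hi₁⟩ := Finite.exists_max H
    obtain ⟨i, hi, hmin⟩ := Finset.exists_min_image
      (Finset.univ.filter fun i => H i₁ ≤ H i) (fun i => (i : ℕ)) ⟨i₁, by simp⟩
    simp only [Finset.mem_filter, Finset.mem_univ, true_and] at hi hmin
    have hpos : 0 < H i := hi₀.trans_le ((hi₁ i₀).trans hi)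
    have hin : (i : ℕ) + 1 < m := by
      refine lt_of_le_of_ne i.isLt fun h1 => ?_
      rw [hlast i h1] at hpos
      exact lt_irrefl _ hpos
    have hgi : 0 < g i := by
      rcases Nat.eq_zero_or_pos (i : ℕ) with h1 | h1
      · rwa [← hfirst i h1]
      · have h2 := hsucc ⟨i - 1, by omega⟩ i (by simp only; omega)
        have h3 : H ⟨i - 1, by omega⟩ < H i := by
          by_contra hc
          have h4 := hmin ⟨i - 1, by omega⟩ (hi.trans (not_lt.1 hc))
          simp only at h4
          omega
        linarith
    have hgj : ¬ 0 < g ⟨i + 1, hin⟩ := by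
      have h2 := hsucc i ⟨i + 1, hin⟩ rfl
      have h3 := (hi₁ ⟨i + 1, hin⟩).trans hi
      linarith
    rw [hg] at hgi hgj
    have h1 : (z ⟨i + 1, hin⟩).arg < (z i).arg := hzw _ _ ((not_lt.1 hgj).trans_lt hgi)
    rcases hcond i ⟨i + 1, hin⟩ rfl with h2 | h2
    · exact absurd h1 h2.1.not_gt
    · exact absurd ((hH i ⟨i + 1, hin⟩ rfl).2 hpos) h2.2.not_gt
  have hdecr : ∀ i j : Fin m, i < j → (z j).arg < (z i).arg := by
    intro i j hij
    refine strictAnti_of_adj (f := fun i => (z i).arg) (fun i j hij => ?_) hij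
    rcases hcond i j hij with h2 | h2
    · exact absurd ((hH i j hij).1 h2.2) (hHnonpos i).not_gt
    · exact h2.1
  have hle : ∀ k, (w k).arg ≤ W.arg := by
    intro k
    have h0 : ¬ 0 < g ⟨0, k.pos⟩ := by
      rw [← hfirst ⟨0, k.pos⟩ rfl]
      exact (hHnonpos _).not_gt
    rw [hg] at h0
    refine le_trans (not_lt.1 fun h1 => ?_) (not_lt.1 h0)
    have h2 := hzw _ _ h1
    rcases Nat.eq_zero_or_pos (k : ℕ) with h3 | h3
    · have h4 : k = ⟨0, k.pos⟩ := Fin.ext h3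
      rw [← h4] at h2
      exact lt_irrefl _ h2
    · exact lt_asymm h2 (hdecr ⟨0, k.pos⟩ k h3)
  have hgnonpos : ∀ k, g k ≤ 0 := fun k => not_lt.1 fun h1 => ((hg k).1 h1).not_ge (hle k)
  have hgzero : ∀ k, g k = 0 := fun k =>
    (Finset.sum_eq_zero_iff_of_nonpos fun k _ => hgnonpos k).1 hgsum k (Finset.mem_univ k)
  have heq : ∀ k, (w k).arg = W.arg := by
    intro k
    refine le_antisymm (hle k) (not_lt.1 fun h1 => ?_)
    rw [arg_lt_arg_iff hWpos (hw k)] at h1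
    have h2 := hgzero k
    simp only [g] at h2
    have h3 : (W * starRingEnd ℂ (w k)).im = -(w k * starRingEnd ℂ W).im := by
      simp only [Complex.mul_im, Complex.conj_re, Complex.conj_im]
      ring
    rw [h3, h2, neg_zero] at h1
    exact lt_irrefl _ h1
  rw [heq i, heq j]

open Classical in
theorem transS_eq_of_arg_eq {m : ℕ} {z w : Fin m → ℂ} (hw : ∀ i, 0 < (w i).im)
    (h : ∀ i j, (w i).arg = (w j).arg) :
    transS z w = if ∀ i j : Fin m, (j : ℕ) = i + 1 → (z j).arg < (z i).arg then 1 else 0 := by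
  have h1 : ∀ i j : Fin m, (∑ k ∈ Finset.univ.filter (fun k => j ≤ k), w k).arg =
      (∑ k ∈ Finset.univ.filter (fun k => k ≤ i), w k).arg := by
    intro i j
    rw [arg_sum_eq ⟨j, by simp⟩ hw fun k _ => h k i, arg_sum_eq ⟨i, by simp⟩ hw fun k _ => h k i]
  have hA : ∀ i j, ¬ condA z w i j := fun i j hA => hA.2.ne (h1 i j)
  have hB : ∀ i j, condB z w i j ↔ (z j).arg < (z i).arg :=
    fun i j => ⟨fun h => h.1, fun h => ⟨h, (h1 i j).ge⟩⟩
  simp [transS, hA, hB]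

theorem arg_div_of_im_pos {a b : ℂ} (ha : 0 < a.im) (hb : 0 < b.im) :
    (a / b).arg = a.arg - b.arg := by
  have ha0 : a ≠ 0 := fun h => by simp [h] at ha
  have hb0 : b ≠ 0 := fun h => by simp [h] at hb
  have h2 : 0 < a.arg := arg_pos_of_im_pos ha
  have h3 : 0 < b.arg := arg_pos_of_im_pos hb
  have h4 := Complex.arg_le_pi a
  have h5 : b.arg < Real.pi := lt_of_le_of_ne (Complex.arg_le_pi b) fun h5 =>
    hb.ne' (Complex.arg_eq_pi_iff.1 h5).2
  have h6 : a / b = (‖a‖ / ‖b‖ : ℝ) * Complex.exp ((a.arg - b.arg : ℝ) * Complex.I) := by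
    conv_lhs => rw [← Complex.norm_mul_exp_arg_mul_I a, ← Complex.norm_mul_exp_arg_mul_I b]
    push_cast
    rw [sub_mul, Complex.exp_sub]
    ring
  rw [h6, Complex.arg_real_mul _ (div_pos (norm_pos_iff.2 ha0) (norm_pos_iff.2 hb0)),
    Complex.arg_exp_mul_I, toIocMod_eq_self]
  constructor <;> linarith

theorem im_blockSum_pos {n : ℕ} (c : Composition n) {z : Fin n → ℂ} (hz : ∀ i, 0 < (z i).im)
    (k : Fin c.length) : 0 < (blockSum c z k).im :=
  im_sum_pos ⟨⟨0, c.one_le_blocksFun k⟩, Finset.mem_univ _⟩ fun j => hz (c.embedding k j)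

theorem arg_blockSum_eq {n : ℕ} (c : Composition n) {z : Fin n → ℂ} (hz : ∀ i, 0 < (z i).im)
    {i : Fin n} (h : ∀ j, c.index j = c.index i → (z j).arg = (z i).arg) :
    (blockSum c z (c.index i)).arg = (z i).arg :=
  arg_sum_eq (w := fun j => z (c.embedding (c.index i) j))
    ⟨⟨0, c.one_le_blocksFun _⟩, Finset.mem_univ _⟩ (fun _ => hz _)
    fun _ _ => h _ (c.index_embedding _ _)

theorem forall_arg_eq_blockSum_iff {n : ℕ} (c : Composition n) {z : Fin n → ℂ}
    (hz : ∀ i, 0 < (z i).im) : (∀ i, (z i).arg = (blockSum c z (c.index i)).arg) ↔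
      ∀ i j, c.index i = c.index j → (z i).arg = (z j).arg := by
  constructor
  · intro h i j hij
    rw [h i, h j, hij]
  · exact fun h i => (arg_blockSum_eq c hz fun j hj => h j i hj).symm

theorem index_surjective {n : ℕ} (c : Composition n) (b : Fin c.length) : ∃ i, c.index i = b :=
  ⟨c.embedding b ⟨0, c.one_le_blocksFun b⟩, c.index_embedding _ _⟩

theorem exists_eq_embedding {n : ℕ} (c : Composition n) {i : Fin n} {k : Fin c.length}
    (h : c.index i = k) : ∃ j, c.embedding k j = i := by
  subst h
  exact ⟨c.invEmbedding i, c.embedding_comp_inv i⟩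

open Classical in
/-- The coefficients `u_n(z; w)` for `z` near `w`: the local coefficients when `w` lies on a ray,
and zero otherwise. -/
theorem transU_eq {n : ℕ} {z w : Fin n → ℂ} (hz : ∀ i, 0 < (z i).im) (hw : ∀ i, 0 < (w i).im)
    (hzw : RefinesPhases z w) :
    transU z w = if ∀ i j, (w i).arg = (w j).arg then localU (fun i => (z i / w i).arg) else 0 := by
  split_ifs with hray
  · rw [transU, localU]
    refine Finset.sum_congr rfl fun p _ => Finset.sum_congr rfl fun q _ => ?_
    have hθ : ∀ i j, (z i / w i).arg - (z j / w j).arg = (z i).arg - (z j).arg := by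
      intro i j
      rw [arg_div_of_im_pos (hz i) (hw i), arg_div_of_im_pos (hz j) (hw j), hray i j]
      ring
    have hq : ∀ a : Fin q.length, (blockSum q (blockSum p w) a).arg = (∑ i, w i).arg := by
      intro a
      obtain ⟨b, rfl⟩ := index_surjective q a
      obtain ⟨i, rfl⟩ := index_surjective p b
      have hp : ∀ j, (blockSum p w (p.index j)).arg = (w i).arg := fun j =>
        (arg_blockSum_eq p hw fun k _ => hray k j).trans (hray j i)
      have hb : ∀ b, (blockSum p w b).arg = (w i).arg := by
        intro b
        obtain ⟨j, rfl⟩ := index_surjective p b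
        exact hp j
      rw [arg_blockSum_eq q (im_blockSum_pos p hw) fun b _ => (hb b).trans (hb _).symm, hb,
        arg_sum_eq ⟨i, Finset.mem_univ i⟩ hw fun k _ => hray k i]
    have h1 : (∀ i j : Fin n, p.index i = p.index j → (z i / w i).arg = (z j / w j).arg) ↔
        ∀ i : Fin n, (z i).arg = (blockSum p z (p.index i)).arg := by
      rw [forall_arg_eq_blockSum_iff p hz]
      refine forall_congr' fun i => forall_congr' fun j => imp_congr_right fun _ => ?_
      rw [← sub_eq_zero, hθ, sub_eq_zero]
    simp only [hq, implies_true, and_true]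
    simp only [h1]
    by_cases hp : ∀ i : Fin n, (z i).arg = (blockSum p z (p.index i)).arg
    swap
    · rw [if_neg hp, if_neg fun h => hp h.1]
    have hwb : ∀ b b', (blockSum p w b).arg = (blockSum p w b').arg := by
      intro b b'
      obtain ⟨i, rfl⟩ := index_surjective p b
      obtain ⟨j, rfl⟩ := index_surjective p b'
      rw [arg_blockSum_eq p hw fun k _ => hray k i, arg_blockSum_eq p hw fun k _ => hray k j,
        hray i j]
    have hS : ∀ a : Fin q.length, transS (fun j => blockSum p z (q.embedding a j))
        (fun j => blockSum p w (q.embedding a j)) =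
        if ∀ i j : Fin (q.blocksFun a), (j : ℕ) = i + 1 →
          (blockSum p z (q.embedding a j)).arg < (blockSum p z (q.embedding a i)).arg
        then 1 else 0 :=
      fun a => transS_eq_of_arg_eq (fun j => im_blockSum_pos p hw _) fun i j => hwb _ _
    have hD : (∀ a ∈ Finset.univ, ∀ i j : Fin (q.blocksFun a), (j : ℕ) = i + 1 →
        (blockSum p z (q.embedding a j)).arg < (blockSum p z (q.embedding a i)).arg) ↔
        ∀ i j : Fin n, p.index i < p.index j → q.index (p.index i) = q.index (p.index j) →
          (z j / w j).arg < (z i / w i).arg := by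
      constructor
      · intro h i j hij hqij
        obtain ⟨a, ha⟩ : ∃ a, q.index (p.index j) = a := ⟨_, rfl⟩
        obtain ⟨k, hk⟩ := exists_eq_embedding q (hqij.trans ha)
        obtain ⟨k', hk'⟩ := exists_eq_embedding q ha
        have h2 : k < k' := by
          rwa [← hk, ← hk', OrderEmbedding.lt_iff_lt] at hij
        have h3 := strictAnti_of_adj (f := fun i => (blockSum p z (q.embedding a i)).arg)
          (h a (Finset.mem_univ _)) h2
        rw [hk, hk', ← hp, ← hp] at h3
        have := hθ i j
        linarith
      · intro h a _ k k' hk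
        obtain ⟨i, hi⟩ := index_surjective p (q.embedding a k)
        obtain ⟨j, hj⟩ := index_surjective p (q.embedding a k')
        have h2 := h i j (by rw [hi, hj, OrderEmbedding.lt_iff_lt, Fin.lt_def]; omega)
          (by rw [hi, hj, q.index_embedding, q.index_embedding])
        rw [← hi, ← hj, ← hp, ← hp]
        have := hθ i j
        linarith
    rw [if_pos hp, Finset.prod_congr rfl fun a _ => hS a, Finset.prod_ite_zero,
      Finset.prod_const_one]
    simp only [hp, implies_true, true_and, hD]
    split_ifs <;> simp
  · rw [transU]
    refine Finset.sum_eq_zero fun p _ => Finset.sum_eq_zero fun q _ => ?_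
    split_ifs with hc
    swap
    · rfl
    rw [forall_arg_eq_blockSum_iff p hz] at hc
    obtain ⟨hp, hq⟩ := hc
    have hwp : ∀ i j, p.index i = p.index j → (w i).arg = (w j).arg := by
      intro i j hij
      refine le_antisymm (not_lt.1 fun h => ?_) (not_lt.1 fun h => ?_)
      · exact (hzw _ _ h).ne (hp j i hij.symm)
      · exact (hzw _ _ h).ne (hp i j hij)
    have hzb : ∀ i, (blockSum p z (p.index i)).arg = (z i).arg :=
      fun i => arg_blockSum_eq p hz fun j hj => hp j i hj
    have hwb : ∀ i, (blockSum p w (p.index i)).arg = (w i).arg :=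
      fun i => arg_blockSum_eq p hw fun j hj => hwp j i hj
    have hzw' : RefinesPhases (blockSum p z) (blockSum p w) := by
      intro b b' h
      obtain ⟨i, rfl⟩ := index_surjective p b
      obtain ⟨j, rfl⟩ := index_surjective p b'
      rw [hwb, hwb] at h
      rw [hzb, hzb]
      exact hzw _ _ h
    suffices h : ∃ a : Fin q.length, transS (fun j => blockSum p z (q.embedding a j))
        (fun j => blockSum p w (q.embedding a j)) = 0 by
      obtain ⟨a, ha⟩ := h
      rw [Finset.prod_eq_zero (Finset.mem_univ a) ha, zero_mul, zero_mul]
    by_contra hne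
    push Not at hne
    refine hray fun i j => ?_
    have key : ∀ i, (w i).arg = (∑ k, w k).arg := by
      intro i
      rw [← hq (q.index (p.index i)), ← hwb i]
      refine (arg_blockSum_eq q (im_blockSum_pos p hw) fun b hb => ?_).symm
      obtain ⟨k, hk⟩ := exists_eq_embedding q hb
      obtain ⟨k', hk'⟩ := exists_eq_embedding q (rfl : q.index (p.index i) = _)
      have h2 := arg_eq_of_transS_ne_zero (fun j => im_blockSum_pos p hw _)
        (hzw'.comp (q.embedding (q.index (p.index i)))) (hne _) k k'
      rwa [hk, hk'] at h2
    rw [key i, key j]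

theorem eventually_refinesPhases {n : ℕ} {w : Fin n → ℂ} (hw : ∀ i, 0 < (w i).im) :
    ∀ᶠ z in 𝓝 w, RefinesPhases z w := by
  refine eventually_all.2 fun i => eventually_all.2 fun j => ?_
  by_cases h : (w i).arg < (w j).arg
  · have hc : ∀ i, ContinuousAt (fun z : Fin n → ℂ => (z i).arg) w := fun i =>
      ContinuousAt.comp (f := fun z : Fin n → ℂ => z i) (Complex.continuousAt_arg (Or.inr (hw i).ne'))
        (continuous_apply i).continuousAt
    exact ((hc i).eventually_lt (hc j) h).mono fun z hz _ => hz
  · exact Eventually.of_forall fun z h' => absurd h' h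

theorem blocksOnRays_iff_arg {n : ℕ} {w : Fin n → ℂ} (hw : ∀ i, 0 < (w i).im)
    (c : Composition n) : BlocksOnRays c w ↔
      ∀ k j j', (w (c.embedding k j)).arg = (w (c.embedding k j')).arg := by
  constructor
  · intro h k j j'
    obtain ⟨θ, _, hρ⟩ := h k
    obtain ⟨ρ, h1, h2⟩ := hρ j
    obtain ⟨ρ', h1', h2'⟩ := hρ j'
    rw [h2, h2', Complex.arg_real_mul _ h1, Complex.arg_real_mul _ h1']
  · intro h k
    have h1 := arg_pos_of_im_pos (hw (c.embedding k ⟨0, c.one_le_blocksFun k⟩))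
    have h2 := Complex.arg_le_pi (w (c.embedding k ⟨0, c.one_le_blocksFun k⟩))
    refine ⟨_, ⟨h1.le, by linarith [Real.pi_pos]⟩, fun j => ⟨‖w (c.embedding k j)‖, ?_, ?_⟩⟩
    · refine norm_pos_iff.2 fun h0 => ?_
      have := hw (c.embedding k j)
      simp [h0] at this
    · rw [h k _ j, Complex.norm_mul_exp_arg_mul_I]

/-- The local expansion with the coefficients of the wall-crossing formula. -/
theorem localExpansion_eq_sum_transU (G : (m : ℕ) → (Fin m → ℂ) → (Fin m → ℂ) → ℂ) {n : ℕ}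
    {z w : Fin n → ℂ} (hz : ∀ i, 0 < (z i).im) (hw : ∀ i, 0 < (w i).im)
    (hzw : RefinesPhases z w) :
    localExpansion G w z = ∑ c : Composition n,
      G c.length (blockSum c w) (blockSum c z) *
        ∏ k, (transU (fun j => z (c.embedding k j)) (fun j => w (c.embedding k j)) : ℂ) := by
  classical
  rw [localExpansion]
  refine Finset.sum_congr rfl fun c _ => ?_
  have h1 : ∀ k, transU (fun j => z (c.embedding k j)) (fun j => w (c.embedding k j)) = _ :=
    fun k => transU_eq (fun j => hz _) (fun j => hw _) (hzw.comp (c.embedding k))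
  simp only [h1]
  split_ifs with h
  · rw [blocksOnRays_iff_arg hw] at h
    congr 1
    exact Finset.prod_congr rfl fun k _ => by rw [if_pos (h k)]
  · rw [blocksOnRays_iff_arg hw, not_forall] at h
    obtain ⟨k, hk⟩ := h
    rw [Finset.prod_eq_zero (Finset.mem_univ k) (by rw [if_neg hk, Rat.cast_zero]), mul_zero]

/-! ### Generating functions -/

/-- The decompositions of `α` into elements of `C`, as lists. -/
def decompLists {K : Type*} [AddCommGroup K] (C : Set K) (α : K) : Set (List K) :=
  {l | l ≠ [] ∧ (∀ x ∈ l, x ∈ C) ∧ l.sum = α}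

theorem finsum_decomps {K M : Type*} [AddCommGroup K] [AddCommMonoid M] {C : Set K} {α : K}
    (hfin : (decompLists C α).Finite) (g : (n : ℕ) → (Fin n → K) → M) :
    ∑ᶠ x ∈ decomps C α, g x.1 x.2 = ∑ l ∈ hfin.toFinset, onList g l := by
  have h1 : decomps C α = List.equivSigmaTuple '' decompLists C α := by
    rw [Equiv.image_eq_preimage_symm]
    ext ⟨n, x⟩
    change (1 ≤ n ∧ (∀ i, x i ∈ C) ∧ ∑ i, x i = α) ↔
      (List.ofFn x ≠ [] ∧ (∀ y ∈ List.ofFn x, y ∈ C) ∧ (List.ofFn x).sum = α)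
    rw [List.forall_mem_ofFn_iff, List.sum_ofFn, Ne, List.ofFn_eq_nil_iff, Nat.one_le_iff_ne_zero]
  rw [h1, finsum_mem_image List.equivSigmaTuple.injective.injOn,
    finsum_mem_eq_finite_toFinset_sum _ hfin]
  rfl

theorem prod_map_smul {K H : Type*} [Ring H] [Algebra ℂ H] (T : List K → ℂ) (e : K → H)
    (ls : List (List K)) : (ls.map fun m => T m • (m.map e).prod).prod = (ls.map T).prod • (ls.flatten.map e).prod := by
  induction ls with
  | nil => simp
  | cons m ls ih =>
    rw [List.map_cons, List.prod_cons, ih, smul_mul_smul_comm, List.map_cons, List.prod_cons,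
      List.flatten_cons, List.map_append, List.prod_append]

namespace CountingData

variable {K : Type*} [AddCommGroup K] {r : ℕ} {H : Type*} [Ring H] [Algebra ℂ H]

theorem sum_mem (A : CountingData K r H) {l : List K} (h0 : l ≠ []) (h : ∀ x ∈ l, x ∈ A.C) :
    l.sum ∈ A.C := by
  induction l with
  | nil => exact absurd rfl h0
  | cons x l ih =>
    rcases l with _ | ⟨y, l⟩
    · simpa using h x (by simp)
    · rw [List.sum_cons]
      exact A.add_mem _ (h x (by simp)) _ (ih (by simp) fun z hz => h z (by simp [hz]))

theorem prod_mem (A : CountingData K r H) {e : K → H} (he : ∀ x ∈ A.C, e x ∈ A.piece x)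
    {l : List K} (h0 : l ≠ []) (h : ∀ x ∈ l, x ∈ A.C) : (l.map e).prod ∈ A.piece l.sum := by
  induction l with
  | nil => exact absurd rfl h0
  | cons x l ih =>
    rcases l with _ | ⟨y, l⟩
    · simpa using he x (h x (by simp))
    · have hl : ∀ z ∈ y :: l, z ∈ A.C := fun z hz => h z (List.mem_cons_of_mem _ hz)
      rw [List.sum_cons, List.map_cons, List.prod_cons]
      exact A.mul_mem _ (h x (by simp)) _ (A.sum_mem (by simp) hl) _ (he x (h x (by simp))) _
        (ih (by simp) hl)

/-- An element of `C` has finitely many decompositions. Only finitely many elements of `C` occur in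
them, and as the imaginary parts of these under a central charge have a positive lower bound, the
length of the decompositions is bounded. -/
theorem finite_decompLists (A : CountingData K r H) {α : K} (hα : α ∈ A.C) :
    (decompLists A.C α).Finite := by
  obtain ⟨Z, hZ⟩ := A.stab_nonempty
  let E : Set K := {β | β ∈ A.C ∧ (β = α ∨ ∃ γ ∈ A.C, α = β + γ)}
  have hE : E.Finite := by
    refine (((A.finite_pairs α hα).image Prod.fst).insert α).subset ?_
    rintro β ⟨hβ, rfl | ⟨γ, hγ, h⟩⟩
    · exact Set.mem_insert _ _
    · exact Set.mem_insert_of_mem _ ⟨(β, γ), ⟨hβ, hγ, h⟩, rfl⟩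
  have hmem : ∀ l ∈ decompLists A.C α, ∀ x ∈ l, x ∈ E := by
    rintro l ⟨_, hl, hs⟩ x hx
    refine ⟨hl x hx, ?_⟩
    obtain ⟨s, t, rfl⟩ := List.append_of_mem hx
    have h1 : α = x + (s ++ t).sum := by
      rw [← hs]
      simp only [List.sum_append, List.sum_cons]
      abel
    by_cases h0 : s ++ t = []
    · left
      rw [h1, h0, List.sum_nil, add_zero]
    · refine Or.inr ⟨(s ++ t).sum, A.sum_mem h0 fun y hy => hl y ?_, h1⟩
      rcases List.mem_append.1 hy with hy | hy <;> simp [hy]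
  obtain ⟨β, hβ, hmin⟩ := Set.exists_min_image E (fun β => (Z β).im) hE ⟨α, hα, Or.inl rfl⟩
  have hpos : 0 < (Z β).im := A.stab_upper Z hZ β hβ.1
  have hlen : ∀ l : List K, (∀ x ∈ l, x ∈ E) → l.length * (Z β).im ≤ (Z l.sum).im := by
    intro l
    induction l with
    | nil => simp
    | cons x l ih =>
      intro h
      have h1 := ih fun y hy => h y (List.mem_cons_of_mem _ hy)
      have h2 := hmin x (h x (by simp))
      rw [List.length_cons, List.sum_cons, map_add, Complex.add_im]
      push_cast
      linarith
  have := hE.to_subtype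
  refine ((List.finite_length_le E ⌊(Z α).im / (Z β).im⌋₊).image (List.map Subtype.val)).subset ?_
  intro l hl
  refine ⟨l.attachWith _ (hmem l hl), ?_, List.attachWith_map_subtype_val _⟩
  rw [Set.mem_ofPred_eq, List.length_attachWith]
  refine Nat.le_floor ?_
  rw [le_div_iff₀ hpos]
  have h1 := hlen l (hmem l hl)
  rwa [hl.2.2] at h1

open Classical in
/-- The finite set of decompositions of an element of `C`. -/
def decompFinset (A : CountingData K r H) (α : K) : Finset (List K) :=
  if h : (decompLists A.C α).Finite then h.toFinset else ∅

theorem mem_decompFinset (A : CountingData K r H) {α : K} (hα : α ∈ A.C) {l : List K} :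
    l ∈ A.decompFinset α ↔ l ≠ [] ∧ (∀ x ∈ l, x ∈ A.C) ∧ l.sum = α := by
  rw [decompFinset, dif_pos (A.finite_decompLists hα), Set.Finite.mem_toFinset]
  rfl

theorem sum_decompFinset (A : CountingData K r H) {α : K} (hα : α ∈ A.C) (e : K → H)
    (g : (n : ℕ) → (Fin n → K) → ℂ) :
    ∑ᶠ x ∈ decomps A.C α, g x.1 x.2 • (List.ofFn fun i => e (x.2 i)).prod =
      ∑ l ∈ A.decompFinset α, onList g l • (l.map e).prod := by
  rw [finsum_decomps (A.finite_decompLists hα) fun n x => g n x • (List.ofFn fun i => e (x i)).prod,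
    decompFinset, dif_pos (A.finite_decompLists hα)]
  refine Finset.sum_congr rfl fun l _ => ?_
  obtain ⟨n, x, rfl⟩ : ∃ n, ∃ x : Fin n → K, l = List.ofFn x := ⟨_, _, (List.ofFn_get l).symm⟩
  rw [onList_ofFn, onList_ofFn, List.map_ofFn]
  rfl

open Classical in
/-- The families of decompositions of the members of a list. -/
def decompFamilies (A : CountingData K r H) : List K → Finset (List (List K))
  | [] => {[]}
  | β :: b => (A.decompFinset β ×ˢ A.decompFamilies b).image fun p => p.1 :: p.2

theorem mem_decompFamilies (A : CountingData K r H) {b : List K} (hb : ∀ β ∈ b, β ∈ A.C)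
    {ls : List (List K)} : ls ∈ A.decompFamilies b ↔
      ls.map List.sum = b ∧ ∀ m ∈ ls, m ≠ [] ∧ ∀ x ∈ m, x ∈ A.C := by
  classical
  induction b generalizing ls with
  | nil =>
    simp only [decompFamilies, Finset.mem_singleton, List.map_eq_nil_iff]
    constructor
    · rintro rfl
      simp
    · exact fun h => h.1
  | cons β b ih =>
    have hβ := hb β (by simp)
    simp only [decompFamilies, Finset.mem_image, Finset.mem_product, Prod.exists,
      A.mem_decompFinset hβ, ih fun γ hγ => hb γ (List.mem_cons_of_mem _ hγ)]
    constructor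
    · rintro ⟨m, ls, ⟨⟨h1, h2, rfl⟩, rfl, h3⟩, rfl⟩
      exact ⟨rfl, List.forall_mem_cons.2 ⟨⟨h1, h2⟩, h3⟩⟩
    · rintro ⟨h1, h2⟩
      obtain ⟨m, ls, rfl, h3, h4⟩ := List.map_eq_cons_iff.1 h1
      rw [List.forall_mem_cons] at h2
      exact ⟨m, ls, ⟨⟨h2.1.1, h2.1.2, h3⟩, h4, h2.2⟩, rfl⟩

theorem prod_map_sum_decompFinset (A : CountingData K r H) (g : List K → H) (b : List K) :
    (b.map fun β => ∑ m ∈ A.decompFinset β, g m).prod =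
      ∑ ls ∈ A.decompFamilies b, (ls.map g).prod := by
  classical
  induction b with
  | nil => simp [decompFamilies]
  | cons β b ih =>
    rw [decompFamilies, Finset.sum_image (by rintro ⟨a, b⟩ _ ⟨c, d⟩ _ h; simpa using h),
      List.map_cons, List.prod_cons, ih, Finset.sum_mul_sum, Finset.sum_product]
    simp

/-- Decomposing `α`, and cutting the decomposition into blocks, amounts to decomposing `α` and then
each of the summands. -/
theorem sum_blockComp_smul (A : CountingData K r H) {α : K} (hα : α ∈ A.C) (φ T : List K → ℂ)
    (e : K → H) :
    ∑ l ∈ A.decompFinset α, blockComp List.sum φ T l • (l.map e).prod =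
      ∑ b ∈ A.decompFinset α,
        φ b • (b.map fun β => ∑ m ∈ A.decompFinset β, T m • (m.map e).prod).prod := by
  simp only [A.prod_map_sum_decompFinset, prod_map_smul, blockComp, Finset.sum_smul,
    Finset.smul_sum, smul_smul]
  rw [Finset.sum_sigma', Finset.sum_sigma']
  refine Finset.sum_bij' (fun x _ => ⟨x.2.map List.sum, x.2⟩) (fun x _ => ⟨x.2.flatten, x.2⟩)
    ?_ ?_ ?_ ?_ ?_
  · rintro ⟨l, ls⟩ h
    simp only [Finset.mem_sigma, A.mem_decompFinset hα, mem_parts] at h ⊢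
    obtain ⟨⟨h0, h1, h2⟩, rfl, h3⟩ := h
    have h4 : ∀ m ∈ ls, m ≠ [] ∧ ∀ x ∈ m, x ∈ A.C := fun m hm =>
      ⟨fun h => h3 (h ▸ hm), fun x hx => h1 x (List.mem_flatten.2 ⟨m, hm, hx⟩)⟩
    have h5 : ∀ β ∈ ls.map List.sum, β ∈ A.C := by
      intro β hβ
      obtain ⟨m, hm, rfl⟩ := List.mem_map.1 hβ
      exact A.sum_mem (h4 m hm).1 (h4 m hm).2
    refine ⟨⟨fun h => h0 ?_, h5, by rw [← List.sum_flatten, h2]⟩,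
      (A.mem_decompFamilies h5).2 ⟨rfl, h4⟩⟩
    rw [List.map_eq_nil_iff.1 h, List.flatten_nil]
  · rintro ⟨b, ls⟩ h
    simp only [Finset.mem_sigma, A.mem_decompFinset hα, mem_parts] at h ⊢
    obtain ⟨⟨h0, h1, h2⟩, h3⟩ := h
    obtain ⟨rfl, h4⟩ := (A.mem_decompFamilies h1).1 h3
    refine ⟨⟨fun h => h0 ?_, fun x hx => ?_, by rw [List.sum_flatten, h2]⟩, trivial,
      fun h => (h4 _ h).1 rfl⟩
    · rw [List.flatten_eq_nil_iff] at h
      rw [List.map_eq_nil_iff]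
      exact List.eq_nil_iff_forall_not_mem.2 fun m hm => (h4 m hm).1 (h m hm)
    · obtain ⟨m, hm, hx⟩ := List.mem_flatten.1 hx
      exact (h4 m hm).2 x hx
  · rintro ⟨l, ls⟩ h
    simp only [Finset.mem_sigma, mem_parts] at h
    simp [h.2.1]
  · rintro ⟨b, ls⟩ h
    simp only [Finset.mem_sigma, A.mem_decompFinset hα] at h
    simp [((A.mem_decompFamilies h.1.2.1).1 h.2).1]
  · rintro ⟨l, ls⟩ h
    simp only [Finset.mem_sigma, mem_parts] at h
    simp [h.2.1]

theorem exists_eval (A : CountingData K r H) (x : K) :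
    ∃ f : (Fin r → ℂ) →L[ℂ] ℂ, ∀ Z : K →+ ℂ, f (A.toCoord Z) = Z x := by
  let L : (K →+ ℂ) →ₗ[ℂ] (Fin r → ℂ) :=
    { toFun := A.toCoord
      map_add' := fun _ _ => rfl
      map_smul' := fun _ _ => rfl }
  let e : (K →+ ℂ) ≃ₗ[ℂ] (Fin r → ℂ) := LinearEquiv.ofBijective L A.coord_bijective
  let ev : (K →+ ℂ) →ₗ[ℂ] ℂ :=
    { toFun := fun Z => Z x
      map_add' := fun _ _ => rfl
      map_smul' := fun _ _ => rfl }
  refine ⟨LinearMap.toContinuousLinearMap (ev ∘ₗ e.symm.toLinearMap), fun Z => ?_⟩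
  have h : e.symm (A.toCoord Z) = Z := e.symm_apply_apply Z
  simp [ev, h]

/-- The value at `x` of the homomorphism with given coordinates. -/
def eval (A : CountingData K r H) (x : K) : (Fin r → ℂ) →L[ℂ] ℂ := (A.exists_eval x).choose

theorem eval_toCoord (A : CountingData K r H) (x : K) (Z : K →+ ℂ) :
    A.eval x (A.toCoord Z) = Z x := (A.exists_eval x).choose_spec Z

/-- The generating functions of a family with the continuity and holomorphicity condition are
continuous and holomorphic: near `Z₀`, the coefficients of the local expansion of the family are
those of the wall-crossing formula from `Z` to `Z₀`, so that the generating function becomes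
`∑ G_n(Z(α_1), …, Z(α_n); Z₀(α_1), …, Z₀(α_n)) ε^{α_1}(Z₀) * ⋯ * ε^{α_n}(Z₀)`. -/
theorem contHolOnStab_genFun (A : CountingData K r H) {F : (n : ℕ) → (Fin n → ℂ) → ℂ}
    (hF : ContHolCondition F) {α : K} (hα : α ∈ A.C) : A.ContHolOnStab α (A.genFun F α) := by
  obtain ⟨N, D, G, hG⟩ := hF
  intro Z₀ hZ₀
  have hpos : ∀ Z ∈ A.Stab, ∀ l ∈ A.decompFinset α, ∀ i : Fin l.length, 0 < (Z (l.get i)).im :=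
    fun Z hZ l hl i => A.stab_upper Z hZ _
      (((A.mem_decompFinset hα).1 hl).2.1 _ (List.get_mem l i))
  have hne : ∀ Z ∈ A.Stab, ∀ l ∈ A.decompFinset α, ∀ i : Fin l.length, Z (l.get i) ≠ 0 :=
    fun Z hZ l hl i h => by
      have := hpos Z hZ l hl i
      rw [h] at this
      exact lt_irrefl _ this
  have hlen : ∀ l ∈ A.decompFinset α, 1 ≤ l.length := fun l hl =>
    List.length_pos_iff.2 ((A.mem_decompFinset hα).1 hl).1
  have hev : ∀ᶠ c in 𝓝 (A.toCoord Z₀), ∀ l ∈ A.decompFinset α,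
      (fun i => A.eval (l.get i) c) ∈ N l.length (fun i => Z₀ (l.get i)) ∧
      (fun i => A.eval (l.get i) c) ∈ D l.length (fun i => Z₀ (l.get i)) ∧
      RefinesPhases (fun i => A.eval (l.get i) c) fun i => Z₀ (l.get i) := by
    rw [Filter.eventually_all_finset]
    intro l hl
    obtain ⟨⟨h1, h2, _⟩, ⟨h3, _⟩, h4, _⟩ := hG _ (hlen l hl) _ (hne Z₀ hZ₀ l hl)
    have h5 := h4 _ h2 _ (blocksOnRays_ones (hlen l hl) (hne Z₀ hZ₀ l hl))
    rw [apply_blockSum_ones (fun m w z => z ∈ D m w)] at h5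
    have hc : Tendsto (fun c => fun i => A.eval (l.get i) c) (𝓝 (A.toCoord Z₀))
        (𝓝 fun i => Z₀ (l.get i)) := by
      have h6 : Continuous fun c => fun i => A.eval (l.get i) c := by fun_prop
      have h7 := h6.tendsto (A.toCoord Z₀)
      simpa only [A.eval_toCoord] using h7
    exact (hc.eventually (h1.mem_nhds h2)).and ((hc.eventually (h3.mem_nhds h5)).and
      (hc.eventually (eventually_refinesPhases (hpos Z₀ hZ₀ l hl))))
  obtain ⟨U, hU, hUo, hU0⟩ := eventually_nhds_iff.1 hev
  refine ⟨U, hUo, hU0, (A.decompFinset α).card,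
    fun i => (((A.decompFinset α).equivFin.symm i).1.map (A.eps Z₀)).prod,
    fun i c => onList (fun n x => G n (fun j => Z₀ (x j)) fun j => A.eval (x j) c)
      ((A.decompFinset α).equivFin.symm i).1, fun i => ?_, fun i => ?_, fun Z hZ hZU => ?_⟩
  · obtain ⟨h1, h2, h3⟩ := (A.mem_decompFinset hα).1 ((A.decompFinset α).equivFin.symm i).2
    have h4 := A.prod_mem (A.eps_mem Z₀ hZ₀) h1 h2
    rwa [h3] at h4
  · have hl := ((A.decompFinset α).equivFin.symm i).2
    obtain ⟨_, ⟨_, _, h1⟩, _⟩ := hG _ (hlen _ hl) _ (hne Z₀ hZ₀ _ hl)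
    have h2 : DifferentiableOn ℂ (fun c => onList (fun n x => G n (fun j => Z₀ (x j))
        fun j => A.eval (x j) c) ((A.decompFinset α).equivFin.symm i).1) U := by
      refine h1.comp (f := fun c => fun j => A.eval
        (((A.decompFinset α).equivFin.symm i).1.get j) c) ?_ fun c hc => (hU c hc _ hl).2.1
      exact Differentiable.differentiableOn (by fun_prop)
    exact ⟨h2.continuousOn, h2⟩
  · let T : List K → ℂ :=
      onList fun n x => (transU (fun i => Z (x i)) (fun i => Z₀ (x i)) : ℂ)
    let φ : List K → ℂ := onList fun n x => G n (fun j => Z₀ (x j)) fun j => Z (x j)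
    have hwall : ∀ β ∈ A.C,
        A.eps Z₀ β = ∑ m ∈ A.decompFinset β, T m • (m.map (A.eps Z)).prod := by
      intro β hβ
      rw [A.wall_crossing Z hZ Z₀ hZ₀ β hβ]
      exact A.sum_decompFinset hβ (A.eps Z) fun n x =>
        (transU (fun i => Z (x i)) (fun i => Z₀ (x i)) : ℂ)
    have hexp : ∀ l ∈ A.decompFinset α,
        onList (fun n x => F n fun i => Z (x i)) l = blockComp List.sum φ T l := by
      intro l hl
      have h1 := hU _ hZU l hl
      simp only [A.eval_toCoord] at h1
      have h2 := (hG _ (hlen l hl) _ (hne Z₀ hZ₀ l hl)).2.2.2 _ h1.1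
      rw [localExpansion_eq_sum_transU G (hpos Z hZ l hl) (hpos Z₀ hZ₀ l hl) h1.2.2] at h2
      refine Eq.trans h2 ?_
      conv_rhs => rw [← List.ofFn_get l]
      rw [blockComp, sum_parts_ofFn]
      refine Finset.sum_congr rfl fun c _ => ?_
      rw [List.map_ofFn, List.map_ofFn, List.prod_ofFn]
      simp only [Function.comp_def, List.sum_ofFn, φ, T, onList_ofFn, map_sum]
      rfl
    rw [genFun, A.sum_decompFinset hα (A.eps Z) fun n x => F n fun i => Z (x i),
      Finset.sum_congr rfl fun l hl => by rw [hexp l hl], A.sum_blockComp_smul hα,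
      Equiv.sum_comp (A.decompFinset α).equivFin.symm fun l => onList (fun n x => G n
        (fun j => Z₀ (x j)) fun j => A.eval (x j) (A.toCoord Z)) l.1 • (l.1.map (A.eps Z₀)).prod,
      Finset.sum_coe_sort (A.decompFinset α) fun l => onList (fun n x => G n
        (fun j => Z₀ (x j)) fun j => A.eval (x j) (A.toCoord Z)) l • (l.map (A.eps Z₀)).prod]
    refine Finset.sum_congr rfl fun b hb => ?_
    simp only [A.eval_toCoord]
    congr 2
    exact List.map_congr_left fun β hβ =>
      (hwall β (((A.mem_decompFinset hα).1 hb).2.1 β hβ)).symm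

end CountingData

end StabGen

end

theorem corollary3p15 :
    ∃ F : (n : ℕ) → (Fin n → ℂ) → ℂ,
      (StabGen.IsExtendedPDESeries F ∧
        ∀ F' : (n : ℕ) → (Fin n → ℂ) → ℂ,
          StabGen.IsExtendedPDESeries F' → StabGen.SameFamily F' F) ∧
      (StabGen.ContHolCondition F ∧ StabGen.ScaleInvariant F ∧ StabGen.Normalised F ∧
        StabGen.SymmetrisationVanishes F ∧ StabGen.GrowthBound F) ∧
      (∀ F' : (n : ℕ) → (Fin n → ℂ) → ℂ,
        StabGen.SatisfiesConditions F' → StabGen.SameFamily F' F) ∧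
      (∀ (K : Type*) [AddCommGroup K] (r : ℕ) (H : Type*) [Ring H] [Algebra ℂ H]
        (A : StabGen.CountingData K r H), ∀ α ∈ A.C,
          A.ContHolOnStab α (A.genFun F α)) := by
  have h : StabGen.SatisfiesConditions StabGen.extFun :=
    ⟨StabGen.contHolCondition_extFun, StabGen.scaleInvariant_extFun, StabGen.normalised_extFun,
      StabGen.symmetrisationVanishes_extFun, StabGen.growthBound_extFun⟩
  exact ⟨StabGen.extFun,
    ⟨StabGen.isExtendedPDESeries_extFun, fun F' hF' =>
      StabGen.sameFamily_of_isExtendedPDESeries hF' StabGen.isExtendedPDESeries_extFun⟩,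
    h, fun F' hF' => StabGen.sameFamily_of_satisfiesConditions hF' h,
    fun K _ r H _ _ A α hα => A.contHolOnStab_genFun StabGen.contHolCondition_extFun hα⟩
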